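/- Let $d\in\{1,2\}$ and let $\Omega=\prod_{i=1}^d(a_i,b_i)\subset\mathbb R^d$ be a bounded open interval ($d=1$) or rectangle ($d=2$) with boundary $\Gamma$, outward unit normal $\mathbf n$ and diameter $L$, star-shaped with respect to the ball $B_{\gamma L}(\mathbf 0)$ for some $\gamma>0$. For $k>0$, $f\in L^2(\Omega)$, $g\in L^2(\Gamma)$ let $u\in H^1(\Omega)$ solve the interior impedance problem $\mathcal L u:=\Delta u+k^2u=-f$ in $\Omega$, $\partial_n u-\mathrm i k u=g$ on $\Gamma$. Let $$\|v\|_{H^1_k(\Omega)}^2=\|\nabla v\|_{L^2(\Omega)}^2+k^2\|v\|_{L^2(\Omega)}^2,\qquad \|v\|_{\Gamma,k}^2=\|\partial_nv\|_{L^2(\Gamma)}^2+\|\nabla_\Gamma v\|_{L^2(\Gamma)}^2+k^2\|v\|_{L^2(\Gamma)}^2,$$ $$\|v\|_{V_1}^2=k^{-2}\|\Delta v\|_{L^2(\Omega)}^2+\|v\|_{H^1_k(\Omega)}^2+\|v\|_{\Gamma,k}^2,\qquad \|v\|_{V_2}^2=\|\mathcal Lv\|_{L^2(\Omega)}^2+\|v\|_{H^1_k(\Omega)}^2+\|v\|_{\Gamma,k}^2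 .$$ With $A=1/3$, $\beta\in\mathbb R$ and $\mathcal M v:=\mathbf x\cdot\nabla v-\mathrm i k\beta v+\frac{d-1}{2}v$, let $$b(u,v)=\int_\Omega\Big(\nabla u\cdot\overline{\nabla v}+k^2u\overline v+\big(\mathcal Mu+\tfrac{A}{k^2}\mathcal Lu\big)\overline{\mathcal Lv}\Big)d\mathbf x-\int_\Gamma\Big(\mathrm i k u\overline{\mathcal Mv}+\big(\mathbf x\cdot\nabla_\Gamma u-\mathrm i k\beta u+\tfrac{d-1}2u\big)\overline{\partial_nv}+(\mathbf x\cdot\mathbf n)\big(k^2u\overline v-\nabla_\Gamma u\cdot\overline{\nabla_\Gamma v}\big)\Big)ds,$$ $$G(v)=\int_\Omega\big(\overline{\mathcal Mv}-\tfrac{A}{k^2}\overline{\mathcal Lv}\big)f\,d\mathbf x+\int_\Gamma\overline{\mathcal Mv}\,g\,ds .$$ Fix $p\ge3$. For a tensor-product mesh of $\Omega$ of width $h$ (the maximal diameter of an element) let $V_N\subset C^1(\overline\Omega)$ be the space of $C^1$ functions which on each element are polynomials of degree at most $p$ in each variable, with any real basis $\phi_1,\dots,\phi_N$. Let $B_{ij}=b(\phi_j,\phi_i)$,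 $\mathbf g_i=G(\phi_i)$ and $$D_{\ell m}=k^{-2}\!\int_\Omega\!\Delta\phi_\ell\Delta\phi_m+\int_\Omega\!\nabla\phi_\ell\cdot\nabla\phi_m+k^2\!\int_\Omega\!\phi_\ell\phi_m+k^2\!\int_\Gamma\!\phi_\ell\phi_m+\int_\Gamma\!\nabla_\Gamma\phi_\ell\cdot\nabla_\Gamma\phi_m+\int_\Gamma\!\partial_n\phi_\ell\,\partial_n\phi_m .$$ Let $\mathbf u^m$ be the $m$-th iterate, with zero initial guess, of GMRES weighted with $D$ and applied to $D^{-1}B\mathbf u=D^{-1}\mathbf g$; that is, $\mathbf u^m$ is the minimiser of $\|D^{-1}(\mathbf g-B\mathbf x)\|_D$, where $\|\mathbf v\|_D^2=\mathbf v^*D\mathbf v$, over $\mathbf x\in\mathrm{span}\{(D^{-1}B)^jD^{-1}\mathbf g:0\le j\le m-1\}$. Let $u_N^m=\sum_j\mathbf u^m_j\phi_j$. Let constants $C_\beta,C_1,C_2$ be given, and let $0<\epsilon<1$ and $k_0>0$. Then there are $C>0$ and $m_0>0$, depending only on $\Omega,\gamma,p,C_\beta,C_1,C_2,\epsilon,k_0$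 (hence independent of $h$ and $k$), such that the following holds for all $k\ge k_0$. Suppose that $$\frac L2\Big(1+\frac4\gamma+\frac\gamma2\Big)\le\beta\le C_\beta L,$$ that $u\in H^4(\Omega)$ and $\|u\|_{H^{j+1}(\Omega)}\le C_1k\|u\|_{H^j(\Omega)}$ for $j=0,1,2,3$, and that the norms $\|u\|_{V_1}$, $\|u\|_{V_2}$ are equal up to a factor at most $C_2$ in either direction, and likewise $\|u\|_{V_2}$, $\|u\|_{H^1_k(\Omega)}$. If $$hk^{7/4}\le C\quad\text{and}\quad m\ge m_0\max\{1,k\log k\},$$ then $D$ is Hermitian positive definite, $B$ is invertible, $\mathbf u^m$ exists and is unique, and $$\|u-u_N^m\|_{H^1_k(\Omega)}\le\epsilon\,\|u\|_{H^1_k(\Omega)} .$$ (If $k_0>1$, the condition on $m$ can be replaced by $m\ge m_0k\log k$, after enlarging $m_0$.) -/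

import Mathlib

open MeasureTheory Filter Topology
open scoped ContDiff ComplexOrder

noncomputable section

namespace HelmholtzMS

/-! The space dimension is `d = n + 1`; points are `x : Fin (n + 1) → ℝ`. The domain `Ω` is the open
box with opposite corners `a` and `b` (an interval if `d = 1`, a rectangle if `d = 2`). -/

/-! ### Geometry of the domain -/

/-- The domain `Ω`. -/
def openBox {n : ℕ} (a b : Fin (n + 1) → ℝ) : Set (Fin (n + 1) → ℝ) :=
  Set.univ.pi fun i => Set.Ioo (a i) (b i)

/-- The (Euclidean) diameter `L` of the box. -/
def boxDiam {n : ℕ} (a b : Fin (n + 1) → ℝ) : ℝ :=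
  √(∑ i, (b i - a i) ^ 2)

/-- `Ω` is star-shaped with respect to (every point of) the Euclidean ball `B_r(x₀)`. -/
def StarShapedWrtBall {d : ℕ} (Ω : Set (Fin d → ℝ)) (x₀ : Fin d → ℝ) (r : ℝ) : Prop :=
  0 < r ∧ ∀ y : Fin d → ℝ, √(∑ i, (y i - x₀ i) ^ 2) < r → StarConvex ℝ y Ω

/-- Lebesgue measure on `Ω`. -/
def volΩ {n : ℕ} (a b : Fin (n + 1) → ℝ) : Measure (Fin (n + 1) → ℝ) :=
  volume.restrict (openBox a b)

/-- The `n`-dimensional Lebesgue measure on the face `{x i = c}` of the box (`c = a i` or `c = b i`),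
as a measure on `ℝ^(n+1)`. For `n = 0` it is the unit mass at the point `c`. -/
def faceMeasure {n : ℕ} (a b : Fin (n + 1) → ℝ) (i : Fin (n + 1)) (c : ℝ) :
    Measure (Fin (n + 1) → ℝ) :=
  Measure.map (fun y : Fin n → ℝ => i.insertNth (α := fun _ => ℝ) c y)
    (volume.restrict (Set.Icc (fun j => a (i.succAbove j)) (fun j => b (i.succAbove j))))

/-- Surface measure on `Γ = ∂Ω`. -/
def surf {n : ℕ} (a b : Fin (n + 1) → ℝ) : Measure (Fin (n + 1) → ℝ) :=
  ∑ i, (faceMeasure a b i (a i) + faceMeasure a b i (b i))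

/-- The outward unit normal on `Γ` (its value at edges and corners, which form a null set, plays
no role). -/
def normal {n : ℕ} (a b : Fin (n + 1) → ℝ) (x : Fin (n + 1) → ℝ) (i : Fin (n + 1)) : ℝ :=
  if x i = b i then 1 else if x i = a i then -1 else 0

/-! ### Weak derivatives and Sobolev spaces -/

/-- The classical partial derivative `∂_i φ`. -/
def pderiv {d : ℕ} (i : Fin d) (φ : (Fin d → ℝ) → ℝ) : (Fin d → ℝ) → ℝ :=
  fun x => fderiv ℝ φ x (Pi.single i 1)

/-- The classical derivative `∂^α φ` for a multi-index `α`. -/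
def mderiv {d : ℕ} (α : Fin d → ℕ) (φ : (Fin d → ℝ) → ℝ) : (Fin d → ℝ) → ℝ :=
  (List.finRange d).foldr (fun i ψ => (pderiv i)^[α i] ψ) φ

/-- `φ ∈ C_c^∞(Ω)`. -/
def IsTestFunction {d : ℕ} (Ω : Set (Fin d → ℝ)) (φ : (Fin d → ℝ) → ℝ) : Prop :=
  ContDiff ℝ ∞ φ ∧ HasCompactSupport φ ∧ tsupport φ ⊆ Ω

/-- `w, v ∈ L²(Ω)` and `v = ∂^α w` in the sense of distributions on `Ω`. -/
def IsWeakDeriv {n : ℕ} (a b : Fin (n + 1) → ℝ) (α : Fin (n + 1) → ℕ)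
    (w v : (Fin (n + 1) → ℝ) → ℂ) : Prop :=
  MemLp w 2 (volΩ a b) ∧ MemLp v 2 (volΩ a b) ∧
    ∀ φ, IsTestFunction (openBox a b) φ →
      ∫ x, mderiv α φ x • w x ∂(volΩ a b) = (-1) ^ (∑ i, α i) * ∫ x, φ x • v x ∂(volΩ a b)

/-- `w, v ∈ L²(Ω)` and `v = Δ w` in the sense of distributions on `Ω`. -/
def IsWeakLaplacian {n : ℕ} (a b : Fin (n + 1) → ℝ) (w v : (Fin (n + 1) → ℝ) → ℂ) : Prop :=
  MemLp w 2 (volΩ a b) ∧ MemLp v 2 (volΩ a b) ∧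
    ∀ φ, IsTestFunction (openBox a b) φ →
      ∫ x, (∑ i, pderiv i (pderiv i φ) x) • w x ∂(volΩ a b) = ∫ x, φ x • v x ∂(volΩ a b)

/-- The weak derivative `∂^α w`, unique almost everywhere in `Ω` if it exists. -/
def weakDeriv {n : ℕ} (a b : Fin (n + 1) → ℝ) (α : Fin (n + 1) → ℕ)
    (w : (Fin (n + 1) → ℝ) → ℂ) : (Fin (n + 1) → ℝ) → ℂ :=
  Classical.epsilon (IsWeakDeriv a b α w)

/-- The component `∂_i w` of the weak gradient. -/
def wgrad {n : ℕ} (a b : Fin (n + 1) → ℝ) (w : (Fin (n + 1) → ℝ) → ℂ) (i : Fin (n + 1)) :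
    (Fin (n + 1) → ℝ) → ℂ :=
  weakDeriv a b (Pi.single i 1) w

/-- The weak Laplacian `Δ w`. -/
def wlap {n : ℕ} (a b : Fin (n + 1) → ℝ) (w : (Fin (n + 1) → ℝ) → ℂ) :
    (Fin (n + 1) → ℝ) → ℂ :=
  Classical.epsilon (IsWeakLaplacian a b w)

/-- The multi-indices of order at most `m`. -/
def multiIndices (d m : ℕ) : Finset (Fin d → ℕ) :=
  (Fintype.piFinset fun _ => Finset.range (m + 1)).filter fun α => ∑ i, α i ≤ m

/-- `w ∈ H^m(Ω)`. -/
def MemSobolev {n : ℕ} (a b : Fin (n + 1) → ℝ) (m : ℕ) (w : (Fin (n + 1) → ℝ) → ℂ) : Prop :=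
  MemLp w 2 (volΩ a b) ∧ ∀ α ∈ multiIndices (n + 1) m, ∃ v, IsWeakDeriv a b α w v

/-- The squared `L²(μ)` norm. -/
def sqNorm {X : Type*} [MeasurableSpace X] (μ : Measure X) (w : X → ℂ) : ℝ :=
  ∫ x, ‖w x‖ ^ 2 ∂μ

/-- The norm of `H^m(Ω)`. -/
def sobolevNorm {n : ℕ} (a b : Fin (n + 1) → ℝ) (m : ℕ) (w : (Fin (n + 1) → ℝ) → ℂ) : ℝ :=
  √(∑ α ∈ multiIndices (n + 1) m, sqNorm (volΩ a b) (weakDeriv a b α w))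

/-! ### Traces

`C¹(Ω̄)` is the set of functions that are `ContDiffOn ℝ 1` on the closed box `Icc a b`. -/

/-- The classical partial derivative `∂_i ψ` on the closed box, for `ψ ∈ C¹(Ω̄)`. -/
def cgrad {n : ℕ} (a b : Fin (n + 1) → ℝ) (ψ : (Fin (n + 1) → ℝ) → ℂ) (i : Fin (n + 1)) :
    (Fin (n + 1) → ℝ) → ℂ :=
  fun x => fderivWithin ℝ ψ (Set.Icc a b) x (Pi.single i 1)

/-- The classical surface gradient `∇_Γ ψ = ∇ψ - n ∂_n ψ` of `ψ ∈ C¹(Ω̄)`. -/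
def csurfGrad {n : ℕ} (a b : Fin (n + 1) → ℝ) (ψ : (Fin (n + 1) → ℝ) → ℂ) (j : Fin (n + 1)) :
    (Fin (n + 1) → ℝ) → ℂ :=
  fun x => cgrad a b ψ j x - normal a b x j * ∑ i, normal a b x i * cgrad a b ψ i x

/-- `t ∈ L²(Γ)` is the trace of `w ∈ H¹(Ω)`: the trace operator is the continuous extension to
`H¹(Ω)` of the restriction of functions in `C¹(Ω̄)` to `Γ`. -/
def IsTrace {n : ℕ} (a b : Fin (n + 1) → ℝ) (w t : (Fin (n + 1) → ℝ) → ℂ) : Prop :=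
  MemLp t 2 (surf a b) ∧ ∃ ψ : ℕ → (Fin (n + 1) → ℝ) → ℂ,
    (∀ m, ContDiffOn ℝ 1 (ψ m) (Set.Icc a b)) ∧
    Tendsto (fun m => eLpNorm (ψ m - w) 2 (volΩ a b)) atTop (𝓝 0) ∧
    (∀ i, Tendsto (fun m => eLpNorm (cgrad a b (ψ m) i - wgrad a b w i) 2 (volΩ a b))
      atTop (𝓝 0)) ∧
    Tendsto (fun m => eLpNorm (ψ m - t) 2 (surf a b)) atTop (𝓝 0)

/-- The trace of `w` on `Γ`. -/
def trace {n : ℕ} (a b : Fin (n + 1) → ℝ) (w : (Fin (n + 1) → ℝ) → ℂ) :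
    (Fin (n + 1) → ℝ) → ℂ :=
  Classical.epsilon (IsTrace a b w)

/-- `q ∈ L²(Γ)` is the normal derivative `∂_n w` of a function `w ∈ H¹(Ω)` with `Δw ∈ L²(Ω)`, in
the usual sense of Green's identity. -/
def IsNormalDeriv {n : ℕ} (a b : Fin (n + 1) → ℝ) (w q : (Fin (n + 1) → ℝ) → ℂ) : Prop :=
  MemLp q 2 (surf a b) ∧ ∀ ψ : (Fin (n + 1) → ℝ) → ℂ, ContDiffOn ℝ 1 ψ (Set.Icc a b) →
    ∫ x, q x * ψ x ∂(surf a b) =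
      ∫ x, ((∑ i, wgrad a b w i x * cgrad a b ψ i x) + wlap a b w x * ψ x) ∂(volΩ a b)

/-- The normal derivative `∂_n w` on `Γ`. -/
def normalDeriv {n : ℕ} (a b : Fin (n + 1) → ℝ) (w : (Fin (n + 1) → ℝ) → ℂ) :
    (Fin (n + 1) → ℝ) → ℂ :=
  Classical.epsilon (IsNormalDeriv a b w)

/-- The trace of `w` is in `H¹(Γ)` with surface gradient `τ ∈ L²(Γ)`; here `H¹(Γ)` is the
completion of the restrictions of functions in `C¹(Ω̄)`. -/
def IsSurfGrad {n : ℕ} (a b : Fin (n + 1) → ℝ) (w : (Fin (n + 1) → ℝ) → ℂ)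
    (τ : Fin (n + 1) → (Fin (n + 1) → ℝ) → ℂ) : Prop :=
  (∀ j, MemLp (τ j) 2 (surf a b)) ∧ ∃ ψ : ℕ → (Fin (n + 1) → ℝ) → ℂ,
    (∀ m, ContDiffOn ℝ 1 (ψ m) (Set.Icc a b)) ∧
    Tendsto (fun m => eLpNorm (ψ m - trace a b w) 2 (surf a b)) atTop (𝓝 0) ∧
    ∀ j, Tendsto (fun m => eLpNorm (csurfGrad a b (ψ m) j - τ j) 2 (surf a b)) atTop (𝓝 0)

/-- The components of the surface gradient `∇_Γ w` on `Γ`. -/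
def surfGrad {n : ℕ} (a b : Fin (n + 1) → ℝ) (w : (Fin (n + 1) → ℝ) → ℂ) :
    Fin (n + 1) → (Fin (n + 1) → ℝ) → ℂ :=
  Classical.epsilon (IsSurfGrad a b w)

/-! ### The interior impedance problem and the norms -/

/-- `u ∈ H¹(Ω)` solves `Δu + k²u = -f` in `Ω`, `∂_n u - iku = g` on `Γ`, with `f ∈ L²(Ω)` and
`g ∈ L²(Γ)`. -/
structure IsIIPSolution {n : ℕ} (a b : Fin (n + 1) → ℝ) (k : ℝ)
    (f g u : (Fin (n + 1) → ℝ) → ℂ) : Prop where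
  memLp_f : MemLp f 2 (volΩ a b)
  memLp_g : MemLp g 2 (surf a b)
  memH1 : MemSobolev a b 1 u
  pde : IsWeakLaplacian a b u fun x => -f x - (k : ℂ) ^ 2 * u x
  bc : IsNormalDeriv a b u fun x => g x + Complex.I * k * trace a b u x

/-- `𝓛 v = Δv + k²v`. -/
def opL {n : ℕ} (a b : Fin (n + 1) → ℝ) (k : ℝ) (v : (Fin (n + 1) → ℝ) → ℂ) :
    (Fin (n + 1) → ℝ) → ℂ :=
  fun x => wlap a b v x + (k : ℂ) ^ 2 * v x

/-- `‖v‖_{H¹_k(Ω)}`. -/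
def normH1k {n : ℕ} (a b : Fin (n + 1) → ℝ) (k : ℝ) (v : (Fin (n + 1) → ℝ) → ℂ) : ℝ :=
  √((∑ i, sqNorm (volΩ a b) (wgrad a b v i)) + k ^ 2 * sqNorm (volΩ a b) v)

/-- The boundary part `‖∂_n v‖² + ‖∇_Γ v‖² + k²‖v‖²` (norms in `L²(Γ)`) of the norms on `V`. -/
def bdrySq {n : ℕ} (a b : Fin (n + 1) → ℝ) (k : ℝ) (v : (Fin (n + 1) → ℝ) → ℂ) : ℝ :=
  sqNorm (surf a b) (normalDeriv a b v) + (∑ j, sqNorm (surf a b) (surfGrad a b v j)) +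
    k ^ 2 * sqNorm (surf a b) (trace a b v)

/-- `‖v‖_{V₁}`, with length scale `1` in front of the boundary terms. -/
def normV1 {n : ℕ} (a b : Fin (n + 1) → ℝ) (k : ℝ) (v : (Fin (n + 1) → ℝ) → ℂ) : ℝ :=
  √((k ^ 2)⁻¹ * sqNorm (volΩ a b) (wlap a b v) + (∑ i, sqNorm (volΩ a b) (wgrad a b v i)) +
    k ^ 2 * sqNorm (volΩ a b) v + bdrySq a b k v)

/-- `‖v‖_{V₂}`, with length scale `1` in front of the boundary terms. -/
def normV2 {n : ℕ} (a b : Fin (n + 1) → ℝ) (k : ℝ) (v : (Fin (n + 1) → ℝ) → ℂ) : ℝ :=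
  √(sqNorm (volΩ a b) (opL a b k v) + (∑ i, sqNorm (volΩ a b) (wgrad a b v i)) +
    k ^ 2 * sqNorm (volΩ a b) v + bdrySq a b k v)

/-- Oscillatory behaviour: `u ∈ H⁴(Ω)` and `‖u‖_{H^{m+1}} ≤ C k ‖u‖_{H^m}` for `m = 0, 1, 2, 3`. -/
def Oscillatory {n : ℕ} (a b : Fin (n + 1) → ℝ) (k C : ℝ) (u : (Fin (n + 1) → ℝ) → ℂ) : Prop :=
  MemSobolev a b 4 u ∧
    ∀ m ≤ 3, sobolevNorm a b (m + 1) u ≤ C * k * sobolevNorm a b m u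

/-- `x` and `y` are equal up to the factor `C`. -/
def EquivUpTo (C x y : ℝ) : Prop := x ≤ C * y ∧ y ≤ C * x

/-- `‖u‖_{V₁} ∼ ‖u‖_{V₂} ∼ ‖u‖_{H¹_k}`, with constant `C`. -/
def NormsComparable {n : ℕ} (a b : Fin (n + 1) → ℝ) (k C : ℝ)
    (u : (Fin (n + 1) → ℝ) → ℂ) : Prop :=
  EquivUpTo C (normV1 a b k u) (normV2 a b k u) ∧ EquivUpTo C (normV2 a b k u) (normH1k a b k u)

/-! ### The MS formulation -/

/-- `𝓜 v = x · ∇v - ikβ v + (d-1)/2 v` in `Ω`, with `d - 1 = n`. -/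
def opM {n : ℕ} (a b : Fin (n + 1) → ℝ) (k β : ℝ) (v : (Fin (n + 1) → ℝ) → ℂ) :
    (Fin (n + 1) → ℝ) → ℂ :=
  fun x => (∑ i, (x i : ℂ) * wgrad a b v i x) - Complex.I * k * β * v x + (n : ℂ) / 2 * v x

/-- `x · n` on `Γ`. -/
def xn {n : ℕ} (a b : Fin (n + 1) → ℝ) (x : Fin (n + 1) → ℝ) : ℂ :=
  ((∑ i, x i * normal a b x i : ℝ) : ℂ)

/-- `x · ∇_Γ v - ikβ v + (d-1)/2 v` on `Γ`. -/
def opMtan {n : ℕ} (a b : Fin (n + 1) → ℝ) (k β : ℝ) (v : (Fin (n + 1) → ℝ) → ℂ) :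
    (Fin (n + 1) → ℝ) → ℂ :=
  fun x => (∑ i, (x i : ℂ) * surfGrad a b v i x) - Complex.I * k * β * trace a b v x +
    (n : ℂ) / 2 * trace a b v x

/-- `𝓜 v` on `Γ`, where `∇v = ∇_Γ v + n ∂_n v`. -/
def opMbdry {n : ℕ} (a b : Fin (n + 1) → ℝ) (k β : ℝ) (v : (Fin (n + 1) → ℝ) → ℂ) :
    (Fin (n + 1) → ℝ) → ℂ :=
  fun x => xn a b x * normalDeriv a b v x + opMtan a b k β v x

/-- The sesquilinear form `b(u, v)` of the MS formulation with parameters `A` and `β`. -/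
def formB {n : ℕ} (a b : Fin (n + 1) → ℝ) (k β A : ℝ) (u v : (Fin (n + 1) → ℝ) → ℂ) : ℂ :=
  (∫ x, ((∑ i, wgrad a b u i x * star (wgrad a b v i x)) + (k : ℂ) ^ 2 * u x * star (v x) +
      (opM a b k β u x + (A : ℂ) / (k : ℂ) ^ 2 * opL a b k u x) * star (opL a b k v x))
      ∂(volΩ a b)) -
    ∫ x, (Complex.I * k * trace a b u x * star (opMbdry a b k β v x) +
      opMtan a b k β u x * star (normalDeriv a b v x) +
      xn a b x * ((k : ℂ) ^ 2 * trace a b u x * star (trace a b v x) -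
        ∑ i, surfGrad a b u i x * star (surfGrad a b v i x))) ∂(surf a b)

/-- The right-hand side `G(v)` of the MS formulation. -/
def rhsG {n : ℕ} (a b : Fin (n + 1) → ℝ) (k β A : ℝ) (f g v : (Fin (n + 1) → ℝ) → ℂ) : ℂ :=
  (∫ x, (star (opM a b k β v x) - (A : ℂ) / (k : ℂ) ^ 2 * star (opL a b k v x)) * f x
      ∂(volΩ a b)) +
    ∫ x, star (opMbdry a b k β v x) * g x ∂(surf a b)

/-! ### The discrete space -/

/-- A tensor-product mesh of the box: in each coordinate `i`, nodes
`a i = x_0 < x_1 < ⋯ < x_{cells i} = b i`. -/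
structure TensorMesh {n : ℕ} (a b : Fin (n + 1) → ℝ) where
  cells : Fin (n + 1) → ℕ
  node : (i : Fin (n + 1)) → Fin (cells i + 1) → ℝ
  strictMono : ∀ i, StrictMono (node i)
  node_first : ∀ i, node i 0 = a i
  node_last : ∀ i, node i (Fin.last (cells i)) = b i

/-- The closed element with index `J`. -/
def TensorMesh.cell {n : ℕ} {a b : Fin (n + 1) → ℝ} (T : TensorMesh a b)
    (J : (i : Fin (n + 1)) → Fin (T.cells i)) : Set (Fin (n + 1) → ℝ) :=
  Set.Icc (fun i => T.node i (J i).castSucc) (fun i => T.node i (J i).succ)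

/-- The mesh width `h`: the maximum of the Euclidean diameters of the elements. -/
def TensorMesh.width {n : ℕ} {a b : Fin (n + 1) → ℝ} (T : TensorMesh a b) : ℝ :=
  ⨆ J : (i : Fin (n + 1)) → Fin (T.cells i),
    √(∑ i, (T.node i (J i).succ - T.node i (J i).castSucc) ^ 2)

/-- The space of real `C¹(Ω̄)` functions that on each element are polynomials of degree at most `p`
in each variable separately. Functions on `Ω̄` are extended by zero to the whole space. -/
def femSpace {n : ℕ} {a b : Fin (n + 1) → ℝ} (T : TensorMesh a b) (p : ℕ) :
    Submodule ℝ ((Fin (n + 1) → ℝ) → ℝ) where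
  carrier := {v | ContDiffOn ℝ 1 v (Set.Icc a b) ∧ (∀ x ∉ Set.Icc a b, v x = 0) ∧
    ∀ J, ∃ q : MvPolynomial (Fin (n + 1)) ℝ, (∀ i, q.degreeOf i ≤ p) ∧
      ∀ x ∈ T.cell J, v x = MvPolynomial.eval x q}
  add_mem' := by
    rintro v w ⟨hv, hv0, hvq⟩ ⟨hw, hw0, hwq⟩
    refine ⟨hv.add hw, fun x hx => by simp [hv0 x hx, hw0 x hx], fun J => ?_⟩
    obtain ⟨q, hq, hq'⟩ := hvq J
    obtain ⟨r, hr, hr'⟩ := hwq J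
    exact ⟨q + r, fun i => (MvPolynomial.degreeOf_add_le i q r).trans (max_le (hq i) (hr i)),
      fun x hx => by simp [hq' x hx, hr' x hx]⟩
  zero_mem' := ⟨contDiffOn_const, fun _ _ => rfl, fun _ => ⟨0, by simp, by simp⟩⟩
  smul_mem' := by
    rintro c v ⟨hv, hv0, hvq⟩
    refine ⟨contDiffOn_const.smul hv, fun x hx => by simp [hv0 x hx], fun J => ?_⟩
    obtain ⟨q, hq, hq'⟩ := hvq J
    exact ⟨MvPolynomial.C c * q, fun i => (MvPolynomial.degreeOf_C_mul_le q i c).trans (hq i),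
      fun x hx => by simp [hq' x hx]⟩

/-- A real function, seen as a complex-valued one. -/
def toC {d : ℕ} (v : (Fin d → ℝ) → ℝ) : (Fin d → ℝ) → ℂ := fun x => (v x : ℂ)

/-- The finite-element function `∑_j c_j φ_j` with coefficient vector `c`. -/
def femFun {d N : ℕ} (φ : Fin N → (Fin d → ℝ) → ℝ) (c : Fin N → ℂ) : (Fin d → ℝ) → ℂ :=
  fun x => ∑ j, c j * (φ j x : ℂ)

/-- The Galerkin matrix `B_{ij} = b(φ_j, φ_i)`. -/
def galerkinMatrix {n N : ℕ} (a b : Fin (n + 1) → ℝ) (k β A : ℝ)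
    (φ : Fin N → (Fin (n + 1) → ℝ) → ℝ) : Matrix (Fin N) (Fin N) ℂ :=
  Matrix.of fun i j => formB a b k β A (toC (φ j)) (toC (φ i))

/-- The Galerkin right-hand side `g_i = G(φ_i)`. -/
def galerkinRhs {n N : ℕ} (a b : Fin (n + 1) → ℝ) (k β A : ℝ) (f g : (Fin (n + 1) → ℝ) → ℂ)
    (φ : Fin N → (Fin (n + 1) → ℝ) → ℝ) : Fin N → ℂ :=
  fun i => rhsG a b k β A f g (toC (φ i))

/-- The matrix `D_k^{(1)} = k⁻² L^{(1)} + S + k² M + k² N^{(0)} + N^{(1)} + N^{(2)}`. -/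
def precondD1 {n N : ℕ} (a b : Fin (n + 1) → ℝ) (k : ℝ)
    (φ : Fin N → (Fin (n + 1) → ℝ) → ℝ) : Matrix (Fin N) (Fin N) ℂ :=
  Matrix.of fun l m =>
    ((k : ℂ) ^ 2)⁻¹ * (∫ x, wlap a b (toC (φ l)) x * wlap a b (toC (φ m)) x ∂(volΩ a b)) +
    (∫ x, ∑ i, wgrad a b (toC (φ l)) i x * wgrad a b (toC (φ m)) i x ∂(volΩ a b)) +
    (k : ℂ) ^ 2 * (∫ x, toC (φ l) x * toC (φ m) x ∂(volΩ a b)) +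
    (k : ℂ) ^ 2 * (∫ x, trace a b (toC (φ l)) x * trace a b (toC (φ m)) x ∂(surf a b)) +
    (∫ x, ∑ i, surfGrad a b (toC (φ l)) i x * surfGrad a b (toC (φ m)) i x ∂(surf a b)) +
    (∫ x, normalDeriv a b (toC (φ l)) x * normalDeriv a b (toC (φ m)) x ∂(surf a b))

/-! ### Weighted GMRES -/

/-- The norm `‖v‖_D = (v^* D v)^{1/2}` of a Hermitian positive-definite matrix `D`. -/
def weightedNorm {N : ℕ} (D : Matrix (Fin N) (Fin N) ℂ) (v : Fin N → ℂ) : ℝ :=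
  √(star v ⬝ᵥ D.mulVec v).re

/-- The Krylov space `span {C^j r : j = 0, …, m - 1}`. -/
def krylov {N : ℕ} (C : Matrix (Fin N) (Fin N) ℂ) (r : Fin N → ℂ) (m : ℕ) :
    Submodule ℂ (Fin N → ℂ) :=
  Submodule.span ℂ {v | ∃ j < m, v = (C ^ j).mulVec r}

/-- `x` is the `m`-th iterate of GMRES with weight `D` applied to `C x = r` with zero initial guess
(so that the initial residual is `r`): it minimises the residual over the Krylov space. -/
def IsGMRESIterate {N : ℕ} (D C : Matrix (Fin N) (Fin N) ℂ) (r : Fin N → ℂ) (m : ℕ)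
    (x : Fin N → ℂ) : Prop :=
  x ∈ krylov C r m ∧
    ∀ y ∈ krylov C r m, weightedNorm D (r - C.mulVec x) ≤ weightedNorm D (r - C.mulVec y)

end HelmholtzMS

end

/-! The Helmholtz operator is indefinite, but the form `b` is built to be coercive. The expression
`𝓜u · conj 𝓛v + 𝓛u · conj 𝓜v + ∇u · conj ∇v + k² u conj v` is a divergence (the Morawetz identity).
Half of this identity with `u = v`, subtracted from `Re b(v, v)`, removes the product of `𝓜v` and
`𝓛v`, which has no sign, and leaves `½|∇v|² + ½k²|v|² + A k⁻²|𝓛v|²` in `Ω`. On `Γ`, star-shapedness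
gives `x · n ≥ γL`, and the lower bound on `β` absorbs the cross terms. So `Re b(v, v)` dominates
the squared `V₁` norm with a constant that does not depend on `k` (`cform_coercive`), while the
continuity constant of `b` is `O(k)` (`norm_cform_le`). The polarised identity gives consistency: a
classical solution satisfies `b(u, v) = G(v)` (`cform_eq_crhs`).

Discretisation error. By the argument of Céa's lemma, the Galerkin error in `V₁` is at most `O(k)`
times the interpolation error. Tensor-product cubic Hermite interpolation has squared errors of
order `h⁸`, `h⁶`, `h⁴` for derivatives of order `0`, `1`, `2` (`exists_interpolant`), and the
multiplicative trace inequality takes care of the boundary terms. If `h k^(7/4) ≤ C`, the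
interpolation error in `V₁` is at most a constant times `C² k⁻⁴ ‖u‖_{H⁴}`
(`exists_interpolant_cnormSq`). Oscillatory behaviour gives `‖u‖_{H⁴} ≲ k³ ‖u‖_{H¹_k}`. The powers
`k · k⁻⁴ · k³` cancel, and a small `C` makes this part small.

Algebraic error. `D` is the Gram matrix of the `V₁` inner product, and in this inner product `D⁻¹B`
is an operator `T` with `Re ⟪x, T x⟫ ≥ α‖x‖²` and `‖T‖ ≤ K = O(k)`. The semigroup `exp (-tT)` decays
like `exp (-αt)`, and its Taylor polynomial of degree `m` is an admissible residual polynomial. With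
`t` of order `m / K` this gives residuals of size `2 exp (-αm / (6K))`
(`exists_krylov_residual_le`): the rate is of order `1/k`, where the usual field-of-values bound
gives only `1/k²`. The algebraic error thus carries the factor `K/α = O(k)`, the `V₁` norm of the
Galerkin solution, which is `O(k) ‖u‖_{H⁴}`, and the factor `k³` from oscillation. Altogether this
is `k⁵ exp (-cm/k)`, which is small once `m ≥ m₀ max (1, k log k)`.

The computations are classical and take place in `gridC2`, which contains the smooth functions and
the discrete functions. The weak derivatives, traces, normal derivatives and surface gradients of
the statement are chosen by `Classical.epsilon`; uniqueness almost everywhere identifies them with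
the classical ones on `gridC2`. The solution itself is only in `H⁴(Ω)` and is never inserted into
the classical form. It is the limit of smooth functions `U` whose data `-𝓛U` and `∂ₙU - ikU`
converge to `f` and `g`; each `U` solves its own impedance problem, and the error in the data
disappears in the limit (`galerkin_error_le`, `normH1k_error_le`). -/

noncomputable section

namespace HelmholtzMS

/-! ### Polynomial residual bounds for accretive operators -/

section Accretive

variable {E : Type*} [NormedAddCommGroup E] [InnerProductSpace ℂ E] [CompleteSpace E]

/-- The semigroup generated by `-T` decays at rate `α` if `Re ⟪x, T x⟫ ≥ α ‖x‖²`. -/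
theorem norm_exp_neg_apply_le (T : E →L[ℂ] E) {α t : ℝ} (ht : 0 ≤ t)
    (hα : ∀ x, α * ‖x‖ ^ 2 ≤ (inner ℂ x (T x)).re) (x : E) :
    ‖NormedSpace.exp (t • (-T)) x‖ ≤ Real.exp (-(α * t)) * ‖x‖ := by
  let : InnerProductSpace ℝ E := InnerProductSpace.rclikeToReal ℂ E
  set y : ℝ → E := fun s => NormedSpace.exp (s • (-T)) x with hy
  have hyd : ∀ s, HasDerivAt y (-(T (y s))) s := by
    intro s
    have h := hasDerivAt_exp_smul_const' (𝕂 := ℝ) (-T) s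
    have h2 := ((ContinuousLinearMap.apply ℂ E x).restrictScalars ℝ).hasFDerivAt
        (x := NormedSpace.exp (s • (-T))) |>.comp_hasDerivAt s h
    exact h2
  set φ : ℝ → ℝ := fun s => Real.exp (2 * α * s) * ‖y s‖ ^ 2 with hφ
  have hφd : ∀ s, HasDerivAt φ (Real.exp (2 * α * s) * (2 * α) * ‖y s‖ ^ 2 +
      Real.exp (2 * α * s) * (2 * inner ℝ (y s) (-(T (y s))))) s := by
    intro s
    have h1 : HasDerivAt (fun s : ℝ => Real.exp (2 * α * s)) (Real.exp (2 * α * s) * (2 * α)) s := by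
      have := ((hasDerivAt_id s).const_mul (2 * α)).exp
      simpa using this
    exact h1.mul (hyd s).norm_sq
  -- The derivative of `φ` is `2 e^(2αs) (α‖y‖² - Re ⟪y, T y⟫)`, which is nonpositive by
  -- accretivity.
  have hanti : Antitone φ := by
    apply antitone_of_deriv_nonpos (fun s => (hφd s).differentiableAt)
    intro s
    rw [(hφd s).deriv]
    have h1 : inner ℝ (y s) (-(T (y s))) = -(inner ℂ (y s) (T (y s))).re := by
      rw [inner_neg_right]; rfl
    rw [h1]
    have h2 := hα (y s)
    have h3 := Real.exp_pos (2 * α * s)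
    nlinarith
  have h0 := hanti ht
  have hy0 : y 0 = x := by simp [hy]
  simp only [hφ, hy0, mul_zero, Real.exp_zero, one_mul] at h0
  have h4 : Real.exp (α * t) * ‖y t‖ ≤ ‖x‖ := by
    apply le_of_sq_le_sq _ (norm_nonneg _)
    rw [mul_pow, ← Real.exp_nat_mul]
    calc _ = Real.exp (2 * α * t) * ‖y t‖ ^ 2 := by congr 2; push_cast; ring
      _ ≤ _ := h0
  rw [Real.exp_neg, ← div_eq_inv_mul, le_div_iff₀ (Real.exp_pos _), mul_comm]
  exact h4

end Accretive

/-- A bound for the remainder of the exponential series. -/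
theorem norm_exp_sub_taylor_le {A : Type*} [NormedRing A] [NormedAlgebra ℝ A] [CompleteSpace A]
    (X : A) (m : ℕ) {s : ℝ} (hs : ‖X‖ ≤ s) :
    ‖NormedSpace.exp X - ∑ j ∈ Finset.range (m + 1), ((j.factorial : ℝ)⁻¹) • X ^ j‖ ≤
      Real.exp (3 * s - m) := by
  have h1 : HasSum (fun j : ℕ => ((j.factorial : ℝ)⁻¹) • X ^ j) (NormedSpace.exp X) :=
    NormedSpace.exp_series_hasSum_exp' (𝕂 := ℝ) X
  have h2 := (hasSum_nat_add_iff' (m + 1)).2 h1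
  rw [← h2.tsum_eq]
  have hs0 : 0 ≤ s := (norm_nonneg _).trans hs
  -- All indices in the remainder exceed `m`, so replacing `sʲ` by `(e s)ʲ` gains a factor `e⁻ᵐ` in
  -- every term. The tilted series sums to at most `exp (e s)`, and `e < 3`.
  have h3 : HasSum (fun j : ℕ => (Real.exp 1 * s) ^ j / (j.factorial : ℝ))
      (Real.exp (Real.exp 1 * s)) := by
    rw [Real.exp_eq_exp_ℝ]
    have := NormedSpace.expSeries_div_hasSum_exp (𝔸 := ℝ) (NormedSpace.exp (1:ℝ) * s)
    exact this
  have h4 : Summable fun j : ℕ => (Real.exp 1 * s) ^ (j + (m + 1)) / ((j + (m + 1)).factorial : ℝ) :=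
    (summable_nat_add_iff (m + 1)).2 h3.summable
  have h5 : ∑' j : ℕ, (Real.exp 1 * s) ^ (j + (m + 1)) / ((j + (m + 1)).factorial : ℝ) ≤
      Real.exp (Real.exp 1 * s) := by
    have h6 := h3.summable.sum_add_tsum_nat_add (m + 1)
    rw [h3.tsum_eq] at h6
    have : 0 ≤ ∑ i ∈ Finset.range (m + 1), (Real.exp 1 * s) ^ i / (i.factorial : ℝ) :=
      Finset.sum_nonneg fun i _ => by positivity
    linarith
  have h7 : ∀ j : ℕ, ‖(((j + (m + 1)).factorial : ℝ)⁻¹) • X ^ (j + (m + 1))‖ ≤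
      Real.exp (-(m : ℝ)) *
        ((Real.exp 1 * s) ^ (j + (m + 1)) / ((j + (m + 1)).factorial : ℝ)) := by
    intro j
    rw [norm_smul, Real.norm_of_nonneg (by positivity), mul_pow, ← Real.exp_nat_mul, div_eq_inv_mul]
    have : Real.exp (-(m:ℝ)) * (((j + (m + 1)).factorial : ℝ)⁻¹ *
        (Real.exp (((j + (m + 1) : ℕ) : ℝ) * 1) * s ^ (j + (m + 1)))) =
        ((j + (m + 1)).factorial : ℝ)⁻¹ * (Real.exp ((j : ℝ) + 1) * s ^ (j + (m + 1))) := by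
      have : Real.exp ((j : ℝ) + 1) = Real.exp (-(m:ℝ)) * Real.exp (((j + (m + 1) : ℕ) : ℝ) * 1) := by
        rw [← Real.exp_add]; congr 1; push_cast; ring
      rw [this]; ring
    rw [this]
    gcongr
    calc ‖X ^ (j + (m + 1))‖ ≤ ‖X‖ ^ (j + (m + 1)) := norm_pow_le' _ (by omega)
      _ ≤ s ^ (j + (m + 1)) := by gcongr
      _ ≤ _ := le_mul_of_one_le_left (by positivity) (Real.one_le_exp (by positivity))
  calc _ ≤ ∑' j : ℕ, Real.exp (-(m : ℝ)) *
        ((Real.exp 1 * s) ^ (j + (m + 1)) / ((j + (m + 1)).factorial : ℝ)) :=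
        tsum_of_norm_bounded (h4.mul_left _).hasSum h7
    _ ≤ Real.exp (-(m : ℝ)) * Real.exp (Real.exp 1 * s) := by
        rw [tsum_mul_left]; gcongr
    _ ≤ _ := by
        rw [← Real.exp_add]
        apply Real.exp_le_exp.2
        have := Real.exp_one_lt_d9
        nlinarith

/-- For an accretive operator, the residuals over the Krylov spaces decay at the rate `α / K`. -/
theorem exists_krylov_residual_le {E : Type*} [NormedAddCommGroup E] [InnerProductSpace ℂ E]
    [CompleteSpace E] (T : E →L[ℂ] E) {α K : ℝ} (hK0 : 0 < K)
    (hα : ∀ x, α * ‖x‖ ^ 2 ≤ (inner ℂ x (T x)).re) (hK : ‖T‖ ≤ K) (m : ℕ) (r : E) :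
    ∃ c : ℕ → ℂ, ‖r - T (∑ j ∈ Finset.range m, c j • (T ^ j) r)‖ ≤
      2 * Real.exp (-(α * m / (6 * K))) * ‖r‖ := by
  by_cases hr : r = 0
  · exact ⟨0, by simp [hr]⟩
  have hr' : 0 < ‖r‖ := norm_pos_iff.2 hr
  have hαK : α ≤ K := by
    have h1 : α * ‖r‖ ^ 2 ≤ K * ‖r‖ ^ 2 :=
      calc _ ≤ (inner ℂ r (T r)).re := hα r
        _ ≤ ‖inner ℂ r (T r)‖ := Complex.re_le_norm _
        _ ≤ ‖r‖ * ‖T r‖ := norm_inner_le_norm _ _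
        _ ≤ ‖r‖ * (K * ‖r‖) := by gcongr; exact T.le_of_opNorm_le hK r
        _ = _ := by ring
    exact le_of_mul_le_mul_right h1 (by positivity)
  -- At this time the Taylor remainder is at most `exp (3 · m/6 - m) = exp (-m/2)`. Since `α ≤ K`,
  -- this is below the decay factor `exp (-αt) ≥ exp (-m/6)` of the semigroup, so both contributions
  -- have the same bound.
  set t : ℝ := m / (6 * K) with ht
  have ht0 : 0 ≤ t := by positivity
  have hX : ‖t • (-T)‖ ≤ m / 6 := by
    rw [norm_smul, norm_neg, Real.norm_of_nonneg ht0]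
    calc t * ‖T‖ ≤ t * K := by gcongr
      _ = m / 6 := by rw [ht]; field_simp
  have h1 := norm_exp_sub_taylor_le (t • (-T)) m hX
  have h2 := norm_exp_neg_apply_le T ht0 hα r
  -- The Taylor polynomial of `exp (-tT)` of degree `m` has constant term `1`, hence is `1 - T q(T)`
  -- with `deg q < m`. These are the coefficients of `q`.
  refine ⟨fun j => -(((j + 1).factorial : ℝ)⁻¹ * (-t) ^ (j + 1) : ℝ), ?_⟩
  have h3 : r - T (∑ j ∈ Finset.range m,
      (-((((j + 1).factorial : ℝ)⁻¹ * (-t) ^ (j + 1) : ℝ) : ℂ)) • (T ^ j) r) =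
      (∑ j ∈ Finset.range (m + 1), ((j.factorial : ℝ)⁻¹) • (t • (-T)) ^ j) r := by
    rw [Finset.sum_range_succ']
    simp only [add_apply, sum_apply, map_sum, map_smul,
      neg_smul, map_neg, Finset.sum_neg_distrib, sub_neg_eq_add]
    rw [add_comm]
    congr 1
    · refine Finset.sum_congr rfl fun j _ => ?_
      have : (t • (-T)) ^ (j + 1) = ((-t) ^ (j + 1)) • T ^ (j + 1) := by
        rw [← smul_pow]; congr 1; simp
      rw [this, smul_smul, smul_apply, pow_succ' T, ContinuousLinearMap.mul_def, ContinuousLinearMap.comp_apply]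
      exact Complex.coe_smul _ _
    · simp
  rw [h3]
  set P := ∑ j ∈ Finset.range (m + 1), ((j.factorial : ℝ)⁻¹) • (t • (-T)) ^ j
  have h4 : P r = NormedSpace.exp (t • (-T)) r - (NormedSpace.exp (t • (-T)) - P) r := by simp
  have h5 : Real.exp (3 * (m / 6 : ℝ) - m) ≤ Real.exp (-(α * t)) := by
    apply Real.exp_le_exp.2
    have : α * t ≤ K * t := by gcongr
    have h6 : K * t = m / 6 := by rw [ht]; field_simp
    have : (0:ℝ) ≤ m := by positivity
    linarith
  have h7 : α * m / (6 * K) = α * t := by rw [ht]; ring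
  rw [h4, h7]
  calc _ ≤ ‖NormedSpace.exp (t • (-T)) r‖ + ‖(NormedSpace.exp (t • (-T)) - P) r‖ := norm_sub_le _ _
    _ ≤ Real.exp (-(α * t)) * ‖r‖ + Real.exp (-(α * t)) * ‖r‖ := by
        gcongr
        exact ContinuousLinearMap.le_of_opNorm_le _ (h1.trans h5) r
    _ = _ := by ring

/-! ### Convergence of weighted GMRES -/

/-- A positive definite matrix is the Gram matrix of the Euclidean inner product in suitable
coordinates. -/
theorem exists_equiv_inner_eq {N : ℕ} {D : Matrix (Fin N) (Fin N) ℂ} (hD : D.PosDef) :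
    ∃ Φ : (Fin N → ℂ) ≃ₗ[ℂ] EuclideanSpace ℂ (Fin N),
      ∀ x y, inner ℂ (Φ x) (Φ y) = star x ⬝ᵥ D.mulVec y := by
  obtain ⟨S, hS⟩ : ∃ S : Matrix (Fin N) (Fin N) ℂ, D = S.conjTranspose * S := by
    open scoped MatrixOrder in
    exact CStarAlgebra.nonneg_iff_eq_star_mul_self.mp hD.posSemidef.nonneg
  have hdet : IsUnit S := by
    have h1 : IsUnit D := hD.isUnit
    rw [Matrix.isUnit_iff_isUnit_det, hS, Matrix.det_mul] at h1
    exact (Matrix.isUnit_iff_isUnit_det S).2 (isUnit_of_mul_isUnit_right h1)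
  have hdet' := (Matrix.isUnit_iff_isUnit_det S).1 hdet
  refine ⟨(Matrix.toLin'OfInv (M := S⁻¹) (M' := S) (Matrix.nonsing_inv_mul S hdet')
    (Matrix.mul_nonsing_inv S hdet')).trans (WithLp.linearEquiv 2 ℂ (Fin N → ℂ)).symm, ?_⟩
  intro x y
  have : ∀ z, ((Matrix.toLin'OfInv (M := S⁻¹) (M' := S) (Matrix.nonsing_inv_mul S hdet')
    (Matrix.mul_nonsing_inv S hdet')).trans (WithLp.linearEquiv 2 ℂ (Fin N → ℂ)).symm) z
      = WithLp.toLp 2 (S.mulVec z) := by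
    intro z
    simp [Matrix.toLin'OfInv]
  rw [this, this, EuclideanSpace.inner_toLp_toLp, hS, ← Matrix.mulVec_mulVec,
    Matrix.dotProduct_mulVec, Matrix.vecMul_conjTranspose, star_star, dotProduct_comm]

/-- The error of weighted GMRES for a coercive and bounded system. -/
theorem gmres_error_le {N : ℕ} {D B : Matrix (Fin N) (Fin N) ℂ} (hD : D.PosDef) {α K : ℝ}
    (hα0 : 0 < α) (hK0 : 0 < K)
    (hco : ∀ c, α * weightedNorm D c ^ 2 ≤ (star c ⬝ᵥ B.mulVec c).re)
    (hbd : ∀ c d, ‖star d ⬝ᵥ B.mulVec c‖ ≤ K * weightedNorm D c * weightedNorm D d)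
    (m : ℕ) (rhs : Fin N → ℂ) :
    IsUnit B ∧ ∃ um : Fin N → ℂ,
      (∀ y, IsGMRESIterate D (D⁻¹ * B) (D⁻¹.mulVec rhs) m y ↔ y = um) ∧
      weightedNorm D (B⁻¹.mulVec rhs - um) ≤
        2 * (K / α) * Real.exp (-(α * m / (6 * K))) * weightedNorm D (B⁻¹.mulVec rhs) := by
  obtain ⟨Φ, hΦ⟩ := exists_equiv_inner_eq hD
  have hDdet : IsUnit D.det := (Matrix.isUnit_iff_isUnit_det D).1 hD.isUnit
  have hnorm : ∀ x, weightedNorm D x = ‖Φ x‖ := by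
    intro x
    rw [weightedNorm, ← hΦ, inner_self_eq_norm_sq_to_K]
    norm_cast
    exact Real.sqrt_sq (norm_nonneg _)
  set C := D⁻¹ * B with hC
  set r := D⁻¹.mulVec rhs with hr
  have hDC : D * C = B := by rw [hC, ← mul_assoc, Matrix.mul_nonsing_inv D hDdet, one_mul]
  -- In the inner product of `D`, the matrix `C = D⁻¹B` represents the sesquilinear form of `B`. The
  -- hypotheses on `B` thereby become accretivity and boundedness of `C`.
  have hin : ∀ x y, inner ℂ (Φ x) (Φ (C.mulVec y)) = star x ⬝ᵥ B.mulVec y := by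
    intro x y; rw [hΦ, Matrix.mulVec_mulVec, hDC]
  have hcoC : ∀ x, α * ‖Φ x‖ ≤ ‖Φ (C.mulVec x)‖ := by
    intro x
    rcases eq_or_lt_of_le (norm_nonneg (Φ x)) with h | h
    · rw [← h]; simp
    have h1 : α * ‖Φ x‖ ^ 2 ≤ ‖Φ x‖ * ‖Φ (C.mulVec x)‖ :=
      calc _ ≤ (star x ⬝ᵥ B.mulVec x).re := by rw [← hnorm]; exact hco x
        _ = (inner ℂ (Φ x) (Φ (C.mulVec x))).re := by rw [hin]
        _ ≤ ‖inner ℂ (Φ x) (Φ (C.mulVec x))‖ := Complex.re_le_norm _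
        _ ≤ _ := norm_inner_le_norm _ _
    nlinarith
  have hinj : Function.Injective B.mulVec := by
    have : Function.Injective B.mulVecLin := by
      rw [← LinearMap.ker_eq_bot, LinearMap.ker_eq_bot']
      intro x hx
      have h1 := hcoC x
      have h2 : C.mulVec x = 0 := by
        rw [hC, ← Matrix.mulVec_mulVec]
        have : B.mulVec x = 0 := hx
        rw [this]; simp
      rw [h2, map_zero, norm_zero] at h1
      have h3 : ‖Φ x‖ = 0 := le_antisymm (by nlinarith) (norm_nonneg _)
      simpa using h3
    exact this
  have hB : IsUnit B := Matrix.mulVec_injective_iff_isUnit.1 hinj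
  have hBdet : IsUnit B.det := (Matrix.isUnit_iff_isUnit_det B).1 hB
  have hCinj : Function.Injective C.mulVec := by
    have : IsUnit C := by
      rw [hC]
      exact (Matrix.isUnit_nonsing_inv_iff.2 hD.isUnit).mul hB
    exact Matrix.mulVec_injective_iff_isUnit.2 this
  set cs := B⁻¹.mulVec rhs with hcs
  have hCcs : C.mulVec cs = r := by
    rw [hC, hcs, hr, Matrix.mulVec_mulVec, mul_assoc, Matrix.mul_nonsing_inv B hBdet, mul_one]
  have hCbd : ∀ x, ‖Φ (C.mulVec x)‖ ≤ K * ‖Φ x‖ := by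
    intro x
    rcases eq_or_lt_of_le (norm_nonneg (Φ (C.mulVec x))) with h | h
    · rw [← h]; positivity
    have h1 : ‖Φ (C.mulVec x)‖ ^ 2 ≤ K * ‖Φ x‖ * ‖Φ (C.mulVec x)‖ := by
      have h2 := hbd x (C.mulVec x)
      rw [← hin, inner_self_eq_norm_sq_to_K, hnorm, hnorm] at h2
      simpa using h2
    nlinarith
  set T : EuclideanSpace ℂ (Fin N) →L[ℂ] EuclideanSpace ℂ (Fin N) :=
    LinearMap.toContinuousLinearMap (Φ.toLinearMap ∘ₗ C.mulVecLin ∘ₗ Φ.symm.toLinearMap) with hT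
  have hTΦ : ∀ x, T (Φ x) = Φ (C.mulVec x) := by intro x; simp [hT]
  have hTpow : ∀ j x, (T ^ j) (Φ x) = Φ ((C ^ j).mulVec x) := by
    intro j
    induction j with
    | zero => intro x; simp
    | succ j ih =>
      intro x
      rw [pow_succ, ContinuousLinearMap.mul_def, ContinuousLinearMap.comp_apply, hTΦ, ih, pow_succ,
        Matrix.mulVec_mulVec]
  refine ⟨hB, ?_⟩
  set V := krylov C r m with hV
  -- Minimising the residual over the Krylov space `V` is orthogonal projection of `Φ r` onto `Φ C
  -- V`. Pythagoras gives minimality, and also uniqueness because `C` is injective.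
  set W : Submodule ℂ (EuclideanSpace ℂ (Fin N)) :=
    V.map (Φ.toLinearMap ∘ₗ C.mulVecLin) with hW
  have hPW : W.starProjection (Φ r) ∈ W := Submodule.starProjection_apply_mem _ _
  obtain ⟨um, hum, humP⟩ := Submodule.mem_map.1 hPW
  have humP' : Φ (C.mulVec um) = W.starProjection (Φ r) := humP
  have hpyth : ∀ y ∈ V, ‖Φ (r - C.mulVec y)‖ ^ 2 =
      ‖Φ (r - C.mulVec um)‖ ^ 2 + ‖Φ (C.mulVec (um - y))‖ ^ 2 := by
    intro y hy
    have h1 : Φ (r - C.mulVec y) = Φ (r - C.mulVec um) + Φ (C.mulVec (um - y)) := by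
      rw [← map_add, Matrix.mulVec_sub]; congr 1; abel
    have h2 : inner ℂ (Φ (r - C.mulVec um)) (Φ (C.mulVec (um - y))) = 0 := by
      have h3 : Φ (r - C.mulVec um) ∈ Wᗮ := by
        rw [map_sub, humP']; exact Submodule.sub_starProjection_mem_orthogonal _
      exact Submodule.inner_left_of_mem_orthogonal
        (Submodule.mem_map.2 ⟨um - y, V.sub_mem hum hy, rfl⟩) h3
    rw [h1, @norm_add_sq ℂ, h2]
    simp
  have hmin : IsGMRESIterate D C r m um := by
    refine ⟨hum, fun y hy => ?_⟩
    rw [hnorm, hnorm]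
    apply le_of_sq_le_sq _ (norm_nonneg _)
    rw [hpyth y hy]
    have := sq_nonneg ‖Φ (C.mulVec (um - y))‖
    linarith
  refine ⟨um, fun y => ⟨fun hy => ?_, fun hy => hy ▸ hmin⟩, ?_⟩
  · have h1 := hy.2 um hum
    rw [hnorm, hnorm] at h1
    have h2 := hpyth y hy.1
    have h3 : ‖Φ (C.mulVec (um - y))‖ ^ 2 ≤ 0 := by
      have : ‖Φ (r - C.mulVec y)‖ ^ 2 ≤ ‖Φ (r - C.mulVec um)‖ ^ 2 := by gcongr
      linarith
    have h4 : C.mulVec (um - y) = 0 := by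
      have h5 : ‖Φ (C.mulVec (um - y))‖ = 0 := by
        rw [← sq_eq_zero_iff]; exact le_antisymm h3 (sq_nonneg _)
      simpa using h5
    have h6 : um - y = 0 := hCinj (by rw [h4]; simp)
    exact (sub_eq_zero.1 h6).symm
  · have hTα : ∀ x, α * ‖x‖ ^ 2 ≤ (inner ℂ x (T x)).re := by
      intro x
      obtain ⟨x, rfl⟩ := Φ.surjective x
      rw [hTΦ, hin, ← hnorm]
      exact hco x
    have hTK : ‖T‖ ≤ K := by
      refine T.opNorm_le_bound hK0.le fun x => ?_
      obtain ⟨x, rfl⟩ := Φ.surjective x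
      rw [hTΦ]
      exact hCbd x
    -- The truncated semigroup supplies a competitor in the Krylov space, and the minimal residual
    -- is no larger.
    obtain ⟨c, hc⟩ := exists_krylov_residual_le T hK0 hTα hTK m (Φ r)
    set y : Fin N → ℂ := ∑ j ∈ Finset.range m, c j • (C ^ j).mulVec r with hy
    have hyV : y ∈ V := by
      refine Submodule.sum_mem _ fun j hj => Submodule.smul_mem _ _ (Submodule.subset_span ?_)
      exact ⟨j, Finset.mem_range.1 hj, rfl⟩
    have h1 : Φ r - T (∑ j ∈ Finset.range m, c j • (T ^ j) (Φ r)) = Φ (r - C.mulVec y) := by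
      have : ∑ j ∈ Finset.range m, c j • (T ^ j) (Φ r) = Φ y := by
        simp only [hTpow, hy, map_sum, map_smul]
      rw [this, hTΦ, map_sub]
    rw [h1] at hc
    have h2 := hmin.2 y hyV
    rw [hnorm, hnorm] at h2
    -- Going from the residual back to the error costs `1/α`, and the initial residual is at most
    -- `K` times the solution. This is the origin of the factor `K / α`.
    have h3 : α * ‖Φ (cs - um)‖ ≤ ‖Φ (r - C.mulVec um)‖ := by
      have := hcoC (cs - um)
      rwa [Matrix.mulVec_sub, hCcs] at this
    have h4 : ‖Φ r‖ ≤ K * ‖Φ cs‖ := by rw [← hCcs]; exact hCbd cs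
    rw [hnorm, hnorm]
    have h5 : α * ‖Φ (cs - um)‖ ≤ 2 * Real.exp (-(α * m / (6 * K))) * (K * ‖Φ cs‖) :=
      h3.trans (h2.trans (hc.trans (by gcongr)))
    rw [show 2 * (K / α) * Real.exp (-(α * m / (6 * K))) * ‖Φ cs‖ =
      (2 * Real.exp (-(α * m / (6 * K))) * (K * ‖Φ cs‖)) / α by ring, le_div_iff₀ hα0, mul_comm]
    exact h5

/-! ### Calculus on a box -/

section Box

variable {n : ℕ} {a b : Fin (n + 1) → ℝ}

/-- Lebesgue measure on the projection of the box along the `i`-th coordinate. -/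
def faceVol (a b : Fin (n + 1) → ℝ) (i : Fin (n + 1)) : Measure (Fin n → ℝ) :=
  volume.restrict (Set.Icc (fun j => a (i.succAbove j)) (fun j => b (i.succAbove j)))

instance (i : Fin (n + 1)) : IsFiniteMeasure (faceVol a b i) :=
  ⟨by rw [faceVol, Measure.restrict_apply_univ]; exact isCompact_Icc.measure_lt_top⟩

theorem isOpen_openBox : IsOpen (openBox a b) :=
  isOpen_set_pi Set.finite_univ fun _ _ => isOpen_Ioo

theorem openBox_subset_Icc : openBox a b ⊆ Set.Icc a b := fun _ hx =>
  ⟨fun i => (hx i trivial).1.le, fun i => (hx i trivial).2.le⟩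

theorem openBox_ae_eq_Icc : openBox a b =ᵐ[volume] Set.Icc a b :=
  Measure.univ_pi_Ioo_ae_eq_Icc

theorem volΩ_eq_Icc : volΩ a b = volume.restrict (Set.Icc a b) :=
  Measure.restrict_congr_set openBox_ae_eq_Icc

instance : IsFiniteMeasure (volΩ a b) :=
  ⟨by rw [volΩ_eq_Icc, Measure.restrict_apply_univ]; exact isCompact_Icc.measure_lt_top⟩

theorem measurableEmbedding_insertNth (i : Fin (n + 1)) (c : ℝ) :
    MeasurableEmbedding (fun y : Fin n → ℝ => i.insertNth (α := fun _ => ℝ) c y) :=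
  (MeasurableEquiv.piFinSuccAbove (fun _ => ℝ) i).symm.measurableEmbedding.comp
    (measurableEmbedding_prodMk_left c)

instance (i : Fin (n + 1)) (c : ℝ) : IsFiniteMeasure (faceMeasure a b i c) := by
  have : IsFiniteMeasure (faceVol a b i) := inferInstance
  rw [faceVol] at this
  rw [faceMeasure]
  infer_instance

instance : IsFiniteMeasure (surf a b) := by
  rw [surf]; infer_instance

/-- Countably many hyperplanes `x_i = s` form a null set. With `S` the set of node coordinates of a
mesh, this allows grid lines to be ignored in every volume integral. -/
theorem ae_openBox {S : Set ℝ} (hS : S.Countable) :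
    ∀ᵐ x ∂(volΩ a b), x ∈ openBox a b ∧ ∀ i, x i ∉ S := by
  have h1 : ∀ᵐ x : Fin (n + 1) → ℝ, ∀ i, ∀ s ∈ S, x i ≠ s := by
    rw [ae_all_iff]
    intro i
    rw [ae_ball_iff hS]
    intro s _
    exact Measure.ae_eval_ne (α := fun _ => ℝ) (fun _ => volume) i s
  filter_upwards [ae_restrict_mem isOpen_openBox.measurableSet, ae_restrict_of_ae h1] with x hx hx2
  exact ⟨hx, fun i hi => hx2 i _ hi rfl⟩

theorem ae_faceVol (i : Fin (n + 1)) {S : Set ℝ} (hS : S.Countable) :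
    ∀ᵐ y ∂(faceVol a b i), (∀ j, y j ∈ Set.Ioo (a (i.succAbove j)) (b (i.succAbove j))) ∧
      ∀ j, y j ∉ S := by
  have h1 : ∀ᵐ x : Fin n → ℝ, ∀ i, ∀ s ∈ S, x i ≠ s := by
    rw [ae_all_iff]
    intro i
    rw [ae_ball_iff hS]
    intro s _
    exact Measure.ae_eval_ne (α := fun _ => ℝ) (fun _ => volume) i s
  have h2 : faceVol a b i = volume.restrict (Set.univ.pi fun j =>
      Set.Ioo (a (i.succAbove j)) (b (i.succAbove j))) :=
    (Measure.restrict_congr_set Measure.univ_pi_Ioo_ae_eq_Icc).symm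
  rw [h2]
  filter_upwards [ae_restrict_mem (isOpen_set_pi Set.finite_univ fun _ _ => isOpen_Ioo).measurableSet,
    ae_restrict_of_ae h1] with x hx hx2
  exact ⟨fun j => hx j trivial, fun i hi => hx2 i _ hi rfl⟩

theorem insertNth_mem_openBox {i : Fin (n + 1)} {t : ℝ} {y : Fin n → ℝ}
    (ht : t ∈ Set.Ioo (a i) (b i))
    (hy : ∀ j, y j ∈ Set.Ioo (a (i.succAbove j)) (b (i.succAbove j))) :
    i.insertNth (α := fun _ => ℝ) t y ∈ openBox a b := by
  intro j _
  refine Fin.succAboveCases i ?_ (fun j => ?_) j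
  · simpa using ht
  · simpa using hy j

theorem insertNth_mem_Icc {i : Fin (n + 1)} {t : ℝ} {y : Fin n → ℝ}
    (ht : t ∈ Set.Icc (a i) (b i))
    (hy : ∀ j, y j ∈ Set.Ioo (a (i.succAbove j)) (b (i.succAbove j))) :
    i.insertNth (α := fun _ => ℝ) t y ∈ Set.Icc a b := by
  rw [← Set.pi_univ_Icc]
  intro j _
  refine Fin.succAboveCases i ?_ (fun j => ?_) j
  · simpa using ht
  · simpa using Set.Ioo_subset_Icc_self (hy j)

/-- Fubini along the `i`-th coordinate. -/
theorem measurePreserving_insertNth (i : Fin (n + 1)) :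
    MeasurePreserving (fun q : ℝ × (Fin n → ℝ) => i.insertNth (α := fun _ => ℝ) q.1 q.2)
      ((volume.restrict (Set.Ioo (a i) (b i))).prod (faceVol a b i)) (volΩ a b) := by
  have h1 := (volume_preserving_piFinSuccAbove (fun _ => ℝ) i).symm
  have h2 := h1.restrict_preimage (s := openBox a b) isOpen_openBox.measurableSet
  have h3 : (volume.restrict (Set.Ioo (a i) (b i))).prod (faceVol a b i) =
      (volume : Measure (ℝ × (Fin n → ℝ))).restrict
      ((MeasurableEquiv.piFinSuccAbove (fun _ => ℝ) i).symm ⁻¹' (openBox a b)) := by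
    have h4 : faceVol a b i = volume.restrict (Set.univ.pi fun j =>
      Set.Ioo (a (i.succAbove j)) (b (i.succAbove j))) :=
      (Measure.restrict_congr_set Measure.univ_pi_Ioo_ae_eq_Icc).symm
    rw [h4, Measure.prod_restrict]
    congr 1
    ext q
    constructor
    · rintro ⟨hq1, hq2⟩
      exact insertNth_mem_openBox hq1 fun j => hq2 j trivial
    · intro hq
      refine ⟨?_, fun j _ => ?_⟩
      · simpa using hq i trivial
      · simpa using hq (i.succAbove j) trivial
  rw [h3]
  exact h2

variable {E : Type*} [NormedAddCommGroup E] [NormedSpace ℝ E]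

theorem integral_faceMeasure (i : Fin (n + 1)) (c : ℝ) (F : (Fin (n + 1) → ℝ) → E) :
    ∫ x, F x ∂(faceMeasure a b i c) = ∫ y, F (i.insertNth (α := fun _ => ℝ) c y) ∂(faceVol a b i) := by
  rw [faceMeasure, (measurableEmbedding_insertNth i c).integral_map]
  rfl

theorem ae_faceMeasure_iff (i : Fin (n + 1)) (c : ℝ) (P : (Fin (n + 1) → ℝ) → Prop) :
    (∀ᵐ x ∂(faceMeasure a b i c), P x) ↔
      ∀ᵐ y ∂(faceVol a b i), P (i.insertNth (α := fun _ => ℝ) c y) := by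
  rw [faceMeasure, (measurableEmbedding_insertNth i c).ae_map_iff]
  rfl

theorem integral_volΩ_eq (i : Fin (n + 1)) {F : (Fin (n + 1) → ℝ) → E}
    (hF : Integrable F (volΩ a b)) :
    ∫ x, F x ∂(volΩ a b) =
      ∫ y, (∫ t in Set.Ioo (a i) (b i), F (i.insertNth (α := fun _ => ℝ) t y)) ∂(faceVol a b i) := by
  have hmp := measurePreserving_insertNth (a := a) (b := b) i
  have he : MeasurableEmbedding
      (fun q : ℝ × (Fin n → ℝ) => i.insertNth (α := fun _ => ℝ) q.1 q.2) :=
    (MeasurableEquiv.piFinSuccAbove (fun _ => ℝ) i).symm.measurableEmbedding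
  rw [← hmp.integral_comp he, integral_prod_symm]
  exact (hmp.integrable_comp_emb he).2 hF

theorem ae_integrable_line (i : Fin (n + 1)) {F : (Fin (n + 1) → ℝ) → E}
    (hF : Integrable F (volΩ a b)) :
    ∀ᵐ y ∂(faceVol a b i), IntegrableOn (fun t => F (i.insertNth (α := fun _ => ℝ) t y))
      (Set.Ioo (a i) (b i)) := by
  have hmp := measurePreserving_insertNth (a := a) (b := b) i
  have he : MeasurableEmbedding
      (fun q : ℝ × (Fin n → ℝ) => i.insertNth (α := fun _ => ℝ) q.1 q.2) :=
    (MeasurableEquiv.piFinSuccAbove (fun _ => ℝ) i).symm.measurableEmbedding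
  exact ((hmp.integrable_comp_emb he).2 hF).prod_left_ae

theorem continuousOn_insertNth {i : Fin (n + 1)} {F : (Fin (n + 1) → ℝ) → E}
    (hF : ContinuousOn F (Set.Icc a b)) {c : ℝ} (hc : c ∈ Set.Icc (a i) (b i)) :
    ContinuousOn (fun y : Fin n → ℝ => F (i.insertNth (α := fun _ => ℝ) c y))
      (Set.Icc (fun j => a (i.succAbove j)) (fun j => b (i.succAbove j))) := by
  refine hF.comp (Continuous.continuousOn (by fun_prop)) fun y hy => ?_
  rw [← Set.pi_univ_Icc]
  intro j _
  refine Fin.succAboveCases i ?_ (fun j => ?_) j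
  · simpa using hc
  · simpa using ⟨hy.1 j, hy.2 j⟩

/-- The integral of a partial derivative over the box, for a function that is continuous up to the
boundary and differentiable off a grid. -/
theorem integral_partialDeriv [CompleteSpace E] (hab : ∀ i, a i < b i) (i : Fin (n + 1))
    {S : Set ℝ} (hS : S.Countable) {F DF : (Fin (n + 1) → ℝ) → E}
    (hF : ContinuousOn F (Set.Icc a b))
    (hd : ∀ x ∈ openBox a b, (∀ j, x j ∉ S) →
      HasDerivAt (fun t => F (Function.update x i t)) (DF x) (x i))
    (hi : Integrable DF (volΩ a b)) :
    ∫ x, DF x ∂(volΩ a b) =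
      ∫ x, F x ∂(faceMeasure a b i (b i)) - ∫ x, F x ∂(faceMeasure a b i (a i)) := by
  have hle := (hab i).le
  rw [integral_volΩ_eq i hi, integral_faceMeasure, integral_faceMeasure, ← integral_sub]
  · apply integral_congr_ae
    filter_upwards [ae_faceVol i hS, ae_integrable_line i hi] with y hy hy2
    rw [← integral_Ioc_eq_integral_Ioo, ← intervalIntegral.integral_of_le hle]
    -- For almost every `y` no coordinate of `y` lies in `S`. On the line through such a `y`,
    -- differentiability fails at most at the countably many `t ∈ S`, where continuity is enough for
    -- the fundamental theorem of calculus.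
    apply integral_eq_of_hasDerivAt_off_countable_of_le
      (fun t => F (i.insertNth (α := fun _ => ℝ) t y)) _ hle hS
    · exact hF.comp (Continuous.continuousOn (by fun_prop)) fun t ht => insertNth_mem_Icc ht hy.1
    · intro t ht
      have h1 := hd (i.insertNth (α := fun _ => ℝ) t y) (insertNth_mem_openBox ht.1 hy.1) ?_
      · simpa using h1
      · intro j
        refine Fin.succAboveCases i ?_ (fun j => ?_) j
        · simpa using ht.2
        · simpa using hy.2 j
    · rw [intervalIntegrable_iff_integrableOn_Ioo_of_le hle]
      exact hy2
  · exact (continuousOn_insertNth hF (Set.right_mem_Icc.2 hle)).integrableOn_compact isCompact_Icc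
  · exact (continuousOn_insertNth hF (Set.left_mem_Icc.2 hle)).integrableOn_compact isCompact_Icc

theorem ae_surf_iff (P : (Fin (n + 1) → ℝ) → Prop) :
    (∀ᵐ x ∂(surf a b), P x) ↔ ∀ i, (∀ᵐ x ∂(faceMeasure a b i (a i)), P x) ∧
      ∀ᵐ x ∂(faceMeasure a b i (b i)), P x := by
  simp only [ae_iff, surf, Measure.coe_finsetSum, Finset.sum_apply, Finset.sum_eq_zero_iff,
    Finset.mem_univ, true_implies, Measure.coe_add, Pi.add_apply, add_eq_zero]

theorem faceMeasure_le_surf (i : Fin (n + 1)) :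
    faceMeasure a b i (a i) ≤ surf a b ∧ faceMeasure a b i (b i) ≤ surf a b := by
  have h : faceMeasure a b i (a i) + faceMeasure a b i (b i) ≤ surf a b :=
    Finset.single_le_sum (f := fun i => faceMeasure a b i (a i) + faceMeasure a b i (b i))
      (fun _ _ => Measure.zero_le _) (Finset.mem_univ i)
  exact ⟨le_trans (Measure.le_add_right le_rfl) h, le_trans (Measure.le_add_left le_rfl) h⟩

theorem integral_surf {F : (Fin (n + 1) → ℝ) → E} (hF : Integrable F (surf a b)) :
    ∫ x, F x ∂(surf a b) =
      ∑ i, (∫ x, F x ∂(faceMeasure a b i (a i)) + ∫ x, F x ∂(faceMeasure a b i (b i))) := by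
  have h1 := fun i => hF.mono_measure (faceMeasure_le_surf i).1
  have h2 := fun i => hF.mono_measure (faceMeasure_le_surf i).2
  rw [surf, integral_finsetSum_measure fun i _ => (h1 i).add_measure (h2 i)]
  exact Finset.sum_congr rfl fun i _ => integral_add_measure (h1 i) (h2 i)

theorem normal_lowerFace (hab : ∀ i, a i < b i) (i : Fin (n + 1)) {y : Fin n → ℝ}
    (hy : ∀ j, y j ∈ Set.Ioo (a (i.succAbove j)) (b (i.succAbove j))) :
    normal a b (i.insertNth (α := fun _ => ℝ) (a i) y) = Pi.single i (-1) := by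
  ext j
  refine Fin.succAboveCases i ?_ (fun j => ?_) j
  · simp [normal, (hab i).ne]
  · simp [normal, (hy j).1.ne', (hy j).2.ne, Fin.succAbove_ne]

theorem normal_upperFace (i : Fin (n + 1)) {y : Fin n → ℝ}
    (hy : ∀ j, y j ∈ Set.Ioo (a (i.succAbove j)) (b (i.succAbove j))) :
    normal a b (i.insertNth (α := fun _ => ℝ) (b i) y) = Pi.single i 1 := by
  ext j
  refine Fin.succAboveCases i ?_ (fun j => ?_) j
  · simp [normal]
  · simp [normal, (hy j).1.ne', (hy j).2.ne, Fin.succAbove_ne]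

theorem ae_normal_lowerFace (hab : ∀ i, a i < b i) (i : Fin (n + 1)) :
    ∀ᵐ x ∂(faceMeasure a b i (a i)), x ∈ Set.Icc a b ∧ normal a b x = Pi.single i (-1) ∧
      x i = a i := by
  rw [ae_faceMeasure_iff]
  filter_upwards [ae_faceVol i Set.countable_empty] with y hy
  exact ⟨insertNth_mem_Icc (Set.left_mem_Icc.2 (hab i).le) hy.1, normal_lowerFace hab i hy.1,
    by simp⟩

theorem ae_normal_upperFace (hab : ∀ i, a i < b i) (i : Fin (n + 1)) :
    ∀ᵐ x ∂(faceMeasure a b i (b i)), x ∈ Set.Icc a b ∧ normal a b x = Pi.single i 1 ∧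
      x i = b i := by
  rw [ae_faceMeasure_iff]
  filter_upwards [ae_faceVol i Set.countable_empty] with y hy
  exact ⟨insertNth_mem_Icc (Set.right_mem_Icc.2 (hab i).le) hy.1, normal_upperFace i hy.1,
    by simp⟩

/-- The outward normal at almost every point of the boundary. -/
theorem ae_surf_normal (hab : ∀ i, a i < b i) :
    ∀ᵐ x ∂(surf a b), x ∈ Set.Icc a b ∧ ∃ i, (normal a b x = Pi.single i (-1) ∧ x i = a i) ∨
      (normal a b x = Pi.single i 1 ∧ x i = b i) := by
  rw [ae_surf_iff]
  refine fun i => ⟨?_, ?_⟩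
  · filter_upwards [ae_normal_lowerFace hab i] with x hx
    exact ⟨hx.1, i, Or.inl hx.2⟩
  · filter_upwards [ae_normal_upperFace hab i] with x hx
    exact ⟨hx.1, i, Or.inr hx.2⟩

theorem measurable_normal (i : Fin (n + 1)) : Measurable fun x => normal a b x i := by
  unfold normal
  refine Measurable.ite ?_ measurable_const (Measurable.ite ?_ measurable_const measurable_const)
  · exact measurableSet_eq_fun (measurable_pi_apply i) measurable_const
  · exact measurableSet_eq_fun (measurable_pi_apply i) measurable_const

theorem norm_normal_le (x : Fin (n + 1) → ℝ) (i : Fin (n + 1)) : ‖normal a b x i‖ ≤ 1 := by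
  unfold normal; split_ifs <;> simp

theorem surf_eq_restrict (hab : ∀ i, a i < b i) :
    surf a b = (surf a b).restrict (Set.Icc a b) := by
  symm
  apply Measure.restrict_eq_self_of_ae_mem
  filter_upwards [ae_surf_normal hab] with x hx using hx.1

theorem aestronglyMeasurable_surf (hab : ∀ i, a i < b i) {F : (Fin (n + 1) → ℝ) → E}
    (hF : ContinuousOn F (Set.Icc a b)) : AEStronglyMeasurable F (surf a b) := by
  rw [surf_eq_restrict hab]
  exact hF.aestronglyMeasurable_of_isCompact isCompact_Icc measurableSet_Icc

theorem memLp_top_volΩ {F : (Fin (n + 1) → ℝ) → E}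
    (hF : ContinuousOn F (Set.Icc a b)) : MemLp F ⊤ (volΩ a b) := by
  obtain ⟨M, hM⟩ := isCompact_Icc.exists_bound_of_continuousOn hF
  refine memLp_top_of_bound ?_ M ?_
  · rw [volΩ_eq_Icc]
    exact hF.aestronglyMeasurable_of_isCompact isCompact_Icc measurableSet_Icc
  · filter_upwards [ae_openBox Set.countable_empty] with x hx using hM x (openBox_subset_Icc hx.1)

theorem memLp_top_surf (hab : ∀ i, a i < b i) {F : (Fin (n + 1) → ℝ) → E}
    (hF : ContinuousOn F (Set.Icc a b)) : MemLp F ⊤ (surf a b) := by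
  obtain ⟨M, hM⟩ := isCompact_Icc.exists_bound_of_continuousOn hF
  refine memLp_top_of_bound (aestronglyMeasurable_surf hab hF) M ?_
  filter_upwards [ae_surf_normal hab] with x hx using hM x hx.1

/-- Only the two faces orthogonal to the `i`-th axis contribute: there the `i`-th component of the
normal is `1` and `-1`, and it vanishes almost everywhere on the other faces. -/
theorem integral_normal_mul (hab : ∀ i, a i < b i) (i : Fin (n + 1))
    {F : (Fin (n + 1) → ℝ) → ℂ} (hF : ContinuousOn F (Set.Icc a b)) :
    ∫ x, (normal a b x i : ℂ) * F x ∂(surf a b) =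
      ∫ x, F x ∂(faceMeasure a b i (b i)) - ∫ x, F x ∂(faceMeasure a b i (a i)) := by
  have hint : Integrable (fun x => (normal a b x i : ℂ) * F x) (surf a b) := by
    refine ((memLp_top_surf hab hF).integrable le_top).bdd_mul (c := 1) ?_ ?_
    · exact (Complex.measurable_ofReal.comp (measurable_normal i)).aestronglyMeasurable
    · exact ae_of_all _ fun x => by simpa using norm_normal_le x i
  rw [integral_surf hint]
  have h1 : ∀ j, ∫ x, (normal a b x i : ℂ) * F x ∂(faceMeasure a b j (a j)) =
      if j = i then - ∫ x, F x ∂(faceMeasure a b i (a i)) else 0 := by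
    intro j
    split_ifs with hj
    · subst hj
      rw [← integral_neg]
      apply integral_congr_ae
      filter_upwards [ae_normal_lowerFace hab j] with x hx
      simp [hx.2.1]
    · apply integral_eq_zero_of_ae
      filter_upwards [ae_normal_lowerFace hab j] with x hx
      simp [hx.2.1, Ne.symm hj]
  have h2 : ∀ j, ∫ x, (normal a b x i : ℂ) * F x ∂(faceMeasure a b j (b j)) =
      if j = i then ∫ x, F x ∂(faceMeasure a b i (b i)) else 0 := by
    intro j
    split_ifs with hj
    · subst hj
      apply integral_congr_ae
      filter_upwards [ae_normal_upperFace hab j] with x hx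
      simp [hx.2.1]
    · apply integral_eq_zero_of_ae
      filter_upwards [ae_normal_upperFace hab j] with x hx
      simp [hx.2.1, Ne.symm hj]
  simp only [h1, h2, Finset.sum_add_distrib, Finset.sum_ite_eq', Finset.mem_univ, if_true]
  ring

/-- The divergence theorem on the box for fields that are differentiable off a grid. -/
theorem integral_divergence (hab : ∀ i, a i < b i) {S : Set ℝ} (hS : S.Countable)
    {F DF : Fin (n + 1) → (Fin (n + 1) → ℝ) → ℂ} (hF : ∀ i, ContinuousOn (F i) (Set.Icc a b))
    (hd : ∀ i, ∀ x ∈ openBox a b, (∀ j, x j ∉ S) →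
      HasDerivAt (fun t => F i (Function.update x i t)) (DF i x) (x i))
    (hi : ∀ i, Integrable (DF i) (volΩ a b)) :
    ∫ x, ∑ i, DF i x ∂(volΩ a b) = ∫ x, ∑ i, (normal a b x i : ℂ) * F i x ∂(surf a b) := by
  rw [integral_finsetSum _ fun i _ => hi i, integral_finsetSum]
  · refine Finset.sum_congr rfl fun i _ => ?_
    rw [integral_normal_mul hab i (hF i), integral_partialDeriv hab i hS (hF i) (hd i) (hi i)]
  · intro i _
    refine ((memLp_top_surf hab (hF i)).integrable le_top).bdd_mul (c := 1) ?_ ?_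
    · exact (Complex.measurable_ofReal.comp (measurable_normal i)).aestronglyMeasurable
    · exact ae_of_all _ fun x => by simpa using norm_normal_le x i

end Box

/-! ### Square integrable functions -/

theorem integral_norm_mul_norm_le {X E F : Type*} [MeasurableSpace X] {μ : Measure X}
    [NormedAddCommGroup E] [NormedAddCommGroup F]
    {f : X → E} {g : X → F} (hf : MemLp f 2 μ) (hg : MemLp g 2 μ) :
    ∫ x, ‖f x‖ * ‖g x‖ ∂μ ≤ √(∫ x, ‖f x‖ ^ 2 ∂μ) * √(∫ x, ‖g x‖ ^ 2 ∂μ) := by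
  have h2 : ENNReal.ofReal 2 = 2 := by norm_num
  have h := integral_mul_le_Lp_mul_Lq_of_nonneg (μ := μ) Real.HolderConjugate.two_two
    (f := fun x => ‖f x‖) (g := fun x => ‖g x‖) (ae_of_all _ fun _ => norm_nonneg _)
    (ae_of_all _ fun _ => norm_nonneg _) (by rw [h2]; exact hf.norm) (by rw [h2]; exact hg.norm)
  rw [Real.sqrt_eq_rpow, Real.sqrt_eq_rpow]
  simpa using h

theorem integrable_norm_sq {X E : Type*} [MeasurableSpace X] {μ : Measure X}
    [NormedAddCommGroup E] {f : X → E} (hf : MemLp f 2 μ) : Integrable (fun x => ‖f x‖ ^ 2) μ := by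
  simpa using hf.integrable_norm_pow (by norm_num)

theorem integrable_norm_mul_norm {X E F : Type*} [MeasurableSpace X] {μ : Measure X}
    [NormedAddCommGroup E] [NormedAddCommGroup F]
    {f : X → E} {g : X → F} (hf : MemLp f 2 μ) (hg : MemLp g 2 μ) :
    Integrable (fun x => ‖f x‖ * ‖g x‖) μ :=
  hf.norm.integrable_mul hg.norm

/-! ### The multiplicative trace inequality -/

section Box

variable {n : ℕ} {a b : Fin (n + 1) → ℝ}

/-- Integrate `∂_i (θ(x_i) |F|²) = s |F|² + 2 θ Re (F · conj ∂_i F)` over the box and use `|θ| ≤ 1`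
and Cauchy–Schwarz. The product of the two norms is kept, because in the interpolation estimate it
is worth an extra half power of `h` compared with the norm of `DF` alone. -/
theorem face_trace_aux (hab : ∀ i, a i < b i) (i : Fin (n + 1)) {S : Set ℝ} (hS : S.Countable)
    {F DF : (Fin (n + 1) → ℝ) → ℂ} (hF : ContinuousOn F (Set.Icc a b))
    (hd : ∀ x ∈ openBox a b, (∀ j, x j ∉ S) →
      HasDerivAt (fun t => F (Function.update x i t)) (DF x) (x i))
    (hi : MemLp DF ⊤ (volΩ a b)) (θ : ℝ → ℝ) (s : ℝ) (hθ : ∀ t, HasDerivAt θ s t)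
    (hθ1 : ∀ t ∈ Set.Icc (a i) (b i), |θ t| ≤ 1) :
    θ (b i) * ∫ x, ‖F x‖ ^ 2 ∂(faceMeasure a b i (b i)) -
      θ (a i) * ∫ x, ‖F x‖ ^ 2 ∂(faceMeasure a b i (a i)) ≤
      |s| * sqNorm (volΩ a b) F + 2 * (√(sqNorm (volΩ a b) F) * √(sqNorm (volΩ a b) DF)) := by
  have hF2 : MemLp F 2 (volΩ a b) := (memLp_top_volΩ hF).mono_exponent le_top
  have hDF2 : MemLp DF 2 (volΩ a b) := hi.mono_exponent le_top
  have hθc : Continuous θ := continuous_iff_continuousAt.2 fun t => (hθ t).continuousAt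
  have hint : Integrable (fun x : Fin (n + 1) → ℝ =>
      s * ‖F x‖ ^ 2 + θ (x i) * (2 * inner ℝ (F x) (DF x))) (volΩ a b) := by
    refine ((integrable_norm_sq hF2).const_mul s).add ?_
    have h1 : MemLp (fun x : Fin (n + 1) → ℝ => θ (x i)) ⊤ (volΩ a b) :=
      memLp_top_volΩ (hθc.comp (continuous_apply i)).continuousOn
    refine (Integrable.const_mul ?_ 2).bdd_mul (c := 1) h1.1 ?_
    · refine (integrable_norm_mul_norm hF2 hDF2).mono' (hF2.1.inner hDF2.1) ?_
      exact ae_of_all _ fun x => norm_inner_le_norm _ _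
    · filter_upwards [ae_openBox Set.countable_empty] with x hx
      exact hθ1 _ ⟨(hx.1 i trivial).1.le, (hx.1 i trivial).2.le⟩
  have h := integral_partialDeriv hab i hS (F := fun x => θ (x i) * ‖F x‖ ^ 2)
    (DF := fun x => s * ‖F x‖ ^ 2 + θ (x i) * (2 * inner ℝ (F x) (DF x)))
    ((hθc.comp (continuous_apply i)).continuousOn.mul (hF.norm.pow 2)) ?_ hint
  · have hb : ∫ x, θ (x i) * ‖F x‖ ^ 2 ∂(faceMeasure a b i (b i)) =
        θ (b i) * ∫ x, ‖F x‖ ^ 2 ∂(faceMeasure a b i (b i)) := by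
      rw [← integral_const_mul]
      apply integral_congr_ae
      filter_upwards [ae_normal_upperFace hab i] with x hx
      rw [hx.2.2]
    have ha : ∫ x, θ (x i) * ‖F x‖ ^ 2 ∂(faceMeasure a b i (a i)) =
        θ (a i) * ∫ x, ‖F x‖ ^ 2 ∂(faceMeasure a b i (a i)) := by
      rw [← integral_const_mul]
      apply integral_congr_ae
      filter_upwards [ae_normal_lowerFace hab i] with x hx
      rw [hx.2.2]
    rw [hb, ha] at h
    rw [← h]
    have hint2 := ((integrable_norm_sq hF2).const_mul |s|).add
      ((integrable_norm_mul_norm hF2 hDF2).const_mul 2)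
    calc _ ≤ ∫ x, (|s| * ‖F x‖ ^ 2 + 2 * (‖F x‖ * ‖DF x‖)) ∂(volΩ a b) := by
          apply integral_mono_ae hint hint2
          filter_upwards [ae_openBox Set.countable_empty] with x hx
          have h1 := hθ1 (x i) ⟨(hx.1 i trivial).1.le, (hx.1 i trivial).2.le⟩
          have h2 := abs_real_inner_le_norm (F x) (DF x)
          have h3 : θ (x i) * (2 * inner ℝ (F x) (DF x)) ≤ 1 * (2 * (‖F x‖ * ‖DF x‖)) := by
            refine (le_abs_self _).trans ?_
            rw [abs_mul, abs_mul, abs_two]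
            gcongr
          have h4 : s * ‖F x‖ ^ 2 ≤ |s| * ‖F x‖ ^ 2 := by gcongr; exact le_abs_self s
          simp only [Pi.add_apply]
          linarith
      _ ≤ _ := by
          rw [integral_add ((integrable_norm_sq hF2).const_mul |s|)
            ((integrable_norm_mul_norm hF2 hDF2).const_mul 2), integral_const_mul,
            integral_const_mul]
          gcongr
          · exact le_rfl
          · exact integral_norm_mul_norm_le hF2 hDF2
  · intro x hx hxS
    have h1 := hd x hx hxS
    have h2 := h1.norm_sq
    have h3 : HasDerivAt (fun t => θ (Function.update x i t i)) s (x i) := by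
      simpa using hθ (x i)
    have h4 := h3.mul h2
    simp only [Function.update_self, Function.update_eq_self] at h4
    simp only [Function.update_self]
    exact h4

/-- The multiplicative trace inequality on a pair of opposite faces. -/
theorem face_trace_le (hab : ∀ i, a i < b i) (i : Fin (n + 1)) {S : Set ℝ} (hS : S.Countable)
    {F DF : (Fin (n + 1) → ℝ) → ℂ} (hF : ContinuousOn F (Set.Icc a b))
    (hd : ∀ x ∈ openBox a b, (∀ j, x j ∉ S) →
      HasDerivAt (fun t => F (Function.update x i t)) (DF x) (x i))
    (hi : MemLp DF ⊤ (volΩ a b)) :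
    (∫ x, ‖F x‖ ^ 2 ∂(faceMeasure a b i (a i)) + ∫ x, ‖F x‖ ^ 2 ∂(faceMeasure a b i (b i))) ≤
      2 * ((b i - a i)⁻¹ * sqNorm (volΩ a b) F +
        2 * (√(sqNorm (volΩ a b) F) * √(sqNorm (volΩ a b) DF))) := by
  have hl : 0 < b i - a i := sub_pos.2 (hab i)
  -- Two linear weights isolate the two faces: the first is `0` on the lower and `1` on the upper
  -- face, the second is `-1` on the lower and `0` on the upper face.
  have h1 := face_trace_aux hab i hS hF hd hi (fun t => (t - a i) / (b i - a i)) (b i - a i)⁻¹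
    (fun t => by simpa using ((hasDerivAt_id t).sub_const (a i)).div_const (b i - a i))
    (fun t ht => by
      rw [abs_of_nonneg (div_nonneg (sub_nonneg.2 ht.1) hl.le), div_le_one hl]
      linarith [ht.2])
  have h2 := face_trace_aux hab i hS hF hd hi (fun t => (t - b i) / (b i - a i)) (b i - a i)⁻¹
    (fun t => by simpa using ((hasDerivAt_id t).sub_const (b i)).div_const (b i - a i))
    (fun t ht => by
      rw [abs_of_nonpos (div_nonpos_of_nonpos_of_nonneg (sub_nonpos.2 ht.2) hl.le), ← neg_div,
        div_le_one hl]
      linarith [ht.1])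
  have e1 : (b i - a i) / (b i - a i) = 1 := div_self hl.ne'
  have e2 : (a i - b i) / (b i - a i) = -1 := by rw [← neg_sub, neg_div, e1]
  simp only [e1, e2, sub_self, zero_div, zero_mul, one_mul, sub_zero, zero_sub, neg_mul,
    neg_neg, abs_of_pos (inv_pos.2 hl)] at h1 h2
  linarith

end Box

/-! ### Functions that are piecewise of class `C²` -/

/-- The classical second derivative `∂_i ∂_j v`. -/
def hess {d : ℕ} (v : (Fin d → ℝ) → ℂ) (i j : Fin d) (x : Fin d → ℝ) : ℂ :=
  fderiv ℝ (fun y => fderiv ℝ v y (Pi.single j 1)) x (Pi.single i 1)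

/-- The classical Laplacian. -/
def clap {d : ℕ} (v : (Fin d → ℝ) → ℂ) (x : Fin d → ℝ) : ℂ := ∑ i, hess v i i x

section Box

variable {n : ℕ} {a b : Fin (n + 1) → ℝ}

theorem uniqueDiffOn_box (hab : ∀ i, a i < b i) : UniqueDiffOn ℝ (Set.Icc a b) := by
  rw [← Set.pi_univ_Icc]
  exact UniqueDiffOn.univ_pi fun i => uniqueDiffOn_Icc (hab i)

theorem cgrad_eq_fderiv {v : (Fin (n + 1) → ℝ) → ℂ} {x : Fin (n + 1) → ℝ} (hx : x ∈ openBox a b)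
    (i : Fin (n + 1)) : cgrad a b v i x = fderiv ℝ v x (Pi.single i 1) := by
  rw [cgrad, fderivWithin_of_mem_nhds]
  exact mem_of_superset (isOpen_openBox.mem_nhds hx) openBox_subset_Icc

theorem continuousOn_cgrad (hab : ∀ i, a i < b i) {v : (Fin (n + 1) → ℝ) → ℂ}
    (hv : ContDiffOn ℝ 1 v (Set.Icc a b)) (i : Fin (n + 1)) :
    ContinuousOn (cgrad a b v i) (Set.Icc a b) :=
  (hv.continuousOn_fderivWithin (uniqueDiffOn_box hab) le_rfl).clm_apply continuousOn_const

theorem hasDerivAt_cgrad {v : (Fin (n + 1) → ℝ) → ℂ}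
    (hv : ContDiffOn ℝ 1 v (Set.Icc a b)) {x : Fin (n + 1) → ℝ} (hx : x ∈ openBox a b)
    (i : Fin (n + 1)) :
    HasDerivAt (fun t => v (Function.update x i t)) (cgrad a b v i x) (x i) := by
  have hd : DifferentiableAt ℝ v x :=
    (hv.differentiableOn one_ne_zero).differentiableAt
      (mem_of_superset (isOpen_openBox.mem_nhds hx) openBox_subset_Icc)
  rw [cgrad_eq_fderiv hx]
  have h1 := hasDerivAt_update x i (x i)
  have h2 : HasFDerivAt v (fderiv ℝ v x) (Function.update x i (x i)) := by
    rw [Function.update_eq_self]; exact hd.hasFDerivAt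
  exact h2.comp_hasDerivAt (x i) h1

theorem cgrad_add {u v : (Fin (n + 1) → ℝ) → ℂ} (hab : ∀ i, a i < b i)
    (hu : ContDiffOn ℝ 1 u (Set.Icc a b)) (hv : ContDiffOn ℝ 1 v (Set.Icc a b))
    {x : Fin (n + 1) → ℝ} (hx : x ∈ Set.Icc a b) (i : Fin (n + 1)) :
    cgrad a b (u + v) i x = cgrad a b u i x + cgrad a b v i x := by
  rw [cgrad, fderivWithin_add (uniqueDiffOn_box hab x hx)
    (hu.differentiableOn one_ne_zero x hx) (hv.differentiableOn one_ne_zero x hx)]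
  rfl

theorem cgrad_smul {u : (Fin (n + 1) → ℝ) → ℂ} (c : ℂ) (hab : ∀ i, a i < b i)
    (hu : ContDiffOn ℝ 1 u (Set.Icc a b))
    {x : Fin (n + 1) → ℝ} (hx : x ∈ Set.Icc a b) (i : Fin (n + 1)) :
    cgrad a b (c • u) i x = c * cgrad a b u i x := by
  rw [cgrad, fderivWithin_const_smul (uniqueDiffOn_box hab x hx)
    (hu.differentiableOn one_ne_zero x hx)]
  rfl

theorem eventually_differentiableAt {d : ℕ} {u : (Fin d → ℝ) → ℂ} {x : Fin d → ℝ}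
    (hu : ContDiffAt ℝ 2 u x) : ∀ᶠ y in 𝓝 x, DifferentiableAt ℝ u y := by
  filter_upwards [hu.eventually (by simp)] with y hy
  exact hy.differentiableAt (by simp)

theorem differentiableAt_fderiv_apply {d : ℕ} {u : (Fin d → ℝ) → ℂ} {x : Fin d → ℝ}
    (hu : ContDiffAt ℝ 2 u x) (j : Fin d) :
    DifferentiableAt ℝ (fun y => fderiv ℝ u y (Pi.single j 1)) x :=
  ((hu.fderiv_right (m := 1) (by norm_num)).differentiableAt one_ne_zero).clm_apply
    (differentiableAt_const _)

theorem hess_add {d : ℕ} {u v : (Fin d → ℝ) → ℂ} {x : Fin d → ℝ} (hu : ContDiffAt ℝ 2 u x)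
    (hv : ContDiffAt ℝ 2 v x) (i j : Fin d) :
    hess (u + v) i j x = hess u i j x + hess v i j x := by
  have h1 : (fun y => fderiv ℝ (u + v) y (Pi.single j 1)) =ᶠ[𝓝 x]
      (fun y => fderiv ℝ u y (Pi.single j 1)) + fun y => fderiv ℝ v y (Pi.single j 1) := by
    filter_upwards [eventually_differentiableAt hu, eventually_differentiableAt hv] with y h1 h2
    simp [fderiv_add h1 h2]
  rw [hess, h1.fderiv_eq, fderiv_add (differentiableAt_fderiv_apply hu j)
    (differentiableAt_fderiv_apply hv j)]
  rfl

theorem hess_smul {d : ℕ} {u : (Fin d → ℝ) → ℂ} {x : Fin d → ℝ} (c : ℂ)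
    (hu : ContDiffAt ℝ 2 u x) (i j : Fin d) :
    hess (c • u) i j x = c * hess u i j x := by
  have h1 : (fun y => fderiv ℝ (c • u) y (Pi.single j 1)) =ᶠ[𝓝 x]
      c • (fun y => fderiv ℝ u y (Pi.single j 1)) := by
    filter_upwards [eventually_differentiableAt hu] with y h1
    simp [fderiv_const_smul h1]
  rw [hess, h1.fderiv_eq, fderiv_const_smul (differentiableAt_fderiv_apply hu j)]
  rfl

theorem hess_symm {d : ℕ} {u : (Fin d → ℝ) → ℂ} {x : Fin d → ℝ}
    (hu : ContDiffAt ℝ 2 u x) (i j : Fin d) : hess u i j x = hess u j i x := by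
  have hs : IsSymmSndFDerivAt ℝ u x := hu.isSymmSndFDerivAt (by simp)
  have h1 : ∀ i j : Fin d, hess u i j x =
      fderiv ℝ (fderiv ℝ u) x (Pi.single i 1) (Pi.single j 1) := by
    intro i j
    have hd : DifferentiableAt ℝ (fderiv ℝ u) x :=
      (hu.fderiv_right (m := 1) (by norm_num)).differentiableAt one_ne_zero
    rw [hess, fderiv_clm_apply hd (differentiableAt_const _)]
    simp
  rw [h1, h1, hs]

/-- The functions in `C¹(Ω̄)` that are of class `C²`, with bounded second derivatives, at the points
of `Ω` no coordinate of which is in `S`. -/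
def gridC2 (a b : Fin (n + 1) → ℝ) (S : Set ℝ) : Submodule ℂ ((Fin (n + 1) → ℝ) → ℂ) where
  carrier := {v | ContDiffOn ℝ 1 v (Set.Icc a b) ∧
    (∀ x ∈ openBox a b, (∀ i, x i ∉ S) → ContDiffAt ℝ 2 v x) ∧
    ∃ M, ∀ x ∈ openBox a b, (∀ i, x i ∉ S) → ∀ i j, ‖hess v i j x‖ ≤ M}
  add_mem' := by
    rintro u v ⟨hu, hu2, M, hM⟩ ⟨hv, hv2, M', hM'⟩
    refine ⟨hu.add hv, fun x hx hS => (hu2 x hx hS).add (hv2 x hx hS), M + M', ?_⟩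
    intro x hx hS i j
    rw [hess_add (hu2 x hx hS) (hv2 x hx hS)]
    exact (norm_add_le _ _).trans (add_le_add (hM x hx hS i j) (hM' x hx hS i j))
  zero_mem' := by
    refine ⟨contDiffOn_const, fun _ _ _ => contDiffAt_const, 0, fun x _ _ i j => ?_⟩
    simp [hess]
  smul_mem' := by
    rintro c v ⟨hv, hv2, M, hM⟩
    refine ⟨hv.const_smul c, fun x hx hS => (hv2 x hx hS).const_smul c, ‖c‖ * M, ?_⟩
    intro x hx hS i j
    rw [hess_smul c (hv2 x hx hS), norm_mul]
    gcongr
    exact hM x hx hS i j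

variable {S : Set ℝ} {u v w : (Fin (n + 1) → ℝ) → ℂ}

theorem hasDerivAt_hess (hv : v ∈ gridC2 a b S) {x : Fin (n + 1) → ℝ} (hx : x ∈ openBox a b)
    (hxS : ∀ i, x i ∉ S) (i j : Fin (n + 1)) :
    HasDerivAt (fun t => cgrad a b v j (Function.update x i t)) (hess v i j x) (x i) := by
  have h1 := hasDerivAt_update x i (x i)
  have h2 : HasFDerivAt (fun y => fderiv ℝ v y (Pi.single j 1))
      (fderiv ℝ (fun y => fderiv ℝ v y (Pi.single j 1)) x) (Function.update x i (x i)) := by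
    rw [Function.update_eq_self]
    exact (differentiableAt_fderiv_apply (hv.2.1 x hx hxS) j).hasFDerivAt
  refine (h2.comp_hasDerivAt (x i) h1).congr_of_eventuallyEq ?_
  have h3 : ∀ᶠ t in 𝓝 (x i), Function.update x i t ∈ openBox a b := by
    apply h1.continuousAt.eventually_mem
    rw [Function.update_eq_self]
    exact isOpen_openBox.mem_nhds hx
  filter_upwards [h3] with t ht
  rw [cgrad_eq_fderiv ht]
  rfl

theorem measurable_hess {d : ℕ} (v : (Fin d → ℝ) → ℂ) (i j : Fin d) : Measurable (hess v i j) :=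
  measurable_fderiv_apply_const ℝ _ _

theorem memLp_hess (hS : S.Countable) (hv : v ∈ gridC2 a b S) (i j : Fin (n + 1)) :
    MemLp (hess v i j) ⊤ (volΩ a b) := by
  obtain ⟨M, hM⟩ := hv.2.2
  refine memLp_top_of_bound (measurable_hess v i j).aestronglyMeasurable M ?_
  filter_upwards [ae_openBox hS] with x hx using hM x hx.1 hx.2 i j

theorem memLp_clap (hS : S.Countable) (hv : v ∈ gridC2 a b S) :
    MemLp (clap v) ⊤ (volΩ a b) :=
  memLp_finsetSum _ fun i _ => memLp_hess hS hv i i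

theorem clap_add {d : ℕ} {u v : (Fin d → ℝ) → ℂ} {x : Fin d → ℝ} (hu : ContDiffAt ℝ 2 u x)
    (hv : ContDiffAt ℝ 2 v x) : clap (u + v) x = clap u x + clap v x := by
  simp only [clap, hess_add hu hv, Finset.sum_add_distrib]

theorem clap_smul {d : ℕ} {u : (Fin d → ℝ) → ℂ} {x : Fin d → ℝ} (c : ℂ)
    (hu : ContDiffAt ℝ 2 u x) : clap (c • u) x = c * clap u x := by
  simp only [clap, hess_smul c hu, Finset.mul_sum]

/-! ### Classical versions of the operators -/

/-- The classical normal derivative. -/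
def cnormalDeriv (a b : Fin (n + 1) → ℝ) (v : (Fin (n + 1) → ℝ) → ℂ) (x : Fin (n + 1) → ℝ) : ℂ :=
  ∑ i, normal a b x i * cgrad a b v i x

/-- The classical `𝓛 v`. -/
def copL {d : ℕ} (k : ℝ) (v : (Fin d → ℝ) → ℂ) (x : Fin d → ℝ) : ℂ :=
  clap v x + (k : ℂ) ^ 2 * v x

/-- The classical `𝓜 v` in `Ω`. -/
def copM (a b : Fin (n + 1) → ℝ) (k β : ℝ) (v : (Fin (n + 1) → ℝ) → ℂ)
    (x : Fin (n + 1) → ℝ) : ℂ :=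
  (∑ i, (x i : ℂ) * cgrad a b v i x) - Complex.I * k * β * v x + (n : ℂ) / 2 * v x

/-- The tangential part of the classical `𝓜 v` on `Γ`. -/
def copMtan (a b : Fin (n + 1) → ℝ) (k β : ℝ) (v : (Fin (n + 1) → ℝ) → ℂ)
    (x : Fin (n + 1) → ℝ) : ℂ :=
  (∑ i, (x i : ℂ) * csurfGrad a b v i x) - Complex.I * k * β * v x + (n : ℂ) / 2 * v x

/-- The classical `𝓜 v` on `Γ`. -/
def copMbdry (a b : Fin (n + 1) → ℝ) (k β : ℝ) (v : (Fin (n + 1) → ℝ) → ℂ)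
    (x : Fin (n + 1) → ℝ) : ℂ :=
  xn a b x * cnormalDeriv a b v x + copMtan a b k β v x

/-- The volume part of the integrand of the classical form `b`. -/
def formΩ (a b : Fin (n + 1) → ℝ) (k β A : ℝ) (u v : (Fin (n + 1) → ℝ) → ℂ)
    (x : Fin (n + 1) → ℝ) : ℂ :=
  (∑ i, cgrad a b u i x * star (cgrad a b v i x)) + (k : ℂ) ^ 2 * u x * star (v x) +
    (copM a b k β u x + (A : ℂ) / (k : ℂ) ^ 2 * copL k u x) * star (copL k v x)

/-- The boundary part of the integrand of the classical form `b`. -/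
def formΓ (a b : Fin (n + 1) → ℝ) (k β : ℝ) (u v : (Fin (n + 1) → ℝ) → ℂ)
    (x : Fin (n + 1) → ℝ) : ℂ :=
  Complex.I * k * u x * star (copMbdry a b k β v x) +
    copMtan a b k β u x * star (cnormalDeriv a b v x) +
    xn a b x * ((k : ℂ) ^ 2 * u x * star (v x) -
      ∑ i, csurfGrad a b u i x * star (csurfGrad a b v i x))

/-- The volume part of the integrand of the `V₁` inner product. -/
def innerΩ (a b : Fin (n + 1) → ℝ) (k : ℝ) (u v : (Fin (n + 1) → ℝ) → ℂ)
    (x : Fin (n + 1) → ℝ) : ℂ :=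
  ((k : ℂ) ^ 2)⁻¹ * (clap u x * star (clap v x)) +
    (∑ i, cgrad a b u i x * star (cgrad a b v i x)) + (k : ℂ) ^ 2 * (u x * star (v x))

/-- The boundary part of the integrand of the `V₁` inner product. -/
def innerΓ (a b : Fin (n + 1) → ℝ) (k : ℝ) (u v : (Fin (n + 1) → ℝ) → ℂ)
    (x : Fin (n + 1) → ℝ) : ℂ :=
  (k : ℂ) ^ 2 * (u x * star (v x)) + (∑ i, csurfGrad a b u i x * star (csurfGrad a b v i x)) +
    cnormalDeriv a b u x * star (cnormalDeriv a b v x)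

/-- The classical form `b`. -/
def cform (a b : Fin (n + 1) → ℝ) (k β A : ℝ) (u v : (Fin (n + 1) → ℝ) → ℂ) : ℂ :=
  ∫ x, formΩ a b k β A u v x ∂(volΩ a b) - ∫ x, formΓ a b k β u v x ∂(surf a b)

/-- The classical `V₁` inner product. -/
def cinner (a b : Fin (n + 1) → ℝ) (k : ℝ) (u v : (Fin (n + 1) → ℝ) → ℂ) : ℂ :=
  ∫ x, innerΩ a b k u v x ∂(volΩ a b) + ∫ x, innerΓ a b k u v x ∂(surf a b)

/-- The classical right-hand side. -/
def crhs (a b : Fin (n + 1) → ℝ) (k β A : ℝ) (f g v : (Fin (n + 1) → ℝ) → ℂ) : ℂ :=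
  (∫ x, (star (copM a b k β v x) - (A : ℂ) / (k : ℂ) ^ 2 * star (copL k v x)) * f x
      ∂(volΩ a b)) + ∫ x, star (copMbdry a b k β v x) * g x ∂(surf a b)

/-! #### Integrability -/

theorem memLp_mul_top {X : Type*} [MeasurableSpace X] {μ : Measure X} {f g : X → ℂ}
    (hf : MemLp f ⊤ μ) (hg : MemLp g ⊤ μ) : MemLp (fun x => f x * g x) ⊤ μ :=
  hg.mul (r := ⊤) hf

theorem memLp_star {X : Type*} [MeasurableSpace X] {μ : Measure X} {p : ENNReal} {f : X → ℂ}
    (hf : MemLp f p μ) : MemLp (fun x => star (f x)) p μ := hf.star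

section MemLp

variable (hab : ∀ i, a i < b i) (hS : S.Countable)
include hab

theorem memLp_cgrad (hv : v ∈ gridC2 a b S) (i : Fin (n + 1)) :
    MemLp (cgrad a b v i) ⊤ (volΩ a b) := memLp_top_volΩ (continuousOn_cgrad hab hv.1 i)

theorem memLp_normal (i : Fin (n + 1)) : MemLp (fun x => (normal a b x i : ℂ)) ⊤ (surf a b) :=
  memLp_top_of_bound (Complex.measurable_ofReal.comp (measurable_normal i)).aestronglyMeasurable 1
    (ae_of_all _ fun x => by simpa using norm_normal_le x i)

theorem memLp_cnormalDeriv (hv : v ∈ gridC2 a b S) :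
    MemLp (cnormalDeriv a b v) ⊤ (surf a b) :=
  memLp_finsetSum _ fun i _ =>
    memLp_mul_top (memLp_normal hab i) (memLp_top_surf hab (continuousOn_cgrad hab hv.1 i))

theorem memLp_csurfGrad (hv : v ∈ gridC2 a b S) (i : Fin (n + 1)) :
    MemLp (csurfGrad a b v i) ⊤ (surf a b) :=
  (memLp_top_surf hab (continuousOn_cgrad hab hv.1 i)).sub
    (memLp_mul_top (memLp_normal hab i) (memLp_cnormalDeriv hab hv))

theorem memLp_coord_surf (i : Fin (n + 1)) :
    MemLp (fun x : Fin (n + 1) → ℝ => (x i : ℂ)) ⊤ (surf a b) :=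
  memLp_top_surf hab (Continuous.continuousOn (by fun_prop))

theorem memLp_xn : MemLp (xn a b) ⊤ (surf a b) := by
  have h : xn a b = fun x => ∑ i, (x i : ℂ) * (normal a b x i : ℂ) := by
    ext x; simp [xn]
  rw [h]
  exact memLp_finsetSum _ fun i _ => memLp_mul_top (memLp_coord_surf hab i) (memLp_normal hab i)

theorem memLp_copM (hv : v ∈ gridC2 a b S) (k β : ℝ) :
    MemLp (copM a b k β v) ⊤ (volΩ a b) := by
  have hv0 := memLp_top_volΩ hv.1.continuousOn
  refine MemLp.add (MemLp.sub (memLp_finsetSum _ fun i _ => memLp_mul_top ?_ (memLp_cgrad hab hv i))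
    (hv0.const_mul _)) (hv0.const_mul _)
  exact memLp_top_volΩ (Continuous.continuousOn (by fun_prop))

theorem memLp_copMtan (hv : v ∈ gridC2 a b S) (k β : ℝ) :
    MemLp (copMtan a b k β v) ⊤ (surf a b) := by
  have hv0 := memLp_top_surf hab hv.1.continuousOn
  exact MemLp.add (MemLp.sub (memLp_finsetSum _ fun i _ =>
    memLp_mul_top (memLp_coord_surf hab i) (memLp_csurfGrad hab hv i))
    (hv0.const_mul _)) (hv0.const_mul _)

theorem memLp_copMbdry (hv : v ∈ gridC2 a b S) (k β : ℝ) :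
    MemLp (copMbdry a b k β v) ⊤ (surf a b) :=
  (memLp_mul_top (memLp_xn hab) (memLp_cnormalDeriv hab hv)).add (memLp_copMtan hab hv k β)

theorem memLp_formΓ (hu : u ∈ gridC2 a b S) (hv : v ∈ gridC2 a b S) (k β : ℝ) :
    MemLp (formΓ a b k β u v) ⊤ (surf a b) := by
  have hu0 := memLp_top_surf hab hu.1.continuousOn
  have hv0 := memLp_top_surf hab hv.1.continuousOn
  refine MemLp.add (MemLp.add ?_ ?_) (memLp_mul_top (memLp_xn hab) (MemLp.sub ?_ ?_))
  · exact memLp_mul_top (hu0.const_mul _) (memLp_star (memLp_copMbdry hab hv k β))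
  · exact memLp_mul_top (memLp_copMtan hab hu k β) (memLp_star (memLp_cnormalDeriv hab hv))
  · exact memLp_mul_top (hu0.const_mul _) (memLp_star hv0)
  · exact memLp_finsetSum _ fun i _ =>
      memLp_mul_top (memLp_csurfGrad hab hu i) (memLp_star (memLp_csurfGrad hab hv i))

theorem memLp_innerΓ (hu : u ∈ gridC2 a b S) (hv : v ∈ gridC2 a b S) (k : ℝ) :
    MemLp (innerΓ a b k u v) ⊤ (surf a b) := by
  have hu0 := memLp_top_surf hab hu.1.continuousOn
  have hv0 := memLp_top_surf hab hv.1.continuousOn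
  refine MemLp.add (MemLp.add ?_ ?_) ?_
  · exact (memLp_mul_top hu0 (memLp_star hv0)).const_mul _
  · exact memLp_finsetSum _ fun i _ =>
      memLp_mul_top (memLp_csurfGrad hab hu i) (memLp_star (memLp_csurfGrad hab hv i))
  · exact memLp_mul_top (memLp_cnormalDeriv hab hu) (memLp_star (memLp_cnormalDeriv hab hv))

include hS

omit hab in
theorem memLp_copL (hv : v ∈ gridC2 a b S) (k : ℝ) : MemLp (copL k v) ⊤ (volΩ a b) :=
  (memLp_clap hS hv).add ((memLp_top_volΩ hv.1.continuousOn).const_mul _)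

theorem memLp_formΩ (hu : u ∈ gridC2 a b S) (hv : v ∈ gridC2 a b S) (k β A : ℝ) :
    MemLp (formΩ a b k β A u v) ⊤ (volΩ a b) := by
  have hu0 := memLp_top_volΩ hu.1.continuousOn
  have hv0 := memLp_top_volΩ hv.1.continuousOn
  refine MemLp.add (MemLp.add ?_ ?_) ?_
  · exact memLp_finsetSum _ fun i _ =>
      memLp_mul_top (memLp_cgrad hab hu i) (memLp_star (memLp_cgrad hab hv i))
  · exact memLp_mul_top (hu0.const_mul _) (memLp_star hv0)
  · exact memLp_mul_top ((memLp_copM hab hu k β).add ((memLp_copL hS hu k).const_mul _))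
      (memLp_star (memLp_copL hS hv k))

theorem memLp_innerΩ (hu : u ∈ gridC2 a b S) (hv : v ∈ gridC2 a b S) (k : ℝ) :
    MemLp (innerΩ a b k u v) ⊤ (volΩ a b) := by
  have hu0 := memLp_top_volΩ hu.1.continuousOn
  have hv0 := memLp_top_volΩ hv.1.continuousOn
  refine MemLp.add (MemLp.add ?_ ?_) ?_
  · exact (memLp_mul_top (memLp_clap hS hu) (memLp_star (memLp_clap hS hv))).const_mul _
  · exact memLp_finsetSum _ fun i _ =>
      memLp_mul_top (memLp_cgrad hab hu i) (memLp_star (memLp_cgrad hab hv i))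
  · exact (memLp_mul_top hu0 (memLp_star hv0)).const_mul _

end MemLp

end Box

section Box

variable {n : ℕ} {a b : Fin (n + 1) → ℝ} {S : Set ℝ} {u v w : (Fin (n + 1) → ℝ) → ℂ}

/-! ### Sesquilinearity -/

theorem ae_vol_of_grid (hS : S.Countable) {P : (Fin (n + 1) → ℝ) → Prop}
    (h : ∀ x ∈ openBox a b, (∀ i, x i ∉ S) → P x) : ∀ᵐ x ∂(volΩ a b), P x := by
  filter_upwards [ae_openBox hS] with x hx using h x hx.1 hx.2

theorem ae_surf_of_Icc (hab : ∀ i, a i < b i) {P : (Fin (n + 1) → ℝ) → Prop}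
    (h : ∀ x ∈ Set.Icc a b, P x) : ∀ᵐ x ∂(surf a b), P x := by
  filter_upwards [ae_surf_normal hab] with x hx using h x hx.1

theorem cnormalDeriv_add (hab : ∀ i, a i < b i)
    (hu : u ∈ gridC2 a b S) (hv : v ∈ gridC2 a b S) {x : Fin (n + 1) → ℝ} (hx : x ∈ Set.Icc a b) :
    cnormalDeriv a b (u + v) x = cnormalDeriv a b u x + cnormalDeriv a b v x := by
  simp only [cnormalDeriv, cgrad_add hab hu.1 hv.1 hx, mul_add, Finset.sum_add_distrib]

theorem cnormalDeriv_smul (c : ℂ) (hab : ∀ i, a i < b i)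
    (hu : u ∈ gridC2 a b S) {x : Fin (n + 1) → ℝ} (hx : x ∈ Set.Icc a b) :
    cnormalDeriv a b (c • u) x = c * cnormalDeriv a b u x := by
  simp only [cnormalDeriv, cgrad_smul c hab hu.1 hx, Finset.mul_sum]
  exact Finset.sum_congr rfl fun i _ => by ring

theorem csurfGrad_add (hab : ∀ i, a i < b i)
    (hu : u ∈ gridC2 a b S) (hv : v ∈ gridC2 a b S) {x : Fin (n + 1) → ℝ} (hx : x ∈ Set.Icc a b)
    (j : Fin (n + 1)) :
    csurfGrad a b (u + v) j x = csurfGrad a b u j x + csurfGrad a b v j x := by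
  have h := cnormalDeriv_add hab hu hv hx
  simp only [cnormalDeriv] at h
  simp only [csurfGrad]
  rw [h, cgrad_add hab hu.1 hv.1 hx]
  ring

theorem csurfGrad_smul (c : ℂ) (hab : ∀ i, a i < b i)
    (hu : u ∈ gridC2 a b S) {x : Fin (n + 1) → ℝ} (hx : x ∈ Set.Icc a b) (j : Fin (n + 1)) :
    csurfGrad a b (c • u) j x = c * csurfGrad a b u j x := by
  have h := cnormalDeriv_smul c hab hu hx
  simp only [cnormalDeriv] at h
  simp only [csurfGrad]
  rw [h, cgrad_smul c hab hu.1 hx]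
  ring

theorem copL_add {d : ℕ} {u v : (Fin d → ℝ) → ℂ} {x : Fin d → ℝ} (k : ℝ)
    (hu : ContDiffAt ℝ 2 u x) (hv : ContDiffAt ℝ 2 v x) :
    copL k (u + v) x = copL k u x + copL k v x := by
  simp only [copL, clap_add hu hv, Pi.add_apply]; ring

theorem copL_smul {d : ℕ} {u : (Fin d → ℝ) → ℂ} {x : Fin d → ℝ} (k : ℝ) (c : ℂ)
    (hu : ContDiffAt ℝ 2 u x) : copL k (c • u) x = c * copL k u x := by
  simp only [copL, clap_smul c hu, Pi.smul_apply, smul_eq_mul]; ring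

theorem copM_add (k β : ℝ) (hab : ∀ i, a i < b i)
    (hu : u ∈ gridC2 a b S) (hv : v ∈ gridC2 a b S) {x : Fin (n + 1) → ℝ} (hx : x ∈ Set.Icc a b) :
    copM a b k β (u + v) x = copM a b k β u x + copM a b k β v x := by
  simp only [copM, cgrad_add hab hu.1 hv.1 hx, mul_add, Finset.sum_add_distrib, Pi.add_apply]; ring

theorem copM_smul (k β : ℝ) (c : ℂ) (hab : ∀ i, a i < b i)
    (hu : u ∈ gridC2 a b S) {x : Fin (n + 1) → ℝ} (hx : x ∈ Set.Icc a b) :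
    copM a b k β (c • u) x = c * copM a b k β u x := by
  simp only [copM, cgrad_smul c hab hu.1 hx, mul_add, mul_sub, Finset.mul_sum, Pi.smul_apply,
    smul_eq_mul]
  congr 1
  · congr 1
    · exact Finset.sum_congr rfl fun i _ => by ring
    · ring
  · ring

theorem copMtan_add (k β : ℝ) (hab : ∀ i, a i < b i)
    (hu : u ∈ gridC2 a b S) (hv : v ∈ gridC2 a b S) {x : Fin (n + 1) → ℝ} (hx : x ∈ Set.Icc a b) :
    copMtan a b k β (u + v) x = copMtan a b k β u x + copMtan a b k β v x := by
  simp only [copMtan, csurfGrad_add hab hu hv hx, mul_add, Finset.sum_add_distrib, Pi.add_apply]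
  ring

theorem copMtan_smul (k β : ℝ) (c : ℂ) (hab : ∀ i, a i < b i)
    (hu : u ∈ gridC2 a b S) {x : Fin (n + 1) → ℝ} (hx : x ∈ Set.Icc a b) :
    copMtan a b k β (c • u) x = c * copMtan a b k β u x := by
  simp only [copMtan, csurfGrad_smul c hab hu hx, mul_add, mul_sub, Finset.mul_sum, Pi.smul_apply,
    smul_eq_mul]
  congr 1
  · congr 1
    · exact Finset.sum_congr rfl fun i _ => by ring
    · ring
  · ring

theorem integral_add_of_pointwise {X : Type*} [MeasurableSpace X] {μ : Measure X}
    [IsFiniteMeasure μ] {f g h : X → ℂ} (hf : MemLp f ⊤ μ) (hg : MemLp g ⊤ μ)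
    (hh : ∀ᵐ x ∂μ, h x = f x + g x) : ∫ x, h x ∂μ = ∫ x, f x ∂μ + ∫ x, g x ∂μ := by
  rw [integral_congr_ae hh, integral_add (hf.integrable le_top) (hg.integrable le_top)]

theorem integral_smul_of_pointwise {X : Type*} [MeasurableSpace X] {μ : Measure X}
    {f h : X → ℂ} {c : ℂ} (hh : ∀ᵐ x ∂μ, h x = c * f x) : ∫ x, h x ∂μ = c * ∫ x, f x ∂μ := by
  rw [integral_congr_ae hh, integral_const_mul]

section

variable (hab : ∀ i, a i < b i) (hS : S.Countable)

/-- The classical form `b` as a sesquilinear map. -/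
def cformₗ (k β A : ℝ) : gridC2 a b S →ₗ[ℂ] gridC2 a b S →ₗ⋆[ℂ] ℂ :=
  LinearMap.mk₂'ₛₗ (RingHom.id ℂ) (starRingEnd ℂ) (fun u v => cform a b k β A u.1 v.1)
    (by
      rintro ⟨u, hu⟩ ⟨v, hv⟩ ⟨w, hw⟩
      simp only [cform, Submodule.coe_add]
      rw [integral_add_of_pointwise (memLp_formΩ hab hS hu hw k β A)
        (memLp_formΩ hab hS hv hw k β A), integral_add_of_pointwise (memLp_formΓ hab hu hw k β)
        (memLp_formΓ hab hv hw k β)]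
      · ring
      · refine ae_surf_of_Icc hab fun x hx => ?_
        simp only [formΓ, copMtan_add k β hab hu hv hx, csurfGrad_add hab hu hv hx, Pi.add_apply,
          add_mul, Finset.sum_add_distrib]
        ring
      · refine ae_vol_of_grid hS fun x hx hxS => ?_
        simp only [formΩ, copM_add k β hab hu hv (openBox_subset_Icc hx),
          cgrad_add hab hu.1 hv.1 (openBox_subset_Icc hx), Pi.add_apply,
          copL_add k (hu.2.1 x hx hxS) (hv.2.1 x hx hxS), add_mul, Finset.sum_add_distrib]
        ring)
    (by
      rintro c ⟨u, hu⟩ ⟨w, hw⟩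
      simp only [cform, Submodule.coe_smul, RingHom.id_apply, smul_eq_mul, mul_sub]
      congr 1
      · refine integral_smul_of_pointwise (ae_vol_of_grid hS fun x hx hxS => ?_)
        simp only [formΩ, copM_smul k β c hab hu (openBox_subset_Icc hx),
          cgrad_smul c hab hu.1 (openBox_subset_Icc hx), Pi.smul_apply, smul_eq_mul,
          copL_smul k c (hu.2.1 x hx hxS), mul_assoc, ← Finset.mul_sum]
        ring
      · refine integral_smul_of_pointwise (ae_surf_of_Icc hab fun x hx => ?_)
        simp only [formΓ, copMtan_smul k β c hab hu hx, csurfGrad_smul c hab hu hx, Pi.smul_apply,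
          smul_eq_mul, mul_assoc, ← Finset.mul_sum]
        ring)
    (by
      rintro ⟨w, hw⟩ ⟨u, hu⟩ ⟨v, hv⟩
      simp only [cform, Submodule.coe_add]
      rw [integral_add_of_pointwise (memLp_formΩ hab hS hw hu k β A)
        (memLp_formΩ hab hS hw hv k β A), integral_add_of_pointwise (memLp_formΓ hab hw hu k β)
        (memLp_formΓ hab hw hv k β)]
      · ring
      · refine ae_surf_of_Icc hab fun x hx => ?_
        simp only [formΓ, copMbdry, cnormalDeriv_add hab hu hv hx, copMtan_add k β hab hu hv hx,
          csurfGrad_add hab hu hv hx, Pi.add_apply, star_add, mul_add, Finset.sum_add_distrib]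
        ring
      · refine ae_vol_of_grid hS fun x hx hxS => ?_
        simp only [formΩ, cgrad_add hab hu.1 hv.1 (openBox_subset_Icc hx), Pi.add_apply,
          copL_add k (hu.2.1 x hx hxS) (hv.2.1 x hx hxS), star_add, mul_add,
          Finset.sum_add_distrib]
        ring)
    (by
      rintro c ⟨w, hw⟩ ⟨u, hu⟩
      simp only [cform, Submodule.coe_smul, smul_eq_mul, mul_sub]
      congr 1
      · refine integral_smul_of_pointwise (ae_vol_of_grid hS fun x hx hxS => ?_)
        simp only [formΩ, cgrad_smul c hab hu.1 (openBox_subset_Icc hx), Pi.smul_apply, smul_eq_mul,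
          copL_smul k c (hu.2.1 x hx hxS), star_mul', mul_left_comm _ (star c), ← Finset.mul_sum,
          starRingEnd_apply]
        ring
      · refine integral_smul_of_pointwise (ae_surf_of_Icc hab fun x hx => ?_)
        simp only [formΓ, copMbdry, cnormalDeriv_smul c hab hu hx, copMtan_smul k β c hab hu hx,
          csurfGrad_smul c hab hu hx, Pi.smul_apply, smul_eq_mul, star_add, star_mul',
          mul_left_comm _ (star c), ← Finset.mul_sum, starRingEnd_apply]
        ring)

/-- The classical `V₁` inner product as a sesquilinear map. -/
def cinnerₗ (k : ℝ) : gridC2 a b S →ₗ[ℂ] gridC2 a b S →ₗ⋆[ℂ] ℂ :=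
  LinearMap.mk₂'ₛₗ (RingHom.id ℂ) (starRingEnd ℂ) (fun u v => cinner a b k u.1 v.1)
    (by
      rintro ⟨u, hu⟩ ⟨v, hv⟩ ⟨w, hw⟩
      simp only [cinner, Submodule.coe_add]
      rw [integral_add_of_pointwise (memLp_innerΩ hab hS hu hw k)
        (memLp_innerΩ hab hS hv hw k), integral_add_of_pointwise (memLp_innerΓ hab hu hw k)
        (memLp_innerΓ hab hv hw k)]
      · ring
      · refine ae_surf_of_Icc hab fun x hx => ?_
        simp only [innerΓ, cnormalDeriv_add hab hu hv hx, csurfGrad_add hab hu hv hx, Pi.add_apply,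
          add_mul, Finset.sum_add_distrib]
        ring
      · refine ae_vol_of_grid hS fun x hx hxS => ?_
        simp only [innerΩ, cgrad_add hab hu.1 hv.1 (openBox_subset_Icc hx), Pi.add_apply,
          clap_add (hu.2.1 x hx hxS) (hv.2.1 x hx hxS), add_mul, Finset.sum_add_distrib]
        ring)
    (by
      rintro c ⟨u, hu⟩ ⟨w, hw⟩
      simp only [cinner, Submodule.coe_smul, RingHom.id_apply, smul_eq_mul, mul_add]
      congr 1
      · refine integral_smul_of_pointwise (ae_vol_of_grid hS fun x hx hxS => ?_)
        simp only [innerΩ, cgrad_smul c hab hu.1 (openBox_subset_Icc hx), Pi.smul_apply,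
          smul_eq_mul, clap_smul c (hu.2.1 x hx hxS), mul_assoc, ← Finset.mul_sum]
        ring
      · refine integral_smul_of_pointwise (ae_surf_of_Icc hab fun x hx => ?_)
        simp only [innerΓ, cnormalDeriv_smul c hab hu hx, csurfGrad_smul c hab hu hx, Pi.smul_apply,
          smul_eq_mul, mul_assoc, ← Finset.mul_sum]
        ring)
    (by
      rintro ⟨w, hw⟩ ⟨u, hu⟩ ⟨v, hv⟩
      simp only [cinner, Submodule.coe_add]
      rw [integral_add_of_pointwise (memLp_innerΩ hab hS hw hu k)
        (memLp_innerΩ hab hS hw hv k), integral_add_of_pointwise (memLp_innerΓ hab hw hu k)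
        (memLp_innerΓ hab hw hv k)]
      · ring
      · refine ae_surf_of_Icc hab fun x hx => ?_
        simp only [innerΓ, cnormalDeriv_add hab hu hv hx,
          csurfGrad_add hab hu hv hx, Pi.add_apply, star_add, mul_add, Finset.sum_add_distrib]
        ring
      · refine ae_vol_of_grid hS fun x hx hxS => ?_
        simp only [innerΩ, cgrad_add hab hu.1 hv.1 (openBox_subset_Icc hx), Pi.add_apply,
          clap_add (hu.2.1 x hx hxS) (hv.2.1 x hx hxS), star_add, mul_add,
          Finset.sum_add_distrib]
        ring)
    (by
      rintro c ⟨w, hw⟩ ⟨u, hu⟩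
      simp only [cinner, Submodule.coe_smul, smul_eq_mul, mul_add]
      congr 1
      · refine integral_smul_of_pointwise (ae_vol_of_grid hS fun x hx hxS => ?_)
        simp only [innerΩ, cgrad_smul c hab hu.1 (openBox_subset_Icc hx), Pi.smul_apply,
          smul_eq_mul, clap_smul c (hu.2.1 x hx hxS), star_mul', mul_left_comm _ (star c),
          ← Finset.mul_sum, starRingEnd_apply]
        ring
      · refine integral_smul_of_pointwise (ae_surf_of_Icc hab fun x hx => ?_)
        simp only [innerΓ, cnormalDeriv_smul c hab hu hx,
          csurfGrad_smul c hab hu hx, Pi.smul_apply, smul_eq_mul, star_mul',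
          mul_left_comm _ (star c), ← Finset.mul_sum, starRingEnd_apply]
        ring)

end

/-! ### The Morawetz identity -/

section Morawetz

variable (hab : ∀ i, a i < b i) (hS : S.Countable)

/-- The field whose divergence gives the Morawetz identity. -/
def morawetzField (a b : Fin (n + 1) → ℝ) (k β : ℝ) (u v : (Fin (n + 1) → ℝ) → ℂ)
    (i : Fin (n + 1)) (x : Fin (n + 1) → ℝ) : ℂ :=
  copM a b k β u x * star (cgrad a b v i x) + cgrad a b u i x * star (copM a b k β v x) +
    (x i : ℂ) * ((k : ℂ) ^ 2 * (u x * star (v x)) - ∑ j, cgrad a b u j x * star (cgrad a b v j x))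

/-- The partial derivative `∂_i 𝓜 v`. -/
def dcopM (a b : Fin (n + 1) → ℝ) (k β : ℝ) (v : (Fin (n + 1) → ℝ) → ℂ)
    (i : Fin (n + 1)) (x : Fin (n + 1) → ℝ) : ℂ :=
  (cgrad a b v i x + ∑ j, (x j : ℂ) * hess v i j x) - Complex.I * k * β * cgrad a b v i x +
    (n : ℂ) / 2 * cgrad a b v i x

/-- The partial derivative `∂_i` of the `i`-th component of the Morawetz field. -/
def dmorawetzField (a b : Fin (n + 1) → ℝ) (k β : ℝ) (u v : (Fin (n + 1) → ℝ) → ℂ)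
    (i : Fin (n + 1)) (x : Fin (n + 1) → ℝ) : ℂ :=
  (dcopM a b k β u i x * star (cgrad a b v i x) + copM a b k β u x * star (hess v i i x)) +
  (hess u i i x * star (copM a b k β v x) + cgrad a b u i x * star (dcopM a b k β v i x)) +
  (((k : ℂ) ^ 2 * (u x * star (v x)) - ∑ j, cgrad a b u j x * star (cgrad a b v j x)) +
    (x i : ℂ) * ((k : ℂ) ^ 2 * (cgrad a b u i x * star (v x) + u x * star (cgrad a b v i x)) -
      ∑ j, (hess u i j x * star (cgrad a b v j x) + cgrad a b u j x * star (hess v i j x))))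

theorem hasDerivAt_coord (x : Fin (n + 1) → ℝ) (i j : Fin (n + 1)) :
    HasDerivAt (fun t => ((Function.update x i t j : ℝ) : ℂ)) (if j = i then 1 else 0) (x i) := by
  by_cases h : j = i
  · subst h
    simpa using (hasDerivAt_id (x j)).ofReal_comp
  · simpa [h] using hasDerivAt_const (x i) ((x j : ℝ) : ℂ)

theorem hasDerivAt_copM (hv : v ∈ gridC2 a b S) (k β : ℝ) {x : Fin (n + 1) → ℝ}
    (hx : x ∈ openBox a b) (hxS : ∀ i, x i ∉ S) (i : Fin (n + 1)) :
    HasDerivAt (fun t => copM a b k β v (Function.update x i t)) (dcopM a b k β v i x) (x i) := by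
  have h0 := hasDerivAt_cgrad hv.1 hx i
  have h1 : HasDerivAt (fun t => ∑ j, ((Function.update x i t j : ℝ) : ℂ) *
      cgrad a b v j (Function.update x i t))
      (∑ j, ((if j = i then 1 else 0) * cgrad a b v j x + (x j : ℂ) * hess v i j x)) (x i) := by
    refine HasDerivAt.fun_sum fun j _ => ?_
    have := (hasDerivAt_coord x i j).mul (hasDerivAt_hess hv hx hxS i j)
    simp only [Function.update_eq_self] at this
    exact this
  have h2 := (h1.sub (h0.const_mul (Complex.I * k * β))).add (h0.const_mul ((n : ℂ) / 2))
  have h3 : dcopM a b k β v i x = ∑ j, ((if j = i then 1 else 0) * cgrad a b v j x +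
      (x j : ℂ) * hess v i j x) - Complex.I * k * β * cgrad a b v i x +
      (n : ℂ) / 2 * cgrad a b v i x := by
    simp [dcopM, Finset.sum_add_distrib]
  rw [h3]
  exact h2

theorem hasDerivAt_morawetzField (hu : u ∈ gridC2 a b S) (hv : v ∈ gridC2 a b S) (k β : ℝ)
    {x : Fin (n + 1) → ℝ}
    (hx : x ∈ openBox a b) (hxS : ∀ i, x i ∉ S) (i : Fin (n + 1)) :
    HasDerivAt (fun t => morawetzField a b k β u v i (Function.update x i t))
      (dmorawetzField a b k β u v i x) (x i) := by
  have hu0 := hasDerivAt_cgrad hu.1 hx i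
  have hv0 := hasDerivAt_cgrad hv.1 hx i
  have hu1 := hasDerivAt_hess hu hx hxS i
  have hv1 := hasDerivAt_hess hv hx hxS i
  have h1 := (hasDerivAt_copM hu k β hx hxS i).mul (hv1 i).star
  have h2 := (hu1 i).mul (hasDerivAt_copM hv k β hx hxS i).star
  have h3 := (hu0.mul hv0.star).const_mul ((k : ℂ) ^ 2)
  have h4 := HasDerivAt.fun_sum (u := Finset.univ) fun j _ => (hu1 j).mul (hv1 j).star
  have h5 := (h1.add h2).add ((hasDerivAt_coord x i i).mul (h3.sub h4))
  simp only [Function.update_eq_self, if_true, one_mul, Pi.sub_apply, Pi.mul_apply] at h5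
  exact h5

include hab

theorem continuousOn_copM (hv : v ∈ gridC2 a b S) (k β : ℝ) :
    ContinuousOn (copM a b k β v) (Set.Icc a b) := by
  have hv0 := hv.1.continuousOn
  refine ((continuousOn_finsetSum _ fun i _ => ContinuousOn.mul ?_ (continuousOn_cgrad hab hv.1 i)).sub
    (continuousOn_const.mul hv0)).add (continuousOn_const.mul hv0)
  exact Continuous.continuousOn (by fun_prop)

theorem continuousOn_morawetzField (hu : u ∈ gridC2 a b S) (hv : v ∈ gridC2 a b S) (k β : ℝ)
    (i : Fin (n + 1)) : ContinuousOn (morawetzField a b k β u v i) (Set.Icc a b) := by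
  have hu0 := hu.1.continuousOn
  have hv0 := hv.1.continuousOn
  have hu1 := continuousOn_cgrad hab hu.1
  have hv1 := continuousOn_cgrad hab hv.1
  refine (((continuousOn_copM hab hu k β).mul (hv1 i).star).add
    ((hu1 i).mul (continuousOn_copM hab hv k β).star)).add (ContinuousOn.mul ?_
    ((continuousOn_const.mul (hu0.mul hv0.star)).sub
      (continuousOn_finsetSum _ fun j _ => (hu1 j).mul (hv1 j).star)))
  exact Continuous.continuousOn (by fun_prop)

include hS

theorem memLp_dcopM (hv : v ∈ gridC2 a b S) (k β : ℝ) (i : Fin (n + 1)) :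
    MemLp (dcopM a b k β v i) ⊤ (volΩ a b) := by
  have hv1 := memLp_cgrad hab hv i
  refine (((hv1.add (memLp_finsetSum _ fun j _ => memLp_mul_top ?_ (memLp_hess hS hv i j))).sub
    (hv1.const_mul _)).add (hv1.const_mul _))
  exact memLp_top_volΩ (Continuous.continuousOn (by fun_prop))

theorem memLp_dmorawetzField (hu : u ∈ gridC2 a b S) (hv : v ∈ gridC2 a b S) (k β : ℝ)
    (i : Fin (n + 1)) : MemLp (dmorawetzField a b k β u v i) ⊤ (volΩ a b) := by
  have hu0 := memLp_top_volΩ hu.1.continuousOn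
  have hv0 := memLp_top_volΩ hv.1.continuousOn
  have hu1 := memLp_cgrad hab hu
  have hv1 := memLp_cgrad hab hv
  have hu2 := memLp_hess hS hu i
  have hv2 := memLp_hess hS hv i
  have h1 := memLp_mul_top (memLp_dcopM hab hS hu k β i) (memLp_star (hv1 i))
  have h2 := memLp_mul_top (memLp_copM hab hu k β) (memLp_star (hv2 i))
  have h3 := memLp_mul_top (hu2 i) (memLp_star (memLp_copM hab hv k β))
  have h4 := memLp_mul_top (hu1 i) (memLp_star (memLp_dcopM hab hS hv k β i))
  have h5 := (memLp_mul_top hu0 (memLp_star hv0)).const_mul ((k : ℂ) ^ 2)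
  have h6 := memLp_finsetSum Finset.univ fun j _ => memLp_mul_top (hu1 j) (memLp_star (hv1 j))
  have h7 : MemLp (fun x : Fin (n + 1) → ℝ => (x i : ℂ)) ⊤ (volΩ a b) :=
    memLp_top_volΩ (Continuous.continuousOn (by fun_prop))
  have h8 := (memLp_mul_top (hu1 i) (memLp_star hv0)).add (memLp_mul_top hu0 (memLp_star (hv1 i)))
  have h9 := memLp_finsetSum Finset.univ fun j _ =>
    (memLp_mul_top (hu2 j) (memLp_star (hv1 j))).add (memLp_mul_top (hu1 j) (memLp_star (hv2 j)))
  have h10 := memLp_mul_top h7 ((h8.const_mul ((k : ℂ) ^ 2)).sub h9)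
  exact ((h1.add h2).add (h3.add h4)).add ((h5.sub h6).add h10)

end Morawetz

end Box

section Box

variable {n : ℕ} {a b : Fin (n + 1) → ℝ} {S : Set ℝ} {u v w : (Fin (n + 1) → ℝ) → ℂ}

theorem star_ofReal (r : ℝ) : star (r : ℂ) = r := Complex.conj_ofReal r

theorem star_I' : star Complex.I = -Complex.I := Complex.conj_I

theorem sum_fin_zero_add_one {M : Type*} [AddCommMonoid M] (f : Fin (0 + 1) → M) :
    ∑ i, f i = f 0 := Fin.sum_univ_one f

theorem sum_fin_one_add_one {M : Type*} [AddCommMonoid M] (f : Fin (1 + 1) → M) :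
    ∑ i, f i = f 0 + f 1 := Fin.sum_univ_two f

/-- By symmetry of the Hessians, the terms `x · ∇(∇u · conj ∇v)` cancel; the terms with `β` cancel
because `ikβ` is imaginary. The zeroth-order term `(d-1)/2` of `𝓜` is chosen so that the remaining
coefficients are `1`: the gradient term has `2 + (d-1) - d`, and the term with `k²` has `d - (d-1)`.
With `d ≤ 2` this is a polynomial identity in finitely many named partial derivatives. -/
theorem sum_dmorawetzField (hn : n ≤ 1) (hu : u ∈ gridC2 a b S) (hv : v ∈ gridC2 a b S) (k β : ℝ)
    {x : Fin (n + 1) → ℝ} (hx : x ∈ openBox a b) (hxS : ∀ i, x i ∉ S) :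
    ∑ i, dmorawetzField a b k β u v i x =
      copM a b k β u x * star (copL k v x) + copL k u x * star (copM a b k β v x) +
      ∑ i, cgrad a b u i x * star (cgrad a b v i x) + (k : ℂ) ^ 2 * (u x * star (v x)) := by
  have hus := hess_symm (hu.2.1 x hx hxS)
  have hvs := hess_symm (hv.2.1 x hx hxS)
  obtain rfl | rfl : n = 0 ∨ n = 1 := by omega
  · simp only [dmorawetzField, dcopM, copM, copL, clap, sum_fin_zero_add_one,
      star_add, star_mul', star_sub, star_ofReal, star_I', star_pow, star_div₀,
      Nat.cast_zero, star_zero, star_ofNat]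
    ring
  · have hu10 := hus 1 0
    have hv10 := hvs 1 0
    simp only [dmorawetzField, dcopM, copM, copL, clap, sum_fin_one_add_one,
      star_add, star_mul', star_sub, star_ofReal, star_I', star_pow, star_div₀,
      Nat.cast_one, star_one, star_ofNat, hu10, hv10]
    ring

theorem copM_eq_copMbdry (k β : ℝ) (v : (Fin (n + 1) → ℝ) → ℂ) (x : Fin (n + 1) → ℝ) :
    copM a b k β v x = copMbdry a b k β v x := by
  have h : ∑ i, (x i : ℂ) * csurfGrad a b v i x =
      ∑ i, (x i : ℂ) * cgrad a b v i x - xn a b x * cnormalDeriv a b v x := by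
    simp only [csurfGrad, mul_sub, Finset.sum_sub_distrib, xn, Complex.ofReal_sum,
      Complex.ofReal_mul, cnormalDeriv, Finset.sum_mul, mul_assoc]
  rw [copMbdry, copMtan, h, copM]
  ring

theorem sum_cgrad_mul_star {x : Fin (n + 1) → ℝ} (hx : ∑ i, normal a b x i ^ 2 = 1)
    (u v : (Fin (n + 1) → ℝ) → ℂ) :
    ∑ i, cgrad a b u i x * star (cgrad a b v i x) =
      cnormalDeriv a b u x * star (cnormalDeriv a b v x) +
        ∑ i, csurfGrad a b u i x * star (csurfGrad a b v i x) := by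
  have hx' : ∑ i, (normal a b x i : ℂ) ^ 2 = 1 := by exact_mod_cast congrArg (fun r : ℝ => (r : ℂ)) hx
  set q := cnormalDeriv a b u x with hq
  set p := cnormalDeriv a b v x with hp
  have h1 : ∀ i, csurfGrad a b u i x * star (csurfGrad a b v i x) =
      cgrad a b u i x * star (cgrad a b v i x) - (normal a b x i * cgrad a b u i x) * star p -
      q * star ((normal a b x i : ℂ) * cgrad a b v i x) + (normal a b x i : ℂ) ^ 2 * (q * star p) := by
    intro i
    have e1 : csurfGrad a b u i x = cgrad a b u i x - normal a b x i * q := rfl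
    have e2 : csurfGrad a b v i x = cgrad a b v i x - normal a b x i * p := rfl
    rw [e1, e2]
    simp only [star_sub, star_mul', star_ofReal]
    ring
  have h2 : ∑ i, (normal a b x i * cgrad a b u i x) * star p = q * star p := by
    rw [← Finset.sum_mul]; rfl
  have h3 : ∑ i, q * star ((normal a b x i : ℂ) * cgrad a b v i x) = q * star p := by
    rw [← Finset.mul_sum, ← star_sum]; rfl
  simp only [h1, Finset.sum_add_distrib, Finset.sum_sub_distrib, h2, h3]
  rw [← Finset.sum_mul, hx']
  ring

theorem ae_sum_normal_sq (hab : ∀ i, a i < b i) :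
    ∀ᵐ x ∂(surf a b), ∑ i, normal a b x i ^ 2 = 1 := by
  filter_upwards [ae_surf_normal hab] with x hx
  obtain ⟨-, i, hi | hi⟩ := hx
  · rw [hi.1, Finset.sum_eq_single i] <;> simp +contextual
  · rw [hi.1, Finset.sum_eq_single i] <;> simp +contextual

/-- The boundary term of the Morawetz identity. -/
def morawetzΓ (a b : Fin (n + 1) → ℝ) (k β : ℝ) (u v : (Fin (n + 1) → ℝ) → ℂ)
    (x : Fin (n + 1) → ℝ) : ℂ :=
  copMtan a b k β u x * star (cnormalDeriv a b v x) +
    cnormalDeriv a b u x * star (copMbdry a b k β v x) +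
    xn a b x * ((k : ℂ) ^ 2 * u x * star (v x) -
      ∑ i, csurfGrad a b u i x * star (csurfGrad a b v i x))

/-- Split the gradients into normal and tangential parts. The product of normal derivatives
contained in `𝓜u · conj ∂ₙv` cancels against the normal part of `-(x · n) ∇u · conj ∇v`, so that
only the tangential part of `𝓜u` survives. -/
theorem sum_normal_morawetzField {x : Fin (n + 1) → ℝ} (hx : ∑ i, normal a b x i ^ 2 = 1)
    (k β : ℝ) (u v : (Fin (n + 1) → ℝ) → ℂ) :
    ∑ i, (normal a b x i : ℂ) * morawetzField a b k β u v i x = morawetzΓ a b k β u v x := by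
  have h1 : ∑ i, (normal a b x i : ℂ) * morawetzField a b k β u v i x =
      copM a b k β u x * star (cnormalDeriv a b v x) +
      cnormalDeriv a b u x * star (copM a b k β v x) +
      xn a b x * ((k : ℂ) ^ 2 * (u x * star (v x)) -
        ∑ j, cgrad a b u j x * star (cgrad a b v j x)) := by
    simp only [morawetzField, mul_add, Finset.sum_add_distrib]
    congr 1
    · congr 1
      · rw [cnormalDeriv, star_sum, Finset.mul_sum]
        exact Finset.sum_congr rfl fun i _ => by rw [star_mul', star_ofReal]; ring
      · rw [cnormalDeriv, Finset.sum_mul]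
        exact Finset.sum_congr rfl fun i _ => by ring
    · rw [xn, Complex.ofReal_sum, Finset.sum_mul]
      exact Finset.sum_congr rfl fun i _ => by push_cast; ring
  rw [h1, sum_cgrad_mul_star hx, copM_eq_copMbdry, copM_eq_copMbdry, morawetzΓ]
  simp only [copMbdry]
  ring

section

variable (hab : ∀ i, a i < b i) (hS : S.Countable) (hn : n ≤ 1)
include hab hS hn

/-- The volume term of the Morawetz identity. -/
theorem morawetz_identity (hu : u ∈ gridC2 a b S) (hv : v ∈ gridC2 a b S) (k β : ℝ) :
    ∫ x, (copM a b k β u x * star (copL k v x) + copL k u x * star (copM a b k β v x) +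
      ∑ i, cgrad a b u i x * star (cgrad a b v i x) + (k : ℂ) ^ 2 * (u x * star (v x))) ∂(volΩ a b) =
      ∫ x, morawetzΓ a b k β u v x ∂(surf a b) := by
  have h := integral_divergence hab hS (F := morawetzField a b k β u v)
    (DF := dmorawetzField a b k β u v) (continuousOn_morawetzField hab hu hv k β)
    (fun i x hx hxS => hasDerivAt_morawetzField hu hv k β hx hxS i)
    (fun i => (memLp_dmorawetzField hab hS hu hv k β i).integrable le_top)
  rw [← integral_congr_ae (ae_vol_of_grid hS fun x hx hxS =>
    sum_dmorawetzField hn hu hv k β hx hxS), h]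
  apply integral_congr_ae
  filter_upwards [ae_sum_normal_sq hab] with x hx
  exact sum_normal_morawetzField hx k β u v

omit hS hn in
theorem memLp_morawetzΓ (hu : u ∈ gridC2 a b S) (hv : v ∈ gridC2 a b S) (k β : ℝ) :
    MemLp (morawetzΓ a b k β u v) ⊤ (surf a b) := by
  have hu0 := memLp_top_surf hab hu.1.continuousOn
  have hv0 := memLp_top_surf hab hv.1.continuousOn
  refine MemLp.add (MemLp.add ?_ ?_) (memLp_mul_top (memLp_xn hab) (MemLp.sub ?_ ?_))
  · exact memLp_mul_top (memLp_copMtan hab hu k β) (memLp_star (memLp_cnormalDeriv hab hv))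
  · exact memLp_mul_top (memLp_cnormalDeriv hab hu) (memLp_star (memLp_copMbdry hab hv k β))
  · exact memLp_mul_top (hu0.const_mul _) (memLp_star hv0)
  · exact memLp_finsetSum _ fun i _ =>
      memLp_mul_top (memLp_csurfGrad hab hu i) (memLp_star (memLp_csurfGrad hab hv i))

omit hn in
theorem memLp_morawetzΩ (hu : u ∈ gridC2 a b S) (hv : v ∈ gridC2 a b S) (k β : ℝ) :
    MemLp (fun x => copM a b k β u x * star (copL k v x) + copL k u x * star (copM a b k β v x) +
      ∑ i, cgrad a b u i x * star (cgrad a b v i x) + (k : ℂ) ^ 2 * (u x * star (v x))) ⊤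
      (volΩ a b) := by
  have hu0 := memLp_top_volΩ hu.1.continuousOn
  have hv0 := memLp_top_volΩ hv.1.continuousOn
  have h1 := memLp_mul_top (memLp_copM hab hu k β) (memLp_star (memLp_copL hS hv k))
  have h2 := memLp_mul_top (memLp_copL hS hu k) (memLp_star (memLp_copM hab hv k β))
  have h3 := memLp_finsetSum Finset.univ fun i _ =>
      memLp_mul_top (memLp_cgrad hab hu i) (memLp_star (memLp_cgrad hab hv i))
  have h4 := (memLp_mul_top hu0 (memLp_star hv0)).const_mul ((k : ℂ) ^ 2)
  exact ((h1.add h2).add h3).add h4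

/-- Consistency: a classical solution satisfies the variational equation. -/
theorem cform_eq_crhs (hu : u ∈ gridC2 a b S) (hv : v ∈ gridC2 a b S) (k β A : ℝ) :
    cform a b k β A u v = crhs a b k β A (fun x => -copL k u x)
      (fun x => cnormalDeriv a b u x - Complex.I * k * u x) v := by
  have hm := morawetz_identity hab hS hn hu hv k β
  have hL := memLp_copL hS hu k
  have hMv := memLp_star (memLp_copM hab hv k β)
  have hLv := memLp_star (memLp_copL hS hv k)
  -- With `f = -𝓛u`, the volume integrand of `b - G` is the Morawetz volume integrand, the two terms
  -- with `A` cancelling. With `g = ∂ₙu - iku`, the boundary integrands of `b` and `G` combine in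
  -- the same way to the Morawetz boundary term, so the identity gives `b(u, v) = G(v)`.
  have h1 : ∫ x, formΩ a b k β A u v x ∂(volΩ a b) =
      ∫ x, (copM a b k β u x * star (copL k v x) + copL k u x * star (copM a b k β v x) +
      ∑ i, cgrad a b u i x * star (cgrad a b v i x) + (k : ℂ) ^ 2 * (u x * star (v x))) ∂(volΩ a b)
      + ∫ x, (star (copM a b k β v x) - (A : ℂ) / (k : ℂ) ^ 2 * star (copL k v x)) *
        (-copL k u x) ∂(volΩ a b) := by
    refine integral_add_of_pointwise (memLp_morawetzΩ hab hS hu hv k β)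
      (memLp_mul_top (hMv.sub (hLv.const_mul _)) hL.neg) (ae_of_all _ fun x => ?_)
    simp only [formΩ]
    ring
  have hg : MemLp (fun x => cnormalDeriv a b u x - Complex.I * k * u x) ⊤ (surf a b) :=
    (memLp_cnormalDeriv hab hu).sub ((memLp_top_surf hab hu.1.continuousOn).const_mul _)
  have h2 : ∫ x, morawetzΓ a b k β u v x ∂(surf a b) =
      ∫ x, formΓ a b k β u v x ∂(surf a b) + ∫ x, star (copMbdry a b k β v x) *
        (cnormalDeriv a b u x - Complex.I * k * u x) ∂(surf a b) := by
    refine integral_add_of_pointwise (memLp_formΓ hab hu hv k β)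
      (memLp_mul_top (memLp_star (memLp_copMbdry hab hv k β)) hg) (ae_of_all _ fun x => ?_)
    simp only [morawetzΓ, formΓ]
    ring
  rw [cform, crhs, h1, hm, h2]
  ring

end

end Box

section Box

variable {n : ℕ} {a b : Fin (n + 1) → ℝ} {S : Set ℝ} {u v w : (Fin (n + 1) → ℝ) → ℂ}

/-! ### Coercivity and continuity -/

/-- The volume density of the squared `V₁` norm. -/
def normΩ (a b : Fin (n + 1) → ℝ) (k : ℝ) (v : (Fin (n + 1) → ℝ) → ℂ)
    (x : Fin (n + 1) → ℝ) : ℝ :=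
  (k ^ 2)⁻¹ * ‖clap v x‖ ^ 2 + (∑ i, ‖cgrad a b v i x‖ ^ 2) + k ^ 2 * ‖v x‖ ^ 2

/-- The boundary density of the squared `V₁` norm. -/
def normΓ (a b : Fin (n + 1) → ℝ) (k : ℝ) (v : (Fin (n + 1) → ℝ) → ℂ)
    (x : Fin (n + 1) → ℝ) : ℝ :=
  k ^ 2 * ‖v x‖ ^ 2 + (∑ i, ‖csurfGrad a b v i x‖ ^ 2) + ‖cnormalDeriv a b v x‖ ^ 2

/-- The squared classical `V₁` norm. -/
def cnormSq (a b : Fin (n + 1) → ℝ) (k : ℝ) (v : (Fin (n + 1) → ℝ) → ℂ) : ℝ :=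
  ∫ x, normΩ a b k v x ∂(volΩ a b) + ∫ x, normΓ a b k v x ∂(surf a b)

theorem mul_star_self' (z : ℂ) : z * star z = ((‖z‖ ^ 2 : ℝ) : ℂ) := by
  have := Complex.mul_conj z
  rw [Complex.normSq_eq_norm_sq] at this
  exact this

theorem innerΩ_self (k : ℝ) (v : (Fin (n + 1) → ℝ) → ℂ) (x : Fin (n + 1) → ℝ) :
    innerΩ a b k v v x = (normΩ a b k v x : ℂ) := by
  simp only [innerΩ, normΩ, mul_star_self']
  push_cast
  rfl

theorem innerΓ_self (k : ℝ) (v : (Fin (n + 1) → ℝ) → ℂ) (x : Fin (n + 1) → ℝ) :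
    innerΓ a b k v v x = (normΓ a b k v x : ℂ) := by
  simp only [innerΓ, normΓ, mul_star_self']
  push_cast
  rfl

theorem cinner_self (k : ℝ) (v : (Fin (n + 1) → ℝ) → ℂ) :
    cinner a b k v v = (cnormSq a b k v : ℂ) := by
  simp only [cinner, cnormSq, innerΩ_self, innerΓ_self, integral_complex_ofReal,
    Complex.ofReal_add]

theorem normΩ_nonneg (k : ℝ) (v : (Fin (n + 1) → ℝ) → ℂ) (x : Fin (n + 1) → ℝ) :
    0 ≤ normΩ a b k v x := by unfold normΩ; positivity

theorem normΓ_nonneg (k : ℝ) (v : (Fin (n + 1) → ℝ) → ℂ) (x : Fin (n + 1) → ℝ) :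
    0 ≤ normΓ a b k v x := by unfold normΓ; positivity

theorem cnormSq_nonneg (k : ℝ) (v : (Fin (n + 1) → ℝ) → ℂ) : 0 ≤ cnormSq a b k v :=
  add_nonneg (integral_nonneg fun x => normΩ_nonneg k v x)
    (integral_nonneg fun x => normΓ_nonneg k v x)

theorem integrable_normΩ (hab : ∀ i, a i < b i) (hS : S.Countable) (hv : v ∈ gridC2 a b S) (k : ℝ) :
    Integrable (normΩ a b k v) (volΩ a b) := by
  have h := ((memLp_innerΩ hab hS hv hv k).integrable le_top).re
  refine h.congr (ae_of_all _ fun x => ?_)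
  simp [innerΩ_self]

theorem integrable_normΓ (hab : ∀ i, a i < b i) (hv : v ∈ gridC2 a b S) (k : ℝ) :
    Integrable (normΓ a b k v) (surf a b) := by
  have h := ((memLp_innerΓ hab hv hv k).integrable le_top).re
  refine h.congr (ae_of_all _ fun x => ?_)
  simp [innerΓ_self]

theorem boxDiam_pos (hab : ∀ i, a i < b i) : 0 < boxDiam a b :=
  Real.sqrt_pos.2 (Finset.sum_pos (fun i _ => by have := sub_pos.2 (hab i); positivity)
    Finset.univ_nonempty)

theorem boxDiam_sq : boxDiam a b ^ 2 = ∑ i, (b i - a i) ^ 2 :=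
  Real.sq_sqrt (Finset.sum_nonneg fun i _ => sq_nonneg _)

theorem side_le_boxDiam (i : Fin (n + 1)) : b i - a i ≤ boxDiam a b := by
  refine (le_abs_self _).trans ?_
  rw [← Real.sqrt_sq_eq_abs]
  exact Real.sqrt_le_sqrt (Finset.single_le_sum (f := fun i => (b i - a i) ^ 2)
    (fun i _ => sq_nonneg _) (Finset.mem_univ i))

/-- Star-shapedness with respect to a ball around the origin puts the faces at distance at least
the radius of that ball. -/
theorem faces_of_starShaped (hab : ∀ i, a i < b i) {r : ℝ}
    (h : StarShapedWrtBall (openBox a b) 0 r) (i : Fin (n + 1)) : a i ≤ -r ∧ r ≤ b i := by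
  obtain ⟨hr, hstar⟩ := h
  have hne : (openBox a b).Nonempty := by
    refine ⟨fun i => (a i + b i) / 2, fun i _ => ⟨?_, ?_⟩⟩ <;> · have := hab i; linarith
  -- A star centre of a nonempty set belongs to it, so the ball is contained in the box. A face at
  -- distance less than `r` from the origin would then have a point in the open box.
  have hmem : ∀ t : ℝ, |t| < r → (Pi.single i t : Fin (n + 1) → ℝ) ∈ openBox a b := by
    intro t ht
    refine (hstar _ ?_).mem hne
    rw [Finset.sum_eq_single i]
    · simpa [Real.sqrt_sq_eq_abs] using ht
    · intro j _ hj; simp [hj]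
    · simp
  constructor
  · by_contra! hlt
    have h2 := hmem (a i) (by
      rw [abs_lt]
      have := (hmem 0 (by simpa using hr) i trivial).1
      simp at this
      exact ⟨hlt, by linarith⟩)
    have h3 := (h2 i trivial).1
    simp at h3
  · by_contra! hlt
    have h2 := hmem (b i) (by
      rw [abs_lt]
      have := (hmem 0 (by simpa using hr) i trivial).2
      simp at this
      exact ⟨by linarith, hlt⟩)
    have h3 := (h2 i trivial).2
    simp at h3

/-- `Re b(v, v)` on the boundary, after subtraction of half of the Morawetz boundary term. -/
theorem boundary_coercive {k β c L γ s : ℝ} {V q T : ℂ} (m : ℕ) (hk : 0 < k) (hγ : 0 < γ)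
    (hγ2 : γ ≤ 1 / 2) (hL : 0 < L) (hc : γ * L ≤ c) (hcL : c ≤ L) (hs : 0 ≤ s)
    (hT : ‖T‖ ^ 2 ≤ L ^ 2 * s) (hβ : L / 2 * (1 + 4 / γ + γ / 2) ≤ β) :
    γ * L / 4 * (k ^ 2 * ‖V‖ ^ 2 + s + ‖q‖ ^ 2) ≤
      -((Complex.I * k * V * star ((c : ℂ) * q + (T - Complex.I * k * β * V + (m : ℂ) / 2 * V)) +
        (T - Complex.I * k * β * V + (m : ℂ) / 2 * V) * star q +
        (c : ℂ) * ((k : ℂ) ^ 2 * V * star V - (s : ℂ))) -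
      (1 / 2 : ℂ) * ((T - Complex.I * k * β * V + (m : ℂ) / 2 * V) * star q +
        q * star ((c : ℂ) * q + (T - Complex.I * k * β * V + (m : ℂ) / 2 * V)) +
        (c : ℂ) * ((k : ℂ) ^ 2 * V * star V - (s : ℂ)))).re := by
  -- In the real part, the products of `q` with `T`, with `ikβV` and with `mV/2` cancel thanks to
  -- the factor `1/2`, and the product of `ikV` with `mV/2` is imaginary. The parameter `β` survives
  -- only in `-k²β|V|²`, which is the term that gives control of the trace.
  have hre : ((Complex.I * k * V * star ((c : ℂ) * q + (T - Complex.I * k * β * V + (m : ℂ) / 2 * V)) +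
        (T - Complex.I * k * β * V + (m : ℂ) / 2 * V) * star q +
        (c : ℂ) * ((k : ℂ) ^ 2 * V * star V - (s : ℂ))) -
      (1 / 2 : ℂ) * ((T - Complex.I * k * β * V + (m : ℂ) / 2 * V) * star q +
        q * star ((c : ℂ) * q + (T - Complex.I * k * β * V + (m : ℂ) / 2 * V)) +
        (c : ℂ) * ((k : ℂ) ^ 2 * V * star V - (s : ℂ)))).re =
      c * k * (Complex.I * V * star q).re + k * (Complex.I * V * star T).re -
      k ^ 2 * β * ‖V‖ ^ 2 - c / 2 * ‖q‖ ^ 2 + c / 2 * (k ^ 2 * ‖V‖ ^ 2 - s) := by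
    have e1 : ((k : ℂ) ^ 2) = ((k ^ 2 : ℝ) : ℂ) := by push_cast; rfl
    have e2 : ((m : ℂ) / 2) = (((m : ℝ) / 2 : ℝ) : ℂ) := by push_cast; rfl
    have e3 : (1 / 2 : ℂ) = ((1 / 2 : ℝ) : ℂ) := by push_cast; rfl
    rw [e1, e2, e3, ← Complex.normSq_eq_norm_sq, ← Complex.normSq_eq_norm_sq]
    simp only [Complex.star_def, Complex.add_re, Complex.sub_re, Complex.mul_re, Complex.mul_im,
      Complex.sub_im, Complex.add_im, Complex.conj_re, Complex.conj_im, Complex.I_re, Complex.I_im,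
      Complex.ofReal_re, Complex.ofReal_im, Complex.normSq_apply]
    ring
  have h1 : (Complex.I * V * star q).re ≤ ‖V‖ * ‖q‖ := by
    refine (Complex.re_le_norm _).trans (le_of_eq ?_)
    simp
  have hTs : ‖T‖ ≤ L * √s := by
    apply le_of_sq_le_sq _ (by positivity)
    rw [mul_pow, Real.sq_sqrt hs]; exact hT
  have h2 : (Complex.I * V * star T).re ≤ ‖V‖ * (L * √s) := by
    refine (Complex.re_le_norm _).trans ?_
    simp only [norm_mul, Complex.norm_I, one_mul, norm_star]
    gcongr
  rw [hre]
  set σ := √s with hσ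
  have hσs : s = σ ^ 2 := (Real.sq_sqrt hs).symm
  rw [hσs]
  set X := k * ‖V‖ with hX
  set Q := ‖q‖ with hQ
  have hc0 : 0 < c := lt_of_lt_of_le (by positivity) hc
  have hX0 : 0 ≤ X := by positivity
  have h1' : c * k * (Complex.I * V * star q).re ≤ c * (X * Q) := by
    have := mul_le_mul_of_nonneg_left h1 (by positivity : 0 ≤ c * k)
    calc _ ≤ c * k * (‖V‖ * Q) := this
      _ = _ := by rw [hX]; ring
  have h2' : k * (Complex.I * V * star T).re ≤ L * (X * σ) := by
    have := mul_le_mul_of_nonneg_left h2 hk.le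
    calc _ ≤ k * (‖V‖ * (L * σ)) := this
      _ = _ := by rw [hX]; ring
  have e4 : k ^ 2 * ‖V‖ ^ 2 = X ^ 2 := by rw [hX]; ring
  have e5 : k ^ 2 * β * ‖V‖ ^ 2 = β * X ^ 2 := by rw [hX]; ring
  rw [e4, e5]
  have hgi : γ * (1 / γ) = 1 := by field_simp
  have hβ' : L / 2 + 2 * L * (1 / γ) + L * γ / 4 ≤ β := by
    calc _ = L / 2 * (1 + 4 / γ + γ / 2) := by field_simp; ring
      _ ≤ β := hβ
  have hgi2 : 2 ≤ 1 / γ := by rw [le_div_iff₀ hγ]; linarith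
  set g := 1 / γ with hg
  -- Young's inequality, weighted so that half of the available `c/2 · Q²`, and below at most half
  -- of `c/2 · σ²` (since `c ≥ γL`), is spent. The rest goes into `X² = k²|V|²`, at the price of `L`
  -- here and `L/γ` below.
  have c1 : c * (X * Q) ≤ c / 4 * Q ^ 2 + L * X ^ 2 := by
    have h := mul_nonneg hc0.le (sq_nonneg (Q / 2 - X))
    have e : c * (Q / 2 - X) ^ 2 = c / 4 * Q ^ 2 - c * (X * Q) + c * X ^ 2 := by ring
    have h' := mul_le_mul_of_nonneg_right hcL (sq_nonneg X)
    linarith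
  have c2 : L * (X * σ) ≤ γ * L / 4 * σ ^ 2 + L * g * X ^ 2 := by
    have h : 0 ≤ L * γ * (σ / 2 - g * X) ^ 2 := by positivity
    have : L * γ * (σ / 2 - g * X) ^ 2 =
        γ * L / 4 * σ ^ 2 - L * (γ * g) * (X * σ) + L * (γ * g) * g * X ^ 2 := by ring
    rw [this, hgi] at h
    linarith
  have c3 : γ * L / 4 * σ ^ 2 + γ * L / 4 * σ ^ 2 ≤ c / 2 * σ ^ 2 := by
    have := mul_le_mul_of_nonneg_right hc (sq_nonneg σ)
    linarith
  have c4 : γ * L / 4 * Q ^ 2 ≤ c / 4 * Q ^ 2 := by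
    have := mul_le_mul_of_nonneg_right hc (sq_nonneg Q)
    linarith
  -- Total demand on the coefficient of `X²`: the term to be proved, the two prices from Young's
  -- inequality, and `c/2` from the term `(x · n) k²|v|²`, which has the wrong sign. The bound on
  -- `β` covers it because `c ≤ L` and `1/γ ≥ 2`.
  have c5 : γ * L / 4 + L + L * g + c / 2 ≤ β := by
    have := mul_le_mul_of_nonneg_left hgi2 hL.le
    linarith
  have c6 := mul_le_mul_of_nonneg_right c5 (sq_nonneg X)
  linarith

theorem norm_add_sq_le_two (z w : ℂ) : ‖z + w‖ ^ 2 ≤ 2 * ‖z‖ ^ 2 + 2 * ‖w‖ ^ 2 := by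
  have h := norm_add_le z w
  have h2 : ‖z + w‖ ^ 2 ≤ (‖z‖ + ‖w‖) ^ 2 := by gcongr
  nlinarith [sq_nonneg (‖z‖ - ‖w‖)]

theorem sum_mul_star_self (z : Fin (n + 1) → ℂ) :
    ∑ i, z i * star (z i) = ((∑ i, ‖z i‖ ^ 2 : ℝ) : ℂ) := by
  push_cast
  exact Finset.sum_congr rfl fun i _ => by rw [mul_star_self']; push_cast; rfl

/-- The coercivity constant. -/
def coerConst (a b : Fin (n + 1) → ℝ) (γ : ℝ) : ℝ := min (1 / 8) (γ * boxDiam a b / 4)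

theorem abs_coord_le {r : ℝ} (hr : 0 < r) (hface : ∀ i, a i ≤ -r ∧ r ≤ b i)
    {x : Fin (n + 1) → ℝ} (hx : x ∈ Set.Icc a b) (i : Fin (n + 1)) : |x i| ≤ b i - a i := by
  have h1 := hx.1 i
  have h2 := hx.2 i
  have h3 := hface i
  rw [abs_le]
  constructor <;> linarith

theorem sum_coord_sq_le {r : ℝ} (hr : 0 < r) (hface : ∀ i, a i ≤ -r ∧ r ≤ b i)
    {x : Fin (n + 1) → ℝ} (hx : x ∈ Set.Icc a b) : ∑ i, x i ^ 2 ≤ boxDiam a b ^ 2 := by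
  rw [boxDiam_sq]
  refine Finset.sum_le_sum fun i _ => ?_
  rw [← sq_abs]
  exact pow_le_pow_left₀ (abs_nonneg _) (abs_coord_le hr hface hx i) 2

theorem norm_sum_coord_mul_sq_le {r : ℝ} (hr : 0 < r) (hface : ∀ i, a i ≤ -r ∧ r ≤ b i)
    {x : Fin (n + 1) → ℝ} (hx : x ∈ Set.Icc a b) (z : Fin (n + 1) → ℂ) :
    ‖∑ i, (x i : ℂ) * z i‖ ^ 2 ≤ boxDiam a b ^ 2 * ∑ i, ‖z i‖ ^ 2 := by
  have h1 : ‖∑ i, (x i : ℂ) * z i‖ ≤ ∑ i, |x i| * ‖z i‖ := by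
    refine (norm_sum_le _ _).trans (le_of_eq (Finset.sum_congr rfl fun i _ => ?_))
    simp
  calc _ ≤ (∑ i, |x i| * ‖z i‖) ^ 2 := by gcongr
    _ ≤ (∑ i, |x i| ^ 2) * ∑ i, ‖z i‖ ^ 2 := Finset.sum_mul_sq_le_sq_mul_sq _ _ _
    _ ≤ _ := by
      gcongr
      simpa using sum_coord_sq_le hr hface hx

theorem ae_xn {r : ℝ} (hr : 0 < r) (hface : ∀ i, a i ≤ -r ∧ r ≤ b i) (hab : ∀ i, a i < b i) :
    ∀ᵐ x ∂(surf a b), x ∈ Set.Icc a b ∧ ∃ c : ℝ, xn a b x = c ∧ r ≤ c ∧ c ≤ boxDiam a b := by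
  filter_upwards [ae_surf_normal hab] with x hx
  obtain ⟨hx, i, hi | hi⟩ := hx
  · refine ⟨hx, -a i, ?_, ?_, ?_⟩
    · rw [xn, hi.1, Finset.sum_eq_single i] <;> simp +contextual [hi.2]
    · linarith [(hface i).1]
    · refine le_trans ?_ (side_le_boxDiam i)
      linarith [(hface i).2]
  · refine ⟨hx, b i, ?_, ?_, ?_⟩
    · rw [xn, hi.1, Finset.sum_eq_single i] <;> simp +contextual [hi.2]
    · linarith [(hface i).2]
    · refine le_trans ?_ (side_le_boxDiam i)
      linarith [(hface i).1]

/-- The form `b` is coercive, uniformly in `k`. -/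
theorem cform_coercive (hab : ∀ i, a i < b i) (hS : S.Countable) (hn : n ≤ 1) {γ k β : ℝ}
    (hγ : 0 < γ) (hface : ∀ i, a i ≤ -(γ * boxDiam a b) ∧ γ * boxDiam a b ≤ b i) (hk : 0 < k)
    (hβ : boxDiam a b / 2 * (1 + 4 / γ + γ / 2) ≤ β) (hv : v ∈ gridC2 a b S) :
    coerConst a b γ * cnormSq a b k v ≤ (cform a b k β (1 / 3) v v).re := by
  have hL := boxDiam_pos hab
  set L := boxDiam a b with hLdef
  -- Two opposite faces are both at distance at least `γL` from the origin, so `2γL` is at most a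
  -- side, and a side is at most `L`.
  have hγ2 : γ ≤ 1 / 2 := by
    have h1 := hface 0
    have h2 := side_le_boxDiam (a := a) (b := b) 0
    rw [← hLdef] at h2
    have : γ * L ≤ 1 / 2 * L := by linarith
    exact le_of_mul_le_mul_right this hL
  have hα1 : coerConst a b γ ≤ 1 / 8 := min_le_left _ _
  have hα2 : coerConst a b γ ≤ γ * L / 4 := min_le_right _ _
  have hm := morawetz_identity hab hS hn hv hv k β
  have iΩ := (memLp_formΩ hab hS hv hv k β (1 / 3)).integrable le_top
  have iΓ := (memLp_formΓ hab hv hv k β).integrable le_top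
  have iM := (memLp_morawetzΩ hab hS hv hv k β).integrable le_top
  have iMΓ := (memLp_morawetzΓ hab hv hv k β).integrable le_top
  set MΩ : (Fin (n + 1) → ℝ) → ℂ := fun x => copM a b k β v x * star (copL k v x) +
    copL k v x * star (copM a b k β v x) +
      ∑ i, cgrad a b v i x * star (cgrad a b v i x) + (k : ℂ) ^ 2 * (v x * star (v x)) with hMΩ
  -- Subtracting half of the volume side of the Morawetz identity and adding half of its boundary
  -- side leaves `b(v, v)` unchanged, and makes the real parts of both integrands definite, with
  -- opposite signs.
  have hsplit : cform a b k β (1 / 3) v v =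
      ∫ x, (formΩ a b k β (1 / 3) v v x - (1 / 2 : ℂ) * MΩ x) ∂(volΩ a b) -
      ∫ x, (formΓ a b k β v v x - (1 / 2 : ℂ) * morawetzΓ a b k β v v x) ∂(surf a b) := by
    rw [integral_sub iΩ (iM.const_mul _), integral_sub iΓ (iMΓ.const_mul _), integral_const_mul,
      integral_const_mul, hm, cform]
    ring
  have jΩ := iΩ.sub (iM.const_mul (1 / 2 : ℂ))
  have jΓ := iΓ.sub (iMΓ.const_mul (1 / 2 : ℂ))
  have h1 : coerConst a b γ * ∫ x, normΩ a b k v x ∂(volΩ a b) ≤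
      (∫ x, (formΩ a b k β (1 / 3) v v x - (1 / 2 : ℂ) * MΩ x) ∂(volΩ a b)).re := by
    have e : (∫ x, (formΩ a b k β (1 / 3) v v x - (1 / 2 : ℂ) * MΩ x) ∂(volΩ a b)).re =
        ∫ x, (formΩ a b k β (1 / 3) v v x - (1 / 2 : ℂ) * MΩ x).re ∂(volΩ a b) :=
      (integral_re jΩ).symm
    rw [e, ← integral_const_mul]
    refine integral_mono ((integrable_normΩ hab hS hv k).const_mul _) jΩ.re fun x => ?_
    simp only [formΩ, hMΩ, sum_mul_star_self, normΩ]
    have hre : ((((∑ i, ‖cgrad a b v i x‖ ^ 2 : ℝ) : ℂ) + (k : ℂ) ^ 2 * v x * star (v x) +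
        (copM a b k β v x + ((1 / 3 : ℝ) : ℂ) / (k : ℂ) ^ 2 * copL k v x) * star (copL k v x)) -
        (1 / 2 : ℂ) * (copM a b k β v x * star (copL k v x) +
          copL k v x * star (copM a b k β v x) +
          ((∑ i, ‖cgrad a b v i x‖ ^ 2 : ℝ) : ℂ) + (k : ℂ) ^ 2 * (v x * star (v x)))).re =
        1 / 2 * (∑ i, ‖cgrad a b v i x‖ ^ 2) + 1 / 2 * (k ^ 2 * ‖v x‖ ^ 2) +
          1 / 3 * (k ^ 2)⁻¹ * ‖copL k v x‖ ^ 2 := by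
      have e1 : ((k : ℂ) ^ 2) = ((k ^ 2 : ℝ) : ℂ) := by push_cast; rfl
      have e2 : ((1 / 3 : ℝ) : ℂ) / (k : ℂ) ^ 2 = ((1 / 3 * (k ^ 2)⁻¹ : ℝ) : ℂ) := by
        push_cast; rw [div_eq_mul_inv]
      have e3 : (1 / 2 : ℂ) = ((1 / 2 : ℝ) : ℂ) := by push_cast; rfl
      rw [e2, e1, e3, ← Complex.normSq_eq_norm_sq (v x), ← Complex.normSq_eq_norm_sq (copL k v x)]
      simp only [Complex.star_def, Complex.add_re, Complex.sub_re, Complex.mul_re, Complex.mul_im,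
        Complex.add_im, Complex.conj_re, Complex.conj_im,
        Complex.ofReal_re, Complex.ofReal_im, Complex.normSq_apply]
      ring
    -- The norm contains `Δv`, whereas coercivity controls `𝓛v = Δv + k²v`. This is where `1/8`
    -- comes from: one eighth of `k⁻²|Δv|²` costs a quarter of `k⁻²|𝓛v|²`, and `1/4 ≤ A = 1/3`; it
    -- also costs a quarter of `k²|v|²`, and `1/4 + 1/8 ≤ 1/2`.
    have hlap : ‖clap v x‖ ^ 2 ≤ 2 * ‖copL k v x‖ ^ 2 + 2 * (k ^ 2 * k ^ 2 * ‖v x‖ ^ 2) := by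
      have h := norm_add_sq_le_two (copL k v x) (-((k : ℂ) ^ 2 * v x))
      have e1 : copL k v x + -((k : ℂ) ^ 2 * v x) = clap v x := by rw [copL]; ring
      rw [e1] at h
      have e2 : ‖-((k : ℂ) ^ 2 * v x)‖ ^ 2 = k ^ 2 * k ^ 2 * ‖v x‖ ^ 2 := by
        rw [norm_neg, norm_mul, norm_pow, Complex.norm_real, Real.norm_of_nonneg hk.le]; ring
      rw [e2] at h
      exact h
    have hki : 0 < (k ^ 2)⁻¹ := by positivity
    have hlap2 : (k ^ 2)⁻¹ * ‖clap v x‖ ^ 2 ≤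
        2 * ((k ^ 2)⁻¹ * ‖copL k v x‖ ^ 2) + 2 * (k ^ 2 * ‖v x‖ ^ 2) := by
      have := mul_le_mul_of_nonneg_left hlap hki.le
      have e : (k ^ 2)⁻¹ * (2 * ‖copL k v x‖ ^ 2 + 2 * (k ^ 2 * k ^ 2 * ‖v x‖ ^ 2)) =
        2 * ((k ^ 2)⁻¹ * ‖copL k v x‖ ^ 2) + 2 * (k ^ 2 * ‖v x‖ ^ 2) := by field_simp
      linarith
    have hsum : 0 ≤ ∑ i, ‖cgrad a b v i x‖ ^ 2 := by positivity
    have hp1 : 0 ≤ (k ^ 2)⁻¹ * ‖copL k v x‖ ^ 2 := by positivity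
    have hp2 : 0 ≤ k ^ 2 * ‖v x‖ ^ 2 := by positivity
    have hN : 0 ≤ (k ^ 2)⁻¹ * ‖clap v x‖ ^ 2 + (∑ i, ‖cgrad a b v i x‖ ^ 2) + k ^ 2 * ‖v x‖ ^ 2 := by
      positivity
    have h5 := mul_le_mul_of_nonneg_right hα1 hN
    refine h5.trans ?_
    refine le_trans ?_ hre.ge
    linarith
  have h2 : coerConst a b γ * ∫ x, normΓ a b k v x ∂(surf a b) ≤
      -(∫ x, (formΓ a b k β v v x - (1 / 2 : ℂ) * morawetzΓ a b k β v v x) ∂(surf a b)).re := by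
    have e : (∫ x, (formΓ a b k β v v x - (1 / 2 : ℂ) * morawetzΓ a b k β v v x) ∂(surf a b)).re =
        ∫ x, (formΓ a b k β v v x - (1 / 2 : ℂ) * morawetzΓ a b k β v v x).re ∂(surf a b) :=
      (integral_re jΓ).symm
    rw [e, ← integral_const_mul, ← integral_neg]
    refine integral_mono_ae ((integrable_normΓ hab hv k).const_mul _) jΓ.re.neg ?_
    filter_upwards [ae_xn (mul_pos hγ hL) hface hab] with x hx
    obtain ⟨hx, c, hc, hc1, hc2⟩ := hx
    have hb := boundary_coercive (V := v x) (q := cnormalDeriv a b v x)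
      (T := ∑ i, (x i : ℂ) * csurfGrad a b v i x) (s := ∑ i, ‖csurfGrad a b v i x‖ ^ 2) n
      hk hγ hγ2 hL hc1 hc2 (by positivity)
      (norm_sum_coord_mul_sq_le (mul_pos hγ hL) hface hx _) hβ
    have h5 := mul_le_mul_of_nonneg_right hα2 (normΓ_nonneg (a := a) (b := b) k v x)
    refine h5.trans (hb.trans (le_of_eq ?_))
    simp only [formΓ, morawetzΓ, copMbdry, copMtan, hc, sum_mul_star_self]
  rw [hsplit, Complex.sub_re, cnormSq, mul_add]
  linarith

end Box

/-! ### Continuity of the form and of the right-hand side -/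

section Box

variable {n : ℕ} {a b : Fin (n + 1) → ℝ} {S : Set ℝ} {u v w : (Fin (n + 1) → ℝ) → ℂ}

theorem memLp_sqrt {X : Type*} [MeasurableSpace X] {μ : Measure X} {f : X → ℝ}
    (hf : Integrable f μ) (h0 : ∀ x, 0 ≤ f x) : MemLp (fun x => √(f x)) 2 μ := by
  rw [memLp_two_iff_integrable_sq (Real.continuous_sqrt.comp_aestronglyMeasurable hf.1)]
  exact hf.congr (ae_of_all _ fun x => (Real.sq_sqrt (h0 x)).symm)

theorem integral_sqrt_mul_sqrt_le {X : Type*} [MeasurableSpace X] {μ : Measure X} {f g : X → ℝ}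
    (hf : Integrable f μ) (hg : Integrable g μ) (hf0 : ∀ x, 0 ≤ f x) (hg0 : ∀ x, 0 ≤ g x) :
    ∫ x, √(f x) * √(g x) ∂μ ≤ √(∫ x, f x ∂μ) * √(∫ x, g x ∂μ) := by
  have h := integral_norm_mul_norm_le (memLp_sqrt hf hf0) (memLp_sqrt hg hg0)
  simpa [Real.sq_sqrt, hf0, hg0, abs_of_nonneg, Real.sqrt_nonneg] using h

theorem sqrt_mul_add_sqrt_mul_le {p q r s : ℝ} (hp : 0 ≤ p) (hq : 0 ≤ q) (hr : 0 ≤ r)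
    (hs : 0 ≤ s) : √p * √q + √r * √s ≤ √(p + r) * √(q + s) := by
  rw [← Real.sqrt_mul (by positivity : 0 ≤ p + r)]
  apply Real.le_sqrt_of_sq_le
  have h1 := Real.sq_sqrt hp
  have h2 := Real.sq_sqrt hq
  have h3 := Real.sq_sqrt hr
  have h4 := Real.sq_sqrt hs
  have : (p + r) * (q + s) = (√p ^ 2 + √r ^ 2) * (√q ^ 2 + √s ^ 2) := by rw [h1, h2, h3, h4]
  rw [this]
  nlinarith [sq_nonneg (√p * √s - √r * √q)]

section Pointwise

variable {k β : ℝ} {x : Fin (n + 1) → ℝ}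

theorem norm_cgrad_le (k : ℝ) (v : (Fin (n + 1) → ℝ) → ℂ) (x : Fin (n + 1) → ℝ)
    (i : Fin (n + 1)) : ‖cgrad a b v i x‖ ≤ √(normΩ a b k v x) := by
  apply Real.le_sqrt_of_sq_le
  have h1 := Finset.single_le_sum (f := fun i => ‖cgrad a b v i x‖ ^ 2)
    (fun i _ => sq_nonneg _) (Finset.mem_univ i)
  have h2 : 0 ≤ (k ^ 2)⁻¹ * ‖clap v x‖ ^ 2 := by positivity
  have h3 : 0 ≤ k ^ 2 * ‖v x‖ ^ 2 := by positivity
  simp only [normΩ]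
  linarith

theorem norm_val_le (hk : 0 < k) (v : (Fin (n + 1) → ℝ) → ℂ) (x : Fin (n + 1) → ℝ) :
    k * ‖v x‖ ≤ √(normΩ a b k v x) := by
  apply Real.le_sqrt_of_sq_le
  have h2 : 0 ≤ (k ^ 2)⁻¹ * ‖clap v x‖ ^ 2 := by positivity
  have h3 : 0 ≤ ∑ i, ‖cgrad a b v i x‖ ^ 2 := by positivity
  simp only [normΩ, mul_pow]
  linarith

theorem norm_clap_le (hk : 0 < k) (v : (Fin (n + 1) → ℝ) → ℂ) (x : Fin (n + 1) → ℝ) :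
    ‖clap v x‖ ≤ k * √(normΩ a b k v x) := by
  have h : ‖clap v x‖ / k ≤ √(normΩ a b k v x) := by
    apply Real.le_sqrt_of_sq_le
    have h2 : 0 ≤ k ^ 2 * ‖v x‖ ^ 2 := by positivity
    have h3 : 0 ≤ ∑ i, ‖cgrad a b v i x‖ ^ 2 := by positivity
    have h4 : (‖clap v x‖ / k) ^ 2 = (k ^ 2)⁻¹ * ‖clap v x‖ ^ 2 := by field_simp
    simp only [normΩ, h4]
    linarith
  rw [div_le_iff₀ hk] at h
  linarith

theorem norm_copL_le (hk : 0 < k) (v : (Fin (n + 1) → ℝ) → ℂ) (x : Fin (n + 1) → ℝ) :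
    ‖copL k v x‖ ≤ 2 * k * √(normΩ a b k v x) := by
  have h1 := norm_clap_le (a := a) (b := b) hk v x
  have h2 := mul_le_mul_of_nonneg_left (norm_val_le (a := a) (b := b) hk v x) hk.le
  calc _ ≤ ‖clap v x‖ + ‖(k : ℂ) ^ 2 * v x‖ := norm_add_le _ _
    _ = ‖clap v x‖ + k * (k * ‖v x‖) := by
      rw [norm_mul, norm_pow, Complex.norm_real, Real.norm_of_nonneg hk.le]; ring
    _ ≤ _ := by linarith

/-- The constant in the bounds for `𝓜`. -/
def boundM (a b : Fin (n + 1) → ℝ) (k₀ β₀ : ℝ) : ℝ := boxDiam a b + β₀ + n / (2 * k₀)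

/-- Common to `𝓜` in `Ω` and to its tangential part on `Γ`. The term `ikβV` carries the weight `k`
of the norm; the term `nV/2` does not, and is bounded through `k ≥ k₀`. -/
theorem norm_multiplier_le {k₀ β₀ P : ℝ} (hk₀ : 0 < k₀) (hk : k₀ ≤ k) (hβ : |β| ≤ β₀)
    {X V : ℂ} (hX : ‖X‖ ≤ boxDiam a b * P) (hV : k * ‖V‖ ≤ P) :
    ‖X - Complex.I * k * β * V + (n : ℂ) / 2 * V‖ ≤ boundM a b k₀ β₀ * P := by
  have hk' : 0 < k := hk₀.trans_le hk
  have h1 : ‖Complex.I * k * β * V‖ ≤ β₀ * P := by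
    calc _ = |β| * (k * ‖V‖) := by simp [abs_of_pos hk']; ring
      _ ≤ _ := by
        have : 0 ≤ β₀ := (abs_nonneg _).trans hβ
        gcongr
  have h2 : ‖(n : ℂ) / 2 * V‖ ≤ n / (2 * k₀) * P := by
    calc _ = n / (2 * k₀) * (k₀ * ‖V‖) := by simp; field_simp
      _ ≤ n / (2 * k₀) * (k * ‖V‖) := by gcongr
      _ ≤ _ := by gcongr
  calc _ ≤ ‖X‖ + ‖Complex.I * k * β * V‖ + ‖(n : ℂ) / 2 * V‖ :=
        (norm_add_le _ _).trans (by gcongr; exact norm_sub_le _ _)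
    _ ≤ boxDiam a b * P + β₀ * P + n / (2 * k₀) * P := by gcongr
    _ = _ := by rw [boundM]; ring

theorem norm_copM_le {r k₀ β₀ : ℝ} (hr : 0 < r) (hface : ∀ i, a i ≤ -r ∧ r ≤ b i)
    (hk₀ : 0 < k₀) (hk : k₀ ≤ k) (hβ : |β| ≤ β₀) (hx : x ∈ Set.Icc a b)
    (v : (Fin (n + 1) → ℝ) → ℂ) :
    ‖copM a b k β v x‖ ≤ boundM a b k₀ β₀ * √(normΩ a b k v x) := by
  refine norm_multiplier_le hk₀ hk hβ ?_ (norm_val_le (hk₀.trans_le hk) v x)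
  apply le_of_sq_le_sq _ (by unfold boxDiam; positivity)
  refine (norm_sum_coord_mul_sq_le hr hface hx _).trans ?_
  rw [mul_pow, Real.sq_sqrt (normΩ_nonneg k v x)]
  gcongr
  have h2 : 0 ≤ (k ^ 2)⁻¹ * ‖clap v x‖ ^ 2 := by positivity
  have h3 : 0 ≤ k ^ 2 * ‖v x‖ ^ 2 := by positivity
  simp only [normΩ]
  linarith

theorem norm_val_bdry_le (hk : 0 < k) (v : (Fin (n + 1) → ℝ) → ℂ) (x : Fin (n + 1) → ℝ) :
    k * ‖v x‖ ≤ √(normΓ a b k v x) := by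
  apply Real.le_sqrt_of_sq_le
  have h3 : 0 ≤ ∑ i, ‖csurfGrad a b v i x‖ ^ 2 := by positivity
  simp only [normΓ, mul_pow]
  linarith [sq_nonneg ‖cnormalDeriv a b v x‖]

theorem norm_cnormalDeriv_le (k : ℝ) (v : (Fin (n + 1) → ℝ) → ℂ) (x : Fin (n + 1) → ℝ) :
    ‖cnormalDeriv a b v x‖ ≤ √(normΓ a b k v x) := by
  apply Real.le_sqrt_of_sq_le
  have h3 : 0 ≤ ∑ i, ‖csurfGrad a b v i x‖ ^ 2 := by positivity
  have h2 : 0 ≤ k ^ 2 * ‖v x‖ ^ 2 := by positivity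
  simp only [normΓ]
  linarith

theorem norm_csurfGrad_le (k : ℝ) (v : (Fin (n + 1) → ℝ) → ℂ) (x : Fin (n + 1) → ℝ)
    (i : Fin (n + 1)) : ‖csurfGrad a b v i x‖ ≤ √(normΓ a b k v x) := by
  apply Real.le_sqrt_of_sq_le
  have h1 := Finset.single_le_sum (f := fun i => ‖csurfGrad a b v i x‖ ^ 2)
    (fun i _ => sq_nonneg _) (Finset.mem_univ i)
  have h2 : 0 ≤ k ^ 2 * ‖v x‖ ^ 2 := by positivity
  simp only [normΓ]
  linarith [sq_nonneg ‖cnormalDeriv a b v x‖]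

theorem norm_copMtan_le {r k₀ β₀ : ℝ} (hr : 0 < r) (hface : ∀ i, a i ≤ -r ∧ r ≤ b i)
    (hk₀ : 0 < k₀) (hk : k₀ ≤ k) (hβ : |β| ≤ β₀) (hx : x ∈ Set.Icc a b)
    (v : (Fin (n + 1) → ℝ) → ℂ) :
    ‖copMtan a b k β v x‖ ≤ boundM a b k₀ β₀ * √(normΓ a b k v x) := by
  refine norm_multiplier_le hk₀ hk hβ ?_ (norm_val_bdry_le (hk₀.trans_le hk) v x)
  apply le_of_sq_le_sq _ (by unfold boxDiam; positivity)
  refine (norm_sum_coord_mul_sq_le hr hface hx _).trans ?_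
  rw [mul_pow, Real.sq_sqrt (normΓ_nonneg k v x)]
  gcongr
  have h2 : 0 ≤ k ^ 2 * ‖v x‖ ^ 2 := by positivity
  simp only [normΓ]
  linarith [sq_nonneg ‖cnormalDeriv a b v x‖]

theorem norm_copMbdry_le {r k₀ β₀ : ℝ} (hr : 0 < r) (hface : ∀ i, a i ≤ -r ∧ r ≤ b i)
    (hk₀ : 0 < k₀) (hk : k₀ ≤ k) (hβ : |β| ≤ β₀) (hx : x ∈ Set.Icc a b)
    (hxn : ‖xn a b x‖ ≤ boxDiam a b) (v : (Fin (n + 1) → ℝ) → ℂ) :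
    ‖copMbdry a b k β v x‖ ≤ (boxDiam a b + boundM a b k₀ β₀) * √(normΓ a b k v x) := by
  have hL : 0 ≤ boxDiam a b := Real.sqrt_nonneg _
  calc _ ≤ ‖xn a b x‖ * ‖cnormalDeriv a b v x‖ + ‖copMtan a b k β v x‖ :=
        (norm_add_le _ _).trans (by rw [norm_mul])
    _ ≤ boxDiam a b * √(normΓ a b k v x) + boundM a b k₀ β₀ * √(normΓ a b k v x) := by
        gcongr
        · exact norm_cnormalDeriv_le k v x
        · exact norm_copMtan_le hr hface hk₀ hk hβ hx v
    _ = _ := by ring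

theorem norm_sum_mul_star_le {P Q : ℝ} {z w : Fin (n + 1) → ℂ} (hz : ∀ i, ‖z i‖ ≤ P)
    (hw : ∀ i, ‖w i‖ ≤ Q) : ‖∑ i, z i * star (w i)‖ ≤ (n + 1) * (P * Q) := by
  have hP : 0 ≤ P := (norm_nonneg _).trans (hz 0)
  calc _ ≤ ∑ i : Fin (n + 1), P * Q := by
        refine norm_sum_le_of_le _ fun i _ => ?_
        rw [norm_mul, norm_star]
        exact mul_le_mul (hz i) (hw i) (norm_nonneg _) hP
    _ = _ := by simp

theorem boundM_nonneg {k₀ β₀ : ℝ} (hk₀ : 0 < k₀) (hβ₀ : 0 ≤ β₀) : 0 ≤ boundM a b k₀ β₀ := by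
  unfold boundM boxDiam; positivity

/-- The growth in `k` comes from `𝓜u · conj 𝓛v` alone: the norm controls `k⁻¹Δv` and `kv`, so `𝓛v`
costs a factor `2k`. The term with `A k⁻² 𝓛u` is bounded uniformly, since its two factors `k` are
compensated by `k⁻²`. All uniformly bounded terms are then bounded by a multiple of `k/k₀`. -/
theorem norm_formΩ_le {r k₀ β₀ : ℝ} (hr : 0 < r) (hface : ∀ i, a i ≤ -r ∧ r ≤ b i)
    (hk₀ : 0 < k₀) (hk : k₀ ≤ k) (hβ : |β| ≤ β₀) (hx : x ∈ Set.Icc a b)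
    (u v : (Fin (n + 1) → ℝ) → ℂ) :
    ‖formΩ a b k β (1 / 3) u v x‖ ≤ ((n + 4) / k₀ + 2 * boundM a b k₀ β₀) * k *
      (√(normΩ a b k u x) * √(normΩ a b k v x)) := by
  have hk' : 0 < k := hk₀.trans_le hk
  set P := √(normΩ a b k u x) with hP
  set Q := √(normΩ a b k v x) with hQ
  have hP0 : 0 ≤ P := Real.sqrt_nonneg _
  have hQ0 : 0 ≤ Q := Real.sqrt_nonneg _
  set Cm := boundM a b k₀ β₀ with hCm
  have hCm0 : 0 ≤ Cm := boundM_nonneg hk₀ ((abs_nonneg _).trans hβ)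
  have h1 : ‖∑ i, cgrad a b u i x * star (cgrad a b v i x)‖ ≤ (n + 1) * (P * Q) :=
    norm_sum_mul_star_le (norm_cgrad_le k u x) (norm_cgrad_le k v x)
  have h2 : ‖(k : ℂ) ^ 2 * u x * star (v x)‖ ≤ P * Q := by
    calc _ = (k * ‖u x‖) * (k * ‖v x‖) := by
          rw [norm_mul, norm_mul, norm_pow, Complex.norm_real, Real.norm_of_nonneg hk'.le,
            norm_star]; ring
      _ ≤ _ := mul_le_mul (norm_val_le hk' u x) (norm_val_le hk' v x) (by positivity) hP0
  have h3 : ‖copM a b k β u x + ((1 / 3 : ℝ) : ℂ) / (k : ℂ) ^ 2 * copL k u x‖ ≤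
      (Cm + 2 / (3 * k)) * P := by
    calc _ ≤ ‖copM a b k β u x‖ + ‖((1 / 3 : ℝ) : ℂ) / (k : ℂ) ^ 2 * copL k u x‖ := norm_add_le _ _
      _ ≤ Cm * P + 1 / 3 / k ^ 2 * (2 * k * P) := by
        gcongr
        · exact norm_copM_le hr hface hk₀ hk hβ hx u
        · rw [norm_mul, norm_div, norm_pow, Complex.norm_real, Complex.norm_real,
            Real.norm_of_nonneg hk'.le, Real.norm_of_nonneg (by norm_num)]
          gcongr
          exact norm_copL_le hk' u x
      _ = _ := by field_simp
  have h4 := norm_copL_le (a := a) (b := b) hk' v x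
  have h5 : ‖(copM a b k β u x + ((1 / 3 : ℝ) : ℂ) / (k : ℂ) ^ 2 * copL k u x) *
      star (copL k v x)‖ ≤ (Cm + 2 / (3 * k)) * P * (2 * k * Q) := by
    rw [norm_mul, norm_star]
    exact mul_le_mul h3 h4 (norm_nonneg _) (by positivity)
  have h6 : (Cm + 2 / (3 * k)) * P * (2 * k * Q) = (2 * Cm * k + 4 / 3) * (P * Q) := by
    field_simp; ring
  have h7 : (n + 4 : ℝ) ≤ (n + 4) / k₀ * k := by
    rw [div_mul_eq_mul_div, le_div_iff₀ hk₀]; gcongr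
  have h8 : ((n : ℝ) + 4) * (P * Q) ≤ (n + 4) / k₀ * k * (P * Q) := by gcongr
  have hPQ : 0 ≤ P * Q := by positivity
  calc _ ≤ (n + 1) * (P * Q) + P * Q + (Cm + 2 / (3 * k)) * P * (2 * k * Q) := by
        refine (norm_add_le _ _).trans (add_le_add ((norm_add_le _ _).trans (add_le_add h1 h2)) h5)
    _ ≤ _ := by
        rw [h6]
        nlinarith

/-- On `Γ` there is no growth in `k`: each trace comes with a factor `k`, and the norm contains the
surface gradient and the normal derivative with weight `1`. -/
theorem norm_formΓ_le {r k₀ β₀ : ℝ} (hr : 0 < r) (hface : ∀ i, a i ≤ -r ∧ r ≤ b i)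
    (hk₀ : 0 < k₀) (hk : k₀ ≤ k) (hβ : |β| ≤ β₀) (hx : x ∈ Set.Icc a b)
    (hxn : ‖xn a b x‖ ≤ boxDiam a b) (u v : (Fin (n + 1) → ℝ) → ℂ) :
    ‖formΓ a b k β u v x‖ ≤ ((n + 3) * boxDiam a b + 2 * boundM a b k₀ β₀) *
      (√(normΓ a b k u x) * √(normΓ a b k v x)) := by
  have hk' : 0 < k := hk₀.trans_le hk
  have hL : 0 ≤ boxDiam a b := Real.sqrt_nonneg _
  set P := √(normΓ a b k u x) with hP
  set Q := √(normΓ a b k v x) with hQ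
  have hP0 : 0 ≤ P := Real.sqrt_nonneg _
  have hQ0 : 0 ≤ Q := Real.sqrt_nonneg _
  set Cm := boundM a b k₀ β₀ with hCm
  have hCm0 : 0 ≤ Cm := boundM_nonneg hk₀ ((abs_nonneg _).trans hβ)
  have h1 : ‖Complex.I * k * u x * star (copMbdry a b k β v x)‖ ≤
      P * ((boxDiam a b + Cm) * Q) := by
    calc _ = (k * ‖u x‖) * ‖copMbdry a b k β v x‖ := by
          rw [norm_mul, norm_mul, norm_mul, Complex.norm_real, Real.norm_of_nonneg hk'.le,
            norm_star, Complex.norm_I, one_mul]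
      _ ≤ _ := mul_le_mul (norm_val_bdry_le hk' u x)
          (norm_copMbdry_le hr hface hk₀ hk hβ hx hxn v) (norm_nonneg _) hP0
  have h2 : ‖copMtan a b k β u x * star (cnormalDeriv a b v x)‖ ≤ Cm * P * Q := by
    rw [norm_mul, norm_star]
    exact mul_le_mul (norm_copMtan_le hr hface hk₀ hk hβ hx u) (norm_cnormalDeriv_le k v x)
      (norm_nonneg _) (by positivity)
  have h3 : ‖(k : ℂ) ^ 2 * u x * star (v x)‖ ≤ P * Q := by
    calc _ = (k * ‖u x‖) * (k * ‖v x‖) := by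
          rw [norm_mul, norm_mul, norm_pow, Complex.norm_real, Real.norm_of_nonneg hk'.le,
            norm_star]; ring
      _ ≤ _ := mul_le_mul (norm_val_bdry_le hk' u x) (norm_val_bdry_le hk' v x) (by positivity) hP0
  have h4 : ‖∑ i, csurfGrad a b u i x * star (csurfGrad a b v i x)‖ ≤ (n + 1) * (P * Q) :=
    norm_sum_mul_star_le (norm_csurfGrad_le k u x) (norm_csurfGrad_le k v x)
  have h5 : ‖xn a b x * ((k : ℂ) ^ 2 * u x * star (v x) -
      ∑ i, csurfGrad a b u i x * star (csurfGrad a b v i x))‖ ≤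
      boxDiam a b * (P * Q + (n + 1) * (P * Q)) := by
    rw [norm_mul]
    exact mul_le_mul hxn ((norm_sub_le _ _).trans (add_le_add h3 h4)) (norm_nonneg _) hL
  calc _ ≤ P * ((boxDiam a b + Cm) * Q) + Cm * P * Q +
        boxDiam a b * (P * Q + (n + 1) * (P * Q)) :=
        (norm_add_le _ _).trans (add_le_add ((norm_add_le _ _).trans (add_le_add h1 h2)) h5)
    _ = _ := by ring

end Pointwise

theorem ae_norm_xn_le {r : ℝ} (hr : 0 < r) (hface : ∀ i, a i ≤ -r ∧ r ≤ b i)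
    (hab : ∀ i, a i < b i) :
    ∀ᵐ x ∂(surf a b), x ∈ Set.Icc a b ∧ ‖xn a b x‖ ≤ boxDiam a b := by
  filter_upwards [ae_xn hr hface hab] with x hx
  obtain ⟨hx, c, hc, hc1, hc2⟩ := hx
  refine ⟨hx, ?_⟩
  rw [hc, Complex.norm_real, Real.norm_of_nonneg (hr.le.trans hc1)]
  exact hc2

/-- The constant in the continuity estimate for the form `b`. -/
def contConst (a b : Fin (n + 1) → ℝ) (k₀ β₀ : ℝ) : ℝ :=
  ((n + 4) / k₀ + 2 * boundM a b k₀ β₀) + ((n + 3) * boxDiam a b + 2 * boundM a b k₀ β₀) / k₀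

theorem contConst_pos {k₀ β₀ : ℝ} (hk₀ : 0 < k₀) (hβ₀ : 0 ≤ β₀) : 0 < contConst a b k₀ β₀ := by
  have h := boundM_nonneg (a := a) (b := b) hk₀ hβ₀
  unfold contConst boxDiam; positivity

/-- Continuity of the form `b`, with a constant that grows linearly in `k`. -/
theorem norm_cform_le (hab : ∀ i, a i < b i) (hS : S.Countable) {r k₀ k β β₀ : ℝ} (hr : 0 < r)
    (hface : ∀ i, a i ≤ -r ∧ r ≤ b i) (hk₀ : 0 < k₀) (hk : k₀ ≤ k) (hβ : |β| ≤ β₀)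
    (hu : u ∈ gridC2 a b S) (hv : v ∈ gridC2 a b S) :
    ‖cform a b k β (1 / 3) u v‖ ≤ contConst a b k₀ β₀ * k *
      √(cnormSq a b k u) * √(cnormSq a b k v) := by
  have hk' : 0 < k := hk₀.trans_le hk
  have hβ₀ := (abs_nonneg _).trans hβ
  have hCm := boundM_nonneg (a := a) (b := b) hk₀ hβ₀
  have hL : 0 ≤ boxDiam a b := Real.sqrt_nonneg _
  have iuΩ := integrable_normΩ hab hS hu k
  have ivΩ := integrable_normΩ hab hS hv k
  have iuΓ := integrable_normΓ hab hu k
  have ivΓ := integrable_normΓ hab hv k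
  set K1 := ((n : ℝ) + 4) / k₀ + 2 * boundM a b k₀ β₀ with hK1
  set K2 := ((n : ℝ) + 3) * boxDiam a b + 2 * boundM a b k₀ β₀ with hK2
  have hK10 : 0 ≤ K1 := by positivity
  have hK20 : 0 ≤ K2 := by positivity
  have hK : contConst a b k₀ β₀ = K1 + K2 / k₀ := rfl
  have hprodΩ := (memLp_sqrt iuΩ (normΩ_nonneg k u)).integrable_mul (memLp_sqrt ivΩ (normΩ_nonneg k v))
  have hprodΓ := (memLp_sqrt iuΓ (normΓ_nonneg k u)).integrable_mul (memLp_sqrt ivΓ (normΓ_nonneg k v))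
  have h1 : ‖∫ x, formΩ a b k β (1 / 3) u v x ∂(volΩ a b)‖ ≤ K1 * k *
      (√(∫ x, normΩ a b k u x ∂(volΩ a b)) * √(∫ x, normΩ a b k v x ∂(volΩ a b))) := by
    refine (norm_integral_le_of_norm_le (hprodΩ.const_mul (K1 * k)) ?_).trans ?_
    · filter_upwards [ae_openBox Set.countable_empty] with x hx
      exact norm_formΩ_le hr hface hk₀ hk hβ (openBox_subset_Icc hx.1) u v
    · rw [integral_const_mul]
      gcongr
      exact integral_sqrt_mul_sqrt_le iuΩ ivΩ (normΩ_nonneg k u) (normΩ_nonneg k v)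
  have h2 : ‖∫ x, formΓ a b k β u v x ∂(surf a b)‖ ≤ K2 *
      (√(∫ x, normΓ a b k u x ∂(surf a b)) * √(∫ x, normΓ a b k v x ∂(surf a b))) := by
    refine (norm_integral_le_of_norm_le (hprodΓ.const_mul K2) ?_).trans ?_
    · filter_upwards [ae_norm_xn_le hr hface hab] with x hx
      exact norm_formΓ_le hr hface hk₀ hk hβ hx.1 hx.2 u v
    · rw [integral_const_mul]
      gcongr
      exact integral_sqrt_mul_sqrt_le iuΓ ivΓ (normΓ_nonneg k u) (normΓ_nonneg k v)
  have hKa : K1 * k ≤ contConst a b k₀ β₀ * k := by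
    rw [hK]; gcongr; linarith [div_nonneg hK20 hk₀.le]
  have hKb : K2 ≤ contConst a b k₀ β₀ * k := by
    rw [hK]
    calc K2 = K2 / k₀ * k₀ := by field_simp
      _ ≤ K2 / k₀ * k := by gcongr
      _ ≤ _ := by gcongr; linarith
  have h3 := sqrt_mul_add_sqrt_mul_le
    (integral_nonneg (μ := volΩ a b) (normΩ_nonneg (a := a) (b := b) k u))
    (integral_nonneg (μ := volΩ a b) (normΩ_nonneg (a := a) (b := b) k v))
    (integral_nonneg (μ := surf a b) (normΓ_nonneg (a := a) (b := b) k u))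
    (integral_nonneg (μ := surf a b) (normΓ_nonneg (a := a) (b := b) k v))
  have hC0 : 0 ≤ contConst a b k₀ β₀ * k := (by positivity : 0 ≤ K1 * k).trans hKa
  rw [cform, mul_assoc]
  refine (norm_sub_le _ _).trans ((add_le_add h1 h2).trans ?_)
  calc _ ≤ contConst a b k₀ β₀ * k *
        (√(∫ x, normΩ a b k u x ∂(volΩ a b)) * √(∫ x, normΩ a b k v x ∂(volΩ a b))) +
        contConst a b k₀ β₀ * k *
        (√(∫ x, normΓ a b k u x ∂(surf a b)) * √(∫ x, normΓ a b k v x ∂(surf a b))) := by gcongr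
    _ ≤ _ := by
      rw [← mul_add]
      exact mul_le_mul_of_nonneg_left h3 hC0

/-- Continuity of the right-hand side. -/
theorem norm_crhs_le (hab : ∀ i, a i < b i) (hS : S.Countable) {r k β : ℝ} (hr : 0 < r)
    (hface : ∀ i, a i ≤ -r ∧ r ≤ b i) (hk : 0 < k) :
    ∃ K, 0 ≤ K ∧ ∀ f g v : (Fin (n + 1) → ℝ) → ℂ, MemLp f 2 (volΩ a b) → MemLp g 2 (surf a b) →
      v ∈ gridC2 a b S → ‖crhs a b k β (1 / 3) f g v‖ ≤
      K * (√(sqNorm (volΩ a b) f) + √(sqNorm (surf a b) g)) * √(cnormSq a b k v) := by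
  have hL : 0 ≤ boxDiam a b := Real.sqrt_nonneg _
  -- The constant may depend on `k` and `β`: it only multiplies errors in the data that tend to zero
  -- for fixed `k` and `β`.
  set Cm := boundM a b k |β| with hCm
  have hCm0 : 0 ≤ Cm := boundM_nonneg hk (abs_nonneg _)
  refine ⟨(Cm + 2 / (3 * k)) + (boxDiam a b + Cm), by positivity, fun f g v hf hg hv => ?_⟩
  have ivΩ := integrable_normΩ hab hS hv k
  have ivΓ := integrable_normΓ hab hv k
  have h1 : ‖∫ x, (star (copM a b k β v x) - ((1 / 3 : ℝ) : ℂ) / (k : ℂ) ^ 2 * star (copL k v x)) *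
      f x ∂(volΩ a b)‖ ≤ (Cm + 2 / (3 * k)) * (√(∫ x, normΩ a b k v x ∂(volΩ a b)) *
        √(sqNorm (volΩ a b) f)) := by
    have hm := memLp_sqrt ivΩ (normΩ_nonneg k v)
    refine (norm_integral_le_of_norm_le ((integrable_norm_mul_norm hm hf).const_mul
      (Cm + 2 / (3 * k))) ?_).trans ?_
    · filter_upwards [ae_openBox Set.countable_empty] with x hx
      rw [norm_mul, Real.norm_of_nonneg (Real.sqrt_nonneg _), ← mul_assoc]
      gcongr
      calc _ ≤ ‖copM a b k β v x‖ + ‖((1 / 3 : ℝ) : ℂ) / (k : ℂ) ^ 2 * copL k v x‖ := by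
            refine (norm_sub_le _ _).trans ?_
            rw [norm_mul, norm_mul, norm_star, norm_star]
        _ ≤ Cm * √(normΩ a b k v x) + 1 / 3 / k ^ 2 * (2 * k * √(normΩ a b k v x)) := by
          gcongr
          · exact norm_copM_le hr hface hk le_rfl le_rfl (openBox_subset_Icc hx.1) v
          · rw [norm_mul, norm_div, norm_pow, Complex.norm_real, Complex.norm_real,
              Real.norm_of_nonneg hk.le, Real.norm_of_nonneg (by norm_num)]
            gcongr
            exact norm_copL_le hk v x
        _ = _ := by field_simp
    · rw [integral_const_mul]
      gcongr
      have h := integral_norm_mul_norm_le hm hf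
      simpa [Real.sq_sqrt, normΩ_nonneg, sqNorm] using h
  have h2 : ‖∫ x, star (copMbdry a b k β v x) * g x ∂(surf a b)‖ ≤
      (boxDiam a b + Cm) * (√(∫ x, normΓ a b k v x ∂(surf a b)) * √(sqNorm (surf a b) g)) := by
    have hm := memLp_sqrt ivΓ (normΓ_nonneg k v)
    refine (norm_integral_le_of_norm_le ((integrable_norm_mul_norm hm hg).const_mul
      (boxDiam a b + Cm)) ?_).trans ?_
    · filter_upwards [ae_norm_xn_le hr hface hab] with x hx
      rw [norm_mul, norm_star, Real.norm_of_nonneg (Real.sqrt_nonneg _), ← mul_assoc]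
      gcongr
      exact norm_copMbdry_le hr hface hk le_rfl le_rfl hx.1 hx.2 v
    · rw [integral_const_mul]
      gcongr
      have h := integral_norm_mul_norm_le hm hg
      simpa [Real.sq_sqrt, normΓ_nonneg, sqNorm] using h
  have e1 : √(∫ x, normΩ a b k v x ∂(volΩ a b)) ≤ √(cnormSq a b k v) :=
    Real.sqrt_le_sqrt (le_add_of_nonneg_right (integral_nonneg fun x => normΓ_nonneg k v x))
  have e2 : √(∫ x, normΓ a b k v x ∂(surf a b)) ≤ √(cnormSq a b k v) :=
    Real.sqrt_le_sqrt (le_add_of_nonneg_left (integral_nonneg fun x => normΩ_nonneg k v x))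
  set F := √(sqNorm (volΩ a b) f)
  set G := √(sqNorm (surf a b) g)
  set N := √(cnormSq a b k v)
  have hF : 0 ≤ F := Real.sqrt_nonneg _
  have hG : 0 ≤ G := Real.sqrt_nonneg _
  have hN : 0 ≤ N := Real.sqrt_nonneg _
  rw [crhs]
  refine (norm_add_le _ _).trans ((add_le_add h1 h2).trans ?_)
  calc _ ≤ (Cm + 2 / (3 * k)) * (N * F) + (boxDiam a b + Cm) * (N * G) := by gcongr
    _ ≤ _ := by
      have h3 : 0 ≤ (Cm + 2 / (3 * k)) * (N * G) := by positivity
      have h4 : 0 ≤ (boxDiam a b + Cm) * (N * F) := by positivity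
      nlinarith

end Box

/-! ### Uniqueness of weak derivatives -/

theorem eLpNorm_two_eq_sqNorm {X : Type*} [MeasurableSpace X] {μ : Measure X} {f : X → ℂ}
    (hf : MemLp f 2 μ) : eLpNorm f 2 μ = ENNReal.ofReal (√(sqNorm μ f)) := by
  rw [hf.eLpNorm_eq_integral_rpow_norm two_ne_zero ENNReal.ofNat_ne_top, Real.sqrt_eq_rpow]
  simp [sqNorm]

theorem tendsto_sqNorm_iff {X ι : Type*} [MeasurableSpace X] {μ : Measure X} {f : ι → X → ℂ}
    {l : Filter ι} (hf : ∀ m, MemLp (f m) 2 μ) :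
    Tendsto (fun m => eLpNorm (f m) 2 μ) l (𝓝 0) ↔ Tendsto (fun m => sqNorm μ (f m)) l (𝓝 0) := by
  have h0 : ∀ m, 0 ≤ sqNorm μ (f m) := fun m => integral_nonneg fun x => sq_nonneg _
  simp only [eLpNorm_two_eq_sqNorm (hf _)]
  constructor
  · intro h
    have h1 := (ENNReal.tendsto_toReal ENNReal.zero_ne_top).comp h
    have h2 : Tendsto (fun m => √(sqNorm μ (f m))) l (𝓝 0) := by
      simpa [Function.comp_def, ENNReal.toReal_ofReal (Real.sqrt_nonneg _)] using h1
    have h3 := h2.pow 2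
    simpa [Real.sq_sqrt (h0 _)] using h3
  · intro h
    have h1 := (Real.continuous_sqrt.tendsto 0).comp h
    have h2 := (ENNReal.continuous_ofReal.tendsto _).comp h1
    simpa [Function.comp_def] using h2

theorem sqNorm_nonneg {X : Type*} [MeasurableSpace X] (μ : Measure X) (f : X → ℂ) :
    0 ≤ sqNorm μ f := integral_nonneg fun _ => sq_nonneg _

theorem sqNorm_add_le {X : Type*} [MeasurableSpace X] {μ : Measure X} {f g : X → ℂ}
    (hf : MemLp f 2 μ) (hg : MemLp g 2 μ) :
    sqNorm μ (f + g) ≤ 2 * sqNorm μ f + 2 * sqNorm μ g := by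
  rw [sqNorm, sqNorm, sqNorm, ← integral_const_mul, ← integral_const_mul,
    ← integral_add ((integrable_norm_sq hf).const_mul 2) ((integrable_norm_sq hg).const_mul 2)]
  exact integral_mono (integrable_norm_sq (hf.add hg))
    (((integrable_norm_sq hf).const_mul 2).add ((integrable_norm_sq hg).const_mul 2))
    fun x => norm_add_sq_le_two _ _

theorem sqNorm_sub_le {X : Type*} [MeasurableSpace X] {μ : Measure X} {f g : X → ℂ}
    (hf : MemLp f 2 μ) (hg : MemLp g 2 μ) :
    sqNorm μ (f - g) ≤ 2 * sqNorm μ f + 2 * sqNorm μ g := by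
  have h := sqNorm_add_le hf hg.neg
  have e : sqNorm μ (-g) = sqNorm μ g := by simp [sqNorm]
  rw [e, ← sub_eq_add_neg] at h
  exact h

theorem sqNorm_congr {X : Type*} [MeasurableSpace X] {μ : Measure X} {f g : X → ℂ}
    (h : f =ᵐ[μ] g) : sqNorm μ f = sqNorm μ g := by
  apply integral_congr_ae
  filter_upwards [h] with x hx
  rw [hx]

theorem ae_eq_zero_of_sqNorm {X : Type*} [MeasurableSpace X] {μ : Measure X} {f : X → ℂ}
    (hf : MemLp f 2 μ) (h : sqNorm μ f = 0) : f =ᵐ[μ] 0 := by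
  have h1 := (integral_eq_zero_iff_of_nonneg (fun x => sq_nonneg ‖f x‖) (integrable_norm_sq hf)).1 h
  filter_upwards [h1] with x hx
  simpa using hx

theorem tendsto_integral_mul {X : Type*} [MeasurableSpace X] {μ : Measure X}
    {f : ℕ → X → ℂ} {f₀ g : X → ℂ} (hf : ∀ m, MemLp (f m) 2 μ)
    (hf₀ : MemLp f₀ 2 μ) (hg : MemLp g 2 μ)
    (h : Tendsto (fun m => sqNorm μ (f m - f₀)) atTop (𝓝 0)) :
    Tendsto (fun m => ∫ x, g x * f m x ∂μ) atTop (𝓝 (∫ x, g x * f₀ x ∂μ)) := by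
  rw [tendsto_iff_norm_sub_tendsto_zero]
  refine squeeze_zero (fun _ => norm_nonneg _) (g := fun m => √(sqNorm μ g) * √(sqNorm μ (f m - f₀)))
    (fun m => ?_) ?_
  · have i1 : Integrable (fun x => g x * f m x) μ := hg.integrable_mul (hf m)
    have i2 : Integrable (fun x => g x * f₀ x) μ := hg.integrable_mul hf₀
    rw [← integral_sub i1 i2]
    refine (norm_integral_le_integral_norm _).trans ?_
    have h1 := integral_norm_mul_norm_le hg ((hf m).sub hf₀)
    refine le_trans (le_of_eq (integral_congr_ae (ae_of_all _ fun x => ?_))) h1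
    simp [← mul_sub]
  · have h1 := ((Real.continuous_sqrt.tendsto 0).comp h).const_mul (√(sqNorm μ g))
    simpa using h1

section Box

variable {n : ℕ} {a b : Fin (n + 1) → ℝ} {S : Set ℝ} {u v w : (Fin (n + 1) → ℝ) → ℂ}

theorem ae_eq_of_test {f f' : (Fin (n + 1) → ℝ) → ℂ} (hf : MemLp f 2 (volΩ a b))
    (hf' : MemLp f' 2 (volΩ a b))
    (h : ∀ φ, IsTestFunction (openBox a b) φ →
      ∫ x, φ x • f x ∂(volΩ a b) = ∫ x, φ x • f' x ∂(volΩ a b)) : f =ᵐ[volΩ a b] f' := by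
  have hi : Integrable (f - f') (volΩ a b) := (hf.sub hf').integrable (by norm_num)
  have h1 := isOpen_openBox (a := a) (b := b).ae_eq_zero_of_integral_contDiff_smul_eq_zero
    (f := f - f') (μ := volume) (IntegrableOn.locallyIntegrableOn hi) ?_
  · have h2 : ∀ᵐ x ∂(volΩ a b), (f - f') x = 0 :=
      (ae_restrict_iff' isOpen_openBox.measurableSet).2 h1
    filter_upwards [h2] with x hx
    exact sub_eq_zero.1 hx
  · intro g hg hgc hgs
    have e : ∫ x, g x • (f - f') x = ∫ x, g x • (f - f') x ∂(volΩ a b) := by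
      symm
      apply setIntegral_eq_integral_of_forall_compl_eq_zero
      intro x hx
      rw [image_eq_zero_of_notMem_tsupport fun hx' => hx (hgs hx'), zero_smul]
    obtain ⟨M, hM⟩ := hgc.exists_bound_of_continuous hg.continuous
    have ii : ∀ q : (Fin (n + 1) → ℝ) → ℂ, MemLp q 2 (volΩ a b) →
        Integrable (fun x => g x • q x) (volΩ a b) := fun q hq =>
      (hq.integrable (by norm_num)).bdd_smul M hg.continuous.aestronglyMeasurable
        (ae_of_all _ hM)
    rw [e]
    simp only [Pi.sub_apply, smul_sub]
    rw [integral_sub (ii f hf) (ii f' hf'), h g ⟨hg, hgc, hgs⟩, sub_self]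

/-- `Classical.epsilon` has the defining property as soon as some function has it, and two functions
with that property have the same integrals against all test functions. The same pattern identifies
the weak Laplacian, the trace, the normal derivative and the surface gradient below. -/
theorem weakDeriv_ae_eq {α : Fin (n + 1) → ℕ} (h : IsWeakDeriv a b α w v) :
    weakDeriv a b α w =ᵐ[volΩ a b] v := by
  have hs : IsWeakDeriv a b α w (weakDeriv a b α w) := Classical.epsilon_spec ⟨v, h⟩
  refine ae_eq_of_test hs.2.1 h.2.1 fun φ hφ => ?_
  have h1 := hs.2.2 φ hφ
  rw [h.2.2 φ hφ] at h1
  exact (mul_left_cancel₀ (pow_ne_zero _ (by norm_num)) h1).symm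

theorem wlap_ae_eq (h : IsWeakLaplacian a b w v) : wlap a b w =ᵐ[volΩ a b] v := by
  have hs : IsWeakLaplacian a b w (wlap a b w) := Classical.epsilon_spec ⟨v, h⟩
  refine ae_eq_of_test hs.2.1 h.2.1 fun φ hφ => ?_
  rw [← hs.2.2 φ hφ, h.2.2 φ hφ]

theorem foldr_iterate_single {d : ℕ} {Y : Type*} (P : Fin d → Y → Y) (i : Fin d) (r : ℕ) (y : Y)
    (l : List (Fin d)) (hl : l.Nodup) :
    l.foldr (fun j z => (P j)^[(Pi.single i r : Fin d → ℕ) j] z) y =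
      if i ∈ l then (P i)^[r] y else y := by
  induction l with
  | nil => simp
  | cons j l ih =>
    rw [List.nodup_cons] at hl
    rw [List.foldr_cons, ih hl.2]
    by_cases hj : j = i
    · subst hj
      simp [hl.1]
    · simp [hj, Ne.symm hj]

theorem mderiv_single {d : ℕ} (i : Fin d) (φ : (Fin d → ℝ) → ℝ) :
    mderiv (Pi.single i 1) φ = pderiv i φ := by
  rw [mderiv, foldr_iterate_single pderiv i 1 φ _ (List.nodup_finRange d)]
  simp

theorem isTestFunction_pderiv {d : ℕ} {Ω : Set (Fin d → ℝ)} {φ : (Fin d → ℝ) → ℝ}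
    (h : IsTestFunction Ω φ) (i : Fin d) : IsTestFunction Ω (pderiv i φ) :=
  ⟨(h.1.fderiv_right (m := ∞) (by simp)).clm_apply contDiff_const, h.2.1.fderiv_apply (𝕜 := ℝ) _,
    (tsupport_fderiv_apply_subset ℝ _).trans h.2.2⟩

theorem hasDerivAt_pderiv {d : ℕ} {φ : (Fin d → ℝ) → ℝ} (hφ : ContDiff ℝ ∞ φ) (x : Fin d → ℝ)
    (i : Fin d) : HasDerivAt (fun t => φ (Function.update x i t)) (pderiv i φ x) (x i) := by
  have h1 := hasDerivAt_update x i (x i)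
  have h2 : HasFDerivAt φ (fderiv ℝ φ x) (Function.update x i (x i)) := by
    rw [Function.update_eq_self]; exact (hφ.differentiable (by simp) x).hasFDerivAt
  exact h2.comp_hasDerivAt (x i) h1

/-- Integration by parts against a test function. -/
theorem integral_pderiv_smul (hab : ∀ i, a i < b i) (hS : S.Countable) (i : Fin (n + 1))
    {G DG : (Fin (n + 1) → ℝ) → ℂ} (hG : ContinuousOn G (Set.Icc a b))
    (hd : ∀ x ∈ openBox a b, (∀ j, x j ∉ S) →
      HasDerivAt (fun t => G (Function.update x i t)) (DG x) (x i))
    (hi : MemLp DG ⊤ (volΩ a b)) {φ : (Fin (n + 1) → ℝ) → ℝ}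
    (hφ : IsTestFunction (openBox a b) φ) :
    ∫ x, pderiv i φ x • G x ∂(volΩ a b) = -∫ x, φ x • DG x ∂(volΩ a b) := by
  have hφ' := isTestFunction_pderiv hφ i
  have i1 : MemLp (fun x => pderiv i φ x • G x) ⊤ (volΩ a b) :=
    memLp_top_volΩ (hφ'.1.continuous.continuousOn.smul hG)
  have i2 : MemLp (fun x => φ x • DG x) ⊤ (volΩ a b) :=
    hi.smul (r := ⊤) (memLp_top_volΩ hφ.1.continuous.continuousOn)
  have h := integral_partialDeriv hab i hS (F := fun x => φ x • G x)
    (DF := fun x => pderiv i φ x • G x + φ x • DG x) (hφ.1.continuous.continuousOn.smul hG)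
    (fun x hx hxS => by
      have := (hasDerivAt_pderiv hφ.1 x i).smul (hd x hx hxS)
      simp only [Function.update_eq_self] at this
      exact (add_comm (φ x • DG x) (pderiv i φ x • G x)) ▸ this)
    ((i1.add i2).integrable le_top)
  have hz : ∀ x ∉ openBox a b, φ x = 0 := fun x hx =>
    image_eq_zero_of_notMem_tsupport fun h' => hx (hφ.2.2 h')
  have z1 : ∫ x, φ x • G x ∂(faceMeasure a b i (b i)) = 0 := by
    apply integral_eq_zero_of_ae
    filter_upwards [ae_normal_upperFace hab i] with x hx
    rw [hz x fun hx' => absurd (hx' i trivial).2 (by simp [hx.2.2]), zero_smul]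
    rfl
  have z2 : ∫ x, φ x • G x ∂(faceMeasure a b i (a i)) = 0 := by
    apply integral_eq_zero_of_ae
    filter_upwards [ae_normal_lowerFace hab i] with x hx
    rw [hz x fun hx' => absurd (hx' i trivial).1 (by simp [hx.2.2]), zero_smul]
    rfl
  rw [z1, z2, sub_zero, integral_add (i1.integrable le_top) (i2.integrable le_top)] at h
  exact eq_neg_of_add_eq_zero_left h

theorem isWeakDeriv_cgrad (hab : ∀ i, a i < b i) (hv : ContDiffOn ℝ 1 v (Set.Icc a b))
    (i : Fin (n + 1)) : IsWeakDeriv a b (Pi.single i 1) v (cgrad a b v i) := by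
  have h1 := memLp_top_volΩ (continuousOn_cgrad hab hv i)
  refine ⟨(memLp_top_volΩ hv.continuousOn).mono_exponent le_top, h1.mono_exponent le_top,
    fun φ hφ => ?_⟩
  rw [mderiv_single, integral_pderiv_smul hab Set.countable_empty i hv.continuousOn
    (fun x hx _ => hasDerivAt_cgrad hv hx i) h1 hφ]
  simp [Finset.sum_pi_single']

theorem wgrad_ae_eq (hab : ∀ i, a i < b i) (hv : ContDiffOn ℝ 1 v (Set.Icc a b))
    (i : Fin (n + 1)) : wgrad a b v i =ᵐ[volΩ a b] cgrad a b v i :=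
  weakDeriv_ae_eq (isWeakDeriv_cgrad hab hv i)

/-- Since `v` is of class `C¹` across the grid, its first derivatives do not jump there. The second
integration by parts therefore produces no terms on the grid lines, and the piecewise Laplacian is
the distributional one. This is the reason for `C¹` elements. -/
theorem isWeakLaplacian_clap (hab : ∀ i, a i < b i) (hS : S.Countable) (hv : v ∈ gridC2 a b S) :
    IsWeakLaplacian a b v (clap v) := by
  refine ⟨(memLp_top_volΩ hv.1.continuousOn).mono_exponent le_top,
    (memLp_clap hS hv).mono_exponent le_top, fun φ hφ => ?_⟩
  have h1 : ∀ i, ∫ x, pderiv i (pderiv i φ) x • v x ∂(volΩ a b) =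
      ∫ x, φ x • hess v i i x ∂(volΩ a b) := by
    intro i
    rw [integral_pderiv_smul hab Set.countable_empty i hv.1.continuousOn
      (fun x hx _ => hasDerivAt_cgrad hv.1 hx i) (memLp_cgrad hab hv i)
      (isTestFunction_pderiv hφ i),
      integral_pderiv_smul hab hS i (continuousOn_cgrad hab hv.1 i)
      (fun x hx hxS => hasDerivAt_hess hv hx hxS i i) (memLp_hess hS hv i i) hφ, neg_neg]
  simp only [clap, Finset.sum_smul, Finset.smul_sum]
  rw [integral_finsetSum, integral_finsetSum]
  · exact Finset.sum_congr rfl fun i _ => h1 i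
  · intro i _
    have : MemLp (fun x => φ x • hess v i i x) ⊤ (volΩ a b) :=
      (memLp_hess hS hv i i).smul (r := ⊤) (memLp_top_volΩ hφ.1.continuous.continuousOn)
    exact this.integrable le_top
  · intro i _
    exact (memLp_top_volΩ (((isTestFunction_pderiv (isTestFunction_pderiv hφ i) i).1.continuous
      ).continuousOn.smul hv.1.continuousOn)).integrable le_top

theorem wlap_ae_eq_clap (hab : ∀ i, a i < b i) (hS : S.Countable) (hv : v ∈ gridC2 a b S) :
    wlap a b v =ᵐ[volΩ a b] clap v := wlap_ae_eq (isWeakLaplacian_clap hab hS hv)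

/-! ### Traces -/

/-- The constant in the trace inequality. -/
def traceConst (a b : Fin (n + 1) → ℝ) : ℝ := ∑ i, (2 * (b i - a i)⁻¹ + 2)

theorem traceConst_nonneg (hab : ∀ i, a i < b i) : 0 ≤ traceConst a b :=
  Finset.sum_nonneg fun i _ => by have := sub_pos.2 (hab i); positivity

/-- The trace inequality for functions in `C¹(Ω̄)`. -/
theorem sqNorm_surf_le (hab : ∀ i, a i < b i) (hv : ContDiffOn ℝ 1 v (Set.Icc a b)) :
    sqNorm (surf a b) v ≤ traceConst a b *
      (sqNorm (volΩ a b) v + ∑ i, sqNorm (volΩ a b) (cgrad a b v i)) := by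
  have hv2 : MemLp v 2 (surf a b) := (memLp_top_surf hab hv.continuousOn).mono_exponent le_top
  rw [sqNorm, integral_surf (integrable_norm_sq hv2), traceConst, Finset.sum_mul]
  refine Finset.sum_le_sum fun i _ => ?_
  refine (face_trace_le hab i Set.countable_empty hv.continuousOn
    (fun x hx _ => hasDerivAt_cgrad hv hx i) (memLp_top_volΩ (continuousOn_cgrad hab hv i))).trans ?_
  have hl := inv_pos.2 (sub_pos.2 (hab i))
  set A := sqNorm (volΩ a b) v with hA
  have hA0 : 0 ≤ A := sqNorm_nonneg _ _
  have hB0 : ∀ i, 0 ≤ sqNorm (volΩ a b) (cgrad a b v i) := fun i => sqNorm_nonneg _ _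
  have h1 := Finset.single_le_sum (fun i _ => hB0 i) (Finset.mem_univ i)
  set B := sqNorm (volΩ a b) (cgrad a b v i)
  set T := ∑ i, sqNorm (volΩ a b) (cgrad a b v i)
  have h2 : 2 * (√A * √B) ≤ A + B := by
    nlinarith [sq_nonneg (√A - √B), Real.sq_sqrt hA0, Real.sq_sqrt (hB0 i)]
  have h3 : 0 ≤ (b i - a i)⁻¹ * T := mul_nonneg hl.le (le_trans (hB0 i) h1)
  nlinarith

theorem cgrad_sub (hab : ∀ i, a i < b i)
    (hu : ContDiffOn ℝ 1 u (Set.Icc a b)) (hv : ContDiffOn ℝ 1 v (Set.Icc a b))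
    {x : Fin (n + 1) → ℝ} (hx : x ∈ Set.Icc a b) (i : Fin (n + 1)) :
    cgrad a b (u - v) i x = cgrad a b u i x - cgrad a b v i x := by
  rw [cgrad, fderivWithin_sub (uniqueDiffOn_box hab x hx)
    (hu.differentiableOn one_ne_zero x hx) (hv.differentiableOn one_ne_zero x hx)]
  rfl

/-- Approximation in `H¹` by functions in `C¹(Ω̄)` determines the limit on the boundary. -/
theorem trace_unique (hab : ∀ i, a i < b i) {t t' : (Fin (n + 1) → ℝ) → ℂ}
    {G : Fin (n + 1) → (Fin (n + 1) → ℝ) → ℂ} {ψ ψ' : ℕ → (Fin (n + 1) → ℝ) → ℂ}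
    (hw : MemLp w 2 (volΩ a b)) (hG : ∀ i, MemLp (G i) 2 (volΩ a b))
    (ht : MemLp t 2 (surf a b)) (ht' : MemLp t' 2 (surf a b))
    (hψ : ∀ m, ContDiffOn ℝ 1 (ψ m) (Set.Icc a b)) (hψ' : ∀ m, ContDiffOn ℝ 1 (ψ' m) (Set.Icc a b))
    (h0 : Tendsto (fun m => sqNorm (volΩ a b) (ψ m - w)) atTop (𝓝 0))
    (h0' : Tendsto (fun m => sqNorm (volΩ a b) (ψ' m - w)) atTop (𝓝 0))
    (h1 : ∀ i, Tendsto (fun m => sqNorm (volΩ a b) (cgrad a b (ψ m) i - G i)) atTop (𝓝 0))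
    (h1' : ∀ i, Tendsto (fun m => sqNorm (volΩ a b) (cgrad a b (ψ' m) i - G i)) atTop (𝓝 0))
    (h2 : Tendsto (fun m => sqNorm (surf a b) (ψ m - t)) atTop (𝓝 0))
    (h2' : Tendsto (fun m => sqNorm (surf a b) (ψ' m - t')) atTop (𝓝 0)) :
    t =ᵐ[surf a b] t' := by
  have m0 : ∀ m, MemLp (ψ m) 2 (volΩ a b) := fun m =>
    (memLp_top_volΩ (hψ m).continuousOn).mono_exponent le_top
  have m0' : ∀ m, MemLp (ψ' m) 2 (volΩ a b) := fun m =>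
    (memLp_top_volΩ (hψ' m).continuousOn).mono_exponent le_top
  have m1 : ∀ m i, MemLp (cgrad a b (ψ m) i) 2 (volΩ a b) := fun m i =>
    (memLp_top_volΩ (continuousOn_cgrad hab (hψ m) i)).mono_exponent le_top
  have m1' : ∀ m i, MemLp (cgrad a b (ψ' m) i) 2 (volΩ a b) := fun m i =>
    (memLp_top_volΩ (continuousOn_cgrad hab (hψ' m) i)).mono_exponent le_top
  have s0 : ∀ m, MemLp (ψ m) 2 (surf a b) := fun m =>
    (memLp_top_surf hab (hψ m).continuousOn).mono_exponent le_top
  have s0' : ∀ m, MemLp (ψ' m) 2 (surf a b) := fun m =>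
    (memLp_top_surf hab (hψ' m).continuousOn).mono_exponent le_top
  -- Bound for the squared distance of `t` and `t'`: pass from `t'` to `ψ' m` to `ψ m` to `t`. The
  -- middle step uses the trace inequality and the common limits `w` and `G` in the interior.
  set Z : ℕ → ℝ := fun m => 2 * (2 * sqNorm (surf a b) (ψ' m - t') + 2 * (traceConst a b *
    ((2 * sqNorm (volΩ a b) (ψ m - w) + 2 * sqNorm (volΩ a b) (ψ' m - w)) +
      ∑ i, (2 * sqNorm (volΩ a b) (cgrad a b (ψ m) i - G i) +
        2 * sqNorm (volΩ a b) (cgrad a b (ψ' m) i - G i))))) +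
    2 * sqNorm (surf a b) (ψ m - t) with hZ
  have hlim : Tendsto Z atTop (𝓝 0) := by
    have : Tendsto Z atTop (𝓝 (2 * (2 * 0 + 2 * (traceConst a b *
      ((2 * 0 + 2 * 0) + ∑ _i : Fin (n + 1), (2 * 0 + 2 * 0)))) + 2 * 0)) := by
      refine Tendsto.add (Tendsto.const_mul _ (Tendsto.add (h2'.const_mul _) (Tendsto.const_mul _
        (Tendsto.const_mul _ (Tendsto.add ((h0.const_mul _).add (h0'.const_mul _))
        (tendsto_finsetSum _ fun i _ => ((h1 i).const_mul _).add ((h1' i).const_mul _)))))))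
        (h2.const_mul _)
    simpa using this
  have hle : ∀ m, sqNorm (surf a b) (t' - t) ≤ Z m := by
    intro m
    have e2 : t' - t = -(ψ' m - t') + (ψ' m - ψ m) + (ψ m - t) := by abel
    have b0 : sqNorm (volΩ a b) (ψ' m - ψ m) ≤
        2 * sqNorm (volΩ a b) (ψ m - w) + 2 * sqNorm (volΩ a b) (ψ' m - w) := by
      have := sqNorm_sub_le ((m0' m).sub hw) ((m0 m).sub hw)
      rw [sub_sub_sub_cancel_right] at this
      linarith
    have b1 : ∀ i, sqNorm (volΩ a b) (cgrad a b (ψ' m - ψ m) i) ≤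
        2 * sqNorm (volΩ a b) (cgrad a b (ψ m) i - G i) +
          2 * sqNorm (volΩ a b) (cgrad a b (ψ' m) i - G i) := by
      intro i
      have := sqNorm_sub_le ((m1' m i).sub (hG i)) ((m1 m i).sub (hG i))
      rw [sub_sub_sub_cancel_right] at this
      rw [sqNorm_congr (g := cgrad a b (ψ' m) i - cgrad a b (ψ m) i)]
      · linarith
      · filter_upwards [ae_openBox Set.countable_empty] with x hx
        exact cgrad_sub hab (hψ' m) (hψ m) (openBox_subset_Icc hx.1) i
    have b2 : sqNorm (surf a b) (ψ' m - ψ m) ≤ traceConst a b *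
        ((2 * sqNorm (volΩ a b) (ψ m - w) + 2 * sqNorm (volΩ a b) (ψ' m - w)) +
        ∑ i, (2 * sqNorm (volΩ a b) (cgrad a b (ψ m) i - G i) +
        2 * sqNorm (volΩ a b) (cgrad a b (ψ' m) i - G i))) :=
      (sqNorm_surf_le hab ((hψ' m).sub (hψ m))).trans
        (mul_le_mul_of_nonneg_left (add_le_add b0 (Finset.sum_le_sum fun i _ => b1 i))
          (traceConst_nonneg hab))
    have c1 := sqNorm_add_le (((s0' m).sub ht').neg.add ((s0' m).sub (s0 m))) ((s0 m).sub ht)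
    have c2 := sqNorm_add_le (((s0' m).sub ht').neg) ((s0' m).sub (s0 m))
    have c3 : sqNorm (surf a b) (-(ψ' m - t')) = sqNorm (surf a b) (ψ' m - t') := by
      simp only [sqNorm, Pi.neg_apply, norm_neg]
    rw [← e2] at c1
    simp only [hZ]
    linarith
  have h3 : sqNorm (surf a b) (t' - t) = 0 :=
    le_antisymm (ge_of_tendsto' hlim hle) (sqNorm_nonneg _ _)
  filter_upwards [ae_eq_zero_of_sqNorm (ht'.sub ht) h3] with x hx
  exact (sub_eq_zero.1 hx).symm

end Box

section Box

variable {n : ℕ} {a b : Fin (n + 1) → ℝ} {S : Set ℝ} {u v w : (Fin (n + 1) → ℝ) → ℂ}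

theorem MemLp.two_vol {F : (Fin (n + 1) → ℝ) → ℂ} (hF : ContinuousOn F (Set.Icc a b)) :
    MemLp F 2 (volΩ a b) := (memLp_top_volΩ hF).mono_exponent le_top

theorem MemLp.two_surf (hab : ∀ i, a i < b i) {F : (Fin (n + 1) → ℝ) → ℂ}
    (hF : ContinuousOn F (Set.Icc a b)) : MemLp F 2 (surf a b) :=
  (memLp_top_surf hab hF).mono_exponent le_top

/-- Two traces of the same function coincide almost everywhere. -/
theorem IsTrace.ae_eq (hab : ∀ i, a i < b i) {t t' : (Fin (n + 1) → ℝ) → ℂ}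
    (hw : MemLp w 2 (volΩ a b)) (hG : ∀ i, MemLp (wgrad a b w i) 2 (volΩ a b))
    (h : IsTrace a b w t) (h' : IsTrace a b w t') : t =ᵐ[surf a b] t' := by
  obtain ⟨ht, ψ, hψ, h0, h1, h2⟩ := h
  obtain ⟨ht', ψ', hψ', h0', h1', h2'⟩ := h'
  refine trace_unique hab (G := wgrad a b w) hw hG ht ht' hψ hψ'
    ((tendsto_sqNorm_iff fun m => (MemLp.two_vol (hψ m).continuousOn).sub hw).1 h0)
    ((tendsto_sqNorm_iff fun m => (MemLp.two_vol (hψ' m).continuousOn).sub hw).1 h0')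
    (fun i => (tendsto_sqNorm_iff fun m =>
      (MemLp.two_vol (continuousOn_cgrad hab (hψ m) i)).sub (hG i)).1 (h1 i))
    (fun i => (tendsto_sqNorm_iff fun m =>
      (MemLp.two_vol (continuousOn_cgrad hab (hψ' m) i)).sub (hG i)).1 (h1' i))
    ((tendsto_sqNorm_iff fun m => (MemLp.two_surf hab (hψ m).continuousOn).sub ht).1 h2)
    ((tendsto_sqNorm_iff fun m => (MemLp.two_surf hab (hψ' m).continuousOn).sub ht').1 h2')

theorem trace_ae_eq_of_isTrace (hab : ∀ i, a i < b i) {t : (Fin (n + 1) → ℝ) → ℂ}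
    (hw : MemLp w 2 (volΩ a b)) (hG : ∀ i, MemLp (wgrad a b w i) 2 (volΩ a b))
    (h : IsTrace a b w t) : trace a b w =ᵐ[surf a b] t :=
  IsTrace.ae_eq hab hw hG (Classical.epsilon_spec ⟨t, h⟩) h

theorem trace_ae_eq (hab : ∀ i, a i < b i) (hv : ContDiffOn ℝ 1 v (Set.Icc a b)) :
    trace a b v =ᵐ[surf a b] v := by
  have hg := wgrad_ae_eq hab hv
  have hG : ∀ i, MemLp (wgrad a b v i) 2 (volΩ a b) := fun i =>
    (memLp_congr_ae (hg i)).2 (MemLp.two_vol (continuousOn_cgrad hab hv i))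
  refine trace_ae_eq_of_isTrace hab (MemLp.two_vol hv.continuousOn) hG
    ⟨MemLp.two_surf hab hv.continuousOn, fun _ => v, fun _ => hv, by simp, fun i => ?_, by simp⟩
  have : eLpNorm (cgrad a b v i - wgrad a b v i) 2 (volΩ a b) = 0 := by
    have h0 : cgrad a b v i - wgrad a b v i =ᵐ[volΩ a b] 0 := by
      filter_upwards [hg i] with x hx
      simp [hx]
    rw [eLpNorm_congr_ae h0]
    simp
  simp [this]

/-! ### Normal derivatives -/

/-- The volume side of Green's identity does not contain `q`, so `q` and `q'` have equal boundary
integrals against smooth functions. These determine an integrable function up to null sets of the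
surface measure. -/
theorem IsNormalDeriv.ae_eq {q q' : (Fin (n + 1) → ℝ) → ℂ}
    (h : IsNormalDeriv a b w q) (h' : IsNormalDeriv a b w q') : q =ᵐ[surf a b] q' := by
  refine ae_eq_of_integral_contDiff_smul_eq (h.1.integrable (by norm_num)).locallyIntegrable
    (h'.1.integrable (by norm_num)).locallyIntegrable fun g hg _ => ?_
  have hc : ContDiffOn ℝ 1 (fun x => (g x : ℂ)) (Set.Icc a b) :=
    (Complex.ofRealCLM.contDiff.comp (hg.of_le (by exact_mod_cast le_top))).contDiffOn
  have e := (h.2 _ hc).trans (h'.2 _ hc).symm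
  simpa [Complex.real_smul, mul_comm] using e

theorem normalDeriv_ae_eq_of_isNormalDeriv {q : (Fin (n + 1) → ℝ) → ℂ}
    (h : IsNormalDeriv a b w q) : normalDeriv a b w =ᵐ[surf a b] q :=
  IsNormalDeriv.ae_eq (Classical.epsilon_spec ⟨q, h⟩) h

/-- Green's identity for piecewise smooth functions. -/
theorem integral_cnormalDeriv_mul (hab : ∀ i, a i < b i) (hS : S.Countable)
    (hv : v ∈ gridC2 a b S) {ψ : (Fin (n + 1) → ℝ) → ℂ} (hψ : ContDiffOn ℝ 1 ψ (Set.Icc a b)) :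
    ∫ x, cnormalDeriv a b v x * ψ x ∂(surf a b) =
      ∫ x, ((∑ i, cgrad a b v i x * cgrad a b ψ i x) + clap v x * ψ x) ∂(volΩ a b) := by
  have hψ0 := memLp_top_volΩ hψ.continuousOn
  have h := integral_divergence hab hS (F := fun i x => cgrad a b v i x * ψ x)
    (DF := fun i x => hess v i i x * ψ x + cgrad a b v i x * cgrad a b ψ i x)
    (fun i => (continuousOn_cgrad hab hv.1 i).mul hψ.continuousOn)
    (fun i x hx hxS => by
      have := (hasDerivAt_hess hv hx hxS i i).mul (hasDerivAt_cgrad hψ hx i)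
      simp only [Function.update_eq_self] at this
      exact this)
    (fun i => ((memLp_mul_top (memLp_hess hS hv i i) hψ0).add
      (memLp_mul_top (memLp_cgrad hab hv i)
        (memLp_top_volΩ (continuousOn_cgrad hab hψ i)))).integrable le_top)
  have e1 : ∀ x, cnormalDeriv a b v x * ψ x =
      ∑ i, (normal a b x i : ℂ) * (cgrad a b v i x * ψ x) := fun x => by
    rw [cnormalDeriv, Finset.sum_mul]
    exact Finset.sum_congr rfl fun i _ => by ring
  have e2 : ∀ x, (∑ i, cgrad a b v i x * cgrad a b ψ i x) + clap v x * ψ x =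
      ∑ i, (hess v i i x * ψ x + cgrad a b v i x * cgrad a b ψ i x) := fun x => by
    rw [Finset.sum_add_distrib, clap, Finset.sum_mul, add_comm]
  simp only [e1, e2]
  exact h.symm

theorem isNormalDeriv_cnormalDeriv (hab : ∀ i, a i < b i) (hS : S.Countable)
    (hv : v ∈ gridC2 a b S) : IsNormalDeriv a b v (cnormalDeriv a b v) := by
  refine ⟨(memLp_cnormalDeriv hab hv).mono_exponent le_top, fun ψ hψ => ?_⟩
  rw [integral_cnormalDeriv_mul hab hS hv hψ]
  apply integral_congr_ae
  have hg : ∀ᵐ x ∂(volΩ a b), ∀ i, wgrad a b v i x = cgrad a b v i x :=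
    ae_all_iff.2 fun i => wgrad_ae_eq hab hv.1 i
  filter_upwards [hg, wlap_ae_eq_clap hab hS hv] with x hx hx2
  simp only [hx, hx2]

theorem normalDeriv_ae_eq (hab : ∀ i, a i < b i) (hS : S.Countable)
    (hv : v ∈ gridC2 a b S) : normalDeriv a b v =ᵐ[surf a b] cnormalDeriv a b v :=
  normalDeriv_ae_eq_of_isNormalDeriv (isNormalDeriv_cnormalDeriv hab hS hv)

/-! ### Surface gradients -/

theorem hasDerivAt_cgrad_of_mem_Icc (hv : ContDiffOn ℝ 1 v (Set.Icc a b)) {x : Fin (n + 1) → ℝ}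
    (hx : x ∈ Set.Icc a b) (j : Fin (n + 1)) (hj : x j ∈ Set.Ioo (a j) (b j)) :
    HasDerivAt (fun t => v (Function.update x j t)) (cgrad a b v j x) (x j) := by
  have h1 : HasFDerivWithinAt v (fderivWithin ℝ v (Set.Icc a b) x) (Set.Icc a b)
      (Function.update x j (x j)) := by
    rw [Function.update_eq_self]
    exact (hv.differentiableOn one_ne_zero x hx).hasFDerivWithinAt
  have h2 : HasDerivWithinAt (Function.update x j) (Pi.single j 1) (Set.Ioo (a j) (b j)) (x j) :=
    (hasDerivAt_update x j (x j)).hasDerivWithinAt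
  have h3 := h1.comp_hasDerivWithinAt (x j) h2 fun t ht => by
    rw [← Set.pi_univ_Icc]
    intro i _
    by_cases hi : i = j
    · subst hi
      simpa using Set.Ioo_subset_Icc_self ht
    · simpa [hi] using ⟨hx.1 i, hx.2 i⟩
  exact h3.hasDerivAt (isOpen_Ioo.mem_nhds hj)

theorem csurfGrad_eq_of_normal {x : Fin (n + 1) → ℝ} {i : Fin (n + 1)} {s : ℝ} (hs : s ^ 2 = 1)
    (hx : normal a b x = Pi.single i s) (v : (Fin (n + 1) → ℝ) → ℂ) (j : Fin (n + 1)) :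
    csurfGrad a b v j x = if j = i then 0 else cgrad a b v j x := by
  have hs' : (s : ℂ) * s = 1 := by rw [← sq]; exact_mod_cast hs
  have h1 : ∑ l, (normal a b x l : ℂ) * cgrad a b v l x = s * cgrad a b v i x := by
    rw [Finset.sum_eq_single i]
    · simp [hx]
    · intro l _ hl; simp [hx, hl]
    · simp
  rw [csurfGrad, h1]
  split_ifs with h
  · subst h
    rw [hx, Pi.single_eq_same, ← mul_assoc, hs', one_mul, sub_self]
  · simp [hx, h]

theorem sqNorm_faceMeasure_le {f : (Fin (n + 1) → ℝ) → ℂ} (hf : MemLp f 2 (surf a b))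
    {μ : Measure (Fin (n + 1) → ℝ)} (hμ : μ ≤ surf a b) : sqNorm μ f ≤ sqNorm (surf a b) f :=
  integral_mono_measure hμ (ae_of_all _ fun _ => sq_nonneg _) (integrable_norm_sq hf)

theorem insertNth_update_comm (i : Fin (n + 2)) (c : ℝ) (y : Fin (n + 1) → ℝ) (j : Fin (n + 1))
    (t : ℝ) : i.insertNth (α := fun _ => ℝ) c (Function.update y j t) =
      Function.update (i.insertNth (α := fun _ => ℝ) c y) (i.succAbove j) t := by
  ext l
  refine Fin.succAboveCases i ?_ (fun l => ?_) l
  · simp [(Fin.succAbove_ne i j).symm]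
  · by_cases h : l = j
    · subst h; simp
    · simp [h]

/-- The tangential derivative on a face is a closable operator. -/
theorem face_closable (hab : ∀ i, a i < b i) {i : Fin (n + 1)} {c : ℝ}
    (hc : c ∈ Set.Icc (a i) (b i)) {χ : ℕ → (Fin (n + 1) → ℝ) → ℂ} {σ : (Fin (n + 1) → ℝ) → ℂ}
    {j : Fin (n + 1)} (hj : j ≠ i) (hχ : ∀ m, ContDiffOn ℝ 1 (χ m) (Set.Icc a b))
    (hσ : MemLp σ 2 (faceMeasure a b i c))
    (h0 : Tendsto (fun m => sqNorm (faceMeasure a b i c) (χ m)) atTop (𝓝 0))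
    (h1 : Tendsto (fun m => sqNorm (faceMeasure a b i c) (cgrad a b (χ m) j - σ)) atTop (𝓝 0)) :
    ∀ᵐ x ∂(faceMeasure a b i c), σ x = 0 := by
  obtain ⟨j', rfl⟩ := Fin.exists_succAbove_eq hj
  -- If `n = 0`, a face is a point and has no tangential direction.
  rcases n with _ | n
  · exact j'.elim0
  rw [ae_faceMeasure_iff]
  set ι : (Fin (n + 1) → ℝ) → (Fin (n + 2) → ℝ) := fun y => i.insertNth (α := fun _ => ℝ) c y with hι
  set a' : Fin (n + 1) → ℝ := fun j => a (i.succAbove j) with ha'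
  set b' : Fin (n + 1) → ℝ := fun j => b (i.succAbove j) with hb'
  have hab' : ∀ j, a' j < b' j := fun j => hab _
  have hfv : faceVol a b i = volΩ a' b' := by rw [volΩ_eq_Icc]; rfl
  have hfm : faceMeasure a b i c = Measure.map ι (volΩ a' b') := by rw [← hfv]; rfl
  have hme : MeasurableEmbedding ι := measurableEmbedding_insertNth i c
  have hsq : ∀ f : (Fin (n + 2) → ℝ) → ℂ,
      sqNorm (faceMeasure a b i c) f = sqNorm (volΩ a' b') (f ∘ ι) := by
    intro f
    rw [sqNorm, hfm, hme.integral_map]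
    rfl
  simp only [hsq] at h0 h1
  rw [hfm] at hσ
  have hσ' : MemLp (σ ∘ ι) 2 (volΩ a' b') := (hme.memLp_map_measure_iff).1 hσ
  rw [hfv]
  have hcont : ∀ m, ContinuousOn (χ m ∘ ι) (Set.Icc a' b') := fun m =>
    continuousOn_insertNth (hχ m).continuousOn hc
  have hcontD : ∀ m, ContinuousOn (cgrad a b (χ m) (i.succAbove j') ∘ ι) (Set.Icc a' b') := fun m =>
    continuousOn_insertNth (continuousOn_cgrad hab (hχ m) _) hc
  have hz : (σ ∘ ι) =ᵐ[volΩ a' b'] 0 := by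
    -- Integrate by parts against a test function on the face and pass to the limit: the derivatives
    -- of `χ m` converge to `σ` while `χ m` converges to `0`, so `σ` is the weak derivative of `0`.
    refine ae_eq_of_test hσ' MemLp.zero fun φ hφ => ?_
    have hpart : ∀ m, ∫ y, pderiv j' φ y • (χ m ∘ ι) y ∂(volΩ a' b') =
        -∫ y, φ y • (cgrad a b (χ m) (i.succAbove j') ∘ ι) y ∂(volΩ a' b') := by
      intro m
      refine integral_pderiv_smul hab' Set.countable_empty j' (hcont m) (fun y hy _ => ?_)
        (memLp_top_volΩ (hcontD m)) hφ
      have hy' : ι y ∈ Set.Icc a b := insertNth_mem_Icc hc fun j => hy j trivial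
      have := hasDerivAt_cgrad_of_mem_Icc (hχ m) hy' (i.succAbove j')
        (by simpa [hι] using hy j' trivial)
      simp only [hι, Fin.insertNth_apply_succAbove, ← insertNth_update_comm] at this
      exact this
    have t1 : Tendsto (fun m => ∫ y, (φ y : ℂ) *
        (cgrad a b (χ m) (i.succAbove j') ∘ ι) y ∂(volΩ a' b')) atTop
        (𝓝 (∫ y, (φ y : ℂ) * (σ ∘ ι) y ∂(volΩ a' b'))) :=
      tendsto_integral_mul (fun m => MemLp.two_vol (hcontD m)) hσ'
        (MemLp.two_vol (Complex.continuous_ofReal.comp hφ.1.continuous).continuousOn) h1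
    have t2 : Tendsto (fun m => ∫ y, (pderiv j' φ y : ℂ) * (χ m ∘ ι) y ∂(volΩ a' b')) atTop
        (𝓝 (∫ y, (pderiv j' φ y : ℂ) * (0 : (Fin (n + 1) → ℝ) → ℂ) y ∂(volΩ a' b'))) :=
      tendsto_integral_mul (fun m => MemLp.two_vol (hcont m)) MemLp.zero
        (MemLp.two_vol (Complex.continuous_ofReal.comp
          (isTestFunction_pderiv hφ j').1.continuous).continuousOn) (by simpa using h0)
    simp only [← Complex.real_smul, hpart] at t1 t2
    have t3 := tendsto_nhds_unique t1.neg t2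
    simp only [Pi.zero_apply, smul_zero, integral_zero, neg_eq_zero] at t3 ⊢
    exact t3
  filter_upwards [hz] with y hy
  exact hy

/-- The differences of two approximating sequences converge to `0` on `Γ`, and their surface
gradients converge to `τ - τ'`. On each face the normal component vanishes for every member of the
sequence, hence in the limit; the tangential components vanish by closability. -/
theorem IsSurfGrad.ae_eq (hab : ∀ i, a i < b i) {τ τ' : Fin (n + 1) → (Fin (n + 1) → ℝ) → ℂ}
    (ht : MemLp (trace a b w) 2 (surf a b))
    (h : IsSurfGrad a b w τ) (h' : IsSurfGrad a b w τ') (j : Fin (n + 1)) :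
    τ j =ᵐ[surf a b] τ' j := by
  obtain ⟨hτ, ψ, hψ, h0, h1⟩ := h
  obtain ⟨hτ', ψ', hψ', h0', h1'⟩ := h'
  have mem : ∀ {v : (Fin (n + 1) → ℝ) → ℂ}, ContDiffOn ℝ 1 v (Set.Icc a b) → ∀ j,
      MemLp (csurfGrad a b v j) 2 (surf a b) := by
    intro v hv j
    refine MemLp.mono_exponent (q := ⊤) ?_ le_top
    exact (memLp_top_surf hab (continuousOn_cgrad hab hv j)).sub
      (memLp_mul_top (memLp_normal hab j) (memLp_finsetSum _ fun i _ =>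
        memLp_mul_top (memLp_normal hab i) (memLp_top_surf hab (continuousOn_cgrad hab hv i))))
  have s0 := (tendsto_sqNorm_iff fun m => (MemLp.two_surf hab (hψ m).continuousOn).sub ht).1 h0
  have s0' := (tendsto_sqNorm_iff fun m => (MemLp.two_surf hab (hψ' m).continuousOn).sub ht).1 h0'
  have s1 := (tendsto_sqNorm_iff fun m => (mem (hψ m) j).sub (hτ j)).1 (h1 j)
  have s1' := (tendsto_sqNorm_iff fun m => (mem (hψ' m) j).sub (hτ' j)).1 (h1' j)
  set χ : ℕ → (Fin (n + 1) → ℝ) → ℂ := fun m => ψ m - ψ' m with hχ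
  have hχc : ∀ m, ContDiffOn ℝ 1 (χ m) (Set.Icc a b) := fun m => (hψ m).sub (hψ' m)
  have d0 : Tendsto (fun m => sqNorm (surf a b) (χ m)) atTop (𝓝 0) := by
    have hl := (s0.const_mul 2).add (s0'.const_mul 2)
    simp only [mul_zero, add_zero] at hl
    refine squeeze_zero (fun m => sqNorm_nonneg _ _) (fun m => ?_) hl
    have := sqNorm_sub_le ((MemLp.two_surf hab (hψ m).continuousOn).sub ht)
      ((MemLp.two_surf hab (hψ' m).continuousOn).sub ht)
    rwa [sub_sub_sub_cancel_right] at this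
  have d1 : Tendsto (fun m => sqNorm (surf a b) (csurfGrad a b (χ m) j - (τ j - τ' j))) atTop
      (𝓝 0) := by
    have hl := (s1.const_mul 2).add (s1'.const_mul 2)
    simp only [mul_zero, add_zero] at hl
    refine squeeze_zero (fun m => sqNorm_nonneg _ _) (fun m => ?_) hl
    have := sqNorm_sub_le ((mem (hψ m) j).sub (hτ j)) ((mem (hψ' m) j).sub (hτ' j))
    refine le_trans (le_of_eq (sqNorm_congr ?_)) this
    refine ae_surf_of_Icc hab fun x hx => ?_
    simp only [csurfGrad, Pi.sub_apply, hχ, cgrad_sub hab (hψ m) (hψ' m) hx, mul_sub,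
      Finset.sum_sub_distrib]
    ring
  have mχ : ∀ m, MemLp (csurfGrad a b (χ m) j - (τ j - τ' j)) 2 (surf a b) := fun m =>
    (mem (hχc m) j).sub ((hτ j).sub (hτ' j))
  have key : ∀ (i : Fin (n + 1)) (c s : ℝ), s ^ 2 = 1 → c ∈ Set.Icc (a i) (b i) →
      faceMeasure a b i c ≤ surf a b →
      (∀ᵐ x ∂(faceMeasure a b i c), normal a b x = Pi.single i s) →
      ∀ᵐ x ∂(faceMeasure a b i c), τ j x = τ' j x := by
    intro i c s hs hc hle hnormal
    have f0 : Tendsto (fun m => sqNorm (faceMeasure a b i c) (χ m)) atTop (𝓝 0) :=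
      squeeze_zero (fun m => sqNorm_nonneg _ _)
        (fun m => sqNorm_faceMeasure_le (MemLp.two_surf hab (hχc m).continuousOn) hle) d0
    have f1 : Tendsto (fun m => sqNorm (faceMeasure a b i c)
        (csurfGrad a b (χ m) j - (τ j - τ' j))) atTop (𝓝 0) :=
      squeeze_zero (fun m => sqNorm_nonneg _ _)
        (fun m => sqNorm_faceMeasure_le (mχ m) hle) d1
    have hσ : MemLp (τ j - τ' j) 2 (faceMeasure a b i c) :=
      ((hτ j).sub (hτ' j)).mono_measure hle
    have hz : ∀ᵐ x ∂(faceMeasure a b i c), (τ j - τ' j) x = 0 := by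
      by_cases hj : j = i
      · have e : ∀ m, sqNorm (faceMeasure a b i c) (csurfGrad a b (χ m) j - (τ j - τ' j)) =
            sqNorm (faceMeasure a b i c) (τ j - τ' j) := by
          intro m
          apply integral_congr_ae
          filter_upwards [hnormal] with x hx
          have := csurfGrad_eq_of_normal hs hx (χ m) j
          rw [if_pos hj] at this
          simp only [Pi.sub_apply, this, zero_sub, norm_neg]
        simp only [e] at f1
        exact ae_eq_zero_of_sqNorm hσ (tendsto_nhds_unique tendsto_const_nhds f1)
      · have e : ∀ m, sqNorm (faceMeasure a b i c) (csurfGrad a b (χ m) j - (τ j - τ' j)) =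
            sqNorm (faceMeasure a b i c) (cgrad a b (χ m) j - (τ j - τ' j)) := by
          intro m
          apply sqNorm_congr
          filter_upwards [hnormal] with x hx
          have := csurfGrad_eq_of_normal hs hx (χ m) j
          rw [if_neg hj] at this
          simp only [Pi.sub_apply, this]
        simp only [e] at f1
        exact face_closable hab hc hj hχc hσ f0 f1
    filter_upwards [hz] with x hx
    exact sub_eq_zero.1 hx
  refine (ae_surf_iff _).2 fun i => ⟨?_, ?_⟩
  · refine key i (a i) (-1) (by norm_num) (Set.left_mem_Icc.2 (hab i).le)
      (faceMeasure_le_surf i).1 ?_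
    filter_upwards [ae_normal_lowerFace hab i] with x hx using hx.2.1
  · refine key i (b i) 1 (by norm_num) (Set.right_mem_Icc.2 (hab i).le)
      (faceMeasure_le_surf i).2 ?_
    filter_upwards [ae_normal_upperFace hab i] with x hx using hx.2.1

theorem surfGrad_ae_eq (hab : ∀ i, a i < b i) (hv : v ∈ gridC2 a b S) (j : Fin (n + 1)) :
    surfGrad a b v j =ᵐ[surf a b] csurfGrad a b v j := by
  have ht := trace_ae_eq hab hv.1
  have htm : MemLp (trace a b v) 2 (surf a b) :=
    (memLp_congr_ae ht).2 (MemLp.two_surf hab hv.1.continuousOn)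
  have h : IsSurfGrad a b v (csurfGrad a b v) := by
    refine ⟨fun j => (memLp_csurfGrad hab hv j).mono_exponent le_top, fun _ => v, fun _ => hv.1, ?_,
      fun j => by simp⟩
    have h0 : v - trace a b v =ᵐ[surf a b] 0 := by
      filter_upwards [ht] with x hx
      simp [hx]
    have : eLpNorm (v - trace a b v) 2 (surf a b) = 0 := by
      rw [eLpNorm_congr_ae h0]; simp
    simp [this]
  exact IsSurfGrad.ae_eq hab htm (Classical.epsilon_spec ⟨_, h⟩) h j

/-! ### The weak forms of piecewise smooth functions -/

section Identification

variable (hab : ∀ i, a i < b i) (hS : S.Countable)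
include hab hS

theorem ae_weak_vol (hv : v ∈ gridC2 a b S) : ∀ᵐ x ∂(volΩ a b),
    (∀ i, wgrad a b v i x = cgrad a b v i x) ∧ wlap a b v x = clap v x := by
  filter_upwards [ae_all_iff.2 fun i => wgrad_ae_eq hab hv.1 i, wlap_ae_eq_clap hab hS hv]
    with x hx hx2 using ⟨hx, hx2⟩

theorem ae_weak_surf (hv : v ∈ gridC2 a b S) : ∀ᵐ x ∂(surf a b),
    trace a b v x = v x ∧ (∀ i, surfGrad a b v i x = csurfGrad a b v i x) ∧
      normalDeriv a b v x = cnormalDeriv a b v x := by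
  filter_upwards [trace_ae_eq hab hv.1, ae_all_iff.2 fun i => surfGrad_ae_eq hab hv i,
    normalDeriv_ae_eq hab hS hv] with x h1 h2 h3 using ⟨h1, h2, h3⟩

theorem formB_eq_cform (k β A : ℝ) (hu : u ∈ gridC2 a b S) (hv : v ∈ gridC2 a b S) :
    formB a b k β A u v = cform a b k β A u v := by
  rw [formB, cform]
  congr 1
  · apply integral_congr_ae
    filter_upwards [ae_weak_vol hab hS hu, ae_weak_vol hab hS hv] with x hx hx2
    simp only [formΩ, opM, opL, copM, copL, hx.1, hx.2, hx2.1, hx2.2]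
  · apply integral_congr_ae
    filter_upwards [ae_weak_surf hab hS hu, ae_weak_surf hab hS hv] with x hx hx2
    simp only [formΓ, opMbdry, opMtan, copMbdry, copMtan, hx.1, hx.2.1, hx2.1, hx2.2.1,
      hx2.2.2]

theorem rhsG_eq_crhs (k β A : ℝ) (f g : (Fin (n + 1) → ℝ) → ℂ) (hv : v ∈ gridC2 a b S) :
    rhsG a b k β A f g v = crhs a b k β A f g v := by
  rw [rhsG, crhs]
  congr 1
  · apply integral_congr_ae
    filter_upwards [ae_weak_vol hab hS hv] with x hx
    simp only [opM, opL, copM, copL, hx.1, hx.2]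
  · apply integral_congr_ae
    filter_upwards [ae_weak_surf hab hS hv] with x hx
    simp only [opMbdry, opMtan, copMbdry, copMtan, hx.1, hx.2.1, hx.2.2]

end Identification

end Box

/-! ### Partial derivatives of vector-valued functions -/

section PartialDerivatives

variable {d : ℕ} {E F : Type*} [NormedAddCommGroup E] [NormedSpace ℝ E]
  [NormedAddCommGroup F] [NormedSpace ℝ F]

/-- The partial derivative `∂_i φ` of a vector-valued function. -/
def pd (i : Fin d) (φ : (Fin d → ℝ) → E) : (Fin d → ℝ) → E :=
  fun x => fderiv ℝ φ x (Pi.single i 1)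

/-- The derivative `∂^α φ` of a vector-valued function. -/
def md (α : Fin d → ℕ) (φ : (Fin d → ℝ) → E) : (Fin d → ℝ) → E :=
  (List.finRange d).foldr (fun i ψ => (pd i)^[α i] ψ) φ

theorem mderiv_eq_md (α : Fin d → ℕ) (φ : (Fin d → ℝ) → ℝ) : mderiv α φ = md α φ := rfl

/-- Induction over the single derivatives of which `∂^α` is composed; the index of `P` counts them.
The rules for `md` (smoothness, affine substitution, convolution) follow from those for one partial
derivative. -/
theorem md_rel {P : ℕ → ((Fin d → ℝ) → E) → ((Fin d → ℝ) → F) → Prop}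
    (hP : ∀ i j f g, P j f g → P (j + 1) (pd i f) (pd i g)) (α : Fin d → ℕ)
    {f : (Fin d → ℝ) → E} {g : (Fin d → ℝ) → F} (h : P 0 f g) :
    P (∑ i, α i) (md α f) (md α g) := by
  rw [Fin.sum_univ_def, md, md]
  induction List.finRange d with
  | nil => exact h
  | cons i l ih =>
    simp only [List.foldr_cons, List.map_cons, List.sum_cons]
    generalize l.foldr (fun i ψ => (pd i)^[α i] ψ) f = f' at ih ⊢
    generalize l.foldr (fun i ψ => (pd i)^[α i] ψ) g = g' at ih ⊢
    induction α i with
    | zero => simpa using ih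
    | succ m ihm =>
      rw [Function.iterate_succ_apply', Function.iterate_succ_apply']
      have := hP i _ _ _ ihm
      rwa [show m + 1 + (l.map α).sum = m + (l.map α).sum + 1 by ring]

theorem contDiff_pd {φ : (Fin d → ℝ) → E} (h : ContDiff ℝ ∞ φ) (i : Fin d) :
    ContDiff ℝ ∞ (pd i φ) :=
  (h.fderiv_right (m := ∞) (by simp)).clm_apply contDiff_const

theorem contDiff_md {φ : (Fin d → ℝ) → E} (h : ContDiff ℝ ∞ φ) (α : Fin d → ℕ) :
    ContDiff ℝ ∞ (md α φ) :=
  md_rel (P := fun _ f (_ : (Fin d → ℝ) → E) => ContDiff ℝ ∞ f)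
    (fun i _ _ _ h => contDiff_pd h i) α (g := φ) h

theorem pd_const_smul {φ : (Fin d → ℝ) → E} (h : ContDiff ℝ ∞ φ) (i : Fin d) (c : ℝ) :
    pd i (fun x => c • φ x) = fun x => c • pd i φ x := by
  ext x
  rw [pd, fderiv_fun_const_smul (h.differentiable (by simp) x)]
  rfl

theorem pd_comp_affine {φ : (Fin d → ℝ) → E} (h : ContDiff ℝ ∞ φ) (i : Fin d)
    (z : Fin d → ℝ) (c : ℝ) :
    pd i (fun x => φ (z + c • x)) = fun x => c • pd i φ (z + c • x) := by
  ext x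
  have h1 : HasFDerivAt (fun x : Fin d → ℝ => z + c • x)
      (c • ContinuousLinearMap.id ℝ (Fin d → ℝ)) x :=
    ((hasFDerivAt_id x).const_smul c).const_add z
  have h2 := (h.differentiable (by simp) (z + c • x)).hasFDerivAt.comp x h1
  have h3 : pd i (fun x => φ (z + c • x)) x =
      ((fderiv ℝ φ (z + c • x)).comp (c • ContinuousLinearMap.id ℝ (Fin d → ℝ)))
        (Pi.single i 1) := by
    rw [pd]
    exact congrArg (fun L : (Fin d → ℝ) →L[ℝ] E => L (Pi.single i 1)) h2.fderiv
  rw [h3]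
  simp [pd]

theorem md_comp_affine {φ : (Fin d → ℝ) → E} (h : ContDiff ℝ ∞ φ) (α : Fin d → ℕ)
    (z : Fin d → ℝ) (c : ℝ) :
    md α (fun x => φ (z + c • x)) = fun x => c ^ (∑ i, α i) • md α φ (z + c • x) := by
  refine (md_rel (P := fun j f g => ContDiff ℝ ∞ g ∧ f = fun x => c ^ j • g (z + c • x)) ?_ α
    ⟨h, by simp⟩).2
  rintro i j f g ⟨hg, rfl⟩
  refine ⟨contDiff_pd hg i, ?_⟩
  have h1 : ContDiff ℝ ∞ fun x => g (z + c • x) :=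
    hg.comp (contDiff_const.add (contDiff_const_smul c))
  rw [pd_const_smul h1, pd_comp_affine hg]
  ext x
  rw [smul_smul, pow_succ]

open scoped Convolution in
theorem md_convolution {ρ : (Fin d → ℝ) → ℝ} (hρ : ContDiff ℝ ∞ ρ) (hc : HasCompactSupport ρ)
    {g : (Fin d → ℝ) → E} (hg : LocallyIntegrable g) [CompleteSpace E] (α : Fin d → ℕ) :
    md α (ρ ⋆[ContinuousLinearMap.lsmul ℝ ℝ] g) = (md α ρ ⋆[ContinuousLinearMap.lsmul ℝ ℝ] g) := by
  refine (md_rel (P := fun _ f q => ContDiff ℝ ∞ q ∧ HasCompactSupport q ∧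
    f = (q ⋆[ContinuousLinearMap.lsmul ℝ ℝ] g)) ?_ α ⟨hρ, hc, rfl⟩).2.2
  rintro i j f q ⟨hq, hqc, rfl⟩
  refine ⟨contDiff_pd hq i, hqc.fderiv_apply (𝕜 := ℝ) _, ?_⟩
  ext x
  have h1 := hqc.hasFDerivAt_convolution_left (ContinuousLinearMap.lsmul ℝ ℝ) (μ := volume)
    (hq.of_le (by simp)) hg x
  rw [pd, h1.fderiv]
  have hcf : HasCompactSupport (fderiv ℝ q) := hqc.fderiv (𝕜 := ℝ)
  have hce : ConvolutionExistsAt (fderiv ℝ q) g x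
      ((ContinuousLinearMap.lsmul ℝ ℝ : ℝ →L[ℝ] E →L[ℝ] E).precompL (Fin d → ℝ)) volume :=
    hcf.convolutionExists_left _ (hq.continuous_fderiv (by simp)) hg x
  rw [convolution, convolution, ContinuousLinearMap.integral_apply hce]
  rfl

end PartialDerivatives

/-! ### Density of smooth functions -/

section Density

variable {n : ℕ} {a b : Fin (n + 1) → ℝ}

/-- The convolution of `v`, extended by zero outside `Ω`, with a normalised bump function. -/
def mollify (a b : Fin (n + 1) → ℝ) (ρ : ContDiffBump (0 : Fin (n + 1) → ℝ))
    (v : (Fin (n + 1) → ℝ) → ℂ) (z : Fin (n + 1) → ℝ) : ℂ :=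
  ∫ y, ρ.normed volume (z - y) • v y ∂(volΩ a b)

open scoped Convolution in
theorem convolution_indicator_eq (q : (Fin (n + 1) → ℝ) → ℝ) (v : (Fin (n + 1) → ℝ) → ℂ) (z) :
    (q ⋆[ContinuousLinearMap.lsmul ℝ ℝ] (openBox a b).indicator v) z =
      ∫ y, q (z - y) • v y ∂(volΩ a b) := by
  rw [convolution_eq_swap, volΩ, ← integral_indicator isOpen_openBox.measurableSet]
  congr 1
  ext y
  by_cases hy : y ∈ openBox a b <;> simp [hy]

theorem locallyIntegrable_indicator {v : (Fin (n + 1) → ℝ) → ℂ} (hv : MemLp v 2 (volΩ a b)) :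
    LocallyIntegrable ((openBox a b).indicator v) := by
  have h : Integrable v (volΩ a b) := hv.integrable (by norm_num)
  exact ((integrable_indicator_iff isOpen_openBox.measurableSet).2 h).locallyIntegrable

open scoped Convolution in
theorem mollify_eq (ρ : ContDiffBump (0 : Fin (n + 1) → ℝ)) (v : (Fin (n + 1) → ℝ) → ℂ) :
    mollify a b ρ v =
      (ρ.normed volume ⋆[ContinuousLinearMap.lsmul ℝ ℝ] (openBox a b).indicator v) := by
  ext z
  rw [convolution_indicator_eq]
  rfl

theorem contDiff_mollify (ρ : ContDiffBump (0 : Fin (n + 1) → ℝ)) {v : (Fin (n + 1) → ℝ) → ℂ}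
    (hv : MemLp v 2 (volΩ a b)) : ContDiff ℝ ∞ (mollify a b ρ v) := by
  rw [mollify_eq]
  exact ρ.hasCompactSupport_normed.contDiff_convolution_left _ ρ.contDiff_normed
    (locallyIntegrable_indicator hv)

theorem integrable_normed_mul (ρ : ContDiffBump (0 : Fin (n + 1) → ℝ)) {F : (Fin (n + 1) → ℝ) → ℝ}
    (hF : Integrable F (volΩ a b)) (z : Fin (n + 1) → ℝ) :
    Integrable (fun y => ρ.normed volume (z - y) * F y) (volΩ a b) := by
  obtain ⟨M, hM⟩ := ρ.hasCompactSupport_normed (μ := volume) |>.exists_bound_of_continuous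
    ρ.continuous_normed
  exact hF.bdd_mul (c := M)
    ((ρ.continuous_normed.comp (continuous_const.sub continuous_id)).aestronglyMeasurable)
    (ae_of_all _ fun y => hM _)

/-- Jensen's inequality, obtained by expanding the weighted variance of `|v|` about its weighted
mean `m`. The part of the kernel that lies in `Ω` has mass at most `1`, which suffices for `m²` to
be below the weighted mean square. -/
theorem norm_mollify_sq_le (ρ : ContDiffBump (0 : Fin (n + 1) → ℝ)) {v : (Fin (n + 1) → ℝ) → ℂ}
    (hv : MemLp v 2 (volΩ a b)) (z : Fin (n + 1) → ℝ) :
    ‖mollify a b ρ v z‖ ^ 2 ≤ ∫ y, ρ.normed volume (z - y) * ‖v y‖ ^ 2 ∂(volΩ a b) := by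
  set m := ∫ y, ρ.normed volume (z - y) * ‖v y‖ ∂(volΩ a b) with hm
  have h0 : ∀ y, 0 ≤ ρ.normed volume (z - y) := fun y => ρ.nonneg_normed _
  have h1 : ‖mollify a b ρ v z‖ ≤ m := by
    refine (norm_integral_le_integral_norm _).trans (le_of_eq (integral_congr_ae
      (ae_of_all _ fun y => ?_)))
    change ‖ρ.normed volume (z - y) • v y‖ = _
    rw [norm_smul, Real.norm_of_nonneg (h0 y)]
  have i1 := integrable_normed_mul ρ (hv.integrable (by norm_num)).norm z
  have i2 := integrable_normed_mul ρ (integrable_norm_sq hv) z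
  have i3 := integrable_normed_mul ρ (integrable_const (μ := volΩ a b) (1 : ℝ)) z
  have h2 : ∫ y, ρ.normed volume (z - y) * 1 ∂(volΩ a b) ≤ 1 := by
    have i4 : Integrable fun y => ρ.normed volume (z - y) :=
      ρ.integrable_normed.comp_sub_left z
    have h3 : ∫ y, ρ.normed volume (z - y) = 1 := by
      rw [integral_sub_left_eq_self (fun y => ρ.normed volume y), ρ.integral_normed]
    simp only [mul_one]
    exact (setIntegral_le_integral i4 (ae_of_all _ h0)).trans_eq h3
  have h3 : 0 ≤ ∫ y, ρ.normed volume (z - y) * (‖v y‖ - m) ^ 2 ∂(volΩ a b) :=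
    integral_nonneg fun y => mul_nonneg (h0 y) (sq_nonneg _)
  have h4 : ∫ y, ρ.normed volume (z - y) * (‖v y‖ - m) ^ 2 ∂(volΩ a b) =
      (∫ y, ρ.normed volume (z - y) * ‖v y‖ ^ 2 ∂(volΩ a b)) - 2 * m * m +
        m ^ 2 * ∫ y, ρ.normed volume (z - y) * 1 ∂(volΩ a b) := by
    have e : ∀ y, ρ.normed volume (z - y) * (‖v y‖ - m) ^ 2 =
        ρ.normed volume (z - y) * ‖v y‖ ^ 2 - 2 * m * (ρ.normed volume (z - y) * ‖v y‖) +
          m ^ 2 * (ρ.normed volume (z - y) * 1) := fun y => by ring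
    simp_rw [e]
    have e1 := integral_add (i2.sub (i1.const_mul (2 * m))) (i3.const_mul (m ^ 2))
    have e2 := integral_sub i2 (i1.const_mul (2 * m))
    rw [integral_const_mul] at e1 e2
    simp only [Pi.sub_apply] at e1
    rw [e1, e2]
  have h5 : ‖mollify a b ρ v z‖ ^ 2 ≤ m ^ 2 := by gcongr
  nlinarith [mul_le_mul_of_nonneg_left h2 (sq_nonneg m)]

/-- Exchange the order of integration: for fixed `y` the kernel `ρ(c x - y)` has integral at most
`c^(-(n+1)) ≤ 2^(n+1)` in `x`. -/
theorem sqNorm_mollify_le (ρ : ContDiffBump (0 : Fin (n + 1) → ℝ)) {v : (Fin (n + 1) → ℝ) → ℂ}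
    (hv : MemLp v 2 (volΩ a b)) {c : ℝ} (hc : 1 / 2 ≤ c) :
    sqNorm (volΩ a b) (fun x => mollify a b ρ v (c • x)) ≤ 2 ^ (n + 1) * sqNorm (volΩ a b) v := by
  obtain ⟨M, hM⟩ := ρ.hasCompactSupport_normed (μ := volume) |>.exists_bound_of_continuous
    ρ.continuous_normed
  have i1 : Integrable (fun p : (Fin (n + 1) → ℝ) × (Fin (n + 1) → ℝ) =>
      ρ.normed volume (c • p.1 - p.2) * ‖v p.2‖ ^ 2) ((volΩ a b).prod (volΩ a b)) := by
    have h1 : Integrable (fun p : (Fin (n + 1) → ℝ) × (Fin (n + 1) → ℝ) => ‖v p.2‖ ^ 2)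
        ((volΩ a b).prod (volΩ a b)) := (integrable_norm_sq hv).comp_snd _
    exact h1.bdd_mul (c := M) ((ρ.continuous_normed.comp (by fun_prop)).aestronglyMeasurable)
      (ae_of_all _ fun y => hM _)
  have h1 : sqNorm (volΩ a b) (fun x => mollify a b ρ v (c • x)) ≤
      ∫ x, (∫ y, ρ.normed volume (c • x - y) * ‖v y‖ ^ 2 ∂(volΩ a b)) ∂(volΩ a b) :=
    integral_mono_of_nonneg (ae_of_all _ fun x => sq_nonneg _) i1.integral_prod_left
      (ae_of_all _ fun x => norm_mollify_sq_le ρ hv _)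
  refine h1.trans ?_
  rw [integral_integral_swap i1, sqNorm, ← integral_const_mul]
  refine integral_mono i1.integral_prod_right ((integrable_norm_sq hv).const_mul _) fun y => ?_
  simp only []
  rw [integral_mul_const]
  refine mul_le_mul_of_nonneg_right ?_ (sq_nonneg _)
  have hc0 : c ≠ 0 := by positivity
  have i2 : Integrable fun x => ρ.normed volume (c • x - y) :=
    (ρ.integrable_normed.comp_sub_right y).comp_smul hc0
  have h2 : ∫ x, ρ.normed volume (c • x - y) ∂(volΩ a b) ≤ ∫ x, ρ.normed volume (c • x - y) :=
    setIntegral_le_integral i2 (ae_of_all _ fun x => ρ.nonneg_normed _)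
  refine h2.trans ?_
  rw [Measure.integral_comp_smul volume (fun x => ρ.normed volume (x - y)) c,
    integral_sub_right_eq_self (fun x => ρ.normed volume x), ρ.integral_normed]
  have hcp : 0 < c := by linarith
  simp only [Module.finrank_fin_fun, smul_eq_mul, mul_one]
  rw [abs_of_nonneg (by positivity), ← inv_pow]
  gcongr
  rw [inv_le_comm₀ hcp (by norm_num)]
  linarith

/-- The bump function used to regularise at scale `1 / (m + 2)`. -/
def scaleBump (n : ℕ) {r : ℝ} (hr : 0 < r) (m : ℕ) : ContDiffBump (0 : Fin (n + 1) → ℝ) where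
  rIn := r / (m + 2) / 2
  rOut := r / (m + 2)
  rIn_pos := by positivity
  rIn_lt_rOut := half_lt_self (by positivity)

/-- The contraction factor used to regularise at scale `1 / (m + 2)`. -/
def scaleFactor (m : ℕ) : ℝ := 1 - 1 / (m + 2)

theorem half_le_scaleFactor (m : ℕ) : 1 / 2 ≤ scaleFactor m := by
  have : (1 : ℝ) / (m + 2) ≤ 1 / 2 := by
    apply one_div_le_one_div_of_le (by norm_num); linarith [Nat.cast_nonneg (α := ℝ) m]
  rw [scaleFactor]; linarith

theorem scaleFactor_le_one (m : ℕ) : scaleFactor m ≤ 1 := by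
  have : (0 : ℝ) ≤ 1 / (m + 2) := by positivity
  rw [scaleFactor]; linarith

theorem tendsto_one_div_add_two : Tendsto (fun m : ℕ => (1 : ℝ) / (m + 2)) atTop (𝓝 0) := by
  have h := (tendsto_one_div_add_atTop_nhds_zero_nat (𝕜 := ℝ)).comp (tendsto_add_atTop_nat 1)
  refine h.congr fun m => ?_
  simp only [Function.comp_apply, Nat.cast_add, Nat.cast_one]
  ring

theorem tendsto_scaleFactor : Tendsto scaleFactor atTop (𝓝 1) := by
  have := tendsto_one_div_add_two.const_sub 1
  rw [sub_zero] at this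
  exact this

/-- Every face is at distance at least `r` from the origin, so contracting `Ω` by the factor `s`
moves its points away from the faces by more than `(1 - s) r`. This is exactly the radius `r / (m +
2)` of the bump function, hence mollification after contraction sees only values in `Ω`. -/
theorem closedBall_subset_openBox {r : ℝ} (hface : ∀ i, a i ≤ -r ∧ r ≤ b i)
    {x : Fin (n + 1) → ℝ} (hx : x ∈ openBox a b) (m : ℕ) :
    Metric.closedBall (scaleFactor m • x) (r / (m + 2)) ⊆ openBox a b := by
  intro y hy i _
  have h1 : |y i - scaleFactor m * x i| ≤ r / (m + 2) := by
    have := (dist_le_pi_dist y (scaleFactor m • x) i).trans hy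
    simpa [Real.dist_eq] using this
  obtain ⟨h2, h3⟩ := hx i trivial
  obtain ⟨h4, h5⟩ := hface i
  rw [abs_le] at h1
  have hs := half_le_scaleFactor m
  have e : r / (m + 2) = (1 - scaleFactor m) * r := by rw [scaleFactor]; ring
  have hs1 := scaleFactor_le_one m
  rw [e] at h1
  have h6 : scaleFactor m * a i < scaleFactor m * x i := by
    apply mul_lt_mul_of_pos_left h2; linarith
  have h7 : scaleFactor m * x i < scaleFactor m * b i := by
    apply mul_lt_mul_of_pos_left h3; linarith
  have h8 := mul_le_mul_of_nonneg_left h5 (sub_nonneg.2 hs1)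
  have h9 := mul_le_mul_of_nonneg_left h4 (sub_nonneg.2 hs1)
  constructor <;> linarith

theorem isTestFunction_bump {r : ℝ} (hr : 0 < r) (hface : ∀ i, a i ≤ -r ∧ r ≤ b i)
    {x : Fin (n + 1) → ℝ} (hx : x ∈ openBox a b) (m : ℕ) :
    IsTestFunction (openBox a b)
      (fun y => (scaleBump n hr m).normed volume (scaleFactor m • x + (-1 : ℝ) • y)) := by
  have hts : tsupport (fun y => (scaleBump n hr m).normed volume
      (scaleFactor m • x + (-1 : ℝ) • y)) ⊆
      Metric.closedBall (scaleFactor m • x) (r / (m + 2)) := by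
    refine closure_minimal (fun y hy => ?_) Metric.isClosed_closedBall
    have h1 : scaleFactor m • x + (-1 : ℝ) • y ∈
        Function.support ((scaleBump n hr m).normed volume) := hy
    rw [ContDiffBump.support_normed_eq] at h1
    have h2 : dist (scaleFactor m • x + (-1 : ℝ) • y) 0 < r / (m + 2) := h1
    rw [Metric.mem_closedBall, dist_comm, dist_eq_norm]
    rw [dist_zero_right, neg_one_smul, ← sub_eq_add_neg] at h2
    exact h2.le
  refine ⟨?_, ?_, hts.trans (closedBall_subset_openBox hface hx m)⟩
  · exact (scaleBump n hr m).contDiff_normed.comp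
      (contDiff_const.add (contDiff_const_smul (-1 : ℝ)))
  · exact (isCompact_closedBall _ _).of_isClosed_subset (isClosed_tsupport _) hts

/-- The reflected and translated bump function is a test function on `Ω`, so its derivatives can be
moved to `w`. The sign `(-1)^|α|` of the reflection cancels that of the integration by parts, and
the contraction contributes the power of `scaleFactor`. -/
theorem md_mollify {r : ℝ} (hr : 0 < r) (hface : ∀ i, a i ≤ -r ∧ r ≤ b i)
    {α : Fin (n + 1) → ℕ} {w v : (Fin (n + 1) → ℝ) → ℂ} (h : IsWeakDeriv a b α w v)
    {x : Fin (n + 1) → ℝ} (hx : x ∈ openBox a b) (m : ℕ) :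
    md α (fun x => mollify a b (scaleBump n hr m) w (scaleFactor m • x)) x =
      scaleFactor m ^ (∑ i, α i) • mollify a b (scaleBump n hr m) v (scaleFactor m • x) := by
  have h1 := md_comp_affine (contDiff_mollify (scaleBump n hr m) h.1) α 0 (scaleFactor m)
  simp only [zero_add] at h1
  rw [h1]
  simp only []
  congr 1
  have hρ : ContDiff ℝ ∞ ((scaleBump n hr m).normed volume : (Fin (n + 1) → ℝ) → ℝ) :=
    ContDiffBump.contDiff_normed _
  rw [mollify_eq, md_convolution hρ (ContDiffBump.hasCompactSupport_normed _)
    (locallyIntegrable_indicator h.1), convolution_indicator_eq]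
  have h2 := h.2.2 _ (isTestFunction_bump hr hface hx m)
  rw [mderiv_eq_md, md_comp_affine hρ] at h2
  have h3 : ((-1 : ℂ) ^ (∑ i, α i)) * ((-1 : ℂ) ^ (∑ i, α i)) = 1 := by
    rw [← mul_pow]; simp
  have e : ∀ y, scaleFactor m • x + (-1 : ℝ) • y = scaleFactor m • x - y := fun y => by
    rw [neg_one_smul, sub_eq_add_neg]
  simp only [e, smul_assoc] at h2
  rw [integral_smul] at h2
  have h4 : ∀ z : ℂ, ((-1 : ℝ) ^ (∑ i, α i)) • z = (-1 : ℂ) ^ (∑ i, α i) * z := fun z => by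
    rw [Complex.real_smul]; push_cast; ring
  rw [h4] at h2
  exact mul_left_cancel₀ (pow_ne_zero _ (by norm_num)) h2

theorem mollify_sub (ρ : ContDiffBump (0 : Fin (n + 1) → ℝ)) {v w : (Fin (n + 1) → ℝ) → ℂ}
    (hv : MemLp v 2 (volΩ a b)) (hw : MemLp w 2 (volΩ a b)) (z : Fin (n + 1) → ℝ) :
    mollify a b ρ (v - w) z = mollify a b ρ v z - mollify a b ρ w z := by
  obtain ⟨M, hM⟩ := ρ.hasCompactSupport_normed (μ := volume) |>.exists_bound_of_continuous
    ρ.continuous_normed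
  have hi : ∀ {q : (Fin (n + 1) → ℝ) → ℂ}, MemLp q 2 (volΩ a b) →
      Integrable (fun y => ρ.normed volume (z - y) • q y) (volΩ a b) := fun hq =>
    (hq.integrable (by norm_num)).bdd_smul M
      ((ρ.continuous_normed.comp (continuous_const.sub continuous_id)).aestronglyMeasurable)
      (ae_of_all _ fun y => hM _)
  rw [mollify, mollify, mollify, ← integral_sub (hi hv) (hi hw)]
  simp only [Pi.sub_apply, smul_sub]

theorem memLp_mollify (ρ : ContDiffBump (0 : Fin (n + 1) → ℝ)) {v : (Fin (n + 1) → ℝ) → ℂ}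
    (hv : MemLp v 2 (volΩ a b)) (c t : ℝ) :
    MemLp (fun x => t • mollify a b ρ v (c • x)) 2 (volΩ a b) := by
  refine (memLp_top_volΩ (Continuous.continuousOn ?_)).mono_exponent le_top
  exact (continuous_const (y := t)).smul ((contDiff_mollify ρ hv).continuous.comp (continuous_const_smul c))

/-- For continuous `φ` there are three errors of at most `η/3` each: averaging over the ball, moving
from `s x` to `x`, and replacing the factor `sʲ` by `1`. The first two are small by uniform
continuity, the third because `φ` is bounded. -/
theorem eventually_mollify_sub_le {r : ℝ} (hr : 0 < r) (hface : ∀ i, a i ≤ -r ∧ r ≤ b i)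
    {φ : (Fin (n + 1) → ℝ) → ℂ} (hφ : Continuous φ) (hφc : HasCompactSupport φ) (j : ℕ)
    {η : ℝ} (hη : 0 < η) :
    ∀ᶠ m in atTop, ∀ x ∈ openBox a b,
      ‖scaleFactor m ^ j • mollify a b (scaleBump n hr m) φ (scaleFactor m • x) - φ x‖ ≤ η := by
  obtain ⟨M, hM⟩ := hφc.exists_bound_of_continuous hφ
  have hM0 : 0 ≤ M := (norm_nonneg _).trans (hM 0)
  obtain ⟨δ, hδ, hu⟩ := Metric.uniformContinuous_iff.1 (hφc.uniformContinuous_of_continuous hφ)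
    (η / 3) (by positivity)
  obtain ⟨R, hR⟩ : ∃ R, ∀ x ∈ openBox a b, ‖x‖ ≤ R := by
    obtain ⟨R, hR⟩ := (isCompact_Icc (a := a) (b := b)).isBounded.exists_norm_le
    exact ⟨R, fun x hx => hR x (openBox_subset_Icc hx)⟩
  have t1 : ∀ᶠ m : ℕ in atTop, r / ((m : ℝ) + 2) < δ := by
    have := tendsto_one_div_add_two.const_mul r
    rw [mul_zero] at this
    filter_upwards [this.eventually (gt_mem_nhds hδ)] with m hm
    rwa [mul_one_div] at hm
  have t2 : ∀ᶠ m : ℕ in atTop, (1 : ℝ) / (m + 2) * R < δ := by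
    have := tendsto_one_div_add_two.mul_const R
    rw [zero_mul] at this
    exact this.eventually (gt_mem_nhds hδ)
  have t3 : ∀ᶠ m : ℕ in atTop, (1 - scaleFactor m ^ j) * M < η / 3 := by
    have := ((tendsto_scaleFactor.pow j).const_sub 1).mul_const M
    rw [one_pow, sub_self, zero_mul] at this
    exact this.eventually (gt_mem_nhds (by positivity))
  filter_upwards [t1, t2, t3] with m h1 h2 h3 x hx
  set s := scaleFactor m with hs
  have hs0 : 0 ≤ s := by linarith [half_le_scaleFactor m]
  have hs1 : s ≤ 1 := scaleFactor_le_one m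
  have hp0 : 0 ≤ s ^ j := pow_nonneg hs0 j
  have hp1 : s ^ j ≤ 1 := pow_le_one₀ hs0 hs1
  have hsub := closedBall_subset_openBox hface hx m
  have hmem : s • x ∈ openBox a b := hsub (Metric.mem_closedBall_self (by positivity))
  have A : dist (mollify a b (scaleBump n hr m) φ (s • x)) (φ (s • x)) ≤ η / 3 := by
    rw [mollify_eq]
    have e : φ (s • x) = (openBox a b).indicator φ (s • x) := by rw [Set.indicator_of_mem hmem]
    rw [e]
    refine ContDiffBump.dist_normed_convolution_le
      (hφ.aestronglyMeasurable.indicator isOpen_openBox.measurableSet) fun y hy => ?_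
    have hy' : dist y (s • x) < r / (m + 2) := hy
    rw [Set.indicator_of_mem hmem, Set.indicator_of_mem (hsub (Metric.ball_subset_closedBall hy))]
    exact (hu (hy'.trans h1)).le
  have B : dist (φ (s • x)) (φ x) ≤ η / 3 := by
    refine (hu ?_).le
    rw [dist_eq_norm, show s • x - x = (s - 1) • x by rw [sub_smul, one_smul], norm_smul,
      Real.norm_eq_abs, abs_of_nonpos (by linarith)]
    refine lt_of_le_of_lt ?_ h2
    rw [hs, scaleFactor, neg_sub, sub_sub_cancel]
    exact mul_le_mul_of_nonneg_left (hR x hx) (by positivity)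
  rw [dist_eq_norm] at A B
  have e : s ^ j • mollify a b (scaleBump n hr m) φ (s • x) - φ x =
      s ^ j • (mollify a b (scaleBump n hr m) φ (s • x) - φ (s • x)) +
        s ^ j • (φ (s • x) - φ x) - (1 - s ^ j) • φ x := by
    simp only [Complex.real_smul]; push_cast; ring
  rw [e]
  refine (norm_sub_le _ _).trans ?_
  have n1 := norm_add_le (s ^ j • (mollify a b (scaleBump n hr m) φ (s • x) - φ (s • x)))
    (s ^ j • (φ (s • x) - φ x))
  rw [norm_smul, norm_smul, Real.norm_of_nonneg hp0] at n1
  rw [norm_smul (1 - s ^ j), Real.norm_of_nonneg (by linarith)]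
  have n2 : s ^ j * ‖mollify a b (scaleBump n hr m) φ (s • x) - φ (s • x)‖ ≤ 1 * (η / 3) := by
    gcongr
  have n3 : s ^ j * ‖φ (s • x) - φ x‖ ≤ 1 * (η / 3) := by gcongr
  have n4 : (1 - s ^ j) * ‖φ x‖ ≤ (1 - s ^ j) * M :=
    mul_le_mul_of_nonneg_left (hM x) (by linarith)
  linarith

theorem tendsto_sqNorm_mollify {r : ℝ} (hr : 0 < r) (hface : ∀ i, a i ≤ -r ∧ r ≤ b i)
    {v : (Fin (n + 1) → ℝ) → ℂ} (hv : MemLp v 2 (volΩ a b)) (j : ℕ) :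
    Tendsto (fun m => sqNorm (volΩ a b) ((fun x => scaleFactor m ^ j •
      mollify a b (scaleBump n hr m) v (scaleFactor m • x)) - v)) atTop (𝓝 0) := by
  rw [Metric.tendsto_atTop']
  intro η hη
  -- Each use of `‖f + g‖² ≤ 2‖f‖² + 2‖g‖²` doubles the constants. The part from `v - φ`, which
  -- enters directly and through its mollification, has a coefficient of at most `K` and contributes
  -- at most `η/2`; the part from `φ` contributes less than `4 · η/8`.
  set K : ℝ := 2 * 2 ^ (n + 1) + 8 with hK
  have hK0 : 0 < K := by positivity
  set V := (volΩ a b).real Set.univ with hV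
  have : (volΩ a b).Regular := by rw [volΩ]; infer_instance
  obtain ⟨φ, hφc, hφ, hφ', hφL⟩ := hv.exists_hasCompactSupport_eLpNorm_sub_le (by norm_num)
    (ε := ENNReal.ofReal (√(η / (2 * K)))) (by
      rw [ne_eq, ENNReal.ofReal_eq_zero, not_le]; positivity)
  have hκ : sqNorm (volΩ a b) (v - φ) ≤ η / (2 * K) := by
    rw [eLpNorm_two_eq_sqNorm (hv.sub hφL), ENNReal.ofReal_le_ofReal_iff (Real.sqrt_nonneg _)] at hφ
    exact (Real.sqrt_le_sqrt_iff (by positivity)).1 hφ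
  have hη' : 0 < √(η / (8 * (V + 1))) := by
    have : 0 ≤ V := measureReal_nonneg
    positivity
  obtain ⟨m₀, hm₀⟩ := eventually_atTop.1 (eventually_mollify_sub_le hr hface hφ' hφc j hη')
  refine ⟨m₀, fun m hm => ?_⟩
  have h1 := hm₀ m (le_of_lt hm)
  rw [Real.dist_0_eq_abs, abs_of_nonneg (sqNorm_nonneg _ _)]
  set s := scaleFactor m with hs
  set ρ := scaleBump n hr m with hρ
  have hs0 : 0 ≤ s := by linarith [half_le_scaleFactor m]
  have hs1 : s ≤ 1 := scaleFactor_le_one m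
  have hp0 : 0 ≤ s ^ j := pow_nonneg hs0 j
  have hp1 : s ^ j ≤ 1 := pow_le_one₀ hs0 hs1
  have e : ((fun x => s ^ j • mollify a b ρ v (s • x)) - v) =
      (fun x => s ^ j • mollify a b ρ (v - φ) (s • x)) +
        (((fun x => s ^ j • mollify a b ρ φ (s • x)) - φ) - (v - φ)) := by
    ext x
    simp only [Pi.sub_apply, Pi.add_apply, mollify_sub ρ hv hφL, smul_sub]
    ring
  have m1 := memLp_mollify ρ (hv.sub hφL) s (s ^ j)
  have m2 := (memLp_mollify ρ hφL s (s ^ j)).sub hφL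
  have s1 := sqNorm_add_le m1 (m2.sub (hv.sub hφL))
  have s2 := sqNorm_sub_le m2 (hv.sub hφL)
  have s3 : sqNorm (volΩ a b) (fun x => s ^ j • mollify a b ρ (v - φ) (s • x)) ≤
      2 ^ (n + 1) * sqNorm (volΩ a b) (v - φ) := by
    refine le_trans ?_ (sqNorm_mollify_le ρ (hv.sub hφL) (half_le_scaleFactor m))
    have i1 := integrable_norm_sq (memLp_mollify ρ (hv.sub hφL) s 1)
    simp only [one_smul] at i1
    refine integral_mono (integrable_norm_sq m1) i1 fun x => ?_
    simp only [norm_smul, Real.norm_of_nonneg hp0]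
    exact pow_le_pow_left₀ (by positivity) (mul_le_of_le_one_left (norm_nonneg _) hp1) 2
  have s4 : sqNorm (volΩ a b) ((fun x => s ^ j • mollify a b ρ φ (s • x)) - φ) ≤
      η / (8 * (V + 1)) * V := by
    have i1 : Integrable (fun _ : Fin (n + 1) → ℝ => η / (8 * (V + 1))) (volΩ a b) :=
      integrable_const _
    have h2 : sqNorm (volΩ a b) ((fun x => s ^ j • mollify a b ρ φ (s • x)) - φ) ≤
        ∫ _, η / (8 * (V + 1)) ∂(volΩ a b) := by
      refine integral_mono_ae (integrable_norm_sq m2) i1 ?_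
      filter_upwards [ae_openBox (a := a) (b := b) Set.countable_empty] with x hx
      have h3 := pow_le_pow_left₀ (norm_nonneg _) (h1 x hx.1) 2
      rw [Real.sq_sqrt (by have : 0 ≤ V := measureReal_nonneg
                           positivity)] at h3
      exact h3
    rw [integral_const, smul_eq_mul, mul_comm] at h2
    exact h2
  have hV0 : 0 ≤ V := measureReal_nonneg
  have s5 : η / (8 * (V + 1)) * V < η / 8 := by
    rw [div_mul_eq_mul_div, div_lt_div_iff₀ (by positivity) (by norm_num)]
    nlinarith
  rw [e]
  have s6 : (2 * 2 ^ (n + 1) + 8) * sqNorm (volΩ a b) (v - φ) ≤ η / 2 := by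
    have := mul_le_mul_of_nonneg_left hκ hK0.le
    rw [← hK]
    refine this.trans (le_of_eq ?_)
    field_simp
  have := sqNorm_nonneg (volΩ a b) (v - φ)
  linarith

/-- Smooth functions are dense in `H^M(Ω)`. -/
theorem exists_smooth_seq {r : ℝ} (hr : 0 < r) (hface : ∀ i, a i ≤ -r ∧ r ≤ b i) {M : ℕ}
    {u : (Fin (n + 1) → ℝ) → ℂ} (hu : MemSobolev a b M u) :
    ∃ U : ℕ → (Fin (n + 1) → ℝ) → ℂ, (∀ m, ContDiff ℝ ∞ (U m)) ∧
      ∀ α ∈ multiIndices (n + 1) M,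
        Tendsto (fun m => sqNorm (volΩ a b) (md α (U m) - weakDeriv a b α u)) atTop (𝓝 0) := by
  refine ⟨fun m x => mollify a b (scaleBump n hr m) u (scaleFactor m • x), fun m => ?_, ?_⟩
  · exact (contDiff_mollify _ hu.1).comp (contDiff_const_smul _)
  · intro α hα
    have h1 : IsWeakDeriv a b α u (weakDeriv a b α u) := Classical.epsilon_spec (hu.2 α hα)
    refine (tendsto_sqNorm_mollify hr hface h1.2.1 (∑ i, α i)).congr fun m => ?_
    apply sqNorm_congr
    filter_upwards [ae_openBox (a := a) (b := b) Set.countable_empty] with x hx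
    simp only [Pi.sub_apply]
    rw [md_mollify hr hface h1 hx.1]

end Density

/-! ### Cubic Hermite interpolation in one variable -/

section Line

theorem memLp_Ioo {f : ℝ → ℂ} (hf : Continuous f) (c d : ℝ) :
    MemLp f 2 (volume.restrict (Set.Ioo c d)) := by
  have h1 : MemLp f 2 (volume.restrict (Set.Icc c d)) := by
    obtain ⟨M, hM⟩ := (isCompact_Icc (a := c) (b := d)).exists_bound_of_continuousOn hf.continuousOn
    exact MemLp.of_bound hf.aestronglyMeasurable M
      ((ae_restrict_iff' measurableSet_Icc).2 (ae_of_all _ hM))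
  exact h1.mono_measure (Measure.restrict_mono Set.Ioo_subset_Icc_self le_rfl)

theorem integral_Ioo_deriv {F F' : ℝ → ℂ} (h : ∀ t, HasDerivAt F (F' t) t) (hF' : Continuous F')
    {c d : ℝ} (hcd : c ≤ d) : ∫ t in Set.Ioo c d, F' t = F d - F c := by
  rw [← integral_Ioc_eq_integral_Ioo, ← intervalIntegral.integral_of_le hcd]
  exact intervalIntegral.integral_eq_sub_of_hasDerivAt (fun t _ => h t)
    (hF'.intervalIntegrable _ _)

/-- Poincaré's inequality: since `g` vanishes at `c`, the fundamental theorem of calculus and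
Cauchy–Schwarz bound `|g|²` pointwise by `(d - c)` times the squared norm of `g'`; integration gives
the second factor `d - c`. -/
theorem sqNorm_le_of_eq_zero {g g' : ℝ → ℂ} (hg : ∀ t, HasDerivAt g (g' t) t) (hg' : Continuous g')
    {c d : ℝ} (hcd : c ≤ d) (h0 : g c = 0) :
    √(sqNorm (volume.restrict (Set.Ioo c d)) g) ≤
      (d - c) * √(sqNorm (volume.restrict (Set.Ioo c d)) g') := by
  set μ := volume.restrict (Set.Ioo c d) with hμ
  have hgc : Continuous g := continuous_iff_continuousAt.2 fun t => (hg t).continuousAt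
  have hm := memLp_Ioo hg' c d
  have hone : sqNorm μ (fun _ => (1 : ℂ)) = d - c := by
    simp [sqNorm, hμ, hcd]
  have h1 : ∫ t, ‖g' t‖ ∂μ ≤ √(d - c) * √(sqNorm μ g') := by
    have := integral_norm_mul_norm_le (memLp_Ioo (continuous_const (y := (1 : ℂ))) c d) hm
    change _ ≤ √(sqNorm μ fun _ => (1 : ℂ)) * √(sqNorm μ g') at this
    rw [hone] at this
    simpa using this
  have h2 : ∀ t ∈ Set.Ioo c d, ‖g t‖ ^ 2 ≤ (d - c) * sqNorm μ g' := by
    intro t ht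
    have e1 := integral_Ioo_deriv hg hg' ht.1.le
    rw [h0, sub_zero] at e1
    have e2 : ‖g t‖ ≤ ∫ s, ‖g' s‖ ∂μ := by
      rw [← e1]
      refine (norm_integral_le_integral_norm _).trans ?_
      exact setIntegral_mono_set ((hm.integrable (by norm_num)).norm) (ae_of_all _ fun _ => norm_nonneg _)
        (Set.Ioo_subset_Ioo_right ht.2.le).eventuallyLE
    calc ‖g t‖ ^ 2 ≤ (√(d - c) * √(sqNorm μ g')) ^ 2 := by
          gcongr; exact e2.trans h1
      _ = _ := by
          rw [mul_pow, Real.sq_sqrt (by linarith), Real.sq_sqrt (sqNorm_nonneg _ _)]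
  have h3 : sqNorm μ g ≤ (d - c) ^ 2 * sqNorm μ g' := by
    have : sqNorm μ g ≤ ∫ _, (d - c) * sqNorm μ g' ∂μ := by
      refine integral_mono_ae (integrable_norm_sq (memLp_Ioo hgc c d)) (integrable_const _) ?_
      exact (ae_restrict_iff' measurableSet_Ioo).2 (ae_of_all _ h2)
    refine this.trans (le_of_eq ?_)
    rw [integral_const, hμ]
    simp [hcd]
    ring
  calc √(sqNorm μ g) ≤ √((d - c) ^ 2 * sqNorm μ g') := Real.sqrt_le_sqrt h3
    _ = _ := by rw [Real.sqrt_mul (sq_nonneg _), Real.sqrt_sq (by linarith)]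

theorem norm_integral_mul_star_le {f g : ℝ → ℂ} (hf : Continuous f) (hg : Continuous g) (c d : ℝ) :
    ‖∫ t in Set.Ioo c d, f t * star (g t)‖ ≤
      √(sqNorm (volume.restrict (Set.Ioo c d)) f) * √(sqNorm (volume.restrict (Set.Ioo c d)) g) := by
  refine (norm_integral_le_integral_norm _).trans ?_
  refine le_trans (le_of_eq (integral_congr_ae (ae_of_all _ fun t => ?_)))
    (integral_norm_mul_norm_le (memLp_Ioo hf c d) (memLp_Ioo hg c d))
  simp

/-- If `f` is the sum of `e`, which vanishes to second order at `c` and `d`, and a cubic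
polynomial `q`, then the derivatives of `e` are bounded by those of `f`. The sequences `e` and `q`
list the successive derivatives of these functions. -/
theorem sqNorm_hermite_error {e q : ℕ → ℝ → ℂ} (he : ∀ j t, HasDerivAt (e j) (e (j + 1) t) t)
    (hq : ∀ j t, HasDerivAt (q j) (q (j + 1) t) t) (hq4 : ∀ t, q 4 t = 0) {c d : ℝ} (hcd : c ≤ d)
    (h0c : e 0 c = 0) (h0d : e 0 d = 0) (h1c : e 1 c = 0) (h1d : e 1 d = 0)
    {r σ : ℕ} (hr : r ≤ 2) (hσ : 2 ≤ σ) (hσ' : σ ≤ 4) :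
    sqNorm (volume.restrict (Set.Ioo c d)) (e r) ≤ (d - c) ^ (2 * (σ - r)) *
      sqNorm (volume.restrict (Set.Ioo c d)) (fun t => e σ t + q σ t) := by
  set μ := volume.restrict (Set.Ioo c d) with hμ
  have hec : ∀ j, Continuous (e j) := fun j =>
    continuous_iff_continuousAt.2 fun t => (he j t).continuousAt
  have hqc : ∀ j, Continuous (q j) := fun j =>
    continuous_iff_continuousAt.2 fun t => (hq j t).continuousAt
  set f : ℕ → ℝ → ℂ := fun j t => e j t + q j t with hf
  have hfd : ∀ j t, HasDerivAt (f j) (f (j + 1) t) t := fun j t => (he j t).add (hq j t)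
  have hfc : ∀ j, Continuous (f j) := fun j => (hec j).add (hqc j)
  have hl : 0 ≤ d - c := by linarith
  have P1 : √(sqNorm μ (e 1)) ≤ (d - c) * √(sqNorm μ (e 2)) :=
    sqNorm_le_of_eq_zero (he 1) (hec 2) hcd h1c
  have P0 : √(sqNorm μ (e 0)) ≤ (d - c) * √(sqNorm μ (e 1)) :=
    sqNorm_le_of_eq_zero (he 0) (hec 1) hcd h0c
  have ii : ∀ {g₁ g₂ : ℝ → ℂ}, Continuous g₁ → Continuous g₂ →
      Integrable (fun t => g₁ t * star (g₂ t)) μ := fun h₁ h₂ =>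
    (memLp_Ioo (h₁.mul h₂.star) c d).integrable (by norm_num)
  have star_d : ∀ {g g' : ℝ → ℂ}, (∀ t, HasDerivAt g (g' t) t) →
      ∀ t, HasDerivAt (fun t => star (g t)) (star (g' t)) t := fun h t => (h t).star
  -- Two integrations by parts move both derivatives of `e` to `q`. The boundary terms vanish with
  -- `e` and `e'`, and `q'''' = 0`: in the energy of the second derivative, the error is orthogonal
  -- to cubics.
  have Q : ∫ t, e 2 t * star (q 2 t) ∂μ = 0 := by
    have h1 : ∀ t, HasDerivAt (fun t => e 1 t * star (q 2 t) - e 0 t * star (q 3 t))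
        (e 2 t * star (q 2 t)) t := by
      intro t
      have := ((he 1 t).mul (star_d (hq 2) t)).sub ((he 0 t).mul (star_d (hq 3) t))
      refine this.congr_deriv ?_
      rw [hq4, star_zero]
      ring
    rw [hμ, integral_Ioo_deriv h1 ((hec 2).mul (hqc 2).star) hcd]
    simp [h0c, h0d, h1c, h1d]
  have F2 : ∫ t, e 2 t * star (f 2 t) ∂μ = (sqNorm μ (e 2) : ℂ) := by
    have e1 : ∀ t, e 2 t * star (f 2 t) = e 2 t * star (e 2 t) + e 2 t * star (q 2 t) := by
      intro t; simp only [hf, star_add]; ring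
    simp_rw [e1]
    rw [integral_add (ii (hec 2) (hec 2)) (ii (hec 2) (hqc 2)), Q, add_zero, sqNorm,
      ← integral_complex_ofReal]
    refine integral_congr_ae (ae_of_all _ fun t => ?_)
    simp [Complex.mul_conj, Complex.normSq_eq_norm_sq]
  have byparts : ∀ j l, e j c = 0 → e j d = 0 →
      ∫ t, e (j + 1) t * star (f l t) ∂μ = -∫ t, e j t * star (f (l + 1) t) ∂μ := by
    intro j l hc hd
    have h1 : ∀ t, HasDerivAt (fun t => e j t * star (f l t))
        (e (j + 1) t * star (f l t) + e j t * star (f (l + 1) t)) t := fun t =>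
      (he j t).mul (star_d (hfd l) t)
    have h2 := integral_Ioo_deriv h1 (((hec (j + 1)).mul (hfc l).star).add
      ((hec j).mul (hfc (l + 1)).star)) hcd
    rw [← hμ, integral_add (ii (hec _) (hfc _)) (ii (hec _) (hfc _))] at h2
    simp only [hc, hd, zero_mul, sub_zero] at h2
    exact eq_neg_of_add_eq_zero_left h2
  -- By orthogonality `‖e''‖²` is the inner product of `e''` and `f''`. Moving `σ - 2` derivatives
  -- from `e` to `f`, again without boundary terms, exposes `f` differentiated `σ` times.
  have key : sqNorm μ (e 2) ≤ √(sqNorm μ (e (4 - σ))) * √(sqNorm μ (f σ)) := by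
    have hn : sqNorm μ (e 2) = ‖(sqNorm μ (e 2) : ℂ)‖ := by
      rw [Complex.norm_real, Real.norm_of_nonneg (sqNorm_nonneg _ _)]
    rw [hn, ← F2]
    obtain rfl | rfl | rfl : σ = 2 ∨ σ = 3 ∨ σ = 4 := by omega
    · exact norm_integral_mul_star_le (hec _) (hfc _) c d
    · rw [byparts 1 2 h1c h1d, norm_neg]
      exact norm_integral_mul_star_le (hec _) (hfc _) c d
    · rw [byparts 1 2 h1c h1d, byparts 0 3 h0c h0d, neg_neg]
      exact norm_integral_mul_star_le (hec _) (hfc _) c d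
  have N0 := Real.sqrt_nonneg (sqNorm μ (f σ))
  have N2 := Real.sqrt_nonneg (sqNorm μ (e 2))
  have hsmall : ∀ j ≤ 2, √(sqNorm μ (e j)) ≤ (d - c) ^ (2 - j) * √(sqNorm μ (e 2)) := by
    intro j hj
    interval_cases j
    · refine P0.trans ((mul_le_mul_of_nonneg_left P1 hl).trans (le_of_eq ?_))
      ring
    · simpa using P1
    · simp
  -- Poincaré bounds the derivative of `e` of order `4 - σ` by `(d - c)^(σ-2) ‖e''‖`; one factor
  -- `‖e''‖` then cancels.
  have B2 : √(sqNorm μ (e 2)) ≤ (d - c) ^ (σ - 2) * √(sqNorm μ (f σ)) := by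
    have h1 := hsmall (4 - σ) (by omega)
    rw [show 2 - (4 - σ) = σ - 2 by omega] at h1
    have h2 : √(sqNorm μ (e 2)) * √(sqNorm μ (e 2)) ≤
        √(sqNorm μ (e 2)) * ((d - c) ^ (σ - 2) * √(sqNorm μ (f σ))) := by
      rw [Real.mul_self_sqrt (sqNorm_nonneg _ _)]
      refine key.trans ((mul_le_mul_of_nonneg_right h1 N0).trans (le_of_eq ?_))
      ring
    rcases N2.eq_or_lt with h | h
    · rw [← h]; positivity
    · exact le_of_mul_le_mul_left h2 h
  have B : √(sqNorm μ (e r)) ≤ (d - c) ^ (σ - r) * √(sqNorm μ (f σ)) := by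
    refine (hsmall r hr).trans ((mul_le_mul_of_nonneg_left B2 (by positivity)).trans (le_of_eq ?_))
    rw [← mul_assoc, ← pow_add]
    congr 2
    omega
  calc sqNorm μ (e r) = √(sqNorm μ (e r)) ^ 2 := (Real.sq_sqrt (sqNorm_nonneg _ _)).symm
    _ ≤ ((d - c) ^ (σ - r) * √(sqNorm μ (f σ))) ^ 2 := by gcongr
    _ = _ := by rw [mul_pow, Real.sq_sqrt (sqNorm_nonneg _ _), ← pow_mul, mul_comm 2]

end Line

/-! ### Cubic Hermite interpolation in one variable of a function on a box -/

section Coordinate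

variable {d : ℕ} {E : Type*} [NormedAddCommGroup E] [NormedSpace ℝ E]

theorem pd_add {f g : (Fin d → ℝ) → E} (hf : ContDiff ℝ ∞ f) (hg : ContDiff ℝ ∞ g) (i : Fin d) :
    pd i (f + g) = pd i f + pd i g := by
  ext x
  rw [pd, fderiv_add (hf.differentiable (by simp) x) (hg.differentiable (by simp) x)]
  rfl

theorem pd_sub {f g : (Fin d → ℝ) → E} (hf : ContDiff ℝ ∞ f) (hg : ContDiff ℝ ∞ g) (i : Fin d) :
    pd i (f - g) = pd i f - pd i g := by
  ext x
  rw [pd, fderiv_sub (hf.differentiable (by simp) x) (hg.differentiable (by simp) x)]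
  rfl

theorem contDiff_iterate_pd {f : (Fin d → ℝ) → E} (hf : ContDiff ℝ ∞ f) (i : Fin d) (r : ℕ) :
    ContDiff ℝ ∞ ((pd i)^[r] f) := by
  induction r with
  | zero => exact hf
  | succ r ih => rw [Function.iterate_succ_apply']; exact contDiff_pd ih i

theorem iterate_pd_add {f g : (Fin d → ℝ) → E} (hf : ContDiff ℝ ∞ f) (hg : ContDiff ℝ ∞ g)
    (i : Fin d) (r : ℕ) : (pd i)^[r] (f + g) = (pd i)^[r] f + (pd i)^[r] g := by
  induction r with
  | zero => rfl
  | succ r ih =>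
    simp only [Function.iterate_succ_apply', ih]
    exact pd_add (contDiff_iterate_pd hf i r) (contDiff_iterate_pd hg i r) i

theorem iterate_pd_sub {f g : (Fin d → ℝ) → E} (hf : ContDiff ℝ ∞ f) (hg : ContDiff ℝ ∞ g)
    (i : Fin d) (r : ℕ) : (pd i)^[r] (f - g) = (pd i)^[r] f - (pd i)^[r] g := by
  induction r with
  | zero => rfl
  | succ r ih =>
    simp only [Function.iterate_succ_apply', ih]
    exact pd_sub (contDiff_iterate_pd hf i r) (contDiff_iterate_pd hg i r) i

theorem pd_comm {f : (Fin d → ℝ) → ℂ} (hf : ContDiff ℝ ∞ f) (i j : Fin d) :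
    pd i (pd j f) = pd j (pd i f) := by
  ext x
  exact hess_symm (hf.contDiffAt.of_le (by norm_cast)) i j

theorem iterate_pd_pd_comm {f : (Fin d → ℝ) → ℂ} (hf : ContDiff ℝ ∞ f) (i j : Fin d) (r : ℕ) :
    (pd i)^[r] (pd j f) = pd j ((pd i)^[r] f) := by
  induction r with
  | zero => rfl
  | succ r ih =>
    rw [Function.iterate_succ_apply', ih, Function.iterate_succ_apply',
      pd_comm (contDiff_iterate_pd hf i r)]

theorem iterate_pd_comm {f : (Fin d → ℝ) → ℂ} (hf : ContDiff ℝ ∞ f) (i j : Fin d) (r s : ℕ) :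
    (pd i)^[r] ((pd j)^[s] f) = (pd j)^[s] ((pd i)^[r] f) := by
  induction s with
  | zero => rfl
  | succ s ih =>
    rw [Function.iterate_succ_apply', Function.iterate_succ_apply',
      iterate_pd_pd_comm (contDiff_iterate_pd hf j s), ih]

theorem hasDerivAt_update_line {f : (Fin d → ℝ) → E} (hf : ContDiff ℝ ∞ f) (x : Fin d → ℝ)
    (i : Fin d) (t : ℝ) :
    HasDerivAt (fun t => f (Function.update x i t)) (pd i f (Function.update x i t)) t :=
  (hf.differentiable (by simp) _).hasFDerivAt.comp_hasDerivAt t (hasDerivAt_update x i t)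

theorem contDiff_update (i : Fin d) (c : ℝ) :
    ContDiff ℝ ∞ fun x : Fin d → ℝ => Function.update x i c := by
  rw [contDiff_pi]
  intro j
  by_cases h : j = i
  · subst h; simpa using contDiff_const
  · simpa [h] using contDiff_apply ℝ ℝ j

/-- The function `p(x_i) F(x)|_{x_i = c}`. -/
def sliceMul (i : Fin d) (p : Polynomial ℝ) (c : ℝ) (F : (Fin d → ℝ) → E) : (Fin d → ℝ) → E :=
  fun x => p.eval (x i) • F (Function.update x i c)

theorem contDiff_sliceMul (i : Fin d) (p : Polynomial ℝ) (c : ℝ) {F : (Fin d → ℝ) → E}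
    (hF : ContDiff ℝ ∞ F) : ContDiff ℝ ∞ (sliceMul i p c F) := by
  have h1 : ContDiff ℝ ∞ fun x : Fin d → ℝ => p.eval (x i) := by
    have := (Polynomial.contDiff_aeval (𝕜 := ℝ) p ∞).comp (contDiff_apply ℝ ℝ i)
    simpa [Polynomial.aeval_def, Function.comp_def] using this
  exact h1.smul (hF.comp (contDiff_update i c))

theorem hasFDerivAt_update' (i : Fin d) (c : ℝ) (x : Fin d → ℝ) :
    HasFDerivAt (fun x : Fin d → ℝ => Function.update x i c)
      (ContinuousLinearMap.pi fun j => if j = i then (0 : (Fin d → ℝ) →L[ℝ] ℝ) else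
        ContinuousLinearMap.proj j) x := by
  rw [hasFDerivAt_pi]
  intro j
  by_cases h : j = i
  · subst h; simpa using hasFDerivAt_const c x
  · simpa [h] using hasFDerivAt_apply j x

theorem pd_sliceMul (i j : Fin d) (p : Polynomial ℝ) (c : ℝ) {F : (Fin d → ℝ) → E}
    (hF : ContDiff ℝ ∞ F) : pd j (sliceMul i p c F) =
      if j = i then sliceMul i (Polynomial.derivative p) c F else sliceMul i p c (pd j F) := by
  ext x
  have h1 : HasFDerivAt (fun x : Fin d → ℝ => p.eval (x i))
      ((Polynomial.derivative p).eval (x i) •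
        (ContinuousLinearMap.proj i : (Fin d → ℝ) →L[ℝ] ℝ)) x := by
    have h0 := (p.hasDerivAt (x i)).comp_hasFDerivAt (h₂ := fun t => p.eval t) x
      (hasFDerivAt_apply (𝕜 := ℝ) (F' := fun _ => ℝ) i x)
    exact h0
  have h2 := (hF.differentiable (by simp) (Function.update x i c)).hasFDerivAt.comp x
    (hasFDerivAt_update' i c x)
  have h3 := congrArg (fun L => L (Pi.single j (1 : ℝ))) (h1.smul h2).fderiv
  have h4 : pd j (sliceMul i p c F) x = _ := h3
  rw [h4]
  by_cases hji : j = i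
  · subst hji
    have : (ContinuousLinearMap.pi fun k => if k = j then (0 : (Fin d → ℝ) →L[ℝ] ℝ) else
        ContinuousLinearMap.proj k) (Pi.single j (1 : ℝ)) = 0 := by
      ext k
      by_cases hk : k = j <;> simp [hk]
    simp [sliceMul, this]
  · have : (ContinuousLinearMap.pi fun k => if k = i then (0 : (Fin d → ℝ) →L[ℝ] ℝ) else
        ContinuousLinearMap.proj k) (Pi.single j (1 : ℝ)) = Pi.single j 1 := by
      ext k
      by_cases hk : k = i
      · subst hk; simp [Ne.symm hji]
      · simp [hk]
    simp [sliceMul, this, hji, Ne.symm hji, pd]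

theorem iterate_pd_sliceMul (i : Fin d) (p : Polynomial ℝ) (c : ℝ) {F : (Fin d → ℝ) → E}
    (hF : ContDiff ℝ ∞ F) (r : ℕ) :
    (pd i)^[r] (sliceMul i p c F) = sliceMul i (Polynomial.derivative^[r] p) c F := by
  induction r with
  | zero => rfl
  | succ r ih =>
    rw [Function.iterate_succ_apply', ih, pd_sliceMul i i _ c hF, if_pos rfl,
      Function.iterate_succ_apply']

end Coordinate

section Hermite

theorem contDiff_pi_add {m : ℕ} {f g : (Fin m → ℝ) → ℂ} (hf : ContDiff ℝ ∞ f)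
    (hg : ContDiff ℝ ∞ g) : ContDiff ℝ ∞ (f + g) := hf.add hg

theorem contDiff_pi_sub {m : ℕ} {f g : (Fin m → ℝ) → ℂ} (hf : ContDiff ℝ ∞ f)
    (hg : ContDiff ℝ ∞ g) : ContDiff ℝ ∞ (f - g) := hf.sub hg

/-- The polynomial `α + β (t - c) + γ (t - c)² + δ (t - c)³`. -/
def cubicAt (c α β γ δ : ℝ) : Polynomial ℝ :=
  .C α + .C β * (.X - .C c) + .C γ * (.X - .C c) ^ 2 + .C δ * (.X - .C c) ^ 3

theorem cubicAt_eval (c α β γ δ t : ℝ) : (cubicAt c α β γ δ).eval t =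
    α + β * (t - c) + γ * (t - c) ^ 2 + δ * (t - c) ^ 3 := by
  simp [cubicAt]

theorem cubicAt_derivative_eval (c α β γ δ t : ℝ) :
    (Polynomial.derivative (cubicAt c α β γ δ)).eval t =
      β + 2 * γ * (t - c) + 3 * δ * (t - c) ^ 2 := by
  simp [cubicAt, Polynomial.derivative_pow]
  ring

theorem cubicAt_natDegree_le (c α β γ δ : ℝ) : (cubicAt c α β γ δ).natDegree ≤ 3 := by
  rw [cubicAt]
  compute_degree

theorem cubicAt_iterate_derivative (c α β γ δ : ℝ) :
    Polynomial.derivative^[4] (cubicAt c α β γ δ) = 0 :=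
  Polynomial.iterate_derivative_eq_zero (by linarith [cubicAt_natDegree_le c α β γ δ])

/-- The cubic with value `1` at `c`, value `0` at `d` and vanishing derivative at both. -/
def valL (c d : ℝ) : Polynomial ℝ := cubicAt c 1 0 (-3 / (d - c) ^ 2) (2 / (d - c) ^ 3)

/-- The cubic with value `0` at `c`, value `1` at `d` and vanishing derivative at both. -/
def valR (c d : ℝ) : Polynomial ℝ := cubicAt c 0 0 (3 / (d - c) ^ 2) (-2 / (d - c) ^ 3)

/-- The cubic that vanishes at `c` and `d` with derivative `1` at `c` and `0` at `d`. -/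
def derL (c d : ℝ) : Polynomial ℝ := cubicAt c 0 1 (-2 / (d - c)) (1 / (d - c) ^ 2)

/-- The cubic that vanishes at `c` and `d` with derivative `0` at `c` and `1` at `d`. -/
def derR (c d : ℝ) : Polynomial ℝ := cubicAt c 0 0 (-1 / (d - c)) (1 / (d - c) ^ 2)

variable {n : ℕ} {m : ℕ}

/-- Cubic Hermite interpolation in the variable `x_i`, at the points `c` and `d`, with values given
by `F` and derivatives given by `G`. -/
def hermite (i : Fin m) (c d : ℝ) (F G : (Fin m → ℝ) → ℂ) : (Fin m → ℝ) → ℂ :=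
  sliceMul i (valL c d) c F + sliceMul i (valR c d) d F +
    (sliceMul i (derL c d) c G + sliceMul i (derR c d) d G)

/-- The error of cubic Hermite interpolation in the variable `x_i`. -/
def hermErr (i : Fin m) (c d : ℝ) (U : (Fin m → ℝ) → ℂ) : (Fin m → ℝ) → ℂ :=
  U - hermite i c d U (pd i U)

theorem contDiff_hermite (i : Fin m) (c d : ℝ) {F G : (Fin m → ℝ) → ℂ} (hF : ContDiff ℝ ∞ F)
    (hG : ContDiff ℝ ∞ G) : ContDiff ℝ ∞ (hermite i c d F G) :=
  ((contDiff_sliceMul i _ c hF).add (contDiff_sliceMul i _ d hF)).add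
    ((contDiff_sliceMul i _ c hG).add (contDiff_sliceMul i _ d hG))

theorem contDiff_hermErr (i : Fin m) (c d : ℝ) {U : (Fin m → ℝ) → ℂ} (hU : ContDiff ℝ ∞ U) :
    ContDiff ℝ ∞ (hermErr i c d U) :=
  hU.sub (contDiff_hermite i c d hU (contDiff_pd hU i))

theorem pd_hermite_of_ne {i j : Fin m} (hij : j ≠ i) (c d : ℝ) {F G : (Fin m → ℝ) → ℂ}
    (hF : ContDiff ℝ ∞ F) (hG : ContDiff ℝ ∞ G) :
    pd j (hermite i c d F G) = hermite i c d (pd j F) (pd j G) := by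
  rw [hermite, pd_add (contDiff_pi_add (contDiff_sliceMul i _ c hF) (contDiff_sliceMul i _ d hF))
    (contDiff_pi_add (contDiff_sliceMul i _ c hG) (contDiff_sliceMul i _ d hG)),
    pd_add (contDiff_sliceMul i _ c hF) (contDiff_sliceMul i _ d hF),
    pd_add (contDiff_sliceMul i _ c hG) (contDiff_sliceMul i _ d hG)]
  simp only [pd_sliceMul _ _ _ _ hF, pd_sliceMul _ _ _ _ hG, if_neg hij]
  rfl

theorem iterate_pd_hermite (i : Fin m) (c d : ℝ) {F G : (Fin m → ℝ) → ℂ}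
    (hF : ContDiff ℝ ∞ F) (hG : ContDiff ℝ ∞ G) (r : ℕ) :
    (pd i)^[r] (hermite i c d F G) =
      sliceMul i (Polynomial.derivative^[r] (valL c d)) c F +
        sliceMul i (Polynomial.derivative^[r] (valR c d)) d F +
        (sliceMul i (Polynomial.derivative^[r] (derL c d)) c G +
          sliceMul i (Polynomial.derivative^[r] (derR c d)) d G) := by
  rw [hermite, iterate_pd_add (contDiff_pi_add (contDiff_sliceMul i _ c hF) (contDiff_sliceMul i _ d hF))
    (contDiff_pi_add (contDiff_sliceMul i _ c hG) (contDiff_sliceMul i _ d hG)),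
    iterate_pd_add (contDiff_sliceMul i _ c hF) (contDiff_sliceMul i _ d hF),
    iterate_pd_add (contDiff_sliceMul i _ c hG) (contDiff_sliceMul i _ d hG)]
  simp only [iterate_pd_sliceMul _ _ _ hF, iterate_pd_sliceMul _ _ _ hG]

theorem iterate_pd_hermite_four (i : Fin m) (c d : ℝ) {F G : (Fin m → ℝ) → ℂ}
    (hF : ContDiff ℝ ∞ F) (hG : ContDiff ℝ ∞ G) (x : Fin m → ℝ) :
    (pd i)^[4] (hermite i c d F G) x = 0 := by
  rw [iterate_pd_hermite i c d hF hG, valL, valR, derL, derR]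
  simp only [cubicAt_iterate_derivative]
  simp [sliceMul]

theorem hermite_sub (i : Fin m) (c d : ℝ) (F G F' G' : (Fin m → ℝ) → ℂ) :
    hermite i c d (F - F') (G - G') = hermite i c d F G - hermite i c d F' G' := by
  ext x
  simp only [hermite, sliceMul, Pi.add_apply, Pi.sub_apply, smul_sub]
  ring

theorem pd_hermErr_of_ne {i j : Fin m} (hij : j ≠ i) (c d : ℝ) {U : (Fin m → ℝ) → ℂ}
    (hU : ContDiff ℝ ∞ U) : pd j (hermErr i c d U) = hermErr i c d (pd j U) := by
  rw [hermErr, pd_sub hU (contDiff_hermite i c d hU (contDiff_pd hU i)),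
    pd_hermite_of_ne hij c d hU (contDiff_pd hU i), pd_comm hU, hermErr]

theorem iterate_pd_hermErr_of_ne {i j : Fin m} (hij : j ≠ i) (c d : ℝ) {U : (Fin m → ℝ) → ℂ}
    (hU : ContDiff ℝ ∞ U) (s : ℕ) :
    (pd j)^[s] (hermErr i c d U) = hermErr i c d ((pd j)^[s] U) := by
  induction s with
  | zero => rfl
  | succ s ih =>
    rw [Function.iterate_succ_apply', ih, pd_hermErr_of_ne hij c d (contDiff_iterate_pd hU j s),
      Function.iterate_succ_apply']

theorem hermErr_left (i : Fin m) {c d : ℝ} (U : (Fin m → ℝ) → ℂ) (x : Fin m → ℝ) :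
    hermErr i c d U (Function.update x i c) = 0 := by
  simp [hermErr, hermite, sliceMul, valL, valR, derL, derR, cubicAt_eval]

theorem hermErr_right (i : Fin m) {c d : ℝ} (hcd : c < d) (U : (Fin m → ℝ) → ℂ)
    (x : Fin m → ℝ) : hermErr i c d U (Function.update x i d) = 0 := by
  have h : d - c ≠ 0 := sub_ne_zero.2 hcd.ne'
  have h1 : (valL c d).eval d = 0 := by rw [valL, cubicAt_eval]; field_simp; ring
  have h2 : (valR c d).eval d = 1 := by rw [valR, cubicAt_eval]; field_simp; ring
  have h3 : (derL c d).eval d = 0 := by rw [derL, cubicAt_eval]; field_simp; ring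
  have h4 : (derR c d).eval d = 0 := by rw [derR, cubicAt_eval]; field_simp; ring
  simp [hermErr, hermite, sliceMul, h1, h2, h3, h4]

theorem pd_hermErr_left (i : Fin m) {c d : ℝ} {U : (Fin m → ℝ) → ℂ} (hU : ContDiff ℝ ∞ U)
    (x : Fin m → ℝ) : pd i (hermErr i c d U) (Function.update x i c) = 0 := by
  have h := iterate_pd_hermite i c d hU (contDiff_pd hU i) 1
  simp only [Function.iterate_one] at h
  rw [hermErr, pd_sub hU (contDiff_hermite i c d hU (contDiff_pd hU i)), h]
  simp [sliceMul, valL, valR, derL, derR, cubicAt_derivative_eval]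

theorem pd_hermErr_right (i : Fin m) {c d : ℝ} (hcd : c < d) {U : (Fin m → ℝ) → ℂ}
    (hU : ContDiff ℝ ∞ U) (x : Fin m → ℝ) :
    pd i (hermErr i c d U) (Function.update x i d) = 0 := by
  have h := iterate_pd_hermite i c d hU (contDiff_pd hU i) 1
  simp only [Function.iterate_one] at h
  rw [hermErr, pd_sub hU (contDiff_hermite i c d hU (contDiff_pd hU i)), h]
  have h0 : d - c ≠ 0 := sub_ne_zero.2 hcd.ne'
  have h1 : (Polynomial.derivative (valL c d)).eval d = 0 := by
    rw [valL, cubicAt_derivative_eval]; field_simp; ring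
  have h2 : (Polynomial.derivative (valR c d)).eval d = 0 := by
    rw [valR, cubicAt_derivative_eval]; field_simp; ring
  have h3 : (Polynomial.derivative (derL c d)).eval d = 0 := by
    rw [derL, cubicAt_derivative_eval]; field_simp; ring
  have h4 : (Polynomial.derivative (derR c d)).eval d = 1 := by
    rw [derR, cubicAt_derivative_eval]; field_simp; ring
  simp [sliceMul, h1, h2, h3, h4]

variable {c d : Fin (n + 1) → ℝ}

theorem integrable_integral_line (i : Fin (n + 1)) {F : (Fin (n + 1) → ℝ) → ℝ}
    (hF : Integrable F (volΩ c d)) :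
    Integrable (fun y => ∫ t in Set.Ioo (c i) (d i), F (i.insertNth (α := fun _ => ℝ) t y))
      (faceVol c d i) := by
  have hmp := measurePreserving_insertNth (a := c) (b := d) i
  have he : MeasurableEmbedding
      (fun q : ℝ × (Fin n → ℝ) => i.insertNth (α := fun _ => ℝ) q.1 q.2) :=
    (MeasurableEquiv.piFinSuccAbove (fun _ => ℝ) i).symm.measurableEmbedding
  exact ((hmp.integrable_comp_emb he).2 hF).integral_prod_right

theorem memLp_of_contDiff {f : (Fin (n + 1) → ℝ) → ℂ} (hf : ContDiff ℝ ∞ f) :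
    MemLp f 2 (volΩ c d) :=
  (memLp_top_volΩ hf.continuous.continuousOn).mono_exponent le_top

/-- On each line parallel to the `i`-th axis, `hermErr` is the error of one-dimensional Hermite
interpolation, and the other variables are parameters. The one-dimensional estimate is integrated
over the lines. -/
theorem sqNorm_hermErr_le (hcd : ∀ i, c i < d i) (i : Fin (n + 1)) {U : (Fin (n + 1) → ℝ) → ℂ}
    (hU : ContDiff ℝ ∞ U) {r σ : ℕ} (hr : r ≤ 2) (hσ : 2 ≤ σ) (hσ' : σ ≤ 4) {h : ℝ}
    (hh : d i - c i ≤ h) :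
    sqNorm (volΩ c d) ((pd i)^[r] (hermErr i (c i) (d i) U)) ≤
      h ^ (2 * (σ - r)) * sqNorm (volΩ c d) ((pd i)^[σ] U) := by
  have hE := contDiff_hermErr i (c i) (d i) hU
  have hH := contDiff_hermite i (c i) (d i) hU (contDiff_pd hU i)
  have i1 := integrable_norm_sq (memLp_of_contDiff (c := c) (d := d) (contDiff_iterate_pd hE i r))
  have i2 := integrable_norm_sq (memLp_of_contDiff (c := c) (d := d) (contDiff_iterate_pd hU i σ))
  rw [sqNorm, sqNorm, integral_volΩ_eq i i1, integral_volΩ_eq i i2, ← integral_const_mul]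
  refine integral_mono (integrable_integral_line i i1)
    ((integrable_integral_line i i2).const_mul _) fun y => ?_
  simp only []
  set x : Fin (n + 1) → ℝ := i.insertNth (α := fun _ => ℝ) 0 y with hx
  have hl : ∀ t, i.insertNth (α := fun _ => ℝ) t y = Function.update x i t := by
    intro t
    rw [hx]
    ext j
    refine Fin.succAboveCases i ?_ (fun j => ?_) j <;> simp
  simp only [hl]
  have key := sqNorm_hermite_error
    (e := fun j t => (pd i)^[j] (hermErr i (c i) (d i) U) (Function.update x i t))
    (q := fun j t => (pd i)^[j] (hermite i (c i) (d i) U (pd i U)) (Function.update x i t))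
    (fun j t => by
      rw [Function.iterate_succ_apply']
      exact hasDerivAt_update_line (contDiff_iterate_pd hE i j) x i t)
    (fun j t => by
      rw [Function.iterate_succ_apply']
      exact hasDerivAt_update_line (contDiff_iterate_pd hH i j) x i t)
    (fun t => iterate_pd_hermite_four i _ _ hU (contDiff_pd hU i) _) (hcd i).le
    (hermErr_left i U x) (hermErr_right i (hcd i) U x)
    (pd_hermErr_left i hU x) (pd_hermErr_right i (hcd i) hU x) hr hσ hσ'
  have e : ∀ t, (pd i)^[σ] (hermErr i (c i) (d i) U) (Function.update x i t) +
      (pd i)^[σ] (hermite i (c i) (d i) U (pd i U)) (Function.update x i t) =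
      (pd i)^[σ] U (Function.update x i t) := by
    intro t
    rw [hermErr, iterate_pd_sub hU hH]
    simp
  simp only [e] at key
  refine key.trans (mul_le_mul_of_nonneg_right ?_ (sqNorm_nonneg _ _))
  exact pow_le_pow_left₀ (sub_nonneg.2 (hcd i).le) hh _

/-- The error of tensor-product cubic Hermite interpolation in two variables. -/
theorem sub_hermite_hermite {i j : Fin m} (hij : i ≠ j) (c d c' d' : ℝ) {U : (Fin m → ℝ) → ℂ}
    (hU : ContDiff ℝ ∞ U) :
    U - hermite i c d (hermite j c' d' U (pd j U)) (hermite j c' d' (pd i U) (pd j (pd i U))) =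
      hermErr i c d U + (hermErr j c' d' U - hermErr i c d (hermErr j c' d' U)) := by
  -- With interpolation operators `I_i`, `I_j` and errors `E = 1 - I`, this is `E_i E_j = E_j - (I_i
  -- - I_i I_j)`, which uses that `∂_i` commutes with `E_j` for `i ≠ j`. It rearranges to `1 - I_i
  -- I_j = E_i + E_j - E_i E_j`.
  have h1 : hermErr i c d (hermErr j c' d' U) = hermErr j c' d' U -
      (hermite i c d U (pd i U) - hermite i c d (hermite j c' d' U (pd j U))
        (hermite j c' d' (pd i U) (pd j (pd i U)))) := by
    rw [← hermite_sub]
    conv_lhs => rw [hermErr, pd_hermErr_of_ne hij c' d' hU]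
    rfl
  rw [h1]
  conv_rhs => rw [hermErr]
  abel

/-- Each of the three errors is bounded by derivatives of total order exactly four. For `E_i` the
`s` derivatives in `x_j` are already spent, so `4 - s` remain in `x_i`, and symmetrically for `E_j`;
in `E_i E_j` each variable takes two. Thus `H⁴` regularity is enough, and `10 = 2 + 4 + 4` comes
from splitting the sum of squares twice. -/
theorem sqNorm_tensor_error_le (hcd : ∀ i, c i < d i) {i j : Fin (n + 1)} (hij : i ≠ j)
    {U : (Fin (n + 1) → ℝ) → ℂ} (hU : ContDiff ℝ ∞ U) {h M : ℝ} (hh : ∀ i, d i - c i ≤ h)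
    {r s : ℕ} (hrs : r + s ≤ 2)
    (h1 : sqNorm (volΩ c d) ((pd i)^[4 - s] ((pd j)^[s] U)) ≤ M)
    (h2 : sqNorm (volΩ c d) ((pd i)^[r] ((pd j)^[4 - r] U)) ≤ M)
    (h3 : sqNorm (volΩ c d) ((pd i)^[2] ((pd j)^[2] U)) ≤ M) :
    sqNorm (volΩ c d) ((pd i)^[r] ((pd j)^[s] (hermErr i (c i) (d i) U +
      (hermErr j (c j) (d j) U - hermErr i (c i) (d i) (hermErr j (c j) (d j) U))))) ≤
      10 * h ^ (2 * (4 - (r + s))) * M := by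
  have hEi := contDiff_hermErr i (c i) (d i) hU
  have hEj := contDiff_hermErr j (c j) (d j) hU
  have hEE := contDiff_hermErr i (c i) (d i) hEj
  have hh0 : 0 ≤ h := (sub_nonneg.2 (hcd i).le).trans (hh i)
  have hM : 0 ≤ M := (sqNorm_nonneg _ _).trans h1
  rw [iterate_pd_add hEi (contDiff_pi_sub hEj hEE), iterate_pd_sub hEj hEE,
    iterate_pd_add (contDiff_iterate_pd hEi j s)
      (contDiff_pi_sub (contDiff_iterate_pd hEj j s) (contDiff_iterate_pd hEE j s)),
    iterate_pd_sub (contDiff_iterate_pd hEj j s) (contDiff_iterate_pd hEE j s)]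
  have A : sqNorm (volΩ c d) ((pd i)^[r] ((pd j)^[s] (hermErr i (c i) (d i) U))) ≤
      h ^ (2 * (4 - (r + s))) * M := by
    rw [iterate_pd_hermErr_of_ne hij.symm _ _ hU]
    have := sqNorm_hermErr_le hcd i (contDiff_iterate_pd hU j s) (r := r) (σ := 4 - s)
      (by omega) (by omega) (by omega) (hh i)
    rw [show 4 - s - r = 4 - (r + s) by omega] at this
    exact this.trans (mul_le_mul_of_nonneg_left h1 (by positivity))
  have B : sqNorm (volΩ c d) ((pd i)^[r] ((pd j)^[s] (hermErr j (c j) (d j) U))) ≤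
      h ^ (2 * (4 - (r + s))) * M := by
    rw [iterate_pd_comm hEj, iterate_pd_hermErr_of_ne hij _ _ hU]
    have := sqNorm_hermErr_le hcd j (contDiff_iterate_pd hU i r) (r := s) (σ := 4 - r)
      (by omega) (by omega) (by omega) (hh j)
    rw [show 4 - r - s = 4 - (r + s) by omega, iterate_pd_comm hU] at this
    exact this.trans (mul_le_mul_of_nonneg_left h2 (by positivity))
  have D : sqNorm (volΩ c d) ((pd i)^[r] ((pd j)^[s]
      (hermErr i (c i) (d i) (hermErr j (c j) (d j) U)))) ≤ h ^ (2 * (4 - (r + s))) * M := by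
    rw [iterate_pd_hermErr_of_ne hij.symm _ _ hEj]
    have t1 := sqNorm_hermErr_le hcd i (contDiff_iterate_pd hEj j s) (r := r) (σ := 2)
      (by omega) (by omega) (by omega) (hh i)
    rw [iterate_pd_comm hEj, iterate_pd_hermErr_of_ne hij _ _ hU] at t1
    have t2 := sqNorm_hermErr_le hcd j (contDiff_iterate_pd hU i 2) (r := s) (σ := 2)
      (by omega) (by omega) (by omega) (hh j)
    rw [iterate_pd_comm hU] at t2
    have t3 := t2.trans (mul_le_mul_of_nonneg_left h3 (by positivity))
    refine t1.trans ((mul_le_mul_of_nonneg_left t3 (by positivity)).trans (le_of_eq ?_))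
    rw [← mul_assoc, ← pow_add]
    congr 2
    omega
  have mm : ∀ {f : (Fin (n + 1) → ℝ) → ℂ}, ContDiff ℝ ∞ f →
      MemLp ((pd i)^[r] ((pd j)^[s] f)) 2 (volΩ c d) := fun hf =>
    memLp_of_contDiff (contDiff_iterate_pd (contDiff_iterate_pd hf j s) i r)
  have s1 := sqNorm_add_le (mm hEi) ((mm hEj).sub (mm hEE))
  have s2 := sqNorm_sub_le (mm hEj) (mm hEE)
  linarith

end Hermite

/-! ### Cubic splines -/

section Spline

theorem hasDerivAt_max_pow (k : ℕ) (t : ℝ) :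
    HasDerivAt (fun t : ℝ => max t 0 ^ (k + 2)) ((k + 2 : ℕ) * max t 0 ^ (k + 1)) t := by
  rcases lt_trichotomy t 0 with ht | rfl | ht
  · rw [max_eq_right ht.le]
    refine ((hasDerivAt_const t (0 : ℝ)).congr_of_eventuallyEq ?_).congr_deriv (by simp)
    filter_upwards [gt_mem_nhds ht] with s hs
    simp [max_eq_right hs.le]
  · rw [hasDerivAt_iff_isLittleO_nhds_zero]
    simp only [zero_add, max_self, ne_eq, Nat.add_eq_zero_iff, OfNat.ofNat_ne_zero, and_false,
      not_false_eq_true, zero_pow, sub_zero, one_ne_zero, mul_zero, smul_zero]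
    refine Asymptotics.IsBigO.trans_isLittleO ?_
      (Asymptotics.isLittleO_pow_id (𝕜 := ℝ) (n := k + 2) (by omega))
    refine Asymptotics.IsBigO.of_bound 1 (Eventually.of_forall fun s => ?_)
    rw [norm_pow, norm_pow, one_mul]
    refine pow_le_pow_left₀ (norm_nonneg _) ?_ _
    rw [Real.norm_eq_abs, Real.norm_eq_abs, abs_of_nonneg (le_max_right _ _)]
    exact max_le (le_abs_self s) (abs_nonneg s)
  · rw [max_eq_left ht.le]
    refine ((hasDerivAt_pow (k + 2) t).congr_of_eventuallyEq ?_).congr_deriv (by simp)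
    filter_upwards [lt_mem_nhds ht] with s hs
    simp [max_eq_left hs.le]

theorem contDiff_max_pow (k : ℕ) : ContDiff ℝ 1 fun t : ℝ => max t 0 ^ (k + 2) := by
  rw [contDiff_one_iff_deriv]
  refine ⟨fun t => (hasDerivAt_max_pow k t).differentiableAt, ?_⟩
  rw [show deriv (fun t : ℝ => max t 0 ^ (k + 2)) = fun t => ((k + 2 : ℕ) : ℝ) * max t 0 ^ (k + 1)
    from funext fun t => (hasDerivAt_max_pow k t).deriv]
  fun_prop

/-- Induction over the nodes. Adding multiples of the truncated powers `(t - c)₊²` and `(t - c)₊³`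
at the last node keeps the function `C¹` and unchanged to the left, and leaves two free coefficients
on the right, which are fixed by value and slope at the next node. The last clause, a cubic beyond
the last node, is what the induction needs. -/
theorem exists_spline_nat (x y z : ℕ → ℝ) (M : ℕ) (hx : ∀ j < M, x j < x (j + 1)) :
    ∃ (s : ℝ → ℝ) (α β : ℝ), ContDiff ℝ 1 s ∧
      (∀ j < M, ∀ t ∈ Set.Icc (x j) (x (j + 1)), s t =
        y j * (valL (x j) (x (j + 1))).eval t + y (j + 1) * (valR (x j) (x (j + 1))).eval t +
        z j * (derL (x j) (x (j + 1))).eval t + z (j + 1) * (derR (x j) (x (j + 1))).eval t) ∧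
      ∀ t, x M ≤ t → s t = (cubicAt (x M) (y M) (z M) α β).eval t := by
  induction M with
  | zero =>
    refine ⟨fun t => y 0 + z 0 * (t - x 0), 0, 0, by fun_prop, by simp, fun t _ => ?_⟩
    simp [cubicAt_eval]
  | succ M ih =>
    obtain ⟨s, α, β, hs, hc, hr⟩ := ih fun j hj => hx j (by omega)
    have hlt := hx M (by omega)
    set c := x M with hcdef
    set d := x (M + 1) with hddef
    have hl : d - c ≠ 0 := sub_ne_zero.2 hlt.ne'
    -- Second and third coefficients, at `c`, of the cubic with the prescribed values and slopes at
    -- `c` and `d`.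
    set A := 3 * (y (M + 1) - y M) / (d - c) ^ 2 - (2 * z M + z (M + 1)) / (d - c) with hA
    set B := 2 * (y M - y (M + 1)) / (d - c) ^ 3 + (z M + z (M + 1)) / (d - c) ^ 2 with hB
    have hnew : ∀ t, c ≤ t → s t + ((A - α) * max (t - c) 0 ^ 2 + (B - β) * max (t - c) 0 ^ 3) =
        y M + z M * (t - c) + A * (t - c) ^ 2 + B * (t - c) ^ 3 := by
      intro t ht
      rw [hr t ht, cubicAt_eval, max_eq_left (sub_nonneg.2 ht)]
      ring
    -- The correction replaces the coefficients `α`, `β` to the right of `c` by `A`, `B`. Expanding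
    -- the new cubic at `d` instead of `c` gives the coefficients `A + 3B(d - c)` and `B`.
    refine ⟨fun t => s t + ((A - α) * max (t - c) 0 ^ 2 + (B - β) * max (t - c) 0 ^ 3),
      A + 3 * B * (d - c), B, ?_, ?_, ?_⟩
    · have h2 : ContDiff ℝ 1 fun t : ℝ => max (t - c) 0 ^ 2 :=
        (contDiff_max_pow 0).comp (contDiff_id.sub contDiff_const)
      have h3 : ContDiff ℝ 1 fun t : ℝ => max (t - c) 0 ^ 3 :=
        (contDiff_max_pow 1).comp (contDiff_id.sub contDiff_const)
      exact hs.add ((contDiff_const.mul h2).add (contDiff_const.mul h3))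
    · intro j hj t ht
      rcases Nat.lt_succ_iff_lt_or_eq.1 hj with hj' | rfl
      · have hmono : x (j + 1) ≤ x M := by
          have : ∀ m, j + 1 + m ≤ M → x (j + 1) ≤ x (j + 1 + m) := by
            intro m
            induction m with
            | zero => intro _; exact le_rfl
            | succ m ihm => intro hm; exact (ihm (by omega)).trans (hx _ (by omega)).le
          have h := this (M - (j + 1)) (by omega)
          rwa [show j + 1 + (M - (j + 1)) = M by omega] at h
        have : t - c ≤ 0 := by linarith [ht.2]
        simp only [max_eq_right this]
        rw [hc j hj' t ht]
        ring
      · refine (hnew t ht.1).trans ?_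
        simp only [valL, valR, derL, derR, cubicAt_eval, ← hcdef, ← hddef, hA, hB]
        field_simp
        ring
    · intro t ht
      refine (hnew t (hlt.le.trans ht)).trans ?_
      rw [cubicAt_eval, hA, hB]
      field_simp
      ring

theorem exists_spline {M : ℕ} {x : Fin (M + 1) → ℝ} (hx : StrictMono x) (y z : Fin (M + 1) → ℝ) :
    ∃ s : ℝ → ℝ, ContDiff ℝ 1 s ∧
      ∀ j : Fin M, ∀ t ∈ Set.Icc (x j.castSucc) (x j.succ), s t =
        y j.castSucc * (valL (x j.castSucc) (x j.succ)).eval t +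
        y j.succ * (valR (x j.castSucc) (x j.succ)).eval t +
        z j.castSucc * (derL (x j.castSucc) (x j.succ)).eval t +
        z j.succ * (derR (x j.castSucc) (x j.succ)).eval t := by
  set e : (Fin (M + 1) → ℝ) → ℕ → ℝ := fun f j => if h : j < M + 1 then f ⟨j, h⟩ else 0 with he
  have e1 : ∀ f (j : Fin M), e f j = f j.castSucc := fun f j => by
    simp only [he]; rw [dif_pos (by omega)]; rfl
  have e2 : ∀ f (j : Fin M), e f (j + 1) = f j.succ := fun f j => by
    simp only [he]; rw [dif_pos (by omega)]; rfl
  obtain ⟨s, α, β, hs, hc, -⟩ := exists_spline_nat (e x) (e y) (e z) M fun j hj => by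
    have h1 := e1 x ⟨j, hj⟩
    have h2 := e2 x ⟨j, hj⟩
    simp only [] at h1 h2
    rw [h1, h2]
    exact hx Fin.castSucc_lt_succ
  refine ⟨s, hs, fun j t ht => ?_⟩
  have := hc j j.2 t (by rwa [e1, e2])
  simpa only [e1, e2] using this

end Spline

/-! ### The mesh -/

section Mesh

variable {n : ℕ} {a b : Fin (n + 1) → ℝ} (T : TensorMesh a b)

/-- The lower corner of an element. -/
def cellL (J : (i : Fin (n + 1)) → Fin (T.cells i)) (i : Fin (n + 1)) : ℝ :=
  T.node i (J i).castSucc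

/-- The upper corner of an element. -/
def cellR (J : (i : Fin (n + 1)) → Fin (T.cells i)) (i : Fin (n + 1)) : ℝ :=
  T.node i (J i).succ

/-- The coordinates of the nodes. -/
def gridSet : Set ℝ := ⋃ i, Set.range (T.node i)

theorem countable_gridSet : (gridSet T).Countable :=
  Set.countable_iUnion fun i => Set.countable_range (T.node i)

theorem cell_lt (J : (i : Fin (n + 1)) → Fin (T.cells i)) (i : Fin (n + 1)) :
    cellL T J i < cellR T J i := T.strictMono i Fin.castSucc_lt_succ

theorem le_cellL (J : (i : Fin (n + 1)) → Fin (T.cells i)) (i : Fin (n + 1)) :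
    a i ≤ cellL T J i := by
  rw [← T.node_first i]; exact (T.strictMono i).monotone (Fin.zero_le _)

theorem cellR_le (J : (i : Fin (n + 1)) → Fin (T.cells i)) (i : Fin (n + 1)) :
    cellR T J i ≤ b i := by
  rw [← T.node_last i]; exact (T.strictMono i).monotone (Fin.le_last _)

theorem cell_subset (J : (i : Fin (n + 1)) → Fin (T.cells i)) : T.cell J ⊆ Set.Icc a b :=
  Set.Icc_subset_Icc (fun i => le_cellL T J i) fun i => cellR_le T J i

theorem openCell_subset (J : (i : Fin (n + 1)) → Fin (T.cells i)) :
    openBox (cellL T J) (cellR T J) ⊆ openBox a b := fun _ hx i _ =>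
  ⟨(le_cellL T J i).trans_lt (hx i trivial).1, (hx i trivial).2.trans_le (cellR_le T J i)⟩

theorem exists_openCell {x : Fin (n + 1) → ℝ} (hx : x ∈ openBox a b)
    (hxS : ∀ i, x i ∉ gridSet T) : ∃ J, x ∈ openBox (cellL T J) (cellR T J) := by
  have h : ∀ i, ∃ j : Fin (T.cells i), x i ∈ Set.Ioo (T.node i j.castSucc) (T.node i j.succ) := by
    intro i
    by_contra! hne
    -- If no cell contains `x i`, which is not a node, then induction pushes `x i` beyond every
    -- node, including the last one, `b i`.
    have hall : ∀ j : Fin (T.cells i + 1), T.node i j < x i := by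
      intro j
      induction j using Fin.induction with
      | zero => rw [T.node_first]; exact (hx i trivial).1
      | succ j ih =>
        have h1 := hne j
        rw [Set.mem_Ioo, not_and, not_lt] at h1
        refine lt_of_le_of_ne (h1 ih) fun he => hxS i ?_
        exact Set.mem_iUnion.2 ⟨i, j.succ, he⟩
    have := hall (Fin.last _)
    rw [T.node_last] at this
    exact lt_asymm this (hx i trivial).2
  choose J hJ using h
  exact ⟨J, fun i _ => hJ i⟩

theorem disjoint_openCell : Pairwise (Function.onFun Disjoint
    fun J : (i : Fin (n + 1)) → Fin (T.cells i) => openBox (cellL T J) (cellR T J)) := by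
  intro J J' hJ
  rw [Function.onFun, Set.disjoint_left]
  intro x hx hx'
  apply hJ
  have key : ∀ J J' : (i : Fin (n + 1)) → Fin (T.cells i), x ∈ openBox (cellL T J) (cellR T J) →
      x ∈ openBox (cellL T J') (cellR T J') → ∀ i, ¬ J i < J' i := by
    intro J J' hx hx' i hlt
    have h1 : cellR T J i ≤ cellL T J' i := (T.strictMono i).monotone (by
      rw [Fin.le_def]; simp only [Fin.val_succ, Fin.val_castSucc]; exact hlt)
    linarith [(hx i trivial).2, (hx' i trivial).1]
  ext1 i
  exact le_antisymm (not_lt.1 (key J' J hx' hx i)) (not_lt.1 (key J J' hx hx' i))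

theorem volΩ_eq_sum : volΩ a b = ∑ J, volΩ (cellL T J) (cellR T J) := by
  have h1 : (openBox a b : Set (Fin (n + 1) → ℝ)) =ᵐ[volume]
      ⋃ J, openBox (cellL T J) (cellR T J) := by
    have h2 : ∀ᵐ x ∂(volume.restrict (openBox a b)), ∃ J, x ∈ openBox (cellL T J) (cellR T J) := by
      filter_upwards [ae_openBox (a := a) (b := b) (countable_gridSet T)] with x hx
      exact exists_openCell T hx.1 hx.2
    rw [ae_restrict_iff' isOpen_openBox.measurableSet] at h2
    filter_upwards [h2] with x hx
    refine propext ⟨fun h => Set.mem_iUnion.2 (hx h), fun h => ?_⟩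
    obtain ⟨J, hJ⟩ := Set.mem_iUnion.1 h
    exact openCell_subset T J hJ
  rw [volΩ, Measure.restrict_congr_set h1, Measure.restrict_iUnion (disjoint_openCell T)
    fun J => isOpen_openBox.measurableSet, Measure.sum_fintype]
  rfl

theorem sqNorm_eq_sum {F : (Fin (n + 1) → ℝ) → ℂ} (hF : MemLp F 2 (volΩ a b)) :
    sqNorm (volΩ a b) F = ∑ J, sqNorm (volΩ (cellL T J) (cellR T J)) F := by
  have h := integrable_norm_sq hF
  rw [volΩ_eq_sum T] at h
  simp only [sqNorm]
  rw [volΩ_eq_sum T, integral_finsetSum_measure fun J _ => (integrable_finsetSum_measure.1 h) J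
    (Finset.mem_univ J)]

theorem cell_side_le (J : (i : Fin (n + 1)) → Fin (T.cells i)) (i : Fin (n + 1)) :
    cellR T J i - cellL T J i ≤ T.width := by
  have h1 : √(∑ i, (T.node i (J i).succ - T.node i (J i).castSucc) ^ 2) ≤ T.width :=
    le_ciSup (f := fun J : (i : Fin (n + 1)) → Fin (T.cells i) =>
      √(∑ i, (T.node i (J i).succ - T.node i (J i).castSucc) ^ 2)) (Set.finite_range _).bddAbove J
  refine le_trans ?_ h1
  apply Real.le_sqrt_of_sq_le
  exact Finset.single_le_sum (f := fun i => (T.node i (J i).succ - T.node i (J i).castSucc) ^ 2)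
    (fun j _ => sq_nonneg _) (Finset.mem_univ i)

/-! ### Tensor products of splines -/

theorem degreeOf_aeval_X_le {m : ℕ} (i j : Fin m) (q : Polynomial ℝ) :
    (Polynomial.aeval (MvPolynomial.X j : MvPolynomial (Fin m) ℝ) q).degreeOf i ≤
      if i = j then q.natDegree else 0 := by
  rw [Polynomial.aeval_eq_sum_range]
  refine (MvPolynomial.degreeOf_sum_le _ _ _).trans (Finset.sup_le fun k hk => ?_)
  rw [MvPolynomial.smul_eq_C_mul]
  refine (MvPolynomial.degreeOf_C_mul_le _ _ _).trans ?_
  split_ifs with h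
  · subst h
    rw [MvPolynomial.degreeOf_X_self_pow]
    exact Nat.lt_succ_iff.1 (Finset.mem_range.1 hk)
  · rw [MvPolynomial.degreeOf_X_pow_of_ne k h]

/-- The functions `σ₁(x₁) ⋯ σ_d(x_d)`, restricted to the domain. -/
def tensorFun (a b : Fin (n + 1) → ℝ) (σ : Fin (n + 1) → ℝ → ℝ) : (Fin (n + 1) → ℝ) → ℝ :=
  (Set.Icc a b).indicator fun x => ∏ i, σ i (x i)

theorem tensorFun_mem {p : ℕ} {σ : Fin (n + 1) → ℝ → ℝ} (hσ : ∀ i, ContDiff ℝ 1 (σ i))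
    (hq : ∀ i (j : Fin (T.cells i)), ∃ q : Polynomial ℝ, q.natDegree ≤ p ∧
      ∀ t ∈ Set.Icc (T.node i j.castSucc) (T.node i j.succ), σ i t = q.eval t) :
    tensorFun a b σ ∈ femSpace T p := by
  refine ⟨?_, fun x hx => Set.indicator_of_notMem hx _, fun J => ?_⟩
  · have h : ContDiff ℝ 1 fun x : Fin (n + 1) → ℝ => ∏ i, σ i (x i) :=
      contDiff_prod fun i _ => (hσ i).comp (contDiff_apply ℝ ℝ i)
    exact h.contDiffOn.congr fun x hx => Set.indicator_of_mem hx _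
  · choose q hqd hqe using fun i => hq i (J i)
    refine ⟨∏ i, Polynomial.aeval (MvPolynomial.X i) (q i), fun i => ?_, fun x hx => ?_⟩
    · refine (MvPolynomial.degreeOf_prod_le _ _ _).trans ?_
      refine (Finset.sum_le_sum fun j _ => degreeOf_aeval_X_le i j (q j)).trans ?_
      rw [Finset.sum_ite_eq]
      simpa using hqd i
    · rw [tensorFun, Set.indicator_of_mem (cell_subset T J hx), map_prod]
      refine Finset.prod_congr rfl fun i _ => ?_
      rw [hqe i (x i) ⟨hx.1 i, hx.2 i⟩]
      have := Polynomial.aeval_algHom_apply (MvPolynomial.aeval (R := ℝ) x) (MvPolynomial.X i) (q i)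
      rw [MvPolynomial.aeval_X] at this
      rw [← MvPolynomial.coe_aeval_eq_eval]
      simp only [RingHom.coe_coe]
      rw [← this, Polynomial.coe_aeval_eq_eval]

end Mesh

section Mesh

variable {n : ℕ} {a b : Fin (n + 1) → ℝ} (T : TensorMesh a b)

/-! ### Functions that are smooth on each element -/

theorem cgrad_eq_of_eqOn {J : (i : Fin (n + 1)) → Fin (T.cells i)}
    {v W : (Fin (n + 1) → ℝ) → ℂ} (h : Set.EqOn v W (openBox (cellL T J) (cellR T J)))
    {x : Fin (n + 1) → ℝ} (hx : x ∈ openBox (cellL T J) (cellR T J)) (i : Fin (n + 1)) :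
    cgrad a b v i x = pd i W x := by
  rw [cgrad_eq_fderiv (openCell_subset T J hx), pd,
    (h.eventuallyEq_of_mem (isOpen_openBox.mem_nhds hx)).fderiv_eq]

theorem hess_eq_of_eqOn {J : (i : Fin (n + 1)) → Fin (T.cells i)}
    {v W : (Fin (n + 1) → ℝ) → ℂ} (h : Set.EqOn v W (openBox (cellL T J) (cellR T J)))
    {x : Fin (n + 1) → ℝ} (hx : x ∈ openBox (cellL T J) (cellR T J)) (i j : Fin (n + 1)) :
    hess v i j x = pd i (pd j W) x := by
  have h1 : (fun y => fderiv ℝ v y (Pi.single j 1)) =ᶠ[𝓝 x] pd j W := by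
    filter_upwards [isOpen_openBox.mem_nhds hx] with y hy
    rw [pd, (h.eventuallyEq_of_mem (isOpen_openBox.mem_nhds hy)).fderiv_eq]
  rw [hess, h1.fderiv_eq]
  rfl

theorem mem_gridC2_of_eqOn {v : (Fin (n + 1) → ℝ) → ℂ} (hv : ContDiffOn ℝ 1 v (Set.Icc a b))
    {W : ((i : Fin (n + 1)) → Fin (T.cells i)) → (Fin (n + 1) → ℝ) → ℂ}
    (hW : ∀ J, ContDiff ℝ ∞ (W J))
    (h : ∀ J, Set.EqOn v (W J) (openBox (cellL T J) (cellR T J))) :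
    v ∈ gridC2 a b (gridSet T) := by
  refine ⟨hv, fun x hx hxS => ?_, ?_⟩
  · obtain ⟨J, hJ⟩ := exists_openCell T hx hxS
    exact ((hW J).contDiffAt.of_le (by norm_cast)).congr_of_eventuallyEq
      ((h J).eventuallyEq_of_mem (isOpen_openBox.mem_nhds hJ))
  · have hb : ∀ (J : (i : Fin (n + 1)) → Fin (T.cells i)) (i j : Fin (n + 1)),
        ∃ M, ∀ x ∈ Set.Icc a b, ‖pd i (pd j (W J)) x‖ ≤ M := fun J i j =>
      isCompact_Icc.exists_bound_of_continuousOn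
        (contDiff_pd (contDiff_pd (hW J) j) i).continuous.continuousOn
    choose M hM using hb
    refine ⟨∑ J, ∑ i, ∑ j, |M J i j|, fun x hx hxS i j => ?_⟩
    obtain ⟨J, hJ⟩ := exists_openCell T hx hxS
    rw [hess_eq_of_eqOn T (h J) hJ]
    refine (hM J i j x (openBox_subset_Icc hx)).trans ((le_abs_self _).trans ?_)
    have h1 : |M J i j| ≤ ∑ j, |M J i j| :=
      Finset.single_le_sum (f := fun j => |M J i j|) (fun _ _ => abs_nonneg _) (Finset.mem_univ j)
    have h2 : ∑ j, |M J i j| ≤ ∑ i, ∑ j, |M J i j| :=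
      Finset.single_le_sum (f := fun i => ∑ j, |M J i j|)
        (fun _ _ => Finset.sum_nonneg fun _ _ => abs_nonneg _) (Finset.mem_univ i)
    have h3 : ∑ i, ∑ j, |M J i j| ≤ ∑ J, ∑ i, ∑ j, |M J i j| :=
      Finset.single_le_sum (f := fun J => ∑ i, ∑ j, |M J i j|)
        (fun _ _ => Finset.sum_nonneg fun _ _ => Finset.sum_nonneg fun _ _ => abs_nonneg _)
        (Finset.mem_univ J)
    exact h1.trans (h2.trans h3)

theorem contDiff_mvPolynomial_eval {m : ℕ} (q : MvPolynomial (Fin m) ℝ) :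
    ContDiff ℝ ∞ fun x : Fin m → ℝ => MvPolynomial.eval x q := by
  induction q using MvPolynomial.induction_on with
  | C r => simpa using contDiff_const
  | add p q hp hq => simpa using hp.add hq
  | mul_X p i hp => simpa using hp.mul (contDiff_apply ℝ ℝ i)

theorem openCell_subset_cell (J : (i : Fin (n + 1)) → Fin (T.cells i)) :
    openBox (cellL T J) (cellR T J) ⊆ T.cell J := openBox_subset_Icc

theorem toC_mem_gridC2 {p : ℕ} {v : (Fin (n + 1) → ℝ) → ℝ} (hv : v ∈ femSpace T p) :
    toC v ∈ gridC2 a b (gridSet T) := by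
  obtain ⟨h1, -, h2⟩ := hv
  choose q _ hq using h2
  refine mem_gridC2_of_eqOn T (Complex.ofRealCLM.contDiff.comp_contDiffOn h1)
    (W := fun J => toC fun x => MvPolynomial.eval x (q J))
    (fun J => Complex.ofRealCLM.contDiff.comp (contDiff_mvPolynomial_eval (q J))) fun J x hx => ?_
  simp only [toC, hq J x (openCell_subset_cell T J hx)]

theorem contDiff_mem_gridC2 {U : (Fin (n + 1) → ℝ) → ℂ} (hU : ContDiff ℝ ∞ U) (S : Set ℝ) :
    U ∈ gridC2 a b S := by
  refine ⟨(hU.of_le (by simp)).contDiffOn, fun x _ _ => hU.contDiffAt.of_le (by norm_cast), ?_⟩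
  have hb : ∀ (i j : Fin (n + 1)), ∃ M, ∀ x ∈ Set.Icc a b, ‖pd i (pd j U) x‖ ≤ M := fun i j =>
    isCompact_Icc.exists_bound_of_continuousOn
      (contDiff_pd (contDiff_pd hU j) i).continuous.continuousOn
  choose M hM using hb
  refine ⟨∑ i, ∑ j, |M i j|, fun x hx _ i j => ?_⟩
  refine (hM i j x (openBox_subset_Icc hx)).trans ((le_abs_self _).trans ?_)
  have h1 : |M i j| ≤ ∑ j, |M i j| :=
    Finset.single_le_sum (f := fun j => |M i j|) (fun _ _ => abs_nonneg _) (Finset.mem_univ j)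
  have h2 : ∑ j, |M i j| ≤ ∑ i, ∑ j, |M i j| :=
    Finset.single_le_sum (f := fun i => ∑ j, |M i j|)
      (fun _ _ => Finset.sum_nonneg fun _ _ => abs_nonneg _) (Finset.mem_univ i)
  exact h1.trans h2

/-! ### Hermite interpolation on the mesh -/

/-- The spline with value `1` at the node `m`, value `0` at the other nodes, and derivative `0` at
all nodes. -/
def valSpline (i : Fin (n + 1)) (m : Fin (T.cells i + 1)) : ℝ → ℝ :=
  (exists_spline (T.strictMono i) (Pi.single m 1) 0).choose

/-- The spline with derivative `1` at the node `m`, derivative `0` at the other nodes, and value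
`0` at all nodes. -/
def derSpline (i : Fin (n + 1)) (m : Fin (T.cells i + 1)) : ℝ → ℝ :=
  (exists_spline (T.strictMono i) 0 (Pi.single m 1)).choose

/-- The functions of one variable from which the discrete space is built. -/
def IsSpline (i : Fin (n + 1)) (σ : ℝ → ℝ) : Prop :=
  ContDiff ℝ 1 σ ∧ ∀ j : Fin (T.cells i), ∃ q : Polynomial ℝ, q.natDegree ≤ 3 ∧
    ∀ t ∈ Set.Icc (T.node i j.castSucc) (T.node i j.succ), σ t = q.eval t

theorem isSpline_of_hermite {i : Fin (n + 1)} {σ : ℝ → ℝ} {y z : Fin (T.cells i + 1) → ℝ}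
    (h : ContDiff ℝ 1 σ ∧ ∀ j : Fin (T.cells i),
      ∀ t ∈ Set.Icc (T.node i j.castSucc) (T.node i j.succ), σ t =
        y j.castSucc * (valL (T.node i j.castSucc) (T.node i j.succ)).eval t +
        y j.succ * (valR (T.node i j.castSucc) (T.node i j.succ)).eval t +
        z j.castSucc * (derL (T.node i j.castSucc) (T.node i j.succ)).eval t +
        z j.succ * (derR (T.node i j.castSucc) (T.node i j.succ)).eval t) : IsSpline T i σ := by
  refine ⟨h.1, fun j => ⟨.C (y j.castSucc) * valL (T.node i j.castSucc) (T.node i j.succ) +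
    .C (y j.succ) * valR (T.node i j.castSucc) (T.node i j.succ) +
    .C (z j.castSucc) * derL (T.node i j.castSucc) (T.node i j.succ) +
    .C (z j.succ) * derR (T.node i j.castSucc) (T.node i j.succ), ?_, fun t ht => ?_⟩⟩
  · have h1 : ∀ (r : ℝ) (c α β γ δ : ℝ), (Polynomial.C r * cubicAt c α β γ δ).natDegree ≤ 3 :=
      fun r c α β γ δ => (Polynomial.natDegree_C_mul_le _ _).trans (cubicAt_natDegree_le _ _ _ _ _)
    have h2 : ∀ {p q : Polynomial ℝ}, p.natDegree ≤ 3 → q.natDegree ≤ 3 → (p + q).natDegree ≤ 3 :=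
      fun hp hq => (Polynomial.natDegree_add_le _ _).trans (max_le hp hq)
    exact h2 (h2 (h2 (h1 _ _ _ _ _ _) (h1 _ _ _ _ _ _)) (h1 _ _ _ _ _ _)) (h1 _ _ _ _ _ _)
  · rw [h.2 j t ht]
    simp

theorem isSpline_valSpline (i : Fin (n + 1)) (m : Fin (T.cells i + 1)) :
    IsSpline T i (valSpline T i m) :=
  isSpline_of_hermite T (exists_spline (T.strictMono i) (Pi.single m 1) 0).choose_spec

theorem isSpline_derSpline (i : Fin (n + 1)) (m : Fin (T.cells i + 1)) :
    IsSpline T i (derSpline T i m) :=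
  isSpline_of_hermite T (exists_spline (T.strictMono i) 0 (Pi.single m 1)).choose_spec

theorem sum_single_mul {M : ℕ} (m : Fin M) (F : Fin M → ℂ) (r : ℝ) :
    ∑ l, ((Pi.single l 1 : Fin M → ℝ) m * r) • F l = r • F m := by
  rw [Finset.sum_eq_single m]
  · simp
  · intro l _ hl
    simp [Ne.symm hl]
  · simp

/-- Hermite interpolation on the mesh in the variable `x_i`, with values given by `F` and
derivatives given by `G`. -/
def meshHermite (i : Fin (n + 1)) (F G : (Fin (n + 1) → ℝ) → ℂ) : (Fin (n + 1) → ℝ) → ℂ :=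
  fun x => ∑ m, (valSpline T i m (x i) • F (Function.update x i (T.node i m)) +
    derSpline T i m (x i) • G (Function.update x i (T.node i m)))

/-- On a cell only the splines of its two end nodes are nonzero, and there they are the four Hermite
cubics. Hence the element-wise interpolants are restrictions of one global combination of `C¹`
splines. Only the `i`-th coordinate has to lie in the cell. -/
theorem meshHermite_eq {J : (i : Fin (n + 1)) → Fin (T.cells i)} {x : Fin (n + 1) → ℝ}
    {i : Fin (n + 1)} (hx : x i ∈ Set.Icc (cellL T J i) (cellR T J i))
    (F G : (Fin (n + 1) → ℝ) → ℂ) :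
    meshHermite T i F G x = hermite i (cellL T J i) (cellR T J i) F G x := by
  have hv : ∀ m, valSpline T i m (x i) =
      (Pi.single m 1 : Fin (T.cells i + 1) → ℝ) (J i).castSucc *
        (valL (cellL T J i) (cellR T J i)).eval (x i) +
      (Pi.single m 1 : Fin (T.cells i + 1) → ℝ) (J i).succ *
        (valR (cellL T J i) (cellR T J i)).eval (x i) := by
    intro m
    have := (exists_spline (T.strictMono i) (Pi.single m 1) 0).choose_spec.2 (J i) (x i) hx
    simp only [Pi.zero_apply, zero_mul, add_zero] at this
    exact this
  have hd : ∀ m, derSpline T i m (x i) =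
      (Pi.single m 1 : Fin (T.cells i + 1) → ℝ) (J i).castSucc *
        (derL (cellL T J i) (cellR T J i)).eval (x i) +
      (Pi.single m 1 : Fin (T.cells i + 1) → ℝ) (J i).succ *
        (derR (cellL T J i) (cellR T J i)).eval (x i) := by
    intro m
    have := (exists_spline (T.strictMono i) 0 (Pi.single m 1)).choose_spec.2 (J i) (x i) hx
    simp only [Pi.zero_apply, zero_mul, zero_add] at this
    exact this
  rw [meshHermite]
  simp only [hv, hd, add_smul, Finset.sum_add_distrib]
  rw [sum_single_mul (J i).castSucc (fun m => F (Function.update x i (T.node i m))),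
    sum_single_mul (J i).succ (fun m => F (Function.update x i (T.node i m))),
    sum_single_mul (J i).castSucc (fun m => G (Function.update x i (T.node i m))),
    sum_single_mul (J i).succ (fun m => G (Function.update x i (T.node i m)))]
  rfl

/-- The complex span of the discrete space. -/
def femC (p : ℕ) : Submodule ℂ ((Fin (n + 1) → ℝ) → ℂ) :=
  Submodule.span ℂ (toC '' (femSpace T p : Set ((Fin (n + 1) → ℝ) → ℝ)))

theorem femC_le_gridC2 (p : ℕ) : femC T p ≤ gridC2 a b (gridSet T) := by
  rw [femC, Submodule.span_le]
  rintro _ ⟨v, hv, rfl⟩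
  exact toC_mem_gridC2 T hv

theorem toC_tensorFun_mem {p : ℕ} (hp : 3 ≤ p) {σ : Fin (n + 1) → ℝ → ℝ}
    (hσ : ∀ i, IsSpline T i (σ i)) : toC (tensorFun a b σ) ∈ femC T p := by
  refine Submodule.subset_span ⟨_, tensorFun_mem T (fun i => (hσ i).1) fun i j => ?_, rfl⟩
  obtain ⟨q, hq, h⟩ := (hσ i).2 j
  exact ⟨q, hq.trans hp, h⟩

end Mesh

theorem exists_interpolant_zero {a b : Fin 1 → ℝ} (T : TensorMesh a b) {p : ℕ} (hp : 3 ≤ p)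
    (F G : (Fin 1 → ℝ) → ℂ) :
    ∃ v ∈ femC T p, ∀ x ∈ Set.Icc a b, v x = meshHermite T 0 F G x := by
  refine ⟨∑ m, (F (fun _ => T.node 0 m) • toC (tensorFun a b fun _ => valSpline T 0 m) +
    G (fun _ => T.node 0 m) • toC (tensorFun a b fun _ => derSpline T 0 m)), ?_, fun x hx => ?_⟩
  · refine Submodule.sum_mem _ fun m _ => Submodule.add_mem _ (Submodule.smul_mem _ _ ?_)
      (Submodule.smul_mem _ _ ?_)
    · refine toC_tensorFun_mem T hp fun i => ?_
      obtain rfl : i = 0 := Subsingleton.elim (α := Fin 1) _ _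
      exact isSpline_valSpline T 0 m
    · refine toC_tensorFun_mem T hp fun i => ?_
      obtain rfl : i = 0 := Subsingleton.elim (α := Fin 1) _ _
      exact isSpline_derSpline T 0 m
  · rw [Finset.sum_apply, meshHermite]
    refine Finset.sum_congr rfl fun m _ => ?_
    have e : Function.update x 0 (T.node 0 m) = fun _ => T.node 0 m := by
      ext i
      obtain rfl : i = 0 := Subsingleton.elim _ _
      simp
    have pe : ∀ σ : Fin 1 → ℝ → ℝ, tensorFun a b σ x = σ 0 (x 0) := by
      intro σ
      rw [tensorFun, Set.indicator_of_mem hx]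
      exact Fin.prod_univ_one _
    rw [e]
    simp only [Pi.add_apply, Pi.smul_apply, toC, pe, smul_eq_mul, Complex.real_smul]
    ring

/-- Expanding the iterated interpolation gives a sum of products of one spline in each variable,
with the values of the four functions at the mesh points as coefficients. In the application these
are `U`, its two first derivatives and its mixed second derivative. -/
theorem exists_interpolant_one {a b : Fin 2 → ℝ} (T : TensorMesh a b) {p : ℕ} (hp : 3 ≤ p)
    (F G F' G' : (Fin 2 → ℝ) → ℂ) :
    ∃ v ∈ femC T p, ∀ x ∈ Set.Icc a b,
      v x = meshHermite T 0 (meshHermite T 1 F G) (meshHermite T 1 F' G') x := by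
  set pt : Fin (T.cells 0 + 1) → Fin (T.cells 1 + 1) → Fin 2 → ℝ :=
    fun m l => ![T.node 0 m, T.node 1 l] with hpt
  have hmem : ∀ σ τ : ℝ → ℝ, IsSpline T 0 σ → IsSpline T 1 τ →
      toC (tensorFun a b ![σ, τ]) ∈ femC T p := by
    intro σ τ hσ hτ
    refine toC_tensorFun_mem T hp fun i => ?_
    fin_cases i
    · exact hσ
    · exact hτ
  refine ⟨∑ m, ∑ l, (F (pt m l) • toC (tensorFun a b ![valSpline T 0 m, valSpline T 1 l]) +
    G (pt m l) • toC (tensorFun a b ![valSpline T 0 m, derSpline T 1 l]) +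
    (F' (pt m l) • toC (tensorFun a b ![derSpline T 0 m, valSpline T 1 l]) +
    G' (pt m l) • toC (tensorFun a b ![derSpline T 0 m, derSpline T 1 l]))), ?_, fun x hx => ?_⟩
  · refine Submodule.sum_mem _ fun m _ => Submodule.sum_mem _ fun l _ => ?_
    exact Submodule.add_mem _ (Submodule.add_mem _
      (Submodule.smul_mem _ _ (hmem _ _ (isSpline_valSpline T 0 m) (isSpline_valSpline T 1 l)))
      (Submodule.smul_mem _ _ (hmem _ _ (isSpline_valSpline T 0 m) (isSpline_derSpline T 1 l))))
      (Submodule.add_mem _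
      (Submodule.smul_mem _ _ (hmem _ _ (isSpline_derSpline T 0 m) (isSpline_valSpline T 1 l)))
      (Submodule.smul_mem _ _ (hmem _ _ (isSpline_derSpline T 0 m) (isSpline_derSpline T 1 l))))
  · have e : ∀ m l, Function.update (Function.update x 0 (T.node 0 m)) 1 (T.node 1 l) = pt m l := by
      intro m l
      ext i
      fin_cases i <;> simp [hpt]
    rw [Finset.sum_apply]
    simp only [meshHermite, Finset.smul_sum, ← Finset.sum_add_distrib, e, Finset.sum_apply]
    refine Finset.sum_congr rfl fun m _ => Finset.sum_congr rfl fun l _ => ?_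
    have e1 : Function.update x 0 (T.node 0 m) 1 = x 1 := by simp
    have pe : ∀ σ τ : ℝ → ℝ, tensorFun a b ![σ, τ] x = σ (x 0) * τ (x 1) := by
      intro σ τ
      rw [tensorFun, Set.indicator_of_mem hx]
      exact Fin.prod_univ_two _
    simp only [e1, Pi.add_apply, Pi.smul_apply, toC, pe, smul_eq_mul, Complex.real_smul]
    push_cast
    ring

section Box

variable {n : ℕ} {a b : Fin (n + 1) → ℝ} {S : Set ℝ} {w : (Fin (n + 1) → ℝ) → ℂ}

/-! ### The norm on `V₁` in terms of derivatives -/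

theorem sum_csurfGrad_add_cnormalDeriv (hab : ∀ i, a i < b i) (w : (Fin (n + 1) → ℝ) → ℂ) :
    ∀ᵐ x ∂(surf a b), (∑ i, ‖csurfGrad a b w i x‖ ^ 2) + ‖cnormalDeriv a b w x‖ ^ 2 =
      ∑ i, ‖cgrad a b w i x‖ ^ 2 := by
  filter_upwards [ae_surf_normal hab] with x hx
  obtain ⟨-, i, hi⟩ := hx
  obtain ⟨s, hs, hxs⟩ : ∃ s : ℝ, s ^ 2 = 1 ∧ normal a b x = Pi.single i s := by
    rcases hi with h | h
    · exact ⟨-1, by norm_num, h.1⟩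
    · exact ⟨1, by norm_num, h.1⟩
  have h1 : cnormalDeriv a b w x = s * cgrad a b w i x := by
    rw [cnormalDeriv, Finset.sum_eq_single i]
    · simp [hxs]
    · intro l _ hl; simp [hxs, hl]
    · simp
  have h2 : ‖(s : ℂ)‖ ^ 2 = 1 := by
    rw [Complex.norm_real, Real.norm_eq_abs, sq_abs, hs]
  rw [h1, norm_mul, mul_pow, h2, one_mul,
    ← Finset.sum_erase_add _ _ (Finset.mem_univ i),
    ← Finset.sum_erase_add _ (fun j => ‖cgrad a b w j x‖ ^ 2) (Finset.mem_univ i)]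
  simp only [csurfGrad_eq_of_normal hs hxs, if_true, norm_zero]
  rw [Finset.sum_congr rfl fun j hj => by rw [if_neg (Finset.ne_of_mem_erase hj)]]
  ring

/-- The constant in the trace inequality. -/
def faceConst (a b : Fin (n + 1) → ℝ) : ℝ := ∑ i, (2 * (b i - a i)⁻¹ + 4)

theorem faceConst_pos (hab : ∀ i, a i < b i) : 0 < faceConst a b :=
  Finset.sum_pos (fun i _ => by have := sub_pos.2 (hab i); positivity) Finset.univ_nonempty

theorem sqNorm_surf_le_of_bounds (hab : ∀ i, a i < b i) (hS : S.Countable)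
    {F : (Fin (n + 1) → ℝ) → ℂ} {DF : Fin (n + 1) → (Fin (n + 1) → ℝ) → ℂ}
    (hF : ContinuousOn F (Set.Icc a b))
    (hd : ∀ i, ∀ x ∈ openBox a b, (∀ j, x j ∉ S) →
      HasDerivAt (fun t => F (Function.update x i t)) (DF i x) (x i))
    (hi : ∀ i, MemLp (DF i) ⊤ (volΩ a b)) {s t : ℝ} (hs : 0 ≤ s) (ht : 0 ≤ t)
    (h0 : sqNorm (volΩ a b) F ≤ s ^ 2) (h1 : ∀ i, sqNorm (volΩ a b) (DF i) ≤ t ^ 2) :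
    sqNorm (surf a b) F ≤ faceConst a b * (s ^ 2 + s * t) := by
  have hF2 : MemLp F 2 (surf a b) := (memLp_top_surf hab hF).mono_exponent le_top
  rw [sqNorm, integral_surf (integrable_norm_sq hF2), faceConst, Finset.sum_mul]
  refine Finset.sum_le_sum fun i _ => (face_trace_le hab i hS hF (hd i) (hi i)).trans ?_
  have hl := inv_pos.2 (sub_pos.2 (hab i))
  have e0 : √(sqNorm (volΩ a b) F) ≤ s := (Real.sqrt_le_left hs).2 h0
  have e1 : √(sqNorm (volΩ a b) (DF i)) ≤ t := (Real.sqrt_le_left ht).2 (h1 i)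
  have e2 : √(sqNorm (volΩ a b) F) * √(sqNorm (volΩ a b) (DF i)) ≤ s * t :=
    mul_le_mul e0 e1 (Real.sqrt_nonneg _) hs
  have e3 := mul_le_mul_of_nonneg_left h0 hl.le
  have e4 : 0 ≤ (b i - a i)⁻¹ * (s * t) := by positivity
  nlinarith [sq_nonneg s]

/-- The constant in the bound of the `V₁` norm in terms of derivatives. -/
def normConst (a b : Fin (n + 1) → ℝ) : ℝ := ((n : ℝ) + 1) ^ 2 * (1 + faceConst a b)

theorem normConst_pos (hab : ∀ i, a i < b i) : 0 < normConst a b := by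
  have := faceConst_pos hab
  rw [normConst]; positivity

/-- The volume terms are immediate. On `Γ` the surface gradient and the normal derivative together
make up the full gradient, and the trace inequality is applied to `w` and to each first derivative,
which produces the mixed products `s₀ s₁` and `s₁ s₂`. -/
theorem cnormSq_le_of_bounds (hab : ∀ i, a i < b i) (hS : S.Countable) (hw : w ∈ gridC2 a b S)
    {k : ℝ} (hk : 0 < k) {s₀ s₁ s₂ : ℝ} (hs₀ : 0 ≤ s₀) (hs₁ : 0 ≤ s₁) (hs₂ : 0 ≤ s₂)
    (h0 : sqNorm (volΩ a b) w ≤ s₀ ^ 2) (h1 : ∀ i, sqNorm (volΩ a b) (cgrad a b w i) ≤ s₁ ^ 2)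
    (h2 : ∀ i j, sqNorm (volΩ a b) (hess w i j) ≤ s₂ ^ 2) :
    cnormSq a b k w ≤ normConst a b * ((k ^ 2)⁻¹ * s₂ ^ 2 + s₁ ^ 2 + k ^ 2 * s₀ ^ 2 +
      k ^ 2 * (s₀ ^ 2 + s₀ * s₁) + (s₁ ^ 2 + s₁ * s₂)) := by
  set N : ℝ := (n : ℝ) + 1 with hN
  have hN1 : 1 ≤ N := by rw [hN]; linarith [Nat.cast_nonneg (α := ℝ) n]
  have hcard : ((Finset.univ : Finset (Fin (n + 1))).card : ℝ) = N := by simp [hN]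
  set Ct := faceConst a b with hCt
  have hCt0 : 0 < Ct := faceConst_pos hab
  have mw : MemLp w 2 (volΩ a b) := MemLp.two_vol hw.1.continuousOn
  have mg : ∀ i, MemLp (cgrad a b w i) 2 (volΩ a b) := fun i =>
    MemLp.two_vol (continuousOn_cgrad hab hw.1 i)
  have mh : ∀ i j, MemLp (hess w i j) 2 (volΩ a b) := fun i j =>
    (memLp_hess hS hw i j).mono_exponent le_top
  have iw := integrable_norm_sq mw
  have ig := fun i => integrable_norm_sq (mg i)
  have ih := fun i => integrable_norm_sq (mh i i)
  have I1 : Integrable (fun x => (k ^ 2)⁻¹ * (N * ∑ i, ‖hess w i i x‖ ^ 2)) (volΩ a b) :=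
    ((integrable_finsetSum _ fun i _ => ih i).const_mul N).const_mul _
  have I2 : Integrable (fun x => ∑ i, ‖cgrad a b w i x‖ ^ 2) (volΩ a b) :=
    integrable_finsetSum _ fun i _ => ig i
  have I12 : Integrable (fun x => (k ^ 2)⁻¹ * (N * ∑ i, ‖hess w i i x‖ ^ 2) +
      ∑ i, ‖cgrad a b w i x‖ ^ 2) (volΩ a b) := I1.add I2
  have V : ∫ x, normΩ a b k w x ∂(volΩ a b) ≤
      (k ^ 2)⁻¹ * (N ^ 2 * s₂ ^ 2) + N * s₁ ^ 2 + k ^ 2 * s₀ ^ 2 := by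
    have e1 : ∫ x, normΩ a b k w x ∂(volΩ a b) ≤
        ∫ x, ((k ^ 2)⁻¹ * (N * ∑ i, ‖hess w i i x‖ ^ 2) + (∑ i, ‖cgrad a b w i x‖ ^ 2) +
          k ^ 2 * ‖w x‖ ^ 2) ∂(volΩ a b) := by
      refine integral_mono (integrable_normΩ hab hS hw k)
        (I12.add (iw.const_mul _)) fun x => ?_
      have : ‖clap w x‖ ^ 2 ≤ N * ∑ i, ‖hess w i i x‖ ^ 2 := by
        have h3 : ‖clap w x‖ ≤ ∑ i, ‖hess w i i x‖ := norm_sum_le _ _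
        refine (pow_le_pow_left₀ (norm_nonneg _) h3 2).trans ?_
        have := sq_sum_le_card_mul_sum_sq (s := (Finset.univ : Finset (Fin (n + 1))))
          (f := fun i => ‖hess w i i x‖)
        rwa [hcard] at this
      simp only [normΩ]
      gcongr
    refine e1.trans ?_
    rw [integral_add I12 (iw.const_mul _), integral_add I1 I2, integral_const_mul,
      integral_const_mul,
      integral_const_mul, integral_finsetSum _ fun i _ => ih i,
      integral_finsetSum _ fun i _ => ig i]
    have s1 : ∑ i, ∫ x, ‖hess w i i x‖ ^ 2 ∂(volΩ a b) ≤ N * s₂ ^ 2 := by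
      refine (Finset.sum_le_sum fun i _ => h2 i i).trans (le_of_eq ?_)
      rw [Finset.sum_const, nsmul_eq_mul, hcard]
    have s2 : ∑ i, ∫ x, ‖cgrad a b w i x‖ ^ 2 ∂(volΩ a b) ≤ N * s₁ ^ 2 := by
      refine (Finset.sum_le_sum fun i _ => h1 i).trans (le_of_eq ?_)
      rw [Finset.sum_const, nsmul_eq_mul, hcard]
    have s3 : (k ^ 2)⁻¹ * (N * ∑ i, ∫ x, ‖hess w i i x‖ ^ 2 ∂(volΩ a b)) ≤
        (k ^ 2)⁻¹ * (N ^ 2 * s₂ ^ 2) := by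
      rw [sq N, mul_assoc]
      gcongr
    have s4 := mul_le_mul_of_nonneg_left h0 (sq_nonneg k)
    rw [sqNorm] at s4
    linarith
  have G : ∫ x, normΓ a b k w x ∂(surf a b) ≤
      k ^ 2 * (Ct * (s₀ ^ 2 + s₀ * s₁)) + N * (Ct * (s₁ ^ 2 + s₁ * s₂)) := by
    have t0 := sqNorm_surf_le_of_bounds hab Set.countable_empty hw.1.continuousOn
      (DF := cgrad a b w) (fun i x hx _ => hasDerivAt_cgrad hw.1 hx i)
      (fun i => memLp_top_volΩ (continuousOn_cgrad hab hw.1 i)) hs₀ hs₁ h0 h1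
    have t1 : ∀ j, sqNorm (surf a b) (cgrad a b w j) ≤ Ct * (s₁ ^ 2 + s₁ * s₂) := fun j =>
      sqNorm_surf_le_of_bounds hab hS (continuousOn_cgrad hab hw.1 j)
        (DF := fun i => hess w i j) (fun i x hx hxS => hasDerivAt_hess hw hx hxS i j)
        (fun i => memLp_hess hS hw i j) hs₁ hs₂ (h1 j) fun i => h2 i j
    have jw := integrable_norm_sq (MemLp.two_surf hab hw.1.continuousOn)
    have jg := fun i => integrable_norm_sq (MemLp.two_surf hab (continuousOn_cgrad hab hw.1 i))
    have e1 : ∫ x, normΓ a b k w x ∂(surf a b) =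
        k ^ 2 * sqNorm (surf a b) w + ∑ j, sqNorm (surf a b) (cgrad a b w j) := by
      simp only [sqNorm]
      rw [← integral_const_mul, ← integral_finsetSum _ fun i _ => jg i,
        ← integral_add (jw.const_mul _) (integrable_finsetSum _ fun i _ => jg i)]
      refine integral_congr_ae ?_
      filter_upwards [sum_csurfGrad_add_cnormalDeriv hab w] with x hx
      rw [normΓ, add_assoc, hx]
    rw [e1]
    have s1 : ∑ j, sqNorm (surf a b) (cgrad a b w j) ≤ N * (Ct * (s₁ ^ 2 + s₁ * s₂)) := by
      refine (Finset.sum_le_sum fun i _ => t1 i).trans (le_of_eq ?_)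
      rw [Finset.sum_const, nsmul_eq_mul, hcard]
    have s2 := mul_le_mul_of_nonneg_left t0 (sq_nonneg k)
    linarith
  rw [cnormSq, normConst, ← hN, ← hCt]
  have hNN : N ≤ N ^ 2 := by nlinarith
  have hN2 : (1 : ℝ) ≤ N ^ 2 := by nlinarith
  have X2 : 0 ≤ (k ^ 2)⁻¹ * s₂ ^ 2 := by positivity
  have X1 : 0 ≤ s₁ ^ 2 := by positivity
  have X0 : 0 ≤ k ^ 2 * s₀ ^ 2 := by positivity
  have Y0 : 0 ≤ k ^ 2 * (s₀ ^ 2 + s₀ * s₁) := by positivity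
  have Y1 : 0 ≤ s₁ ^ 2 + s₁ * s₂ := by positivity
  have A : (k ^ 2)⁻¹ * (N ^ 2 * s₂ ^ 2) = N ^ 2 * ((k ^ 2)⁻¹ * s₂ ^ 2) := by ring
  have hNC : N * Ct ≤ N ^ 2 * Ct := mul_le_mul_of_nonneg_right hNN hCt0.le
  have hC2 : Ct ≤ N ^ 2 * Ct := le_mul_of_one_le_left hCt0.le hN2
  have q2 := mul_le_mul_of_nonneg_right (show N ^ 2 ≤ N ^ 2 * (1 + Ct) by nlinarith) X2
  have q1 := mul_le_mul_of_nonneg_right (show N ≤ N ^ 2 * (1 + Ct) by linarith) X1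
  have q0 := mul_le_mul_of_nonneg_right (show 1 ≤ N ^ 2 * (1 + Ct) by linarith) X0
  have p0 := mul_le_mul_of_nonneg_right (show Ct ≤ N ^ 2 * (1 + Ct) by linarith) Y0
  have p1 := mul_le_mul_of_nonneg_right (show N * Ct ≤ N ^ 2 * (1 + Ct) by linarith) Y1
  have e0 : k ^ 2 * (Ct * (s₀ ^ 2 + s₀ * s₁)) = Ct * (k ^ 2 * (s₀ ^ 2 + s₀ * s₁)) := by ring
  have e1 : N * (Ct * (s₁ ^ 2 + s₁ * s₂)) = N * Ct * (s₁ ^ 2 + s₁ * s₂) := by ring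
  rw [A] at V
  rw [e0, e1] at G
  rw [one_mul] at q0
  simp only [mul_add] at *
  linarith

/-! ### Approximation in the discrete space -/

/-- The sum of the squared `L²(Ω)` norms of the derivatives of order at most `4`. -/
def sobSq (a b : Fin (n + 1) → ℝ) (U : (Fin (n + 1) → ℝ) → ℂ) : ℝ :=
  ∑ α ∈ multiIndices (n + 1) 4, sqNorm (volΩ a b) (md α U)

theorem sobSq_nonneg (a b : Fin (n + 1) → ℝ) (U : (Fin (n + 1) → ℝ) → ℂ) : 0 ≤ sobSq a b U :=
  Finset.sum_nonneg fun _ _ => sqNorm_nonneg _ _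

theorem sqNorm_md_le_sobSq {α : Fin (n + 1) → ℕ} (hα : α ∈ multiIndices (n + 1) 4)
    (a b : Fin (n + 1) → ℝ) (U : (Fin (n + 1) → ℝ) → ℂ) :
    sqNorm (volΩ a b) (md α U) ≤ sobSq a b U :=
  Finset.single_le_sum (f := fun α => sqNorm (volΩ a b) (md α U))
    (fun _ _ => sqNorm_nonneg _ _) hα

theorem sobSq_eq_sum (T : TensorMesh a b) {U : (Fin (n + 1) → ℝ) → ℂ} (hU : ContDiff ℝ ∞ U) :
    sobSq a b U = ∑ J, sobSq (cellL T J) (cellR T J) U := by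
  simp only [sobSq]
  rw [Finset.sum_comm]
  exact Finset.sum_congr rfl fun α _ => sqNorm_eq_sum T (memLp_of_contDiff (contDiff_md hU α))

end Box

theorem mem_multiIndices_one {r : ℕ} (hr : r ≤ 4) : (fun _ => r) ∈ multiIndices (0 + 1) 4 := by
  simp [multiIndices]; omega

theorem mem_multiIndices_two {r s : ℕ} (h : r + s ≤ 4) : ![r, s] ∈ multiIndices (1 + 1) 4 := by
  simp only [multiIndices, Finset.mem_filter, Fintype.mem_piFinset, Finset.mem_range]
  refine ⟨fun i => ?_, ?_⟩
  · have : (![r, s] : Fin 2 → ℕ) i ≤ r + s := by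
      fin_cases i <;> simp
    exact lt_of_le_of_lt this (by omega)
  · have : ∑ i : Fin 2, (![r, s] : Fin 2 → ℕ) i = r + s := by simp
    exact this.trans_le h

theorem md_two (r s : ℕ) (U : (Fin 2 → ℝ) → ℂ) :
    md ![r, s] U = (pd 0)^[r] ((pd 1)^[s] U) := rfl

/-- The derivatives of order at most two of `W` are bounded as for an interpolation error. -/
def ErrorBounds {n : ℕ} (c d : Fin (n + 1) → ℝ) (h M : ℝ) (W : (Fin (n + 1) → ℝ) → ℂ) : Prop :=
  sqNorm (volΩ c d) W ≤ 10 * h ^ 8 * M ∧ (∀ i, sqNorm (volΩ c d) (pd i W) ≤ 10 * h ^ 6 * M) ∧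
    ∀ i j, sqNorm (volΩ c d) (pd i (pd j W)) ≤ 10 * h ^ 4 * M

theorem errorBounds_zero {c d : Fin (0 + 1) → ℝ} (hcd : ∀ i, c i < d i)
    {U : (Fin (0 + 1) → ℝ) → ℂ} (hU : ContDiff ℝ ∞ U) {h : ℝ} (hh : ∀ i, d i - c i ≤ h) :
    ErrorBounds c d h (sobSq c d U) (hermErr 0 (c 0) (d 0) U) := by
  have hh0 : 0 ≤ h := (sub_nonneg.2 (hcd 0).le).trans (hh 0)
  have key : ∀ r ≤ 2, sqNorm (volΩ c d) ((pd 0)^[r] (hermErr 0 (c 0) (d 0) U)) ≤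
      10 * h ^ (2 * (4 - r)) * sobSq c d U := by
    intro r hr
    refine (sqNorm_hermErr_le hcd 0 hU hr (by norm_num) le_rfl (hh 0)).trans ?_
    have h1 := sqNorm_md_le_sobSq (mem_multiIndices_one (r := 4) le_rfl) c d U
    have h2 : 0 ≤ h ^ (2 * (4 - r)) * sobSq c d U :=
      mul_nonneg (by positivity) (sobSq_nonneg _ _ _)
    have h3 := mul_le_mul_of_nonneg_left h1 (show 0 ≤ h ^ (2 * (4 - r)) by positivity)
    refine h3.trans ?_
    linarith
  refine ⟨key 0 (by norm_num), fun i => ?_, fun i j => ?_⟩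
  · obtain rfl : i = 0 := Subsingleton.elim (α := Fin 1) _ _
    exact key 1 (by norm_num)
  · obtain rfl : i = 0 := Subsingleton.elim (α := Fin 1) _ _
    obtain rfl : j = 0 := Subsingleton.elim (α := Fin 1) _ _
    exact key 2 le_rfl

theorem errorBounds_one {c d : Fin (1 + 1) → ℝ} (hcd : ∀ i, c i < d i)
    {U : (Fin (1 + 1) → ℝ) → ℂ} (hU : ContDiff ℝ ∞ U) {h : ℝ} (hh : ∀ i, d i - c i ≤ h) :
    ErrorBounds c d h (sobSq c d U) (hermErr 0 (c 0) (d 0) U +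
      (hermErr 1 (c 1) (d 1) U - hermErr 0 (c 0) (d 0) (hermErr 1 (c 1) (d 1) U))) := by
  set W := hermErr 0 (c 0) (d 0) U +
      (hermErr 1 (c 1) (d 1) U - hermErr 0 (c 0) (d 0) (hermErr 1 (c 1) (d 1) U)) with hWdef
  have hE1 := contDiff_hermErr 1 (c 1) (d 1) hU
  have hW : ContDiff ℝ ∞ W := contDiff_pi_add (contDiff_hermErr 0 (c 0) (d 0) hU)
    (contDiff_pi_sub hE1 (contDiff_hermErr 0 (c 0) (d 0) hE1))
  have key : ∀ r s, r + s ≤ 2 → sqNorm (volΩ c d) ((pd 0)^[r] ((pd 1)^[s] W)) ≤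
      10 * h ^ (2 * (4 - (r + s))) * sobSq c d U := fun r s hrs =>
    sqNorm_tensor_error_le hcd (by decide) hU hh hrs
      (sqNorm_md_le_sobSq (mem_multiIndices_two (r := 4 - s) (s := s) (by omega)) c d U)
      (sqNorm_md_le_sobSq (mem_multiIndices_two (r := r) (s := 4 - r) (by omega)) c d U)
      (sqNorm_md_le_sobSq (mem_multiIndices_two (r := 2) (s := 2) (by omega)) c d U)
  refine ⟨key 0 0 (by norm_num), fun i => ?_, fun i j => ?_⟩
  · fin_cases i
    · exact key 1 0 (by norm_num)
    · exact key 0 1 (by norm_num)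
  · have h10 : pd 1 (pd 0 W) = pd 0 (pd 1 W) := pd_comm hW 1 0
    fin_cases i <;> fin_cases j
    · exact key 2 0 le_rfl
    · exact key 1 1 le_rfl
    · refine le_of_eq_of_le ?_ (key 1 1 le_rfl)
      exact congrArg (sqNorm (volΩ c d)) h10
    · exact key 0 2 le_rfl

/-- The global interpolant agrees on each element with the Hermite interpolant of that element, so
that the error there is `E_0` in one dimension and `E_0 + E_1 - E_0 E_1` in two. These are smooth
functions, to which the element-wise bounds apply. -/
theorem exists_local_interpolant {n : ℕ} (hn : n ≤ 1) {a b : Fin (n + 1) → ℝ} (T : TensorMesh a b)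
    {p : ℕ} (hp : 3 ≤ p) {U : (Fin (n + 1) → ℝ) → ℂ} (hU : ContDiff ℝ ∞ U) :
    ∃ v ∈ femC T p, ∀ J, ∃ W, ContDiff ℝ ∞ W ∧
      Set.EqOn (U - v) W (openBox (cellL T J) (cellR T J)) ∧
      ErrorBounds (cellL T J) (cellR T J) T.width (sobSq (cellL T J) (cellR T J) U) W := by
  obtain rfl | rfl : n = 0 ∨ n = 1 := by omega
  · obtain ⟨v, hv, h⟩ := exists_interpolant_zero T hp U (pd 0 U)
    refine ⟨v, hv, fun J => ⟨hermErr 0 (cellL T J 0) (cellR T J 0) U, contDiff_hermErr _ _ _ hU,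
      fun x hx => ?_, errorBounds_zero (cell_lt T J) hU (cell_side_le T J)⟩⟩
    have hx' := openCell_subset_cell T J hx
    rw [Pi.sub_apply, h x (cell_subset T J hx'), meshHermite_eq T ⟨hx'.1 0, hx'.2 0⟩]
    rfl
  · obtain ⟨v, hv, h⟩ := exists_interpolant_one T hp U (pd 1 U) (pd 0 U) (pd 1 (pd 0 U))
    have hE := fun J => contDiff_hermErr 1 (cellL T J 1) (cellR T J 1) hU
    refine ⟨v, hv, fun J => ⟨_, contDiff_pi_add (contDiff_hermErr 0 (cellL T J 0) (cellR T J 0) hU)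
      (contDiff_pi_sub (hE J) (contDiff_hermErr 0 (cellL T J 0) (cellR T J 0) (hE J))),
      fun x hx => ?_, errorBounds_one (cell_lt T J) hU (cell_side_le T J)⟩⟩
    have hx' := openCell_subset_cell T J hx
    rw [← sub_hermite_hermite (by decide) _ _ _ _ hU, Pi.sub_apply, Pi.sub_apply,
      h x (cell_subset T J hx'), meshHermite_eq T ⟨hx'.1 0, hx'.2 0⟩]
    congr 1
    -- The outer interpolation evaluates the inner one at points whose first coordinate is an end
    -- point of the cell. The inner interpolation acts in the second variable only, whose coordinate
    -- stays in the cell.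
    have hm : ∀ (F G : (Fin 2 → ℝ) → ℂ) (t : ℝ),
        meshHermite T 1 F G (Function.update x 0 t) =
          hermite 1 (cellL T J 1) (cellR T J 1) F G (Function.update x 0 t) := by
      intro F G t
      refine meshHermite_eq T (J := J) ?_ F G
      rw [show Function.update x 0 t 1 = x 1 by simp]
      exact ⟨hx'.1 1, hx'.2 1⟩
    simp only [hermite, Pi.add_apply, sliceMul] at hm ⊢
    simp only [hm]

/-- Squared `L²` norms are additive over the elements, whose boundaries are null, and so is `sobSq`
on the right. The constants do not depend on the mesh because no inverse estimate or shape
regularity enters. -/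
theorem exists_interpolant {n : ℕ} (hn : n ≤ 1) {a b : Fin (n + 1) → ℝ} (hab : ∀ i, a i < b i)
    (T : TensorMesh a b) {p : ℕ} (hp : 3 ≤ p) {U : (Fin (n + 1) → ℝ) → ℂ}
    (hU : ContDiff ℝ ∞ U) :
    ∃ v ∈ femC T p, sqNorm (volΩ a b) (U - v) ≤ 10 * T.width ^ 8 * sobSq a b U ∧
      (∀ i, sqNorm (volΩ a b) (cgrad a b (U - v) i) ≤ 10 * T.width ^ 6 * sobSq a b U) ∧
      ∀ i j, sqNorm (volΩ a b) (hess (U - v) i j) ≤ 10 * T.width ^ 4 * sobSq a b U := by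
  obtain ⟨v, hv, h⟩ := exists_local_interpolant hn T hp hU
  choose W hW hWe hWb using h
  have hw : U - v ∈ gridC2 a b (gridSet T) :=
    Submodule.sub_mem _ (contDiff_mem_gridC2 hU _) (femC_le_gridC2 T p hv)
  have hglue : ∀ (F : (Fin (n + 1) → ℝ) → ℂ)
      (G : ((i : Fin (n + 1)) → Fin (T.cells i)) → (Fin (n + 1) → ℝ) → ℂ) (r : ℕ),
      MemLp F 2 (volΩ a b) → (∀ J, Set.EqOn F (G J) (openBox (cellL T J) (cellR T J))) →
      (∀ J, sqNorm (volΩ (cellL T J) (cellR T J)) (G J) ≤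
        10 * T.width ^ r * sobSq (cellL T J) (cellR T J) U) →
      sqNorm (volΩ a b) F ≤ 10 * T.width ^ r * sobSq a b U := by
    intro F G r hF hFG hG
    rw [sqNorm_eq_sum T hF, sobSq_eq_sum T hU, Finset.mul_sum]
    refine Finset.sum_le_sum fun J _ => le_of_eq_of_le (sqNorm_congr ?_) (hG J)
    filter_upwards [ae_openBox (a := cellL T J) (b := cellR T J) Set.countable_empty] with x hx
    exact hFG J hx.1
  refine ⟨v, hv, ?_, fun i => ?_, fun i j => ?_⟩
  · exact hglue _ W 8 (MemLp.two_vol hw.1.continuousOn) hWe fun J => (hWb J).1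
  · exact hglue _ (fun J => pd i (W J)) 6 (MemLp.two_vol (continuousOn_cgrad hab hw.1 i))
      (fun J x hx => cgrad_eq_of_eqOn T (hWe J) hx i) fun J => (hWb J).2.1 i
  · exact hglue _ (fun J => pd i (pd j (W J))) 4
      ((memLp_hess (countable_gridSet T) hw i j).mono_exponent le_top)
      (fun J x hx => hess_eq_of_eqOn T (hWe J) hx i j) fun J => (hWb J).2.2 i j

section Matrices

variable {n : ℕ} {a b : Fin (n + 1) → ℝ} {S : Set ℝ} {u v w : (Fin (n + 1) → ℝ) → ℂ}

/-! ### Derivatives of real functions -/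

theorem star_cgrad_of_real (hab : ∀ i, a i < b i) (hv : ∀ x, star (v x) = v x)
    {x : Fin (n + 1) → ℝ} (hx : x ∈ Set.Icc a b) (i : Fin (n + 1)) :
    star (cgrad a b v i x) = cgrad a b v i x := by
  have h : (Complex.conjCLE ∘ v) = v := funext fun y => hv y
  have h1 := Complex.conjCLE.comp_fderivWithin (f := v) (uniqueDiffOn_box hab x hx)
  rw [h] at h1
  conv_rhs => rw [cgrad, h1]
  rfl

theorem star_fderiv_of_real {d : ℕ} {v : (Fin d → ℝ) → ℂ} (hv : ∀ x, star (v x) = v x)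
    (x e : Fin d → ℝ) : star (fderiv ℝ v x e) = fderiv ℝ v x e := by
  have h : (Complex.conjCLE ∘ v) = v := funext fun y => hv y
  have h1 := Complex.conjCLE.comp_fderiv (f := v) (x := x)
  rw [h] at h1
  conv_rhs => rw [h1]
  rfl

theorem star_clap_of_real {d : ℕ} {v : (Fin d → ℝ) → ℂ} (hv : ∀ x, star (v x) = v x)
    (x : Fin d → ℝ) : star (clap v x) = clap v x := by
  rw [clap, star_sum]
  exact Finset.sum_congr rfl fun i _ =>
    star_fderiv_of_real (fun y => star_fderiv_of_real hv y _) x _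

theorem star_cnormalDeriv_of_real (hab : ∀ i, a i < b i) (hv : ∀ x, star (v x) = v x)
    {x : Fin (n + 1) → ℝ} (hx : x ∈ Set.Icc a b) :
    star (cnormalDeriv a b v x) = cnormalDeriv a b v x := by
  rw [cnormalDeriv, star_sum]
  refine Finset.sum_congr rfl fun i _ => ?_
  rw [star_mul', star_cgrad_of_real hab hv hx, star_ofReal]

theorem star_csurfGrad_of_real (hab : ∀ i, a i < b i) (hv : ∀ x, star (v x) = v x)
    {x : Fin (n + 1) → ℝ} (hx : x ∈ Set.Icc a b) (i : Fin (n + 1)) :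
    star (csurfGrad a b v i x) = csurfGrad a b v i x := by
  have h := star_cnormalDeriv_of_real hab hv hx
  rw [cnormalDeriv] at h
  rw [csurfGrad, star_sub, star_mul', star_cgrad_of_real hab hv hx, star_ofReal, h]

/-! ### The right-hand side as an antilinear map -/

theorem crhs_add_right (hab : ∀ i, a i < b i) (hS : S.Countable) (k β A : ℝ)
    {f g : (Fin (n + 1) → ℝ) → ℂ} (hf : MemLp f 2 (volΩ a b)) (hg : MemLp g 2 (surf a b))
    (hv : v ∈ gridC2 a b S) (hw : w ∈ gridC2 a b S) :
    crhs a b k β A f g (v + w) = crhs a b k β A f g v + crhs a b k β A f g w := by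
  have iΩ : ∀ {z}, z ∈ gridC2 a b S → Integrable (fun x => (star (copM a b k β z x) -
      (A : ℂ) / (k : ℂ) ^ 2 * star (copL k z x)) * f x) (volΩ a b) := fun hz =>
    ((((memLp_star (memLp_copM hab hz k β)).sub
      ((memLp_star (memLp_copL hS hz k)).const_mul _)).mono_exponent (p := 2) le_top).integrable_mul hf)
  have iΓ : ∀ {z}, z ∈ gridC2 a b S → Integrable (fun x => star (copMbdry a b k β z x) * g x)
      (surf a b) := fun hz =>
    ((memLp_star (memLp_copMbdry hab hz k β)).mono_exponent (p := 2) le_top).integrable_mul hg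
  have e1 := integral_add (iΩ hv) (iΩ hw)
  have e2 := integral_add (iΓ hv) (iΓ hw)
  rw [crhs, crhs, crhs, add_add_add_comm, ← e1, ← e2]
  congr 1
  · refine integral_congr_ae (ae_vol_of_grid hS fun x hx hxS => ?_)
    simp only [copM_add k β hab hv hw (openBox_subset_Icc hx),
      copL_add k (hv.2.1 x hx hxS) (hw.2.1 x hx hxS), star_add]
    ring
  · refine integral_congr_ae (ae_surf_of_Icc hab fun x hx => ?_)
    simp only [copMbdry, copMtan_add k β hab hv hw hx, cnormalDeriv_add hab hv hw hx, star_add,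
      mul_add, add_mul]
    ring

theorem crhs_smul_right (hab : ∀ i, a i < b i) (hS : S.Countable) (k β A : ℝ)
    (f g : (Fin (n + 1) → ℝ) → ℂ) (c : ℂ) (hv : v ∈ gridC2 a b S) :
    crhs a b k β A f g (c • v) = star c * crhs a b k β A f g v := by
  rw [crhs, crhs, mul_add]
  congr 1
  · refine integral_smul_of_pointwise (ae_vol_of_grid hS fun x hx hxS => ?_)
    simp only [copM_smul k β c hab hv (openBox_subset_Icc hx), copL_smul k c (hv.2.1 x hx hxS),
      star_mul']
    ring
  · refine integral_smul_of_pointwise (ae_surf_of_Icc hab fun x hx => ?_)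
    simp only [copMbdry, copMtan_smul k β c hab hv hx, cnormalDeriv_smul c hab hv hx, star_add,
      star_mul']
    ring

/-- The classical right-hand side as an antilinear map. -/
def crhsₗ (hab : ∀ i, a i < b i) (hS : S.Countable) (k β A : ℝ)
    {f g : (Fin (n + 1) → ℝ) → ℂ} (hf : MemLp f 2 (volΩ a b)) (hg : MemLp g 2 (surf a b)) :
    gridC2 a b S →ₗ⋆[ℂ] ℂ where
  toFun v := crhs a b k β A f g v.1
  map_add' v w := crhs_add_right hab hS k β A hf hg v.2 w.2
  map_smul' c v := crhs_smul_right hab hS k β A f g c v.2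

theorem crhs_sub_left (hab : ∀ i, a i < b i) (hS : S.Countable) (k β A : ℝ)
    {f g f' g' : (Fin (n + 1) → ℝ) → ℂ} (hf : MemLp f 2 (volΩ a b)) (hg : MemLp g 2 (surf a b))
    (hf' : MemLp f' 2 (volΩ a b)) (hg' : MemLp g' 2 (surf a b)) (hv : v ∈ gridC2 a b S) :
    crhs a b k β A (f - f') (g - g') v = crhs a b k β A f g v - crhs a b k β A f' g' v := by
  have mΩ := ((memLp_star (memLp_copM hab hv k β)).sub
      ((memLp_star (memLp_copL hS hv k)).const_mul ((A : ℂ) / (k : ℂ) ^ 2))).mono_exponent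
        (p := 2) le_top
  have mΓ := (memLp_star (memLp_copMbdry hab hv k β)).mono_exponent (p := 2) le_top
  have e1 := integral_sub (mΩ.integrable_mul hf) (mΩ.integrable_mul hf')
  have e2 := integral_sub (mΓ.integrable_mul hg) (mΓ.integrable_mul hg')
  simp only [Pi.mul_apply, Pi.sub_apply] at e1 e2
  simp only [crhs, Pi.sub_apply, mul_sub]
  rw [e1, e2]
  ring

/-! ### The matrices of the discrete problem -/

variable {T : TensorMesh a b} {p N : ℕ} (φ : Module.Basis (Fin N) ℝ (femSpace T p))

theorem femFun_eq_sum (c : Fin N → ℂ) :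
    femFun (fun j => (φ j).1) c = ∑ j, c j • toC (φ j).1 := by
  ext x
  simp [femFun, toC]

theorem femFun_sub (c d : Fin N → ℂ) :
    femFun (fun j => (φ j).1) (c - d) =
      femFun (fun j => (φ j).1) c - femFun (fun j => (φ j).1) d := by
  ext x
  simp [femFun, sub_mul, Finset.sum_sub_distrib]

theorem femFun_mem_femC (c : Fin N → ℂ) : femFun (fun j => (φ j).1) c ∈ femC T p := by
  rw [femFun_eq_sum]
  exact Submodule.sum_mem _ fun j _ => Submodule.smul_mem _ _
    (Submodule.subset_span ⟨_, (φ j).2, rfl⟩)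

theorem femFun_mem (c : Fin N → ℂ) : femFun (fun j => (φ j).1) c ∈ gridC2 a b (gridSet T) :=
  femC_le_gridC2 T p (femFun_mem_femC φ c)

theorem exists_femFun_eq (hv : v ∈ femC T p) : ∃ c, v = femFun (fun j => (φ j).1) c := by
  induction hv using Submodule.span_induction with
  | mem x hx =>
    obtain ⟨q, hq, rfl⟩ := hx
    refine ⟨fun j => (φ.repr ⟨q, hq⟩ j : ℂ), ?_⟩
    have h1 := φ.sum_repr ⟨q, hq⟩
    have h2 := congrArg Subtype.val h1
    ext x
    have h3 := congrFun h2 x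
    simp only [AddSubmonoidClass.coe_finsetSum, SetLike.val_smul, Finset.sum_apply, Pi.smul_apply,
      smul_eq_mul] at h3
    simp only [toC, femFun]
    rw [← h3]
    push_cast
    rfl
  | zero => exact ⟨0, by ext x; simp [femFun]⟩
  | add x y _ _ hx hy =>
    obtain ⟨c, rfl⟩ := hx
    obtain ⟨d, rfl⟩ := hy
    exact ⟨c + d, by ext x; simp [femFun, add_mul, Finset.sum_add_distrib]⟩
  | smul r x _ hx =>
    obtain ⟨c, rfl⟩ := hx
    exact ⟨r • c, by ext x; simp [femFun, Finset.mul_sum, mul_assoc]⟩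

theorem sesquilinear_sum {V : Type*} [AddCommGroup V] [Module ℂ V] (F : V →ₗ[ℂ] V →ₗ⋆[ℂ] ℂ)
    (e : Fin N → V) (c d : Fin N → ℂ) :
    F (∑ j, c j • e j) (∑ i, d i • e i) = star d ⬝ᵥ (Matrix.of fun i j => F (e j) (e i)).mulVec c := by
  simp only [map_sum, LinearMap.sum_apply, LinearMap.map_smulₛₗ, LinearMap.smul_apply,
    RingHom.id_apply, smul_eq_mul, dotProduct, Matrix.mulVec, Matrix.of_apply, Pi.star_apply,
    Finset.mul_sum]
  refine Finset.sum_congr rfl fun i _ => Finset.sum_congr rfl fun j _ => ?_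
  simp only [starRingEnd_apply]
  ring

theorem femFun_eq_coe_sum (c : Fin N → ℂ) : femFun (fun j => (φ j).1) c =
    (∑ j, c j • (⟨toC (φ j).1, toC_mem_gridC2 T (φ j).2⟩ : gridC2 a b (gridSet T))).1 := by
  rw [femFun_eq_sum]
  simp

theorem galerkinMatrix_apply (hab : ∀ i, a i < b i) (k β A : ℝ) (c d : Fin N → ℂ) :
    star d ⬝ᵥ (galerkinMatrix a b k β A (fun j => (φ j).1)).mulVec c =
      cform a b k β A (femFun (fun j => (φ j).1) c) (femFun (fun j => (φ j).1) d) := by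
  have h := sesquilinear_sum (cformₗ hab (countable_gridSet T) k β A)
    (fun j => (⟨toC (φ j).1, toC_mem_gridC2 T (φ j).2⟩ : gridC2 a b (gridSet T))) c d
  rw [femFun_eq_coe_sum, femFun_eq_coe_sum]
  refine Eq.trans ?_ h.symm
  congr 2
  ext i j
  exact formB_eq_cform hab (countable_gridSet T) k β A (toC_mem_gridC2 T (φ j).2)
    (toC_mem_gridC2 T (φ i).2)

theorem galerkinRhs_apply (hab : ∀ i, a i < b i) (k β A : ℝ) {f g : (Fin (n + 1) → ℝ) → ℂ}
    (hf : MemLp f 2 (volΩ a b)) (hg : MemLp g 2 (surf a b)) (d : Fin N → ℂ) :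
    star d ⬝ᵥ galerkinRhs a b k β A f g (fun j => (φ j).1) =
      crhs a b k β A f g (femFun (fun j => (φ j).1) d) := by
  rw [femFun_eq_coe_sum]
  have h := map_sum (crhsₗ hab (countable_gridSet T) k β A hf hg)
    (fun j => d j • (⟨toC (φ j).1, toC_mem_gridC2 T (φ j).2⟩ : gridC2 a b (gridSet T))) Finset.univ
  refine Eq.trans ?_ h.symm
  refine Finset.sum_congr rfl fun i _ => ?_
  rw [LinearMap.map_smulₛₗ]
  exact congrArg _ (rhsG_eq_crhs hab (countable_gridSet T) k β A f g (toC_mem_gridC2 T (φ i).2))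

/-- The matrix is defined without complex conjugation; since the basis functions are real, their
derivatives are real as well, and the products agree with the Hermitian ones. -/
theorem precondD1_eq_cinner (hab : ∀ i, a i < b i) (k : ℝ) (l m : Fin N) :
    precondD1 a b k (fun j => (φ j).1) l m = cinner a b k (toC (φ m).1) (toC (φ l).1) := by
  have hS := countable_gridSet T
  have hl := toC_mem_gridC2 T (φ l).2
  have hm := toC_mem_gridC2 T (φ m).2
  have hr : ∀ x, star (toC (φ l).1 x) = toC (φ l).1 x := fun x => star_ofReal _
  set P := toC (φ l).1 with hP
  set Q := toC (φ m).1 with hQ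
  have ii : ∀ {μ : Measure (Fin (n + 1) → ℝ)} [IsFiniteMeasure μ] {f g : (Fin (n + 1) → ℝ) → ℂ},
      MemLp f ⊤ μ → MemLp g ⊤ μ → Integrable (fun x => f x * g x) μ := fun hf hg =>
    (memLp_mul_top hf hg).integrable le_top
  have j1 := ii (memLp_clap hS hl) (memLp_clap hS hm)
  have j2 : Integrable (fun x => ∑ i, cgrad a b P i x * cgrad a b Q i x) (volΩ a b) :=
    integrable_finsetSum _ fun i _ => ii (memLp_cgrad hab hl i) (memLp_cgrad hab hm i)
  have j3 := ii (memLp_top_volΩ hl.1.continuousOn) (memLp_top_volΩ hm.1.continuousOn)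
  have j4 := ii (memLp_top_surf hab hl.1.continuousOn) (memLp_top_surf hab hm.1.continuousOn)
  have j5 : Integrable (fun x => ∑ i, csurfGrad a b P i x * csurfGrad a b Q i x) (surf a b) :=
    integrable_finsetSum _ fun i _ => ii (memLp_csurfGrad hab hl i) (memLp_csurfGrad hab hm i)
  have j6 := ii (memLp_cnormalDeriv hab hl) (memLp_cnormalDeriv hab hm)
  have e1 : ∫ x, wlap a b P x * wlap a b Q x ∂(volΩ a b) = ∫ x, clap P x * clap Q x ∂(volΩ a b) := by
    refine integral_congr_ae ?_
    filter_upwards [ae_weak_vol hab hS hl, ae_weak_vol hab hS hm] with x h1 h2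
    rw [h1.2, h2.2]
  have e2 : ∫ x, ∑ i, wgrad a b P i x * wgrad a b Q i x ∂(volΩ a b) =
      ∫ x, ∑ i, cgrad a b P i x * cgrad a b Q i x ∂(volΩ a b) := by
    refine integral_congr_ae ?_
    filter_upwards [ae_weak_vol hab hS hl, ae_weak_vol hab hS hm] with x h1 h2
    simp only [h1.1, h2.1]
  have e4 : ∫ x, trace a b P x * trace a b Q x ∂(surf a b) = ∫ x, P x * Q x ∂(surf a b) := by
    refine integral_congr_ae ?_
    filter_upwards [ae_weak_surf hab hS hl, ae_weak_surf hab hS hm] with x h1 h2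
    rw [h1.1, h2.1]
  have e5 : ∫ x, ∑ i, surfGrad a b P i x * surfGrad a b Q i x ∂(surf a b) =
      ∫ x, ∑ i, csurfGrad a b P i x * csurfGrad a b Q i x ∂(surf a b) := by
    refine integral_congr_ae ?_
    filter_upwards [ae_weak_surf hab hS hl, ae_weak_surf hab hS hm] with x h1 h2
    simp only [h1.2.1, h2.2.1]
  have e6 : ∫ x, normalDeriv a b P x * normalDeriv a b Q x ∂(surf a b) =
      ∫ x, cnormalDeriv a b P x * cnormalDeriv a b Q x ∂(surf a b) := by
    refine integral_congr_ae ?_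
    filter_upwards [ae_weak_surf hab hS hl, ae_weak_surf hab hS hm] with x h1 h2
    rw [h1.2.2, h2.2.2]
  have c1 : ∫ x, innerΩ a b k Q P x ∂(volΩ a b) =
      ((k : ℂ) ^ 2)⁻¹ * (∫ x, clap P x * clap Q x ∂(volΩ a b)) +
      (∫ x, ∑ i, cgrad a b P i x * cgrad a b Q i x ∂(volΩ a b)) +
      (k : ℂ) ^ 2 * ∫ x, P x * Q x ∂(volΩ a b) := by
    have j12 : Integrable (fun x => ((k : ℂ) ^ 2)⁻¹ * (clap P x * clap Q x) +
        ∑ i, cgrad a b P i x * cgrad a b Q i x) (volΩ a b) := (j1.const_mul _).add j2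
    rw [← integral_const_mul, ← integral_const_mul, ← integral_add (j1.const_mul _) j2,
      ← integral_add j12 (j3.const_mul _)]
    refine integral_congr_ae (ae_vol_of_grid hS fun x hx hxS => ?_)
    simp only [innerΩ, star_clap_of_real hr, star_cgrad_of_real hab hr (openBox_subset_Icc hx),
      hr, mul_comm (clap Q x), mul_comm (Q x), mul_comm (cgrad a b Q _ x)]
  have c2 : ∫ x, innerΓ a b k Q P x ∂(surf a b) =
      (k : ℂ) ^ 2 * (∫ x, P x * Q x ∂(surf a b)) +
      (∫ x, ∑ i, csurfGrad a b P i x * csurfGrad a b Q i x ∂(surf a b)) +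
      ∫ x, cnormalDeriv a b P x * cnormalDeriv a b Q x ∂(surf a b) := by
    have j45 : Integrable (fun x => (k : ℂ) ^ 2 * (P x * Q x) +
        ∑ i, csurfGrad a b P i x * csurfGrad a b Q i x) (surf a b) := (j4.const_mul _).add j5
    rw [← integral_const_mul, ← integral_add (j4.const_mul _) j5, ← integral_add j45 j6]
    refine integral_congr_ae (ae_surf_of_Icc hab fun x hx => ?_)
    simp only [innerΓ, star_cnormalDeriv_of_real hab hr hx, star_csurfGrad_of_real hab hr hx,
      hr, mul_comm (cnormalDeriv a b Q x), mul_comm (Q x), mul_comm (csurfGrad a b Q _ x)]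
  rw [precondD1, Matrix.of_apply, cinner, c1, c2, e1, e2, e4, e5, e6]
  ring

theorem precondD1_apply (hab : ∀ i, a i < b i) (k : ℝ) (c : Fin N → ℂ) :
    star c ⬝ᵥ (precondD1 a b k (fun j => (φ j).1)).mulVec c =
      (cnormSq a b k (femFun (fun j => (φ j).1) c) : ℂ) := by
  have h := sesquilinear_sum (cinnerₗ hab (countable_gridSet T) k)
    (fun j => (⟨toC (φ j).1, toC_mem_gridC2 T (φ j).2⟩ : gridC2 a b (gridSet T))) c c
  rw [← cinner_self, femFun_eq_coe_sum]
  refine Eq.trans ?_ h.symm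
  congr 2
  ext i j
  exact precondD1_eq_cinner φ hab k i j

theorem weightedNorm_precondD1 (hab : ∀ i, a i < b i) (k : ℝ) (c : Fin N → ℂ) :
    weightedNorm (precondD1 a b k (fun j => (φ j).1)) c =
      √(cnormSq a b k (femFun (fun j => (φ j).1) c)) := by
  rw [weightedNorm, precondD1_apply φ hab, Complex.ofReal_re]

theorem closure_openBox (hab : ∀ i, a i < b i) : closure (openBox a b) = Set.Icc a b := by
  rw [openBox, closure_pi_set, ← Set.pi_univ_Icc]
  exact Set.pi_congr rfl fun i _ => closure_Ioo (hab i).ne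

theorem sqNorm_le_cnormSq (hab : ∀ i, a i < b i) (hS : S.Countable) (hv : v ∈ gridC2 a b S)
    (k : ℝ) : (∑ i, sqNorm (volΩ a b) (cgrad a b v i)) + k ^ 2 * sqNorm (volΩ a b) v ≤
      cnormSq a b k v := by
  have iw := integrable_norm_sq (MemLp.two_vol hv.1.continuousOn)
  have ig := fun i => integrable_norm_sq (MemLp.two_vol (continuousOn_cgrad hab hv.1 i))
  have h1 : (∑ i, sqNorm (volΩ a b) (cgrad a b v i)) + k ^ 2 * sqNorm (volΩ a b) v ≤
      ∫ x, normΩ a b k v x ∂(volΩ a b) := by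
    simp only [sqNorm]
    rw [← integral_const_mul, ← integral_finsetSum _ fun i _ => ig i,
      ← integral_add (integrable_finsetSum _ fun i _ => ig i) (iw.const_mul _)]
    refine integral_mono ((integrable_finsetSum _ fun i _ => ig i).add (iw.const_mul _))
      (integrable_normΩ hab hS hv k) fun x => ?_
    have : 0 ≤ (k ^ 2)⁻¹ * ‖clap v x‖ ^ 2 := by positivity
    simp only [normΩ]
    linarith
  have h2 : 0 ≤ ∫ x, normΓ a b k v x ∂(surf a b) := integral_nonneg fun x => normΓ_nonneg _ _ _
  rw [cnormSq]
  linarith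

/-- A function in the space that vanishes almost everywhere in `Ω` vanishes on the closed box by
continuity, and outside by convention. The basis is linearly independent over `ℝ`, so real and
imaginary parts of the coefficients vanish separately. This makes `D` definite and not merely
semidefinite. -/
theorem femFun_eq_zero (hab : ∀ i, a i < b i) {c : Fin N → ℂ}
    (h : sqNorm (volΩ a b) (femFun (fun j => (φ j).1) c) = 0) : c = 0 := by
  set v := femFun (fun j => (φ j).1) c with hv
  have hvm := femFun_mem φ c
  have h1 : v =ᵐ[volΩ a b] 0 := ae_eq_zero_of_sqNorm (MemLp.two_vol hvm.1.continuousOn) h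
  have h2 : Set.EqOn v 0 (openBox a b) :=
    Measure.eqOn_open_of_ae_eq h1 isOpen_openBox (hvm.1.continuousOn.mono openBox_subset_Icc)
      continuousOn_const
  have h3 : Set.EqOn v 0 (Set.Icc a b) :=
    h2.of_subset_closure hvm.1.continuousOn continuousOn_const openBox_subset_Icc
      (closure_openBox hab).ge
  have h4 : ∀ x, v x = 0 := by
    intro x
    by_cases hx : x ∈ Set.Icc a b
    · exact h3 hx
    · rw [hv]
      simp only [femFun]
      exact Finset.sum_eq_zero fun j _ => by rw [(φ j).2.2.1 x hx]; simp
  have hli := Fintype.linearIndependent_iff.1 φ.linearIndependent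
  have key : ∀ r : Fin N → ℝ, (∀ x, ∑ j, r j * (φ j).1 x = 0) → ∀ j, r j = 0 := by
    intro r hr
    refine hli r ?_
    ext x
    simpa using hr x
  have hre := key (fun j => (c j).re) fun x => by
    have := congrArg Complex.re (h4 x)
    simpa [hv, femFun] using this
  have him := key (fun j => (c j).im) fun x => by
    have := congrArg Complex.im (h4 x)
    simpa [hv, femFun] using this
  ext j
  exact Complex.ext (hre j) (him j)

theorem star_cinner (k : ℝ) (u v : (Fin (n + 1) → ℝ) → ℂ) :
    star (cinner a b k u v) = cinner a b k v u := by
  have hs : star (k : ℂ) = k := star_ofReal k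
  rw [cinner, cinner, star_add, ← starRingEnd_apply, ← starRingEnd_apply, ← integral_conj,
    ← integral_conj]
  congr 1
  · refine integral_congr_ae (ae_of_all _ fun x => ?_)
    simp only [innerΩ, starRingEnd_apply, star_add, star_mul', star_sum, star_star, star_pow,
      star_inv₀, hs]
    simp only [mul_comm, mul_left_comm]
  · refine integral_congr_ae (ae_of_all _ fun x => ?_)
    simp only [innerΓ, starRingEnd_apply, star_add, star_mul', star_sum, star_star, star_pow, hs]
    simp only [mul_comm, mul_left_comm]

theorem precondD1_posDef (hab : ∀ i, a i < b i) {k : ℝ} (hk : 0 < k) :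
    (precondD1 a b k (fun j => (φ j).1)).PosDef := by
  refine Matrix.PosDef.of_dotProduct_mulVec_pos ?_ fun c hc => ?_
  · refine Matrix.IsHermitian.ext fun l m => ?_
    rw [precondD1_eq_cinner φ hab, precondD1_eq_cinner φ hab, star_cinner]
  · rw [precondD1_apply φ hab]
    have h1 := sqNorm_le_cnormSq hab (countable_gridSet T) (femFun_mem φ c) k
    have h2 : 0 < sqNorm (volΩ a b) (femFun (fun j => (φ j).1) c) :=
      lt_of_le_of_ne (sqNorm_nonneg _ _) fun h => hc (femFun_eq_zero φ hab h.symm)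
    have h3 : 0 ≤ ∑ i, sqNorm (volΩ a b) (cgrad a b (femFun (fun j => (φ j).1) c) i) :=
      Finset.sum_nonneg fun _ _ => sqNorm_nonneg _ _
    have h4 : 0 < k ^ 2 * sqNorm (volΩ a b) (femFun (fun j => (φ j).1) c) := by positivity
    exact_mod_cast (show 0 < cnormSq a b k (femFun (fun j => (φ j).1) c) by linarith)

end Matrices

/-! ### Convergence in `L²` -/

section L2

variable {X : Type*} [MeasurableSpace X] {μ : Measure X}

theorem sqrt_sqNorm_add_le {f g : X → ℂ} (hf : MemLp f 2 μ) (hg : MemLp g 2 μ) :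
    √(sqNorm μ (f + g)) ≤ √(sqNorm μ f) + √(sqNorm μ g) := by
  have h := eLpNorm_add_le hf.1 hg.1 (p := 2) (by norm_num)
  rw [eLpNorm_two_eq_sqNorm hf, eLpNorm_two_eq_sqNorm hg, eLpNorm_two_eq_sqNorm (hf.add hg),
    ← ENNReal.ofReal_add (Real.sqrt_nonneg _) (Real.sqrt_nonneg _)] at h
  exact (ENNReal.ofReal_le_ofReal_iff (by positivity)).1 h

theorem sqNorm_sub_comm (f g : X → ℂ) : sqNorm μ (f - g) = sqNorm μ (g - f) := by
  simp [sqNorm, norm_sub_rev]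

/-- The sequence `F` of functions in `L²(μ)` converges to `f ∈ L²(μ)`. -/
structure TendstoL2 (μ : Measure X) (F : ℕ → X → ℂ) (f : X → ℂ) : Prop where
  memLp_seq : ∀ m, MemLp (F m) 2 μ
  memLp_lim : MemLp f 2 μ
  tendsto : Tendsto (fun m => sqNorm μ (F m - f)) atTop (𝓝 0)

namespace TendstoL2

variable {F G : ℕ → X → ℂ} {f g : X → ℂ}

theorem congr (h : TendstoL2 μ F f) (hF : ∀ m, F m =ᵐ[μ] G m) (hf : f =ᵐ[μ] g) :
    TendstoL2 μ G g where
  memLp_seq m := (memLp_congr_ae (hF m)).1 (h.memLp_seq m)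
  memLp_lim := (memLp_congr_ae hf).1 h.memLp_lim
  tendsto := by
    refine h.tendsto.congr fun m => sqNorm_congr ?_
    filter_upwards [hF m, hf] with x h1 h2
    simp [h1, h2]

theorem add (hF : TendstoL2 μ F f) (hG : TendstoL2 μ G g) :
    TendstoL2 μ (fun m x => F m x + G m x) (fun x => f x + g x) where
  memLp_seq m := (hF.memLp_seq m).add (hG.memLp_seq m)
  memLp_lim := hF.memLp_lim.add hG.memLp_lim
  tendsto := by
    have h := (hF.tendsto.const_mul 2).add (hG.tendsto.const_mul 2)
    simp only [mul_zero, add_zero] at h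
    refine squeeze_zero (fun m => sqNorm_nonneg _ _) (fun m => ?_) h
    refine le_trans (le_of_eq ?_) (sqNorm_add_le ((hF.memLp_seq m).sub hF.memLp_lim)
      ((hG.memLp_seq m).sub hG.memLp_lim))
    refine congrArg _ (funext fun x => ?_)
    simp only [Pi.sub_apply, Pi.add_apply]
    ring

theorem bdd_mul (hF : TendstoL2 μ F f) {c : X → ℂ} (hc : AEStronglyMeasurable c μ) {M : ℝ}
    (hM : ∀ x, ‖c x‖ ≤ M) : TendstoL2 μ (fun m x => c x * F m x) (fun x => c x * f x) := by
  have hb : ∀ {q : X → ℂ}, MemLp q 2 μ → MemLp (fun x => c x * q x) 2 μ := fun {q} hq =>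
    hq.of_le_mul (c := M) (hc.mul hq.1) (ae_of_all _ fun x => by
      rw [norm_mul]; exact mul_le_mul_of_nonneg_right (hM x) (norm_nonneg _))
  refine ⟨fun m => hb (hF.memLp_seq m), hb hF.memLp_lim, ?_⟩
  have h := hF.tendsto.const_mul (M ^ 2)
  rw [mul_zero] at h
  refine squeeze_zero (fun m => sqNorm_nonneg _ _) (fun m => ?_) h
  have h1 := (hF.memLp_seq m).sub hF.memLp_lim
  rw [sqNorm, sqNorm, ← integral_const_mul]
  refine integral_mono (integrable_norm_sq ((hb (hF.memLp_seq m)).sub (hb hF.memLp_lim)))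
    ((integrable_norm_sq h1).const_mul _) fun x => ?_
  simp only [Pi.sub_apply]
  rw [← mul_sub, norm_mul, mul_pow]
  exact mul_le_mul_of_nonneg_right (pow_le_pow_left₀ (norm_nonneg _) (hM x) 2) (sq_nonneg _)

theorem const_mul (hF : TendstoL2 μ F f) (c : ℂ) :
    TendstoL2 μ (fun m x => c * F m x) (fun x => c * f x) :=
  hF.bdd_mul aestronglyMeasurable_const (c := fun _ => c) (M := ‖c‖) fun _ => le_rfl

theorem sum {ι : Type*} (s : Finset ι) {F : ι → ℕ → X → ℂ} {f : ι → X → ℂ}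
    (h : ∀ i ∈ s, TendstoL2 μ (F i) (f i)) :
    TendstoL2 μ (fun m x => ∑ i ∈ s, F i m x) (fun x => ∑ i ∈ s, f i x) := by
  classical
  induction s using Finset.induction_on with
  | empty =>
    exact ⟨fun m => by simp, by simp, by simp [sqNorm]⟩
  | insert i s hi ih =>
    simp only [Finset.sum_insert hi]
    exact (h i (Finset.mem_insert_self _ _)).add
      (ih fun j hj => h j (Finset.mem_insert_of_mem hj))

theorem tendsto_sqNorm (hF : TendstoL2 μ F f) :
    Tendsto (fun m => sqNorm μ (F m)) atTop (𝓝 (sqNorm μ f)) := by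
  have h0 : Tendsto (fun m => √(sqNorm μ (F m - f))) atTop (𝓝 0) := by
    have := (Real.continuous_sqrt.tendsto _).comp hF.tendsto
    rwa [Real.sqrt_zero] at this
  have h1 : Tendsto (fun m => √(sqNorm μ (F m))) atTop (𝓝 (√(sqNorm μ f))) := by
    rw [tendsto_iff_dist_tendsto_zero]
    refine squeeze_zero (fun _ => dist_nonneg) (fun m => ?_) h0
    have hd := (hF.memLp_seq m).sub hF.memLp_lim
    have e1 := sqrt_sqNorm_add_le hd hF.memLp_lim
    have e2 := sqrt_sqNorm_add_le (hF.memLp_lim.sub (hF.memLp_seq m)) (hF.memLp_seq m)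
    rw [sub_add_cancel] at e1 e2
    rw [sqNorm_sub_comm] at e2
    rw [Real.dist_eq, abs_le]
    constructor <;> linarith
  have h2 := h1.pow 2
  simpa only [Real.sq_sqrt (sqNorm_nonneg _ _)] using h2

theorem integral_mul (hF : TendstoL2 μ F f) {q : X → ℂ} (hq : MemLp q 2 μ) :
    Tendsto (fun m => ∫ x, q x * F m x ∂μ) atTop (𝓝 (∫ x, q x * f x ∂μ)) :=
  tendsto_integral_mul hF.memLp_seq hF.memLp_lim hq hF.tendsto

end TendstoL2

/-- `L²(μ)` is complete. -/
theorem exists_tendstoL2 {F : ℕ → X → ℂ} (hF : ∀ m, MemLp (F m) 2 μ) {e : ℕ → ℝ}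
    (he : Tendsto e atTop (𝓝 0)) (h : ∀ m l, sqNorm μ (F m - F l) ≤ e m + e l) :
    ∃ f, TendstoL2 μ F f := by
  have hd : ∀ m l, dist ((hF m).toLp (F m)) ((hF l).toLp (F l)) ≤ √(e m + e l) := by
    intro m l
    rw [dist_edist, Lp.edist_toLp_toLp, eLpNorm_two_eq_sqNorm ((hF m).sub (hF l)),
      ENNReal.toReal_ofReal (Real.sqrt_nonneg _)]
    exact Real.sqrt_le_sqrt (h m l)
  have hc : CauchySeq fun m => (hF m).toLp (F m) := by
    rw [Metric.cauchySeq_iff']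
    intro ε hε
    have h1 : ∀ᶠ m in atTop, e m < ε ^ 2 / 2 := he.eventually_lt_const (by positivity)
    obtain ⟨N, hN⟩ := eventually_atTop.1 h1
    refine ⟨N, fun m hm => (hd m N).trans_lt ?_⟩
    rw [Real.sqrt_lt' hε]
    linarith [hN m hm, hN N le_rfl]
  obtain ⟨f, hf⟩ := cauchySeq_tendsto_of_complete hc
  refine ⟨f, hF, Lp.memLp f, ?_⟩
  rw [← tendsto_sqNorm_iff fun m => (hF m).sub (Lp.memLp f)]
  have h2 := (Lp.tendsto_Lp_iff_tendsto_eLpNorm' _ _).1 hf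
  refine h2.congr fun m => eLpNorm_congr_ae ?_
  filter_upwards [(hF m).coeFn_toLp] with x hx
  simp [hx]

end L2

/-! ### Approximation of the solution by smooth functions -/

section Approx

variable {n : ℕ} {a b : Fin (n + 1) → ℝ} {u v w : (Fin (n + 1) → ℝ) → ℂ}

theorem md_single {d : ℕ} {E : Type*} [NormedAddCommGroup E] [NormedSpace ℝ E] (i : Fin d) (r : ℕ)
    (φ : (Fin d → ℝ) → E) : md (Pi.single i r) φ = (pd i)^[r] φ := by
  rw [md, foldr_iterate_single pd i r φ _ (List.nodup_finRange d)]
  simp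

theorem md_zero {d : ℕ} {E : Type*} [NormedAddCommGroup E] [NormedSpace ℝ E]
    (φ : (Fin d → ℝ) → E) : md 0 φ = φ := by
  rw [md]
  induction List.finRange d with
  | nil => rfl
  | cons j l ih => simp [ih]

theorem isWeakDeriv_zero (hu : MemLp u 2 (volΩ a b)) : IsWeakDeriv a b 0 u u :=
  ⟨hu, hu, fun φ _ => by rw [mderiv_eq_md, md_zero]; simp⟩

theorem single_mem_multiIndices {d m r : ℕ} (hr : r ≤ m) (i : Fin d) :
    Pi.single i r ∈ multiIndices d m := by
  simp only [multiIndices, Finset.mem_filter, Fintype.mem_piFinset, Finset.mem_range]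
  refine ⟨fun j => ?_, by simpa [Finset.sum_pi_single'] using hr⟩
  by_cases h : j = i
  · subst h; simp; omega
  · simp [h]

theorem cgrad_eq_pd (hab : ∀ i, a i < b i) (hv : ContDiff ℝ ∞ v) {x : Fin (n + 1) → ℝ}
    (hx : x ∈ Set.Icc a b) (i : Fin (n + 1)) : cgrad a b v i x = pd i v x := by
  rw [cgrad, pd, fderivWithin_eq_fderiv (uniqueDiffOn_box hab x hx)
    (hv.differentiable (by simp) x)]

theorem integrable_smul_of_contDiff {ψ : (Fin (n + 1) → ℝ) → ℝ} (hψ : ContDiff ℝ ∞ ψ)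
    (hu : MemLp u 2 (volΩ a b)) : Integrable (fun x => ψ x • u x) (volΩ a b) := by
  have h1 : MemLp (fun x => (ψ x : ℂ)) 2 (volΩ a b) :=
    MemLp.two_vol (Complex.continuous_ofReal.comp hψ.continuous).continuousOn
  simp only [Complex.real_smul]
  exact h1.integrable_mul hu

theorem isWeakLaplacian_of_memSobolev {m : ℕ} (hm : 2 ≤ m) (hu : MemSobolev a b m u) :
    IsWeakLaplacian a b u fun x => ∑ i, weakDeriv a b (Pi.single i 2) u x := by
  have hs : ∀ i, IsWeakDeriv a b (Pi.single i 2) u (weakDeriv a b (Pi.single i 2) u) := fun i =>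
    Classical.epsilon_spec (hu.2 _ (single_mem_multiIndices hm i))
  refine ⟨hu.1, memLp_finsetSum _ fun i _ => (hs i).2.1, fun φ hφ => ?_⟩
  simp only [Finset.sum_smul, Finset.smul_sum]
  have hφ3 : ∀ i, Integrable (fun x => pderiv i (pderiv i φ) x • u x) (volΩ a b) := fun i =>
    integrable_smul_of_contDiff (contDiff_pd (contDiff_pd hφ.1 i) i) hu.1
  rw [integral_finsetSum _ fun i _ => hφ3 i, integral_finsetSum _ fun i _ =>
    integrable_smul_of_contDiff hφ.1 (hs i).2.1]
  refine Finset.sum_congr rfl fun i _ => ?_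
  have h := (hs i).2.2 φ hφ
  rw [mderiv_eq_md, md_single] at h
  simp only [Finset.sum_pi_single', Finset.mem_univ, if_true, even_two.neg_pow, one_pow,
    one_mul] at h
  exact h

/-- Smooth functions converging in `H¹(Ω)` converge on the boundary. -/
theorem exists_tendstoL2_surf (hab : ∀ i, a i < b i) {V : ℕ → (Fin (n + 1) → ℝ) → ℂ}
    (hV : ∀ m, ContDiff ℝ ∞ (V m)) {W : Fin (n + 1) → (Fin (n + 1) → ℝ) → ℂ}
    (h0 : TendstoL2 (volΩ a b) V w) (h1 : ∀ i, TendstoL2 (volΩ a b) (fun m => pd i (V m)) (W i)) :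
    ∃ t, TendstoL2 (surf a b) V t := by
  have hC : ∀ m, ContDiffOn ℝ 1 (V m) (Set.Icc a b) := fun m =>
    ((hV m).of_le (by simp)).contDiffOn
  have hK := traceConst_nonneg hab
  refine exists_tendstoL2 (fun m => MemLp.two_surf hab (hV m).continuous.continuousOn)
    (e := fun m => traceConst a b * (2 * sqNorm (volΩ a b) (V m - w) +
      ∑ i, 2 * sqNorm (volΩ a b) (pd i (V m) - W i))) ?_ fun m l => ?_
  · have h := ((h0.tendsto.const_mul 2).add
      (tendsto_finsetSum Finset.univ fun i _ => (h1 i).tendsto.const_mul 2)).const_mul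
        (traceConst a b)
    simpa using h
  · refine (sqNorm_surf_le hab ((hC m).sub (hC l))).trans ?_
    rw [← mul_add]
    refine mul_le_mul_of_nonneg_left ?_ hK
    have key : ∀ {F : ℕ → (Fin (n + 1) → ℝ) → ℂ} {q : (Fin (n + 1) → ℝ) → ℂ},
        TendstoL2 (volΩ a b) F q → sqNorm (volΩ a b) (F m - F l) ≤
          2 * sqNorm (volΩ a b) (F m - q) + 2 * sqNorm (volΩ a b) (F l - q) := by
      intro F q h
      have := sqNorm_sub_le ((h.memLp_seq m).sub h.memLp_lim) ((h.memLp_seq l).sub h.memLp_lim)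
      rwa [sub_sub_sub_cancel_right] at this
    have e1 := key h0
    have e2 : ∑ i, sqNorm (volΩ a b) (cgrad a b (V m - V l) i) ≤
        ∑ i, 2 * sqNorm (volΩ a b) (pd i (V m) - W i) +
        ∑ i, 2 * sqNorm (volΩ a b) (pd i (V l) - W i) := by
      rw [← Finset.sum_add_distrib]
      refine Finset.sum_le_sum fun i _ => ?_
      have e3 : cgrad a b (V m - V l) i =ᵐ[volΩ a b] pd i (V m) - pd i (V l) := by
        refine ae_vol_of_grid Set.countable_empty fun x hx _ => ?_
        have hx' := openBox_subset_Icc hx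
        rw [cgrad_sub hab (hC m) (hC l) hx', cgrad_eq_pd hab (hV m) hx', cgrad_eq_pd hab (hV l) hx']
        rfl
      rw [sqNorm_congr e3]
      exact key (F := fun m => pd i (V m)) (h1 i)
    exact (add_le_add e1 e2).trans (by linarith)

/-- A multi-index does not record the order of differentiation; for mixed derivatives the symmetry
of second derivatives is used. -/
theorem exists_md_eq_pd_pd (hn : n ≤ 1) (i j : Fin (n + 1)) :
    ∃ α ∈ multiIndices (n + 1) 4, ∀ {V : (Fin (n + 1) → ℝ) → ℂ}, ContDiff ℝ ∞ V →
      md α V = pd i (pd j V) := by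
  by_cases hij : i = j
  · subst hij
    exact ⟨_, single_mem_multiIndices (r := 2) (by norm_num) i, fun _ => by rw [md_single]; rfl⟩
  obtain rfl | rfl : n = 0 ∨ n = 1 := by omega
  · exact absurd (Subsingleton.elim (α := Fin 1) i j) hij
  · refine ⟨![1, 1], mem_multiIndices_two (by norm_num), fun {V} hV => ?_⟩
    rw [md_two]
    fin_cases i <;> fin_cases j
    · exact absurd rfl hij
    · rfl
    · exact pd_comm hV 0 1
    · exact absurd rfl hij

/-- A solution in `H⁴(Ω)` is the limit of smooth functions, together with its data. -/
theorem exists_smooth_approx (hn : n ≤ 1) (hab : ∀ i, a i < b i) {r : ℝ} (hr : 0 < r)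
    (hface : ∀ i, a i ≤ -r ∧ r ≤ b i) {k : ℝ} {f g : (Fin (n + 1) → ℝ) → ℂ}
    (hsol : IsIIPSolution a b k f g u) (hu : MemSobolev a b 4 u) :
    ∃ U : ℕ → (Fin (n + 1) → ℝ) → ℂ, (∀ m, ContDiff ℝ ∞ (U m)) ∧
      TendstoL2 (volΩ a b) U u ∧
      (∀ i, TendstoL2 (volΩ a b) (fun m => cgrad a b (U m) i) (wgrad a b u i)) ∧
      Tendsto (fun m => sobSq a b (U m)) atTop (𝓝 (sobolevNorm a b 4 u ^ 2)) ∧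
      TendstoL2 (volΩ a b) (fun m x => -copL k (U m) x) f ∧
      TendstoL2 (surf a b) (fun m x => cnormalDeriv a b (U m) x - Complex.I * k * U m x) g := by
  obtain ⟨U, hU, hlim⟩ := exists_smooth_seq hr hface hu
  have hs : ∀ α ∈ multiIndices (n + 1) 4, IsWeakDeriv a b α u (weakDeriv a b α u) := fun α hα =>
    Classical.epsilon_spec (hu.2 α hα)
  have hmd : ∀ α ∈ multiIndices (n + 1) 4,
      TendstoL2 (volΩ a b) (fun m => md α (U m)) (weakDeriv a b α u) := fun α hα =>
    ⟨fun m => memLp_of_contDiff (contDiff_md (hU m) α), (hs α hα).2.1, hlim α hα⟩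
  have hC : ∀ m, U m ∈ gridC2 a b ∅ := fun m => contDiff_mem_gridC2 (hU m) ∅
  have h0 : TendstoL2 (volΩ a b) U u :=
    (hmd 0 (by simpa using single_mem_multiIndices (r := 0) (Nat.zero_le 4) (0 : Fin (n + 1)))).congr
      (fun m => by rw [md_zero]) (weakDeriv_ae_eq (isWeakDeriv_zero hu.1))
  have h1 : ∀ i, TendstoL2 (volΩ a b) (fun m => pd i (U m)) (wgrad a b u i) := fun i =>
    (hmd _ (single_mem_multiIndices (r := 1) (by norm_num) i)).congr
      (fun m => by rw [md_single]; rfl) (by rfl)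
  have h1c : ∀ i, TendstoL2 (volΩ a b) (fun m => cgrad a b (U m) i) (wgrad a b u i) := fun i =>
    (h1 i).congr (fun m => ae_vol_of_grid Set.countable_empty fun x hx _ =>
      (cgrad_eq_pd hab (hU m) (openBox_subset_Icc hx) i).symm) (by rfl)
  have hlap : wlap a b u =ᵐ[volΩ a b] fun x => ∑ i, weakDeriv a b (Pi.single i 2) u x :=
    wlap_ae_eq (isWeakLaplacian_of_memSobolev (by norm_num) hu)
  have h2 : TendstoL2 (volΩ a b) (fun m => clap (U m)) (wlap a b u) := by
    refine (TendstoL2.sum Finset.univ fun i _ =>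
      hmd _ (single_mem_multiIndices (r := 2) (by norm_num) i)).congr (fun m => ?_) hlap.symm
    refine ae_of_all _ fun x => ?_
    simp only [md_single, clap]
    rfl
  -- Convergence of the first derivatives on `Γ` follows from the trace inequality, which requires
  -- convergence of all second derivatives in `Ω`, including the mixed ones.
  have hpd2 : ∀ i j, ∃ W, TendstoL2 (volΩ a b) (fun m => pd i (pd j (U m))) W := by
    intro i j
    obtain ⟨α, hα, he⟩ := exists_md_eq_pd_pd hn i j
    exact ⟨_, (hmd α hα).congr (fun m => by rw [he (hU m)]) (by rfl)⟩
  choose W hW using hpd2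
  obtain ⟨t, ht⟩ := exists_tendstoL2_surf hab hU h0 h1
  have htj := fun j => exists_tendstoL2_surf hab (fun m => contDiff_pd (hU m) j) (h1 j)
    fun i => hW i j
  choose τ hτ using htj
  have hq : TendstoL2 (surf a b) (fun m => cnormalDeriv a b (U m))
      (fun x => ∑ i, (normal a b x i : ℂ) * τ i x) := by
    refine (TendstoL2.sum Finset.univ fun i _ => (hτ i).bdd_mul
      (c := fun x => (normal a b x i : ℂ)) (M := 1)
      (Complex.measurable_ofReal.comp (measurable_normal i)).aestronglyMeasurable
      fun x => by simpa using norm_normal_le x i).congr (fun m => ?_) (by rfl)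
    refine ae_surf_of_Icc hab fun x hx => ?_
    simp only [cnormalDeriv, cgrad_eq_pd hab (hU m) hx]
  have htr : trace a b u =ᵐ[surf a b] t := by
    refine trace_ae_eq_of_isTrace hab hu.1 (fun i => (h1 i).memLp_lim)
      ⟨ht.memLp_lim, U, fun m => (hC m).1, ?_, fun i => ?_, ?_⟩
    · exact (tendsto_sqNorm_iff fun m => (h0.memLp_seq m).sub h0.memLp_lim).2 h0.tendsto
    · exact (tendsto_sqNorm_iff fun m => ((h1c i).memLp_seq m).sub (h1c i).memLp_lim).2
        (h1c i).tendsto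
    · exact (tendsto_sqNorm_iff fun m => (ht.memLp_seq m).sub ht.memLp_lim).2 ht.tendsto
  -- Each `U m` satisfies Green's identity, and all its terms converge. So the limit of the
  -- classical normal derivatives is a normal derivative of `u`, and by uniqueness it agrees with
  -- the boundary condition.
  have hnd : IsNormalDeriv a b u fun x => ∑ i, (normal a b x i : ℂ) * τ i x := by
    refine ⟨hq.memLp_lim, fun ψ hψ => ?_⟩
    have hψ0 := MemLp.two_vol (a := a) (b := b) hψ.continuousOn
    have hψ1 := fun i => MemLp.two_vol (continuousOn_cgrad hab hψ i)
    have l1 := hq.integral_mul (MemLp.two_surf hab hψ.continuousOn)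
    have l2 := (tendsto_finsetSum Finset.univ fun i _ => (h1c i).integral_mul (hψ1 i)).add
      (h2.integral_mul hψ0)
    have split : ∀ {P : Fin (n + 1) → (Fin (n + 1) → ℝ) → ℂ} {Q : (Fin (n + 1) → ℝ) → ℂ},
        (∀ i, MemLp (P i) 2 (volΩ a b)) → MemLp Q 2 (volΩ a b) →
        ∑ i, ∫ x, cgrad a b ψ i x * P i x ∂(volΩ a b) + ∫ x, ψ x * Q x ∂(volΩ a b) =
          ∫ x, ((∑ i, P i x * cgrad a b ψ i x) + Q x * ψ x) ∂(volΩ a b) := by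
      intro P Q hP hQ
      have j1 : ∀ i, Integrable (fun x => cgrad a b ψ i x * P i x) (volΩ a b) := fun i =>
        (hψ1 i).integrable_mul (hP i)
      have j2 : Integrable (fun x => ψ x * Q x) (volΩ a b) := hψ0.integrable_mul hQ
      rw [← integral_finsetSum _ fun i _ => j1 i,
        ← integral_add (integrable_finsetSum _ fun i _ => j1 i) j2]
      simp only [mul_comm]
    have l3 : ∀ m, ∑ i, ∫ x, cgrad a b ψ i x * cgrad a b (U m) i x ∂(volΩ a b) +
        ∫ x, ψ x * clap (U m) x ∂(volΩ a b) =
        ∫ x, ψ x * cnormalDeriv a b (U m) x ∂(surf a b) := by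
      intro m
      rw [split (fun i => (h1c i).memLp_seq m) (h2.memLp_seq m),
        ← integral_cnormalDeriv_mul hab Set.countable_empty (hC m) hψ]
      simp only [mul_comm]
    simp only [l3] at l2
    have l4 := tendsto_nhds_unique l1 l2
    rw [split (fun i => (h1c i).memLp_lim) h2.memLp_lim] at l4
    rw [← l4]
    simp only [mul_comm]
  refine ⟨U, hU, h0, h1c, ?_, ?_, ?_⟩
  · rw [sobolevNorm, Real.sq_sqrt (Finset.sum_nonneg fun _ _ => sqNorm_nonneg _ _)]
    exact tendsto_finsetSum _ fun α hα => (hmd α hα).tendsto_sqNorm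
  · refine ((h2.add (h0.const_mul ((k : ℂ) ^ 2))).const_mul (-1)).congr
      (fun m => ae_of_all _ fun x => by simp [copL]) ?_
    filter_upwards [wlap_ae_eq hsol.pde] with x hx
    rw [hx]
    ring
  · refine (hq.add (ht.const_mul (-(Complex.I * k)))).congr
      (fun m => ae_of_all _ fun x => by simp only; ring) ?_
    filter_upwards [htr, hsol.bc.ae_eq hnd] with x h3 h4
    rw [← h4, h3]
    ring

end Approx

/-! ### Scalar estimates -/

/-- The exponential decay of the GMRES error beats the polynomial growth in the wave number. -/
theorem exists_iterations {c k₀ η : ℝ} (P : ℝ) (hc : 0 < c) (hk₀ : 0 < k₀) (hη : 0 < η) :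
    ∃ m₀ : ℝ, 0 < m₀ ∧ ∀ k m : ℝ, k₀ ≤ k → m₀ * max 1 (k * Real.log k) ≤ m →
      |P| * k ^ 5 * Real.exp (-(c * m / k)) ≤ η := by
  have hlim : Tendsto (fun x : ℝ => |P| * (32 * Real.exp (5 / 2)) * Real.exp (-(c / 2 * x))) atTop
      (𝓝 (|P| * (32 * Real.exp (5 / 2)) * 0)) :=
    ((Real.tendsto_exp_neg_atTop_nhds_zero.comp
      (tendsto_id.const_mul_atTop (half_pos hc))).const_mul _)
  rw [mul_zero] at hlim
  obtain ⟨m₀, h1, h2, h3⟩ := ((hlim.eventually_lt_const hη).and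
    ((eventually_gt_atTop 0).and (eventually_ge_atTop (5 / c)))).exists
  rw [div_le_iff₀' hc] at h3
  refine ⟨m₀, h2, fun k m hk hm => le_trans ?_ h1.le⟩
  have hk' : 0 < k := hk₀.trans_le hk
  have key : k ^ 5 * Real.exp (-(c * m / k)) ≤
      32 * Real.exp (5 / 2) * Real.exp (-(c / 2 * m₀)) := by
    -- For `k ≥ 2` write `k⁵ = exp (5 log k)`; the exponent `-(c m₀ - 5) log k` is at most `-(c m₀ -
    -- 5)/2` because `c m₀ ≥ 5` and `log k ≥ 1/2`. For `k < 2`, where `log k` may be small or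
    -- negative, `k⁵ ≤ 32` and the entry `1` of the maximum gives `m/k ≥ m₀/2`.
    by_cases h : 2 ≤ k
    · have hl : 1 / 2 ≤ Real.log k :=
        (by linarith [Real.log_two_gt_d9] : (1 / 2 : ℝ) ≤ Real.log 2).trans
          (Real.log_le_log (by norm_num) h)
      have e1 : m₀ * Real.log k ≤ m / k := by
        rw [le_div_iff₀ hk']
        have := mul_le_mul_of_nonneg_left (le_max_right 1 (k * Real.log k)) h2.le
        linarith
      have e2 : k ^ 5 = Real.exp (5 * Real.log k) := by
        rw [mul_comm, Real.exp_mul, Real.exp_log hk']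
        norm_cast
      have e3 : Real.exp (-(c * m / k)) ≤ Real.exp (-(c * (m₀ * Real.log k))) := by
        rw [mul_div_assoc]
        exact Real.exp_le_exp.2 (neg_le_neg (mul_le_mul_of_nonneg_left e1 hc.le))
      have e4 : (c * m₀ - 5) * (1 / 2) ≤ (c * m₀ - 5) * Real.log k :=
        mul_le_mul_of_nonneg_left hl (by linarith)
      calc k ^ 5 * Real.exp (-(c * m / k))
          ≤ Real.exp (5 * Real.log k) * Real.exp (-(c * (m₀ * Real.log k))) := by
            rw [e2]; exact mul_le_mul_of_nonneg_left e3 (Real.exp_pos _).le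
        _ = Real.exp (5 * Real.log k + -(c * (m₀ * Real.log k))) := (Real.exp_add _ _).symm
        _ ≤ Real.exp (5 / 2 + -(c / 2 * m₀)) := Real.exp_le_exp.2 (by linarith)
        _ = Real.exp (5 / 2) * Real.exp (-(c / 2 * m₀)) := Real.exp_add _ _
        _ ≤ 32 * Real.exp (5 / 2) * Real.exp (-(c / 2 * m₀)) := by
            have : 0 < Real.exp (5 / 2) * Real.exp (-(c / 2 * m₀)) := by positivity
            linarith
    · push Not at h
      have e1 : m₀ / 2 ≤ m / k := by
        have := mul_le_mul_of_nonneg_left (le_max_left 1 (k * Real.log k)) h2.le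
        rw [div_le_div_iff₀ (by norm_num) hk']
        nlinarith
      have e2 : k ^ 5 ≤ 32 :=
        (pow_le_pow_left₀ hk'.le h.le 5).trans (by norm_num)
      have e3 : Real.exp (-(c * m / k)) ≤ Real.exp (-(c / 2 * m₀)) := by
        refine Real.exp_le_exp.2 (neg_le_neg ?_)
        have := mul_le_mul_of_nonneg_left e1 hc.le
        rw [mul_div_assoc]
        linarith
      have e4 : 1 ≤ Real.exp (5 / 2) := Real.one_le_exp (by norm_num)
      exact mul_le_mul (e2.trans (by linarith)) e3 (Real.exp_pos _).le (by positivity)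
  calc |P| * k ^ 5 * Real.exp (-(c * m / k)) = |P| * (k ^ 5 * Real.exp (-(c * m / k))) := by ring
    _ ≤ |P| * (32 * Real.exp (5 / 2) * Real.exp (-(c / 2 * m₀))) :=
        mul_le_mul_of_nonneg_left key (abs_nonneg _)
    _ = _ := by ring

/-- The mesh condition `h k^{7/4} ≤ C` bounds the interpolation error. -/
theorem mesh_bound {κ k h C : ℝ} (hκ : 1 ≤ κ) (hk : 0 < k) (hκk : 1 ≤ κ * k) (hh : 0 ≤ h)
    (hC : C ≤ 1) (hm : h * k ^ (7 / 4 : ℝ) ≤ C) :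
    (k ^ 2)⁻¹ * h ^ 4 + h ^ 6 + k ^ 2 * h ^ 8 + k ^ 2 * (h ^ 8 + h ^ 7) + (h ^ 6 + h ^ 5) ≤
      7 * C ^ 4 * κ ^ 5 / k ^ 8 := by
  have h4 : h ^ 4 * k ^ 7 ≤ C ^ 4 := by
    have := pow_le_pow_left₀ (mul_nonneg hh (Real.rpow_nonneg hk.le _)) hm 4
    rwa [mul_pow, ← Real.rpow_natCast, ← Real.rpow_natCast (k ^ (7 / 4 : ℝ)),
      ← Real.rpow_mul hk.le, (by norm_num : (7 / 4 : ℝ) * (4 : ℕ) = (7 : ℕ)), Real.rpow_natCast,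
      Real.rpow_natCast] at this
  have hC0 : 0 ≤ C := le_trans (by positivity) hm
  have hC4 : C ^ 4 ≤ 1 := pow_le_one₀ hC0 hC
  have hκ0 : 0 ≤ κ := by linarith
  -- The lower bound on `k`, in the form `κ k ≥ 1`, turns `h⁴k⁷ ≤ 1` into a bound for `hk`: multiply
  -- `(hk)⁴` by `(κk)³ ≥ 1`.
  have hkh : h * k ≤ κ := by
    refine le_of_pow_le_pow_left₀ (n := 4) (by norm_num) hκ0 ?_
    have e : (h * k) ^ 4 ≤ (h ^ 4 * k ^ 7) * κ ^ 3 := by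
      have := one_le_pow₀ hκk (n := 3)
      calc (h * k) ^ 4 ≤ (h * k) ^ 4 * (κ * k) ^ 3 := le_mul_of_one_le_right (by positivity) this
        _ = _ := by ring
    calc (h * k) ^ 4 ≤ (h ^ 4 * k ^ 7) * κ ^ 3 := e
      _ ≤ 1 * κ ^ 3 := mul_le_mul_of_nonneg_right (h4.trans hC4) (by positivity)
      _ ≤ κ ^ 4 := by rw [one_mul]; exact pow_le_pow_right₀ hκ (by norm_num)
  have hX0 : 0 ≤ h * k := by positivity
  have h6 : h ^ 4 * k ^ 6 ≤ C ^ 4 * κ := by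
    calc h ^ 4 * k ^ 6 ≤ h ^ 4 * k ^ 6 * (κ * k) := le_mul_of_one_le_right (by positivity) hκk
      _ = (h ^ 4 * k ^ 7) * κ := by ring
      _ ≤ _ := mul_le_mul_of_nonneg_right h4 hκ0
  have low : ∀ j, j ≤ 4 → h ^ 4 * k ^ 6 * (h * k) ^ j ≤ C ^ 4 * κ ^ 5 := fun j hj => by
    calc h ^ 4 * k ^ 6 * (h * k) ^ j ≤ C ^ 4 * κ * κ ^ j :=
          mul_le_mul h6 (pow_le_pow_left₀ hX0 hkh j) (by positivity) (by positivity)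
      _ = C ^ 4 * κ ^ (j + 1) := by ring
      _ ≤ _ := mul_le_mul_of_nonneg_left (pow_le_pow_right₀ hκ (by omega)) (by positivity)
  have high : ∀ j, j ≤ 5 → h ^ 4 * k ^ 7 * (h * k) ^ j ≤ C ^ 4 * κ ^ 5 := fun j hj =>
    mul_le_mul h4 ((pow_le_pow_left₀ hX0 hkh j).trans (pow_le_pow_right₀ hκ hj)) (by positivity)
      (by positivity)
  rw [le_div_iff₀ (by positivity)]
  -- After multiplication by `k⁸`, each of the seven terms is `h⁴k⁶` or `h⁴k⁷` times a power of the
  -- bounded quantity `hk`. The odd powers of `h` come from the trace inequality, and for them the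
  -- full `h⁴k⁷ = (h k^(7/4))⁴` is used.
  calc _ = h ^ 4 * k ^ 6 * (h * k) ^ 0 + 2 * (h ^ 4 * k ^ 6 * (h * k) ^ 2) +
        2 * (h ^ 4 * k ^ 6 * (h * k) ^ 4) + h ^ 4 * k ^ 7 * (h * k) ^ 3 +
        h ^ 4 * k ^ 7 * (h * k) ^ 1 := by
        field_simp
        ring
    _ ≤ _ := by
        linarith [low 0 (by norm_num), low 2 (by norm_num), low 4 (by norm_num),
          high 3 (by norm_num), high 1 (by norm_num)]

section Error

variable {n : ℕ} {a b : Fin (n + 1) → ℝ} {S : Set ℝ} {u v w U : (Fin (n + 1) → ℝ) → ℂ}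

/-! ### The norms of the approximations -/

theorem sobolevNorm_zero (hu : MemLp u 2 (volΩ a b)) :
    sobolevNorm a b 0 u = √(sqNorm (volΩ a b) u) := by
  have h : multiIndices (n + 1) 0 = {0} := by
    ext α
    simp only [multiIndices, Finset.mem_filter, Fintype.mem_piFinset, Finset.mem_range,
      Finset.mem_singleton]
    constructor
    · rintro ⟨h, -⟩
      ext i
      have := h i
      simp at this ⊢
      exact this
    · rintro rfl
      simp
  rw [sobolevNorm, h, Finset.sum_singleton, sqNorm_congr (weakDeriv_ae_eq (isWeakDeriv_zero hu))]

theorem sobolevNorm_nonneg (m : ℕ) : 0 ≤ sobolevNorm a b m u := Real.sqrt_nonneg _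

/-- Four applications of the oscillation bound lead to `k⁴` times the `L²` norm, and one factor `k`
is part of the energy norm, so only `k³` remains. -/
theorem sobolevNorm_four_le {k C₁ : ℝ} (hk : 0 < k) (hu : Oscillatory a b k C₁ u) :
    sobolevNorm a b 4 u ≤ |C₁| ^ 4 * k ^ 3 * normH1k a b k u := by
  have step : ∀ m ≤ 3, sobolevNorm a b (m + 1) u ≤ |C₁| * k * sobolevNorm a b m u := fun m hm =>
    (hu.2 m hm).trans (mul_le_mul_of_nonneg_right
      (mul_le_mul_of_nonneg_right (le_abs_self _) hk.le) (sobolevNorm_nonneg m))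
  have hc : 0 ≤ |C₁| * k := by positivity
  have h1 : k * sobolevNorm a b 0 u ≤ normH1k a b k u := by
    rw [sobolevNorm_zero hu.1.1, normH1k]
    refine Real.le_sqrt_of_sq_le ?_
    rw [mul_pow, Real.sq_sqrt (sqNorm_nonneg _ _)]
    exact le_add_of_nonneg_left (Finset.sum_nonneg fun _ _ => sqNorm_nonneg _ _)
  calc sobolevNorm a b 4 u ≤ |C₁| * k * sobolevNorm a b 3 u := step 3 le_rfl
    _ ≤ |C₁| * k * (|C₁| * k * sobolevNorm a b 2 u) :=
        mul_le_mul_of_nonneg_left (step 2 (by norm_num)) hc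
    _ ≤ |C₁| * k * (|C₁| * k * (|C₁| * k * sobolevNorm a b 1 u)) := by
        gcongr; exact step 1 (by norm_num)
    _ ≤ |C₁| * k * (|C₁| * k * (|C₁| * k * (|C₁| * k * sobolevNorm a b 0 u))) := by
        gcongr; exact step 0 (by norm_num)
    _ = |C₁| ^ 4 * k ^ 3 * (k * sobolevNorm a b 0 u) := by ring
    _ ≤ _ := by gcongr

/-- A consequence of the parallelogram law. The factor `2` is a lossy substitute for the triangle
inequality and only affects constants. -/
theorem sqrt_cnormSq_add_sub_le (hab : ∀ i, a i < b i) (hS : S.Countable) (k : ℝ)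
    (hu : u ∈ gridC2 a b S) (hv : v ∈ gridC2 a b S) :
    √(cnormSq a b k (u + v)) ≤ 2 * (√(cnormSq a b k u) + √(cnormSq a b k v)) ∧
    √(cnormSq a b k (u - v)) ≤ 2 * (√(cnormSq a b k u) + √(cnormSq a b k v)) := by
  have hp : cnormSq a b k (u + v) + cnormSq a b k (u - v) =
      2 * (cnormSq a b k u + cnormSq a b k v) := by
    have h : ∀ x y : gridC2 a b S, cinnerₗ hab hS k (x + y) (x + y) +
        cinnerₗ hab hS k (x - y) (x - y) = 2 * (cinnerₗ hab hS k x x + cinnerₗ hab hS k y y) := by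
      intro x y
      simp only [map_add, map_sub, LinearMap.add_apply, LinearMap.sub_apply]
      ring
    have h1 : cinner a b k (u + v) (u + v) + cinner a b k (u - v) (u - v) =
        2 * (cinner a b k u u + cinner a b k v v) := h ⟨u, hu⟩ ⟨v, hv⟩
    simp only [cinner_self] at h1
    exact_mod_cast h1
  have aux : ∀ {x : ℝ}, 0 ≤ x → x ≤ 2 * (cnormSq a b k u + cnormSq a b k v) →
      √x ≤ 2 * (√(cnormSq a b k u) + √(cnormSq a b k v)) := by
    intro x _ hx
    have e1 := Real.sqrt_nonneg (cnormSq a b k u)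
    have e2 := Real.sqrt_nonneg (cnormSq a b k v)
    refine Real.sqrt_le_iff.2 ⟨by positivity, ?_⟩
    have e3 := Real.sq_sqrt (cnormSq_nonneg (a := a) (b := b) k u)
    have e4 := Real.sq_sqrt (cnormSq_nonneg (a := a) (b := b) k v)
    have e5 := mul_nonneg e1 e2
    nlinarith
  have n1 := cnormSq_nonneg (a := a) (b := b) k (u + v)
  have n2 := cnormSq_nonneg (a := a) (b := b) k (u - v)
  exact ⟨aux n1 (by linarith), aux n2 (by linarith)⟩

theorem IsWeakDeriv.sub {α : Fin (n + 1) → ℕ} {u' v' : (Fin (n + 1) → ℝ) → ℂ}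
    (hu : IsWeakDeriv a b α u u') (hv : IsWeakDeriv a b α v v') :
    IsWeakDeriv a b α (u - v) (u' - v') := by
  refine ⟨hu.1.sub hv.1, hu.2.1.sub hv.2.1, fun φ hφ => ?_⟩
  have hm : ContDiff ℝ ∞ (mderiv α φ) := contDiff_md hφ.1 α
  simp only [Pi.sub_apply, smul_sub]
  rw [integral_sub (integrable_smul_of_contDiff hm hu.1) (integrable_smul_of_contDiff hm hv.1),
    integral_sub (integrable_smul_of_contDiff hφ.1 hu.2.1)
      (integrable_smul_of_contDiff hφ.1 hv.2.1), hu.2.2 φ hφ, hv.2.2 φ hφ, mul_sub]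

/-- The bridge between the weak solution `u` and the classical setting: `u - w` is split at a
function `U` of `gridC2`, and only `U - w` is measured in the `V₁` norm. The distance of `U` and `u`
is needed in the energy norm alone. -/
theorem normH1k_sub_le (hab : ∀ i, a i < b i) (hS : S.Countable) (k : ℝ) (hu : MemSobolev a b 1 u)
    (hU : U ∈ gridC2 a b S) (hw : w ∈ gridC2 a b S) :
    normH1k a b k (u - w) ≤ 2 * (√((∑ i, sqNorm (volΩ a b) (cgrad a b U i - wgrad a b u i)) +
      k ^ 2 * sqNorm (volΩ a b) (U - u)) + √(cnormSq a b k (U - w))) := by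
  have hs : ∀ i, IsWeakDeriv a b (Pi.single i 1) u (wgrad a b u i) := fun i =>
    Classical.epsilon_spec (hu.2 _ (single_mem_multiIndices le_rfl i))
  have hUw : U - w ∈ gridC2 a b S := Submodule.sub_mem _ hU hw
  have mU := fun i => MemLp.two_vol (continuousOn_cgrad hab hU.1 i)
  have mUw := fun i => MemLp.two_vol (continuousOn_cgrad hab hUw.1 i)
  have g1 : ∀ i, sqNorm (volΩ a b) (wgrad a b (u - w) i) ≤
      2 * sqNorm (volΩ a b) (cgrad a b (U - w) i) +
      2 * sqNorm (volΩ a b) (cgrad a b U i - wgrad a b u i) := by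
    intro i
    refine le_trans (le_of_eq (sqNorm_congr ?_))
      (sqNorm_sub_le (mUw i) ((mU i).sub (hs i).2.1))
    refine (weakDeriv_ae_eq ((hs i).sub (isWeakDeriv_cgrad hab hw.1 i))).trans ?_
    refine ae_vol_of_grid hS fun x hx _ => ?_
    simp only [Pi.sub_apply, cgrad_sub hab hU.1 hw.1 (openBox_subset_Icc hx)]
    ring
  have g0 : sqNorm (volΩ a b) (u - w) ≤ 2 * sqNorm (volΩ a b) (U - w) +
      2 * sqNorm (volΩ a b) (U - u) := by
    have := sqNorm_sub_le (MemLp.two_vol hUw.1.continuousOn)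
      ((MemLp.two_vol hU.1.continuousOn).sub hu.1)
    rwa [sub_sub_sub_cancel_left] at this
  have gs := Finset.sum_le_sum fun i (_ : i ∈ Finset.univ) => g1 i
  rw [Finset.sum_add_distrib, ← Finset.mul_sum, ← Finset.mul_sum] at gs
  have gk := mul_le_mul_of_nonneg_left g0 (sq_nonneg k)
  have gV := sqNorm_le_cnormSq hab hS hUw k
  set d := (∑ i, sqNorm (volΩ a b) (cgrad a b U i - wgrad a b u i)) +
      k ^ 2 * sqNorm (volΩ a b) (U - u) with hd
  have hd0 : 0 ≤ d := add_nonneg (Finset.sum_nonneg fun _ _ => sqNorm_nonneg _ _)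
    (mul_nonneg (sq_nonneg _) (sqNorm_nonneg _ _))
  have hc0 := cnormSq_nonneg (a := a) (b := b) k (U - w)
  have e1 := Real.sqrt_nonneg d
  have e2 := Real.sqrt_nonneg (cnormSq a b k (U - w))
  rw [normH1k]
  refine Real.sqrt_le_iff.2 ⟨by positivity, ?_⟩
  have e3 := Real.sq_sqrt hd0
  have e4 := Real.sq_sqrt hc0
  have e5 := mul_nonneg e1 e2
  nlinarith

/-- All derivatives of order at most two are bounded crudely by the `H⁴` norm, which loses one power
of `k`. It is used only for the algebraic error, where exponential decay compensates for polynomial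
factors. -/
theorem sqrt_cnormSq_le_of_smooth (hn : n ≤ 1) (hab : ∀ i, a i < b i) (hU : ContDiff ℝ ∞ U)
    {κ k : ℝ} (hκ : 1 ≤ κ) (hk : 0 < k) (hκk : 1 ≤ κ * k) :
    √(cnormSq a b k U) ≤ √(7 * normConst a b) * κ ^ 2 * k * √(sobSq a b U) := by
  set s := √(sobSq a b U) with hs
  have hs0 : 0 ≤ s := Real.sqrt_nonneg _
  have hs2 : s ^ 2 = sobSq a b U := Real.sq_sqrt (sobSq_nonneg a b U)
  have hN := normConst_pos hab
  have h := cnormSq_le_of_bounds hab Set.countable_empty (contDiff_mem_gridC2 (a := a) (b := b) hU ∅)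
    hk hs0 hs0 hs0
    (by
      rw [hs2]
      have := sqNorm_md_le_sobSq (α := 0)
        (by simpa using single_mem_multiIndices (r := 0) (Nat.zero_le 4) (0 : Fin (n + 1))) a b U
      rwa [md_zero] at this)
    (fun i => by
      rw [hs2]
      have := sqNorm_md_le_sobSq (single_mem_multiIndices (r := 1) (m := 4) (by norm_num) i) a b U
      rw [md_single] at this
      refine le_trans (le_of_eq (sqNorm_congr ?_)) this
      exact ae_vol_of_grid Set.countable_empty fun x hx _ =>
        cgrad_eq_pd hab hU (openBox_subset_Icc hx) i)
    (fun i j => by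
      rw [hs2]
      obtain ⟨α, hα, he⟩ := exists_md_eq_pd_pd hn i j
      have := sqNorm_md_le_sobSq hα a b U
      rw [he hU] at this
      exact this)
  have hx1 : 1 ≤ (κ * k) ^ 2 := one_le_pow₀ hκk
  have hx2 : (k ^ 2)⁻¹ ≤ κ ^ 2 := by
    rw [inv_le_iff_one_le_mul₀ (by positivity), ← mul_pow]; exact hx1
  have hκ2 : κ ^ 2 ≤ κ ^ 4 * k ^ 2 := by
    calc κ ^ 2 = κ ^ 2 * 1 := (mul_one _).symm
      _ ≤ κ ^ 2 * (κ * k) ^ 2 := by gcongr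
      _ = _ := by ring
  have h1κ : 1 ≤ κ ^ 2 := one_le_pow₀ hκ
  have hk2 : k ^ 2 ≤ κ ^ 4 * k ^ 2 := le_mul_of_one_le_left (by positivity) (one_le_pow₀ hκ)
  refine Real.sqrt_le_iff.2 ⟨by positivity, h.trans ?_⟩
  rw [mul_pow, mul_pow, mul_pow,
    Real.sq_sqrt (show 0 ≤ 7 * normConst a b by positivity)]
  have e : (k ^ 2)⁻¹ * s ^ 2 + s ^ 2 + k ^ 2 * s ^ 2 + k ^ 2 * (s ^ 2 + s * s) + (s ^ 2 + s * s) =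
      ((k ^ 2)⁻¹ + 3 + 3 * k ^ 2) * s ^ 2 := by ring
  rw [e]
  have f : (k ^ 2)⁻¹ + 3 + 3 * k ^ 2 ≤ 7 * (κ ^ 4 * k ^ 2) := by linarith
  calc normConst a b * (((k ^ 2)⁻¹ + 3 + 3 * k ^ 2) * s ^ 2)
      ≤ normConst a b * ((7 * (κ ^ 4 * k ^ 2)) * s ^ 2) := by gcongr
    _ = _ := by ring

theorem TensorMesh.width_nonneg (T : TensorMesh a b) : 0 ≤ T.width :=
  Real.iSup_nonneg fun _ => Real.sqrt_nonneg _

/-- The interpolation errors `h⁴`, `h³`, `h²` are inserted into the bound of the `V₁` norm. The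
power `k⁻⁴` is what is needed to outweigh the continuity constant, `O(k)`, and the factor `k³` of
the `H⁴` norm. -/
theorem exists_interpolant_cnormSq (hn : n ≤ 1) (hab : ∀ i, a i < b i) (T : TensorMesh a b) {p : ℕ}
    (hp : 3 ≤ p) (hU : ContDiff ℝ ∞ U) {κ k C : ℝ} (hκ : 1 ≤ κ) (hk : 0 < k) (hκk : 1 ≤ κ * k)
    (hC : C ≤ 1) (hm : T.width * k ^ (7 / 4 : ℝ) ≤ C) :
    ∃ v ∈ femC T p, √(cnormSq a b k (U - v)) ≤
      √(70 * normConst a b * κ ^ 5) * C ^ 2 / k ^ 4 * √(sobSq a b U) := by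
  obtain ⟨v, hv, h0, h1, h2⟩ := exists_interpolant hn hab T hp hU
  refine ⟨v, hv, ?_⟩
  set h := T.width with hh
  have hh0 : 0 ≤ h := T.width_nonneg
  set s := √(10 * sobSq a b U) with hs
  have hs0 : 0 ≤ s := Real.sqrt_nonneg _
  have hs2 : s ^ 2 = 10 * sobSq a b U :=
    Real.sq_sqrt (mul_nonneg (by norm_num) (sobSq_nonneg a b U))
  have hN := normConst_pos hab
  have hw : U - v ∈ gridC2 a b (gridSet T) :=
    Submodule.sub_mem _ (contDiff_mem_gridC2 hU _) (femC_le_gridC2 T p hv)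
  have key := cnormSq_le_of_bounds hab (countable_gridSet T) hw hk
    (s₀ := s * h ^ 4) (s₁ := s * h ^ 3) (s₂ := s * h ^ 2) (by positivity) (by positivity)
    (by positivity) (h0.trans (le_of_eq (by rw [mul_pow, hs2]; ring)))
    (fun i => (h1 i).trans (le_of_eq (by rw [mul_pow, hs2]; ring)))
    (fun i j => (h2 i j).trans (le_of_eq (by rw [mul_pow, hs2]; ring)))
  have e : (k ^ 2)⁻¹ * (s * h ^ 2) ^ 2 + (s * h ^ 3) ^ 2 + k ^ 2 * (s * h ^ 4) ^ 2 +
      k ^ 2 * ((s * h ^ 4) ^ 2 + s * h ^ 4 * (s * h ^ 3)) +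
      ((s * h ^ 3) ^ 2 + s * h ^ 3 * (s * h ^ 2)) =
      s ^ 2 * ((k ^ 2)⁻¹ * h ^ 4 + h ^ 6 + k ^ 2 * h ^ 8 + k ^ 2 * (h ^ 8 + h ^ 7) +
        (h ^ 6 + h ^ 5)) := by ring
  rw [e] at key
  have hC0 : 0 ≤ C := le_trans (by positivity) hm
  refine Real.sqrt_le_iff.2 ⟨by positivity, key.trans ?_⟩
  calc normConst a b * (s ^ 2 * ((k ^ 2)⁻¹ * h ^ 4 + h ^ 6 + k ^ 2 * h ^ 8 +
        k ^ 2 * (h ^ 8 + h ^ 7) + (h ^ 6 + h ^ 5)))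
      ≤ normConst a b * (s ^ 2 * (7 * C ^ 4 * κ ^ 5 / k ^ 8)) := by
        gcongr
        exact mesh_bound hκ hk hκk hh0 hC hm
    _ = _ := by
        rw [hs2, mul_pow, div_pow, mul_pow,
          Real.sq_sqrt (show 0 ≤ 70 * normConst a b * κ ^ 5 by positivity),
          Real.sq_sqrt (sobSq_nonneg a b U)]
        field_simp
        ring

end Error

section Galerkin

variable {n : ℕ} {a b : Fin (n + 1) → ℝ} {S : Set ℝ} {u v w y U uN : (Fin (n + 1) → ℝ) → ℂ}

/-! ### The error of the iterates -/

theorem cform_sub_left (hab : ∀ i, a i < b i) (hS : S.Countable) (k β A : ℝ)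
    (hu : u ∈ gridC2 a b S) (hv : v ∈ gridC2 a b S) (hy : y ∈ gridC2 a b S) :
    cform a b k β A (u - v) y = cform a b k β A u y - cform a b k β A v y := by
  have h := congrArg (fun F => F ⟨y, hy⟩) (map_sub (cformₗ hab hS k β A) ⟨u, hu⟩ ⟨v, hv⟩)
  exact h

/-- Quasi-optimality of the Galerkin solution, up to an error in the data. -/
theorem galerkin_error_le (hn : n ≤ 1) (hab : ∀ i, a i < b i) (hS : S.Countable)
    {γ k₀ k β β₀ K : ℝ} (hγ : 0 < γ)
    (hface : ∀ i, a i ≤ -(γ * boxDiam a b) ∧ γ * boxDiam a b ≤ b i) (hk₀ : 0 < k₀) (hk : k₀ ≤ k)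
    (hβ : boxDiam a b / 2 * (1 + 4 / γ + γ / 2) ≤ β) (hβ₀ : |β| ≤ β₀) (hK0 : 0 ≤ K)
    (hK : ∀ f g v : (Fin (n + 1) → ℝ) → ℂ, MemLp f 2 (volΩ a b) → MemLp g 2 (surf a b) →
      v ∈ gridC2 a b S → ‖crhs a b k β (1 / 3) f g v‖ ≤
      K * (√(sqNorm (volΩ a b) f) + √(sqNorm (surf a b) g)) * √(cnormSq a b k v))
    {f g : (Fin (n + 1) → ℝ) → ℂ} (hf : MemLp f 2 (volΩ a b)) (hg : MemLp g 2 (surf a b))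
    (huN : uN ∈ gridC2 a b S) (hv : v ∈ gridC2 a b S) (hU : U ∈ gridC2 a b S)
    (hG : cform a b k β (1 / 3) uN (uN - v) = crhs a b k β (1 / 3) f g (uN - v)) :
    coerConst a b γ * √(cnormSq a b k (uN - v)) ≤
      K * (√(sqNorm (volΩ a b) ((fun x => -copL k U x) - f)) +
        √(sqNorm (surf a b) ((fun x => cnormalDeriv a b U x - Complex.I * k * U x) - g))) +
      contConst a b k₀ β₀ * k * √(cnormSq a b k (U - v)) := by
  have hk' : 0 < k := hk₀.trans_le hk
  have hr : 0 < γ * boxDiam a b := mul_pos hγ (boxDiam_pos hab)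
  have hz : uN - v ∈ gridC2 a b S := Submodule.sub_mem _ huN hv
  set z := uN - v with hzdef
  have hfU : MemLp (fun x => -copL k U x) 2 (volΩ a b) :=
    ((memLp_copL hS hU k).mono_exponent le_top).neg
  have hgU : MemLp (fun x => cnormalDeriv a b U x - Complex.I * k * U x) 2 (surf a b) :=
    ((memLp_cnormalDeriv hab hU).mono_exponent le_top).sub
      ((MemLp.two_surf hab hU.1.continuousOn).const_mul _)
  -- `U` satisfies the variational equation with its own data and `uN` with the data `f`, `g`.
  -- Galerkin orthogonality therefore holds up to the functional whose data are the differences.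
  have hid : cform a b k β (1 / 3) z z = cform a b k β (1 / 3) (U - v) z -
      crhs a b k β (1 / 3) ((fun x => -copL k U x) - f)
        ((fun x => cnormalDeriv a b U x - Complex.I * k * U x) - g) z := by
    rw [crhs_sub_left hab hS k β (1 / 3) hfU hgU hf hg hz, ← cform_eq_crhs hab hS hn hU hz,
      cform_sub_left hab hS _ _ _ hU hv hz, ← hG]
    have : cform a b k β (1 / 3) z z = cform a b k β (1 / 3) uN z - cform a b k β (1 / 3) v z := by
      rw [← cform_sub_left hab hS _ _ _ huN hv hz]
    rw [this]
    ring
  have h1 := cform_coercive hab hS hn hγ hface hk' hβ hz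
  have h2 := (Complex.re_le_norm _).trans ((le_of_eq (congrArg norm hid)).trans (norm_sub_le _ _))
  have h3 := norm_cform_le hab hS hr hface hk₀ hk hβ₀ (Submodule.sub_mem _ hU hv) hz
  have h4 := hK _ _ z (hfU.sub hf) (hgU.sub hg) hz
  have hnn : 0 ≤ K * (√(sqNorm (volΩ a b) ((fun x => -copL k U x) - f)) +
        √(sqNorm (surf a b) ((fun x => cnormalDeriv a b U x - Complex.I * k * U x) - g))) +
      contConst a b k₀ β₀ * k * √(cnormSq a b k (U - v)) := by
    have := (contConst_pos (a := a) (b := b) hk₀ ((abs_nonneg _).trans hβ₀)).le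
    positivity
  have hsq := Real.sq_sqrt (cnormSq_nonneg (a := a) (b := b) k z)
  rcases (Real.sqrt_nonneg (cnormSq a b k z)).eq_or_lt with h0 | h0
  · rw [← h0, mul_zero]
    exact hnn
  · refine le_of_mul_le_mul_right ?_ h0
    calc coerConst a b γ * √(cnormSq a b k z) * √(cnormSq a b k z)
        = coerConst a b γ * cnormSq a b k z := by rw [← hsq]; simp only [Real.sqrt_sq h0.le]; ring
      _ ≤ _ := by linarith

/-- The error of an approximate Galerkin solution `w`, in terms of the interpolation error of smooth
functions and of the relative error of the solution of the linear system. -/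
theorem normH1k_error_le (hn : n ≤ 1) (hab : ∀ i, a i < b i) {T : TensorMesh a b} {p : ℕ}
    {γ k₀ k β β₀ I Q θ : ℝ} (hγ : 0 < γ)
    (hface : ∀ i, a i ≤ -(γ * boxDiam a b) ∧ γ * boxDiam a b ≤ b i) (hk₀ : 0 < k₀) (hk : k₀ ≤ k)
    (hβ : boxDiam a b / 2 * (1 + 4 / γ + γ / 2) ≤ β) (hβ₀ : |β| ≤ β₀)
    {f g : (Fin (n + 1) → ℝ) → ℂ} (hsol : IsIIPSolution a b k f g u) (hu : MemSobolev a b 4 u)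
    (hI : ∀ U, ContDiff ℝ ∞ U → ∃ v ∈ femC T p,
      √(cnormSq a b k (U - v)) ≤ I * √(sobSq a b U))
    (hQ : ∀ U, ContDiff ℝ ∞ U → √(cnormSq a b k U) ≤ Q * √(sobSq a b U))
    (huN : uN ∈ femC T p)
    (hG : ∀ y ∈ femC T p, cform a b k β (1 / 3) uN y = crhs a b k β (1 / 3) f g y)
    (hw : w ∈ femC T p) (hθ : 0 ≤ θ)
    (hθw : √(cnormSq a b k (uN - w)) ≤ θ * √(cnormSq a b k uN)) :
    normH1k a b k (u - w) ≤ ((4 + 32 * θ) * I +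
      (8 + 16 * θ) * (contConst a b k₀ β₀ * k * I / coerConst a b γ) + 32 * θ * Q) *
        sobolevNorm a b 4 u := by
  have hS := countable_gridSet T
  have hk' : 0 < k := hk₀.trans_le hk
  have hL := boxDiam_pos hab
  have hr : 0 < γ * boxDiam a b := mul_pos hγ hL
  have hα : 0 < coerConst a b γ := lt_min (by norm_num) (by positivity)
  have hκ := contConst_pos (a := a) (b := b) hk₀ ((abs_nonneg _).trans hβ₀)
  obtain ⟨K, hK0, hK⟩ := norm_crhs_le hab hS (β := β) hr hface hk'
  obtain ⟨U, hU, hU0, hU1, hUs, hUf, hUg⟩ := exists_smooth_approx hn hab hr hface hsol hu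
  set A := coerConst a b γ with hA
  set B := contConst a b k₀ β₀ with hB
  set d : ℕ → ℝ := fun m => √((∑ i, sqNorm (volΩ a b) (cgrad a b (U m) i - wgrad a b u i)) +
      k ^ 2 * sqNorm (volΩ a b) (U m - u)) with hd
  set ρ : ℕ → ℝ := fun m => √(sqNorm (volΩ a b) ((fun x => -copL k (U m) x) - f)) +
      √(sqNorm (surf a b) ((fun x => cnormalDeriv a b (U m) x - Complex.I * k * U m x) - g)) with hρ
  set s : ℕ → ℝ := fun m => √(sobSq a b (U m)) with hs
  have hle : ∀ m, normH1k a b k (u - w) ≤ 2 * d m + (4 + 32 * θ) * (I * s m) +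
      (8 + 16 * θ) * ((K * ρ m + B * k * (I * s m)) / A) + 32 * θ * (Q * s m) := by
    intro m
    obtain ⟨v, hv, hvI⟩ := hI (U m) (hU m)
    have gU : U m ∈ gridC2 a b (gridSet T) := contDiff_mem_gridC2 (hU m) _
    have gv := femC_le_gridC2 T p hv
    have gN := femC_le_gridC2 T p huN
    have gw := femC_le_gridC2 T p hw
    have hz := galerkin_error_le hn hab hS hγ hface hk₀ hk hβ hβ₀ hK0 hK hsol.memLp_f hsol.memLp_g
      gN gv gU (hG _ (Submodule.sub_mem _ huN hv))
    have hz' : √(cnormSq a b k (uN - v)) ≤ (K * ρ m + B * k * (I * s m)) / A := by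
      rw [le_div_iff₀' hα]
      refine hz.trans (add_le_add le_rfl ?_)
      exact mul_le_mul_of_nonneg_left hvI (by positivity)
    have t1 := normH1k_sub_le hab hS k hsol.memH1 gU gw
    have t2 := (sqrt_cnormSq_add_sub_le hab hS k (Submodule.sub_mem _ gU gv)
      (Submodule.sub_mem _ gv gw)).1
    rw [sub_add_sub_cancel] at t2
    have t3 := (sqrt_cnormSq_add_sub_le hab hS k (Submodule.sub_mem _ gN gw)
      (Submodule.sub_mem _ gN gv)).2
    rw [sub_sub_sub_cancel_left] at t3
    have t4 := (sqrt_cnormSq_add_sub_le hab hS k (Submodule.sub_mem _ gN gv) gv).1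
    rw [sub_add_cancel] at t4
    have t5 := (sqrt_cnormSq_add_sub_le hab hS k gU (Submodule.sub_mem _ gU gv)).2
    rw [sub_sub_cancel] at t5
    have t6 := hQ (U m) (hU m)
    -- The algebraic error is relative to the Galerkin solution `uN`, whose size is estimated by way
    -- of the interpolant `v` and the smooth function `U m`.
    have t7 : √(cnormSq a b k uN) ≤ 2 * ((K * ρ m + B * k * (I * s m)) / A) + 4 * (Q * s m) +
      4 * (I * s m) := by linarith
    have t8 := mul_le_mul_of_nonneg_left t7 hθ
    have t9 : √(cnormSq a b k (U m - w)) ≤ 2 * (I * s m) + 4 * (θ * √(cnormSq a b k uN)) +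
      4 * ((K * ρ m + B * k * (I * s m)) / A) := by linarith
    change _ ≤ 2 * (d m + _) at t1
    linarith
  -- In the limit the distances to `u` and to the data vanish, so the constant `K` disappears, and
  -- `s m` tends to the `H⁴` norm of `u`.
  have ld : Tendsto d atTop (𝓝 0) := by
    have h := (tendsto_finsetSum Finset.univ fun i _ => (hU1 i).tendsto).add
      (hU0.tendsto.const_mul (k ^ 2))
    simp only [Finset.sum_const_zero, mul_zero, add_zero] at h
    have := h.sqrt
    rwa [Real.sqrt_zero] at this
  have lρ : Tendsto ρ atTop (𝓝 0) := by
    have := hUf.tendsto.sqrt.add hUg.tendsto.sqrt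
    rwa [Real.sqrt_zero, add_zero] at this
  have ls : Tendsto s atTop (𝓝 (sobolevNorm a b 4 u)) := by
    have := hUs.sqrt
    rwa [Real.sqrt_sq (sobolevNorm_nonneg 4)] at this
  have lim := (((ld.const_mul 2).add ((ls.const_mul I).const_mul (4 + 32 * θ))).add
    ((((lρ.const_mul K).add ((ls.const_mul I).const_mul (B * k))).div_const A).const_mul
      (8 + 16 * θ))).add ((ls.const_mul Q).const_mul (32 * θ))
  refine (ge_of_tendsto lim (Eventually.of_forall hle)).trans (le_of_eq ?_)
  ring

end Galerkin

end HelmholtzMS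

end

/-! ### The main theorem: choice of the constants and conclusion -/

theorem mainTheorem1
    -- the dimension is `n + 1`, that is `1` or `2`
    (n : ℕ) (hn : n ≤ 1) (a b : Fin (n + 1) → ℝ) (hab : ∀ i, a i < b i)
    (γ : ℝ) (hγ : 0 < γ)
    (hstar : HelmholtzMS.StarShapedWrtBall (HelmholtzMS.openBox a b) 0
      (γ * HelmholtzMS.boxDiam a b))
    (p : ℕ) (hp : 3 ≤ p)
    -- the constants in the upper bound for `β` and in the two assumptions on `u`
    (Cβ C₁ C₂ : ℝ)
    (ε k₀ : ℝ) (hε : 0 < ε) (hε1 : ε < 1) (hk₀ : 0 < k₀) :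
    ∃ C m₀ : ℝ, 0 < C ∧ 0 < m₀ ∧
      ∀ k : ℝ, k₀ ≤ k →
      ∀ β : ℝ, HelmholtzMS.boxDiam a b / 2 * (1 + 4 / γ + γ / 2) ≤ β →
        β ≤ Cβ * HelmholtzMS.boxDiam a b →
      ∀ f g u : (Fin (n + 1) → ℝ) → ℂ, HelmholtzMS.IsIIPSolution a b k f g u →
        HelmholtzMS.Oscillatory a b k C₁ u → HelmholtzMS.NormsComparable a b k C₂ u →
      ∀ (T : HelmholtzMS.TensorMesh a b) (N : ℕ)
        (φ : Module.Basis (Fin N) ℝ (HelmholtzMS.femSpace T p)) (m : ℕ),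
        T.width * k ^ (7 / 4 : ℝ) ≤ C → m₀ * max 1 (k * Real.log k) ≤ m →
        ∀ (B D : Matrix (Fin N) (Fin N) ℂ) (rhs : Fin N → ℂ),
          B = HelmholtzMS.galerkinMatrix a b k β (1 / 3) (fun j => (φ j).1) →
          rhs = HelmholtzMS.galerkinRhs a b k β (1 / 3) f g (fun j => (φ j).1) →
          D = HelmholtzMS.precondD1 a b k (fun j => (φ j).1) →
          -- the preconditioned system and its GMRES iterate are well defined
          D.PosDef ∧ IsUnit B ∧
          ∃ um : Fin N → ℂ,
            (∀ y, HelmholtzMS.IsGMRESIterate D (D⁻¹ * B) (D⁻¹.mulVec rhs) m y ↔ y = um) ∧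
            HelmholtzMS.normH1k a b k (u - HelmholtzMS.femFun (fun j => (φ j).1) um) ≤
              ε * HelmholtzMS.normH1k a b k u := by
  have hL := HelmholtzMS.boxDiam_pos hab
  have hface := HelmholtzMS.faces_of_starShaped hab hstar
  have hr : 0 < γ * HelmholtzMS.boxDiam a b := mul_pos hγ hL
  set β₀ : ℝ := |Cβ| * HelmholtzMS.boxDiam a b with hβ₀
  set α : ℝ := HelmholtzMS.coerConst a b γ with hα
  have hα0 : 0 < α := lt_min (by norm_num) (by positivity)
  set M : ℝ := HelmholtzMS.contConst a b k₀ β₀ with hM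
  have hM0 : 0 < M := HelmholtzMS.contConst_pos hk₀ (by positivity)
  -- This `κ` satisfies `κ ≥ 1` and `κ k ≥ 1` for all `k ≥ k₀`; it replaces missing powers of `k`
  -- when `k` is small.
  set κ : ℝ := max 1 k₀⁻¹ with hκ
  have hκ1 : 1 ≤ κ := le_max_left _ _
  have hκ0 : 0 < κ := by linarith
  set c₁ : ℝ := |C₁| ^ 4 with hc₁
  have hc₁0 : 0 ≤ c₁ := by positivity
  set J : ℝ := √(70 * HelmholtzMS.normConst a b * κ ^ 5) with hJ
  have hJ0 : 0 ≤ J := Real.sqrt_nonneg _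
  set q : ℝ := √(7 * HelmholtzMS.normConst a b) with hq
  have hq0 : 0 ≤ q := Real.sqrt_nonneg _
  -- `R C²` will be the relative discretisation error; `36 = 4 + 32` and `24 = 8 + 16` are the
  -- coefficients of the error bound at `θ = 1`. Likewise `R' θ k⁴` will be the relative algebraic
  -- error.
  set R : ℝ := (36 * κ + 24 * (M / α)) * J * c₁ with hR
  have hR0 : 0 ≤ R := by positivity
  set R' : ℝ := 32 * q * κ ^ 2 * c₁ with hR'
  have hR'0 : 0 ≤ R' := by positivity
  -- Target for `θ k⁴`: the first entry enforces `θ ≤ 1`, the second makes the algebraic error at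
  -- most `ε/2`.
  set η : ℝ := min (κ ^ 4)⁻¹ (ε / (2 * (R' + 1))) with hη
  have hη0 : 0 < η := lt_min (by positivity) (by positivity)
  obtain ⟨m₀, hm₀, hiter⟩ := HelmholtzMS.exists_iterations (2 * (M / α)) (c := α / (6 * M))
    (by positivity) hk₀ hη0
  -- Since `C ≤ 1`, also `C² ≤ ε / (2(R + 1))`, which makes the discretisation error at most `ε/2`.
  set C : ℝ := min 1 (ε / (2 * (R + 1))) with hC
  have hC0 : 0 < C := lt_min one_pos (by positivity)
  refine ⟨C, m₀, hC0, hm₀, fun k hk β hβ hβ' f g u hsol hosc _ T N φ m hwidth hm B D rhs hB hrhs hD =>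
    ?_⟩
  have hk' : 0 < k := hk₀.trans_le hk
  have hκk : 1 ≤ κ * k := by
    calc 1 = k₀⁻¹ * k₀ := (inv_mul_cancel₀ hk₀.ne').symm
      _ ≤ κ * k := mul_le_mul (le_max_right _ _) hk hk₀.le hκ0.le
  have hβabs : |β| ≤ β₀ := by
    have hβpos : 0 ≤ β := le_trans (by positivity) hβ
    rw [abs_of_nonneg hβpos]
    exact hβ'.trans (mul_le_mul_of_nonneg_right (le_abs_self _) hL.le)
  have hS := HelmholtzMS.countable_gridSet T
  have hDpos : D.PosDef := hD ▸ HelmholtzMS.precondD1_posDef φ hab hk'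
  have hw : ∀ c, HelmholtzMS.weightedNorm D c =
      √(HelmholtzMS.cnormSq a b k (HelmholtzMS.femFun (fun j => (φ j).1) c)) := fun c => by
    rw [hD, HelmholtzMS.weightedNorm_precondD1 φ hab]
  have hBc : ∀ c d, star d ⬝ᵥ B.mulVec c = HelmholtzMS.cform a b k β (1 / 3)
      (HelmholtzMS.femFun (fun j => (φ j).1) c) (HelmholtzMS.femFun (fun j => (φ j).1) d) :=
    fun c d => by rw [hB, HelmholtzMS.galerkinMatrix_apply φ hab]
  obtain ⟨hBu, um, hum, hum2⟩ := HelmholtzMS.gmres_error_le hDpos hα0 (mul_pos hM0 hk')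
    (fun c => by
      rw [hw, hBc, Real.sq_sqrt (HelmholtzMS.cnormSq_nonneg _ _)]
      exact HelmholtzMS.cform_coercive hab hS hn hγ hface hk' hβ (HelmholtzMS.femFun_mem φ c))
    (fun c d => by
      rw [hw, hw, hBc]
      exact HelmholtzMS.norm_cform_le hab hS hr hface hk₀ hk hβabs (HelmholtzMS.femFun_mem φ c)
        (HelmholtzMS.femFun_mem φ d)) m rhs
  refine ⟨hDpos, hBu, um, hum, ?_⟩
  set θ : ℝ := 2 * (M * k / α) * Real.exp (-(α * m / (6 * (M * k)))) with hθ
  have hθ0 : 0 ≤ θ := by positivity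
  rw [hw, hw, HelmholtzMS.femFun_sub φ] at hum2
  have hG : ∀ y ∈ HelmholtzMS.femC T p, HelmholtzMS.cform a b k β (1 / 3)
      (HelmholtzMS.femFun (fun j => (φ j).1) (B⁻¹.mulVec rhs)) y =
      HelmholtzMS.crhs a b k β (1 / 3) f g y := by
    intro y hy
    obtain ⟨d, rfl⟩ := HelmholtzMS.exists_femFun_eq φ hy
    rw [← hBc, Matrix.mulVec_mulVec, Matrix.mul_nonsing_inv _ ((Matrix.isUnit_iff_isUnit_det _).1 hBu),
      Matrix.one_mulVec, hrhs, HelmholtzMS.galerkinRhs_apply φ hab _ _ _ hsol.memLp_f hsol.memLp_g]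
  have herr := HelmholtzMS.normH1k_error_le (I := J * C ^ 2 / k ^ 4) (Q := q * κ ^ 2 * k) hn hab hγ
    hface hk₀ hk hβ hβabs hsol hosc.1
    (fun U hU => HelmholtzMS.exists_interpolant_cnormSq hn hab T hp hU hκ1 hk' hκk (min_le_left _ _)
      hwidth)
    (fun U hU => HelmholtzMS.sqrt_cnormSq_le_of_smooth hn hab hU hκ1 hk' hκk)
    (HelmholtzMS.femFun_mem_femC φ _) hG (HelmholtzMS.femFun_mem_femC φ um) hθ0 hum2
  have hs := HelmholtzMS.sobolevNorm_four_le hk' hosc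
  set H := HelmholtzMS.normH1k a b k u with hH
  have hH0 : 0 ≤ H := Real.sqrt_nonneg _
  -- With the continuity constant `M k` in the GMRES bound, `θ k⁴ = 2 (M/α) k⁵ exp (-(α/(6M)) m /
  -- k)`, the quantity for which `m₀` was chosen.
  have hθk : θ * k ^ 4 ≤ η := by
    have := hiter k m hk hm
    rw [abs_of_nonneg (by positivity)] at this
    refine le_trans (le_of_eq ?_) this
    have e : α * (m : ℝ) / (6 * (M * k)) = α / (6 * M) * m / k := by field_simp
    rw [hθ, e]
    ring
  have hθ1 : θ ≤ 1 := by
    have h1 : 1 ≤ (κ * k) ^ 4 := one_le_pow₀ hκk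
    calc θ ≤ θ * (κ * k) ^ 4 := le_mul_of_one_le_right hθ0 h1
      _ = κ ^ 4 * (θ * k ^ 4) := by ring
      _ ≤ κ ^ 4 * (κ ^ 4)⁻¹ :=
          mul_le_mul_of_nonneg_left (hθk.trans (min_le_left _ _)) (by positivity)
      _ = 1 := mul_inv_cancel₀ (by positivity)
  have hC2 : C ^ 2 ≤ ε / (2 * (R + 1)) := by
    rw [sq]
    calc C * C ≤ 1 * C := mul_le_mul_of_nonneg_right (min_le_left _ _) hC0.le
      _ ≤ _ := by rw [one_mul]; exact min_le_right _ _
  have hRC : R * C ^ 2 ≤ ε / 2 := by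
    calc R * C ^ 2 ≤ (R + 1) * (ε / (2 * (R + 1))) :=
          mul_le_mul (by linarith) hC2 (by positivity) (by positivity)
      _ = ε / 2 := by field_simp
  have hRη : R' * (θ * k ^ 4) ≤ ε / 2 := by
    calc R' * (θ * k ^ 4) ≤ (R' + 1) * (ε / (2 * (R' + 1))) :=
          mul_le_mul (by linarith) (hθk.trans (min_le_right _ _)) (by positivity) (by positivity)
      _ = ε / 2 := by field_simp
  have hkinv : 1 / k ≤ κ := by rw [div_le_iff₀ hk']; exact hκk
  -- After inserting the factor `k³` from oscillation, the first term keeps `1/k ≤ κ`, the Galerkin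
  -- term is free of `k`, and the algebraic term has `θ k⁴`.
  calc _ ≤ ((4 + 32 * θ) * (J * C ^ 2 / k ^ 4) + (8 + 16 * θ) * (M * k * (J * C ^ 2 / k ^ 4) / α) +
        32 * θ * (q * κ ^ 2 * k)) * HelmholtzMS.sobolevNorm a b 4 u := herr
    _ ≤ ((4 + 32 * θ) * (J * C ^ 2 / k ^ 4) + (8 + 16 * θ) * (M * k * (J * C ^ 2 / k ^ 4) / α) +
        32 * θ * (q * κ ^ 2 * k)) * (c₁ * k ^ 3 * H) :=
        mul_le_mul_of_nonneg_left hs (by positivity)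
    _ = ((4 + 32 * θ) * (J * C ^ 2 * c₁) * (1 / k) + (8 + 16 * θ) * (M / α * (J * C ^ 2 * c₁)) +
        R' * (θ * k ^ 4)) * H := by
        rw [hR']
        field_simp
    _ ≤ (36 * (J * C ^ 2 * c₁) * κ + 24 * (M / α * (J * C ^ 2 * c₁)) + ε / 2) * H := by
        gcongr
        · linarith
        · linarith
    _ = (R * C ^ 2 + ε / 2) * H := by rw [hR]; ring
    _ ≤ ε * H := mul_le_mul_of_nonneg_right (by linarith) hH0
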